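/- Let $k>2$, $\gamma\in(0,1)$, $s\in(0,1/2)$, $c_b>0$, and let $b$ be a measurable (for instance locally smooth) angular function, with $b(\cos\theta)=0$ for $\cos\theta<0$ and $$\frac{c_b}{\theta^{1+2s}}\le \sin\theta\, b(\cos\theta)\le \frac{1}{c_b\,\theta^{1+2s}}\qquad\text{for all }\theta\in(0,\pi/2].$$ For $v,v_*\in\mathbb R^3$ and $\sigma\in\mathbb S^2$ put $v'=\frac{v+v_*}2+\frac{|v-v_*|}2\sigma$, $v'_*=\frac{v+v_*}2-\frac{|v-v_*|}2\sigma$, $\cos\theta=\big\langle\frac{v-v_*}{|v-v_*|},\sigma\big\rangle$ with $\theta\in[0,\pi]$, and write $h=h(v)$, $h_*=h(v_*)$, $h'=h(v')$, $h'_*=h(v'_*)$. Let $\mu(v)=(2\pi)^{-3/2}e^{-|v|^2/2}$ and $\langle v\rangle=(1+|v|^2)^{1/2}$. Let $L^1(\langle v\rangle^k)$ be the space of real functions with norm $\int_{\mathbb R^3}|h|\,\langle v\rangle^k\,dv$. For $\delta,\varepsilon\in(0,1)$ let $b_\delta=\mathbf 1_{\theta\le\delta}\,b$ and $b^c_\delta=\mathbf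 1_{\theta\ge\delta}\,b$. Let $\Theta_\varepsilon=\Theta_\varepsilon(v,v_*,\sigma)$ be any measurable (for instance $C^\infty$) function with $0\le\Theta_\varepsilon\le1$, equal to $1$ on $\{|v|\le\varepsilon^{-1},\ 2\varepsilon\le|v-v_*|\le\varepsilon^{-1},\ |\cos\theta|\le1-2\varepsilon\}$ and vanishing outside $\{|v|\le2\varepsilon^{-1},\ \varepsilon\le|v-v_*|\le2\varepsilon^{-1},\ |\cos\theta|\le1-\varepsilon\}$. Define $\mathcal B_{\delta,\varepsilon}=\mathcal L_\delta+\mathcal B^c_{\delta,\varepsilon}-\nu_\delta$ with $$\mathcal L_\delta h=\int_{\mathbb R^3\times\mathbb S^2}\big[\mu'_*h'-\mu_*h+h'_*\mu'-h_*\mu\big]\,b_\delta(\cos\theta)\,|v-v_*|^\gamma\,d\sigma\,dv_*,$$ $$\mathcal B^c_{\delta,\varepsilon}h=\int_{\mathbb R^3\times\mathbb S^2}(1-\Theta_\varepsilon)\big[\mu'_*h'+\mu'h'_*-\mu h_*\big]\,b^c_\delta(\cos\theta)\,|v-v_*|^\gamma\,d\sigma\,dv_*,$$ $$\nu_\delta(v)=\int_{\mathbb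 R^3\times\mathbb S^2}\mu_*\,b^c_\delta(\cos\theta)\,|v-v_*|^\gamma\,d\sigma\,dv_* .$$ Then there is a constant $\lambda_k>0$ (depending on $k$ and on the collision kernel) such that for every $a\in(-\lambda_k,0)$, for all sufficiently small $\delta>0$, and then for all sufficiently small $\varepsilon>0$ (depending on $\delta$, but not on the choice of $\Theta_\varepsilon$), the following holds. For $h\in C_c^\infty(\mathbb R^3)$ the integrals above converge absolutely at every $v$, and $\mathcal B_{\delta,\varepsilon}h\in L^1(\langle v\rangle^k)$. The closure in $L^1(\langle v\rangle^k)$ of $\mathcal B_{\delta,\varepsilon}$, defined on $C^\infty_c(\mathbb R^3)$, is such that $\mathcal B_{\delta,\varepsilon}-a$ is dissipative, i.e. $\|(r+a-\mathcal B_{\delta,\varepsilon})h\|\ge r\|h\|$ for all $r>0$ and all $h$ in its domain. It generates a strongly continuous semigroup $S_{\mathcal B_{\delta,\varepsilon}}$ on $L^1(\langle v\rangle^k)$, which satisfies $$\forall\,t\ge0,\qquad \|S_{\mathcal B_{\delta,\varepsilon}}(t)\|_{L^1(\langle v\rangle^k)\to L^1(\langle v\rangle^k)}\le e^{at}.$$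 -/

import Mathlib

open MeasureTheory Filter Topology Set
open scoped ContDiff NNReal

noncomputable section

namespace Boltzmann

/-- The velocity space `ℝ³` with its Euclidean norm. -/
abbrev Vel : Type := EuclideanSpace ℝ (Fin 3)

/-- The unit sphere `𝕊²` of `ℝ³`. -/
abbrev Sph : Type := Metric.sphere (0 : Vel) 1

/-- The surface measure `dσ` on `𝕊²` (of total mass `4π`). -/
def surf : Measure Sph := (volume : Measure Vel).toSphere

/-- The measure `d(v_*, σ)` on `ℝ³ × 𝕊²`. -/
def collMeasure : Measure (Vel × Sph) := (volume : Measure Vel).prod surf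

/-- `⟨v⟩ = (1 + |v|²)^{1/2}`. -/
def jap (v : Vel) : ℝ := Real.sqrt (1 + ‖v‖ ^ 2)

/-- The Maxwellian `μ(v) = (2π)^{-3/2} e^{-|v|²/2}`. -/
def maxw (v : Vel) : ℝ := (2 * Real.pi) ^ (-(3 / 2) : ℝ) * Real.exp (-‖v‖ ^ 2 / 2)

/-- Post-collisional velocity `v' = (v + v_*)/2 + (|v - v_*|/2) σ`. -/
def post (v w : Vel) (σ : Sph) : Vel := (1 / 2 : ℝ) • (v + w) + (‖v - w‖ / 2) • (σ : Vel)

/-- Post-collisional velocity `v'_* = (v + v_*)/2 - (|v - v_*|/2) σ`. -/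
def postStar (v w : Vel) (σ : Sph) : Vel := (1 / 2 : ℝ) • (v + w) - (‖v - w‖ / 2) • (σ : Vel)

/-- `cos θ = ⟨(v - v_*)/|v - v_*|, σ⟩`. -/
def cosDev (v w : Vel) (σ : Sph) : ℝ := inner ℝ (‖v - w‖⁻¹ • (v - w)) (σ : Vel)

/-- Angular functions `b = b(cos θ)`, supported in `cos θ ≥ 0`, with the nonintegrable singularity
`sin θ b(cos θ) ≈ θ^{-1-2s}` at `θ = 0`.  Only measurability is required of `b`, which covers
(locally) smooth functions. -/
structure IsAngularKernel (s cb : ℝ) (b : ℝ → ℝ) : Prop where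
  measurable : Measurable b
  supp : ∀ x, x < 0 → b x = 0
  lower : ∀ θ ∈ Ioc 0 (Real.pi / 2), cb / θ ^ (1 + 2 * s) ≤ Real.sin θ * b (Real.cos θ)
  upper : ∀ θ ∈ Ioc 0 (Real.pi / 2),
    Real.sin θ * b (Real.cos θ) ≤ 1 / (cb * θ ^ (1 + 2 * s))

open Classical in
/-- Grazing part `b_δ = 𝟙_{θ ≤ δ} b`, as a function of `x = cos θ`. -/
def bGraz (b : ℝ → ℝ) (δ : ℝ) (x : ℝ) : ℝ := if Real.arccos x ≤ δ then b x else 0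

open Classical in
/-- Cut-off part `b^c_δ = 𝟙_{θ ≥ δ} b`, as a function of `x = cos θ`. -/
def bCut (b : ℝ → ℝ) (δ : ℝ) (x : ℝ) : ℝ := if δ ≤ Real.arccos x then b x else 0

/-- Truncation functions `Θ_ε(v, v_*, σ)`.  Only measurability is required, which covers smooth
functions. -/
structure IsTruncation (ε : ℝ) (Θ : Vel → Vel → Sph → ℝ) : Prop where
  measurable : Measurable fun p : Vel × Vel × Sph => Θ p.1 p.2.1 p.2.2
  nonneg : ∀ v w σ, 0 ≤ Θ v w σ
  le_one : ∀ v w σ, Θ v w σ ≤ 1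
  eq_one : ∀ v w σ, ‖v‖ ≤ ε⁻¹ → 2 * ε ≤ ‖v - w‖ → ‖v - w‖ ≤ ε⁻¹ →
    |cosDev v w σ| ≤ 1 - 2 * ε → Θ v w σ = 1
  supp : ∀ v w σ, Θ v w σ ≠ 0 →
    ‖v‖ ≤ 2 * ε⁻¹ ∧ ε ≤ ‖v - w‖ ∧ ‖v - w‖ ≤ 2 * ε⁻¹ ∧ |cosDev v w σ| ≤ 1 - ε

/-- Integrand of `𝓛_δ h (v)`:
`[μ'_* h' - μ_* h + h'_* μ' - h_* μ] b_δ(cos θ) |v - v_*|^γ`, with `p = (v_*, σ)`. -/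
def grazIntegrand (b : ℝ → ℝ) (γ δ : ℝ) (h : Vel → ℝ) (v : Vel) (p : Vel × Sph) : ℝ :=
  (maxw (postStar v p.1 p.2) * h (post v p.1 p.2) - maxw p.1 * h v
    + h (postStar v p.1 p.2) * maxw (post v p.1 p.2) - h p.1 * maxw v)
    * bGraz b δ (cosDev v p.1 p.2) * ‖v - p.1‖ ^ γ

/-- Integrand of `𝓑^c_{δ,ε} h (v)`:
`(1 - Θ_ε) [μ'_* h' + μ' h'_* - μ h_*] b^c_δ(cos θ) |v - v_*|^γ`, with `p = (v_*, σ)`. -/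
def remIntegrand (b : ℝ → ℝ) (γ δ : ℝ) (Θ : Vel → Vel → Sph → ℝ) (h : Vel → ℝ) (v : Vel)
    (p : Vel × Sph) : ℝ :=
  (1 - Θ v p.1 p.2)
    * (maxw (postStar v p.1 p.2) * h (post v p.1 p.2)
      + maxw (post v p.1 p.2) * h (postStar v p.1 p.2) - maxw v * h p.1)
    * bCut b δ (cosDev v p.1 p.2) * ‖v - p.1‖ ^ γ

/-- Integrand of the collision frequency `ν_δ(v)`: `μ_* b^c_δ(cos θ) |v - v_*|^γ`. -/
def freqIntegrand (b : ℝ → ℝ) (γ δ : ℝ) (v : Vel) (p : Vel × Sph) : ℝ :=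
  maxw p.1 * bCut b δ (cosDev v p.1 p.2) * ‖v - p.1‖ ^ γ

/-- The grazing collisions operator `𝓛_δ`. -/
def grazOp (b : ℝ → ℝ) (γ δ : ℝ) (h : Vel → ℝ) (v : Vel) : ℝ :=
  ∫ p, grazIntegrand b γ δ h v p ∂collMeasure

/-- The remainder operator `𝓑^c_{δ,ε}`. -/
def remOp (b : ℝ → ℝ) (γ δ : ℝ) (Θ : Vel → Vel → Sph → ℝ) (h : Vel → ℝ) (v : Vel) : ℝ :=
  ∫ p, remIntegrand b γ δ Θ h v p ∂collMeasure

/-- The collision frequency `ν_δ`. -/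
def freq (b : ℝ → ℝ) (γ δ : ℝ) (v : Vel) : ℝ := ∫ p, freqIntegrand b γ δ v p ∂collMeasure

/-- `𝓑_{δ,ε} h = 𝓛_δ h + 𝓑^c_{δ,ε} h - ν_δ h`. -/
def BOp (b : ℝ → ℝ) (γ δ : ℝ) (Θ : Vel → Vel → Sph → ℝ) (h : Vel → ℝ) (v : Vel) : ℝ :=
  grazOp b γ δ h v + remOp b γ δ Θ h v - freq b γ δ v * h v

/-- The measure `⟨v⟩^k dv`. -/
def wMeasure (k : ℝ) : Measure Vel :=
  (volume : Measure Vel).withDensity fun v => ENNReal.ofReal (jap v ^ k)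

/-- The Banach space `L¹(⟨v⟩^k)`, with norm `∫ |h| ⟨v⟩^k dv`. -/
abbrev L1w (k : ℝ) : Type := Lp ℝ 1 (wMeasure k)

/-- Test functions: `C_c^∞(ℝ³)`. -/
def IsTest (f : Vel → ℝ) : Prop := ContDiff ℝ ∞ f ∧ HasCompactSupport f

/-- The graph in `L¹(⟨v⟩^k)` of an operator given on `C_c^∞(ℝ³)`. -/
def testGraph (k : ℝ) (T : (Vel → ℝ) → Vel → ℝ) : Set (L1w k × L1w k) :=
  {p | ∃ f, IsTest f ∧ p.1 =ᵐ[wMeasure k] f ∧ p.2 =ᵐ[wMeasure k] T f}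

section Semigroup

variable {X : Type*} [NormedAddCommGroup X] [NormedSpace ℝ X]

/-- Strongly continuous semigroups of bounded operators. -/
structure IsC0Semigroup (S : ℝ≥0 → X →L[ℝ] X) : Prop where
  zero : S 0 = ContinuousLinearMap.id ℝ X
  add : ∀ t r, S (t + r) = (S t).comp (S r)
  cont : ∀ x, Continuous fun t => S t x

/-- The graph of the infinitesimal generator of a semigroup. -/
def generatorGraph (S : ℝ≥0 → X →L[ℝ] X) : Set (X × X) :=
  {p | Tendsto (fun t : ℝ≥0 => (t : ℝ)⁻¹ • (S t p.1 - p.1)) (𝓝[>] 0) (𝓝 p.2)}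

/-- `Λ - a` is dissipative, where `Λ` is the operator with graph `G`:
`‖(r - (Λ - a)) x‖ ≥ r ‖x‖` for every `x` in the domain and every `r > 0`. -/
def IsDissipativeSub (G : Set (X × X)) (a : ℝ) : Prop :=
  ∀ p ∈ G, ∀ r : ℝ, 0 < r → r * ‖p.1‖ ≤ ‖r • p.1 - (p.2 - a • p.1)‖

end Semigroup

end Boltzmann

end

open Boltzmann

noncomputable section
set_option linter.unusedSectionVars false
namespace Boltzmann

section Generation

variable {X : Type*} [NormedAddCommGroup X] [NormedSpace ℝ X]

/-- Bounded sequences of operators which converge pointwise on a dense set converge pointwise. -/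
theorem exists_tendsto_of_dense [CompleteSpace X] {T : ℕ → X →L[ℝ] X} (hT : ∀ n, ‖T n‖ ≤ 1)
    {D : Set X} (hD : Dense D) (hc : ∀ x ∈ D, CauchySeq fun n => T n x) (x : X) :
    ∃ y, Tendsto (fun n => T n x) atTop (𝓝 y) := by
  refine cauchySeq_tendsto_of_complete ?_
  rw [Metric.cauchySeq_iff]
  intro ε hε
  obtain ⟨z, hz, hxz⟩ := Metric.dense_iff.1 hD x (ε / 3) (by positivity)
  obtain ⟨N, hN⟩ := Metric.cauchySeq_iff.1 (hc z hxz) (ε / 3) (by positivity)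
  refine ⟨N, fun m hm n hn => ?_⟩
  have key : ∀ m, dist (T m x) (T m z) < ε / 3 := fun m => by
    rw [dist_eq_norm, ← map_sub]
    calc ‖T m (x - z)‖ ≤ 1 * ‖x - z‖ := (T m).le_of_opNorm_le (hT m) _
      _ < ε / 3 := by rw [one_mul, ← dist_eq_norm, dist_comm]; exact hz
  have h1 := key m
  have h2 := key n
  have h3 := hN m hm n hn
  have h4 := dist_triangle4 (T m x) (T m z) (T n z) (T n x)
  rw [dist_comm (T n z)] at h4
  linarith

/-- The pointwise limit of contractions. -/
theorem exists_limit_contraction {T : ℕ → X →L[ℝ] X} (hT : ∀ n, ‖T n‖ ≤ 1)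
    (h : ∀ x, ∃ y, Tendsto (fun n => T n x) atTop (𝓝 y)) :
    ∃ S : X →L[ℝ] X, ‖S‖ ≤ 1 ∧ ∀ x, Tendsto (fun n => T n x) atTop (𝓝 (S x)) := by
  choose f hf using h
  let L : X →ₗ[ℝ] X :=
    { toFun := f
      map_add' := fun x y => tendsto_nhds_unique (hf (x + y)) (by simpa using (hf x).add (hf y))
      map_smul' := fun c x =>
        tendsto_nhds_unique (hf (c • x)) (by simpa using (hf x).const_smul c) }
  have hL : ∀ x, ‖L x‖ ≤ 1 * ‖x‖ := fun x =>
    le_of_tendsto (hf x).norm (Eventually.of_forall fun n => (T n).le_of_opNorm_le (hT n) x)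
  exact ⟨L.mkContinuous 1 hL, L.mkContinuous_norm_le zero_le_one hL, hf⟩

variable [CompleteSpace X]

/-- The uniformly continuous semigroup of a bounded operator. -/
def expOp (A : X →L[ℝ] X) (t : ℝ) : X →L[ℝ] X := NormedSpace.exp (t • A)

theorem expOp_zero (A : X →L[ℝ] X) : expOp A 0 = 1 := by simp [expOp]

theorem expOp_add (A : X →L[ℝ] X) (t r : ℝ) : expOp A (t + r) = expOp A t * expOp A r := by
  let _ : NormedAlgebra ℚ (X →L[ℝ] X) := NormedAlgebra.restrictScalars ℚ ℝ _
  rw [expOp, add_smul, NormedSpace.exp_add_of_commute]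
  · rfl
  · exact ((Commute.refl A).smul_left t).smul_right r

theorem hasDerivAt_expOp (A : X →L[ℝ] X) (t : ℝ) :
    HasDerivAt (expOp A) (expOp A t * A) t := hasDerivAt_exp_smul_const A t

theorem expOp_commute {A B : X →L[ℝ] X} (h : Commute A B) (t : ℝ) : Commute (expOp A t) B :=
  (h.smul_left t).exp_left

theorem norm_exp_op_le (A : X →L[ℝ] X) : ‖NormedSpace.exp A‖ ≤ Real.exp ‖A‖ := by
  rw [NormedSpace.exp_eq_tsum ℝ]
  have h : HasSum (fun n : ℕ => ((n.factorial : ℝ))⁻¹ • ‖A‖ ^ n) (Real.exp ‖A‖) := by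
    rw [Real.exp_eq_exp_ℝ]
    exact NormedSpace.exp_series_hasSum_exp' (𝕂 := ℝ) ‖A‖
  refine tsum_of_norm_bounded h fun n => ?_
  rw [norm_smul, Real.norm_of_nonneg (by positivity), smul_eq_mul]
  gcongr
  rcases n.eq_zero_or_pos with rfl | hn
  · rw [pow_zero, pow_zero]; exact ContinuousLinearMap.norm_id_le
  · exact norm_pow_le' A hn

theorem norm_expOp_yosida_le {J : X →L[ℝ] X} {r : ℝ} (hr : 0 < r) (hJ : ‖J‖ ≤ 1 / r) {t : ℝ}
    (ht : 0 ≤ t) : ‖expOp (r ^ 2 • J - r • (1 : X →L[ℝ] X)) t‖ ≤ 1 := by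
  let _ : NormedAlgebra ℚ (X →L[ℝ] X) := NormedAlgebra.restrictScalars ℚ ℝ _
  have h : t • (r ^ 2 • J - r • (1 : X →L[ℝ] X))
      = (t * r ^ 2) • J + (-(t * r)) • (1 : X →L[ℝ] X) := by
    module
  rw [expOp, h, NormedSpace.exp_add_of_commute
    (((Commute.one_right J).smul_left _).smul_right _)]
  have h1 : NormedSpace.exp ((-(t * r)) • (1 : X →L[ℝ] X))
      = Real.exp (-(t * r)) • (1 : X →L[ℝ] X) := by
    have := NormedSpace.algebraMap_exp_comm (𝔸 := X →L[ℝ] X) (-(t * r))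
    rw [Algebra.algebraMap_eq_smul_one, Algebra.algebraMap_eq_smul_one] at this
    rw [← this, Real.exp_eq_exp_ℝ]
  rw [h1, mul_smul_comm, mul_one, norm_smul]
  have h2 : ‖NormedSpace.exp ((t * r ^ 2) • J)‖ ≤ Real.exp (t * r) := by
    refine (norm_exp_op_le _).trans ?_
    refine Real.exp_le_exp.2 ?_
    rw [norm_smul, Real.norm_of_nonneg (by positivity)]
    calc t * r ^ 2 * ‖J‖ ≤ t * r ^ 2 * (1 / r) := by gcongr
      _ = t * r := by field_simp
  rw [Real.norm_of_nonneg (Real.exp_pos _).le]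
  calc Real.exp (-(t * r)) * ‖NormedSpace.exp ((t * r ^ 2) • J)‖
      ≤ Real.exp (-(t * r)) * Real.exp (t * r) := by gcongr
    _ = 1 := by rw [← Real.exp_add]; simp

theorem norm_expOp_sub_expOp_le {P Q : X →L[ℝ] X} (h : Commute P Q)
    (hP : ∀ t, 0 ≤ t → ‖expOp P t‖ ≤ 1) (hQ : ∀ t, 0 ≤ t → ‖expOp Q t‖ ≤ 1) {t : ℝ} (ht : 0 ≤ t)
    (x : X) : ‖expOp P t x - expOp Q t x‖ ≤ ‖P x - Q x‖ * t := by
  have hd : ∀ τ : ℝ, HasDerivAt (fun τ => (expOp P τ * expOp Q (t - τ)) x)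
      ((expOp P τ * expOp Q (t - τ)) (P x - Q x)) τ := by
    intro τ
    have h1 := (hasDerivAt_expOp Q (t - τ)).scomp τ ((hasDerivAt_id τ).const_sub t)
    have h2 := ((hasDerivAt_expOp P τ).mul h1).clm_apply (hasDerivAt_const τ x)
    refine h2.congr_deriv ?_
    have hc : P * expOp Q (t - τ) = expOp Q (t - τ) * P := (expOp_commute h.symm _).symm
    simp only [neg_smul, one_smul, map_zero, add_zero, mul_neg, Function.comp_apply]
    rw [mul_assoc, hc, ← mul_assoc, ← mul_assoc, ← sub_eq_add_neg]
    simp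
  have := norm_image_sub_le_of_norm_deriv_le_segment' (a := 0) (b := t) (C := ‖P x - Q x‖)
    (fun τ _ => (hd τ).hasDerivWithinAt) (fun τ hτ => by
      refine ((expOp P τ * expOp Q (t - τ)).le_of_opNorm_le ?_ _).trans (one_mul _).le
      refine (norm_mul_le _ _).trans ?_
      exact mul_le_one₀ (hP τ hτ.1) (norm_nonneg _) (hQ _ (by linarith [hτ.2]))) t ⟨ht, le_rfl⟩
  simpa [expOp_zero] using this

theorem norm_expOp_sub_id_le {P : X →L[ℝ] X} (hP : ∀ t, 0 ≤ t → ‖expOp P t‖ ≤ 1) {t : ℝ}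
    (ht : 0 ≤ t) (x : X) : ‖expOp P t x - x‖ ≤ ‖P x‖ * t := by
  have h0 : ∀ t, expOp (0 : X →L[ℝ] X) t = 1 := fun t => by simp [expOp]
  have := norm_expOp_sub_expOp_le (Commute.zero_right P) hP
    (fun t _ => by rw [h0]; exact ContinuousLinearMap.norm_id_le) ht x
  simpa [h0] using this

theorem norm_expOp_sub_sub_le {P : X →L[ℝ] X} (hP : ∀ t, 0 ≤ t → ‖expOp P t‖ ≤ 1) {t : ℝ}
    (ht : 0 ≤ t) (x y z : X) :
    ‖expOp P t x - x - t • y‖ ≤ (‖P x - y‖ + 2 * ‖y - z‖ + ‖P z‖ * t) * t := by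
  have hd : ∀ τ : ℝ, HasDerivAt (fun τ => expOp P τ x - τ • y) (expOp P τ (P x) - y) τ := by
    intro τ
    have := ((hasDerivAt_expOp P τ).clm_apply (hasDerivAt_const τ x)).sub
      ((hasDerivAt_id τ).smul_const y)
    refine this.congr_deriv ?_
    simp
  have := norm_image_sub_le_of_norm_deriv_le_segment' (a := 0) (b := t)
    (C := ‖P x - y‖ + 2 * ‖y - z‖ + ‖P z‖ * t)
    (fun τ _ => (hd τ).hasDerivWithinAt) (fun τ hτ => by
      have e : expOp P τ (P x) - y
          = expOp P τ (P x - y) + (expOp P τ (y - z) + (z - y) + (expOp P τ z - z)) := by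
        simp only [map_sub]; abel
      have h1 := (expOp P τ).le_of_opNorm_le (hP τ hτ.1) (P x - y)
      have h2 := (expOp P τ).le_of_opNorm_le (hP τ hτ.1) (y - z)
      have h3 := norm_expOp_sub_id_le hP hτ.1 z
      have h4 : ‖P z‖ * τ ≤ ‖P z‖ * t := by gcongr; exact hτ.2.le
      have h5 := norm_add₃_le (a := expOp P τ (y - z)) (b := z - y) (c := expOp P τ z - z)
      have h6 := norm_add_le (expOp P τ (P x - y))
        (expOp P τ (y - z) + (z - y) + (expOp P τ z - z))
      rw [norm_sub_rev z y] at h5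
      rw [e]; linarith) t ⟨ht, le_rfl⟩
  simp only [expOp_zero, zero_smul, sub_zero, one_apply_eq_self] at this
  convert this using 2
  abel

/-- Resolvents of a dissipative relation with full range. -/
theorem exists_resolvent {G : Submodule ℝ (X × X)}
    (hd : ∀ p ∈ G, ∀ r : ℝ, 0 < r → r * ‖p.1‖ ≤ ‖r • p.1 - p.2‖) {r : ℝ} (hr : 0 < r)
    (hs : ∀ z, ∃ p ∈ G, r • p.1 - p.2 = z) :
    ∃ J : X →L[ℝ] X, ‖J‖ ≤ 1 / r ∧ (∀ z, (J z, r • J z - z) ∈ G) ∧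
      ∀ p ∈ G, J (r • p.1 - p.2) = p.1 := by
  choose f hf hfz using hs
  have huniq : ∀ p ∈ G, ∀ q ∈ G, r • p.1 - p.2 = r • q.1 - q.2 → p.1 = q.1 := by
    intro p hp q hq h
    have := hd _ (G.sub_mem hp hq) r hr
    have e : r • (p - q).1 - (p - q).2 = (r • p.1 - p.2) - (r • q.1 - q.2) := by
      simp only [Prod.fst_sub, Prod.snd_sub, smul_sub]; abel
    rw [e, h, sub_self, norm_zero] at this
    have h0 : ‖(p - q).1‖ ≤ 0 := by
      by_contra hc
      push Not at hc
      linarith [mul_pos hr hc]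
    exact sub_eq_zero.1 (norm_le_zero_iff.1 h0)
  let L : X →ₗ[ℝ] X :=
    { toFun := fun z => (f z).1
      map_add' := fun x y => huniq _ (hf (x + y)) _ (G.add_mem (hf x) (hf y)) (by
        rw [hfz, Prod.fst_add, Prod.snd_add, smul_add, add_sub_add_comm, hfz, hfz])
      map_smul' := fun c x => huniq _ (hf (c • x)) _ (G.smul_mem c (hf x)) (by
        rw [hfz, Prod.smul_fst, Prod.smul_snd, smul_comm, ← smul_sub, hfz]) }
  have hL : ∀ x, ‖L x‖ ≤ 1 / r * ‖x‖ := fun x => by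
    have := hd _ (hf x) r hr
    rw [hfz] at this
    change ‖(f x).1‖ ≤ _
    rw [one_div, inv_mul_eq_div, le_div_iff₀ hr]
    linarith
  refine ⟨L.mkContinuous _ hL, L.mkContinuous_norm_le (by positivity) hL, fun z => ?_,
    fun p hp => ?_⟩
  · change ((f z).1, r • (f z).1 - z) ∈ G
    have : r • (f z).1 - z = (f z).2 := by rw [sub_eq_iff_eq_add', ← sub_eq_iff_eq_add, hfz]
    rw [this]
    exact hf z
  · exact huniq _ (hf _) _ hp (hfz _)

theorem resolvent_commute {G : Submodule ℝ (X × X)} {J K : X →L[ℝ] X} {r q : ℝ}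
    (hJ : ∀ z, (J z, r • J z - z) ∈ G) (hJ' : ∀ p ∈ G, J (r • p.1 - p.2) = p.1)
    (hK : ∀ z, (K z, q • K z - z) ∈ G) (hK' : ∀ p ∈ G, K (q • p.1 - p.2) = p.1)
    (hrq : r ≠ q) : Commute J K := by
  ext z
  have h1 := hJ' _ (hK z)
  have h2 := hK' _ (hJ z)
  simp only at h1 h2
  have e1 : r • K z - (q • K z - z) = (r - q) • K z + z := by module
  have e2 : q • J z - (r • J z - z) = -((r - q) • J z) + z := by module
  rw [e1, map_add, map_smul] at h1
  rw [e2, map_add, map_neg, map_smul] at h2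
  have h3 : (r - q) • (J (K z)) = (r - q) • (K (J z)) := by
    rw [← h1] at h2
    have e : (r - q) • J (K z) - (r - q) • K (J z)
      = -((r - q) • K (J z)) + ((r - q) • J (K z) + J z) - J z := by abel
    rw [← sub_eq_zero, e, sub_eq_zero]
    simpa [h1] using h2
  exact smul_right_injective X (sub_ne_zero.2 hrq) h3

/-- Contraction semigroups from dissipative relations satisfying a range condition. -/
theorem exists_contraction_family {G : Submodule ℝ (X × X)}
    (hd : ∀ p ∈ G, ∀ r : ℝ, 0 < r → r * ‖p.1‖ ≤ ‖r • p.1 - p.2‖)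
    (hdense : Dense {x | ∃ y, (x, y) ∈ G})
    {r₀ : ℝ} (hs : ∀ r, r₀ ≤ r → ∀ z, ∃ p ∈ G, r • p.1 - p.2 = z) :
    ∃ S : ℝ → X →L[ℝ] X, (∀ t, 0 ≤ t → ‖S t‖ ≤ 1) ∧ S 0 = 1 ∧
      (∀ t r, 0 ≤ t → 0 ≤ r → S (t + r) = S t * S r) ∧
      (∀ p ∈ G, ∀ t, 0 ≤ t → ‖S t p.1 - p.1‖ ≤ ‖p.2‖ * t) ∧
      (∀ p ∈ G, ∀ q ∈ G, ∀ t, 0 ≤ t →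
        ‖S t p.1 - p.1 - t • p.2‖ ≤ (2 * ‖p.2 - q.1‖ + ‖q.2‖ * t) * t) := by
  set ρ : ℕ → ℝ := fun n => max r₀ 0 + (n + 1) with hρdef
  have hρ0 : ∀ n, 0 < ρ n := fun n => by
    have := le_max_right r₀ 0
    have : (0 : ℝ) ≤ n := n.cast_nonneg
    simp only [hρdef]; linarith
  have hρ1 : ∀ n, r₀ ≤ ρ n := fun n => by
    have := le_max_left r₀ 0
    have : (0 : ℝ) ≤ n := n.cast_nonneg
    simp only [hρdef]; linarith
  have hρt : Tendsto ρ atTop atTop :=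
    tendsto_atTop_add_const_left _ _ (tendsto_atTop_add_const_right _ _ tendsto_natCast_atTop_atTop)
  have hρinj : ∀ m n, m ≠ n → ρ m ≠ ρ n := fun m n h e => h (by
    simp only [hρdef, add_right_inj, add_left_inj] at e; exact_mod_cast e)
  choose J hJn hJG hJG' using fun n => exists_resolvent hd (hρ0 n) (hs _ (hρ1 n))
  set A : ℕ → X →L[ℝ] X := fun n => ρ n ^ 2 • J n - ρ n • (1 : X →L[ℝ] X) with hA
  have hcomm : ∀ m n, Commute (A m) (A n) := by
    intro m n
    rcases eq_or_ne m n with rfl | h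
    · exact Commute.refl _
    · have := resolvent_commute (hJG m) (hJG' m) (hJG n) (hJG' n) (hρinj m n h)
      exact (((this.smul_left _).smul_right _).sub_right
        ((Commute.one_right _).smul_right _)).sub_left
        (((Commute.one_left _).smul_left _))
  have hU : ∀ n t, 0 ≤ t → ‖expOp (A n) t‖ ≤ 1 := fun n t ht =>
    norm_expOp_yosida_le (hρ0 n) (hJn n) ht
  have hJA : ∀ n, ∀ p ∈ G, A n p.1 = ρ n • J n p.2 := by
    intro n p hp
    have h := hJG' n p hp
    rw [map_sub, map_smul] at h
    have : J n p.2 = ρ n • J n p.1 - p.1 := by rw [eq_sub_iff_add_eq', ← eq_sub_iff_add_eq, h]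
    rw [this]
    simp [hA, smul_sub, smul_smul, pow_two]
  have hJid : ∀ n, ‖ρ n • J n‖ ≤ 1 := fun n => by
    rw [norm_smul, Real.norm_of_nonneg (hρ0 n).le]
    calc ρ n * ‖J n‖ ≤ ρ n * (1 / ρ n) := mul_le_mul_of_nonneg_left (hJn n) (hρ0 n).le
      _ = 1 := by have := hρ0 n; field_simp
  have hJlim0 : ∀ p ∈ G, Tendsto (fun n => (ρ n • J n) p.1) atTop (𝓝 p.1) := by
    intro p hp
    rw [tendsto_iff_norm_sub_tendsto_zero]
    have hle : ∀ n, ‖(ρ n • J n) p.1 - p.1‖ ≤ ‖p.2‖ * (ρ n)⁻¹ := by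
      intro n
      have h := hJG' n p hp
      rw [map_sub, map_smul] at h
      have : (ρ n • J n) p.1 - p.1 = J n p.2 := by
        rw [smul_apply]; nth_rw 2 [← h]; abel
      rw [this]
      refine ((J n).le_of_opNorm_le (hJn n) _).trans_eq ?_
      rw [one_div, mul_comm]
    have hz : Tendsto (fun n => ‖p.2‖ * (ρ n)⁻¹) atTop (𝓝 0) := by
      simpa using (tendsto_inv_atTop_zero.comp hρt).const_mul ‖p.2‖
    exact squeeze_zero (fun _ => norm_nonneg _) hle hz
  obtain ⟨K, -, hK⟩ := exists_limit_contraction hJid (exists_tendsto_of_dense hJid hdense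
    (fun x ⟨y, hy⟩ => (hJlim0 _ hy).cauchySeq))
  have hK1 : K = 1 := by
    refine ContinuousLinearMap.coeFn_injective (Continuous.ext_on hdense K.continuous
      (1 : X →L[ℝ] X).continuous ?_)
    rintro x ⟨y, hy⟩
    exact tendsto_nhds_unique (hK x) (hJlim0 _ hy)
  have hAlim : ∀ p ∈ G, Tendsto (fun n => A n p.1) atTop (𝓝 p.2) := by
    intro p hp
    have := hK p.2
    rw [hK1] at this
    refine this.congr fun n => ?_
    rw [hJA n p hp]; rfl
  have hcau : ∀ t, 0 ≤ t → ∀ x ∈ {x | ∃ y, (x, y) ∈ G}, CauchySeq fun n => expOp (A n) t x := by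
    rintro t ht x ⟨y, hy⟩
    have hc := (hAlim _ hy).cauchySeq
    rw [Metric.cauchySeq_iff] at hc ⊢
    intro ε hε
    obtain ⟨N, hN⟩ := hc (ε / (t + 1)) (by positivity)
    refine ⟨N, fun m hm n hn => ?_⟩
    rw [dist_eq_norm]
    refine (norm_expOp_sub_expOp_le (hcomm m n) (hU m) (hU n) ht x).trans_lt ?_
    have h1 := hN m hm n hn
    rw [dist_eq_norm] at h1
    calc ‖A m x - A n x‖ * t ≤ ε / (t + 1) * t := by gcongr
      _ < ε / (t + 1) * (t + 1) := by gcongr; linarith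
      _ = ε := by field_simp
  have hex : ∀ t, ∃ S : X →L[ℝ] X, 0 ≤ t →
      ‖S‖ ≤ 1 ∧ ∀ x, Tendsto (fun n => expOp (A n) t x) atTop (𝓝 (S x)) := by
    intro t
    by_cases ht : 0 ≤ t
    · obtain ⟨S, h1, h2⟩ := exists_limit_contraction (fun n => hU n t ht)
        (exists_tendsto_of_dense (fun n => hU n t ht) hdense (hcau t ht))
      exact ⟨S, fun _ => ⟨h1, h2⟩⟩
    · exact ⟨0, fun h => absurd h ht⟩
  choose S hS using hex
  refine ⟨S, fun t ht => (hS t ht).1, ?_, ?_, ?_, ?_⟩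
  · ext x
    refine tendsto_nhds_unique ((hS 0 le_rfl).2 x) ?_
    simp [expOp_zero]
  · intro t r ht hr
    ext x
    refine tendsto_nhds_unique ((hS _ (add_nonneg ht hr)).2 x) ?_
    have h1 : Tendsto (fun n => expOp (A n) t (S r x)) atTop (𝓝 (S t (S r x))) := (hS t ht).2 _
    have h2 : Tendsto (fun n => expOp (A n) t (expOp (A n) r x - S r x)) atTop (𝓝 0) := by
      have h3 : Tendsto (fun n => ‖expOp (A n) r x - S r x‖) atTop (𝓝 0) :=
        tendsto_iff_norm_sub_tendsto_zero.1 ((hS r hr).2 x)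
      refine squeeze_zero_norm (fun n => ?_) h3
      exact ((expOp (A n) t).le_of_opNorm_le (hU n t ht) _).trans (one_mul _).le
    have h3 := h1.add h2
    rw [add_zero] at h3
    refine h3.congr fun n => ?_
    rw [← map_add, add_sub_cancel, expOp_add]; rfl
  · intro p hp t ht
    refine le_of_tendsto_of_tendsto (((hS t ht).2 p.1).sub_const p.1).norm
      ((hAlim p hp).norm.mul_const t) (Eventually.of_forall fun n => ?_)
    exact norm_expOp_sub_id_le (hU n) ht _
  · intro p hp q hq t ht
    have h1 : Tendsto (fun n => (‖A n p.1 - p.2‖ + 2 * ‖p.2 - q.1‖ + ‖A n q.1‖ * t) * t) atTop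
        (𝓝 ((0 + 2 * ‖p.2 - q.1‖ + ‖q.2‖ * t) * t)) :=
      (((tendsto_iff_norm_sub_tendsto_zero.1 (hAlim p hp)).add_const _).add
        ((hAlim q hq).norm.mul_const t)).mul_const t
    rw [zero_add] at h1
    refine le_of_tendsto_of_tendsto ((((hS t ht).2 p.1).sub_const p.1).sub_const _).norm h1
      (Eventually.of_forall fun n => ?_)
    exact norm_expOp_sub_sub_le (hU n) ht _ _ _

theorem tendsto_inv_mul_exp_sub_one (a : ℝ) :
    Tendsto (fun t : ℝ≥0 => (t : ℝ)⁻¹ * (Real.exp (a * t) - 1)) (𝓝[>] 0) (𝓝 a) := by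
  have h1 : HasDerivAt (fun t : ℝ => Real.exp (a * t)) a 0 := by
    have := ((hasDerivAt_id (0 : ℝ)).const_mul a).exp
    simpa using this
  have h2 := (hasDerivAt_iff_tendsto_slope_zero.1 h1)
  have h3 : Tendsto (fun t : ℝ≥0 => (t : ℝ)) (𝓝[>] 0) (𝓝[≠] 0) := by
    refine tendsto_nhdsWithin_iff.2 ⟨?_, ?_⟩
    · exact (NNReal.continuous_coe.tendsto' 0 0 rfl).mono_left nhdsWithin_le_nhds
    · filter_upwards [self_mem_nhdsWithin] with t ht
      exact (show (0 : ℝ) < t from ht).ne'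
  refine (h2.comp h3).congr fun t => ?_
  simp

/-- The Lumer–Phillips theorem, for a closed densely defined operator given by its graph `G`, with
decay rate `a`. -/
theorem exists_semigroup_of_dissipative {G : Submodule ℝ (X × X)} {a : ℝ}
    (hd : IsDissipativeSub (G : Set (X × X)) a) (hdense : Dense {x | ∃ y, (x, y) ∈ G})
    {r₀ : ℝ} (hs : ∀ r, r₀ ≤ r → ∀ z, ∃ p ∈ G, r • p.1 - p.2 = z) :
    ∃ S : ℝ≥0 → X →L[ℝ] X, IsC0Semigroup S ∧ generatorGraph S = (G : Set (X × X)) ∧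
      ∀ t : ℝ≥0, ‖S t‖ ≤ Real.exp (a * t) := by
  let φ : X × X →ₗ[ℝ] X × X :=
    (LinearMap.fst ℝ X X).prod (LinearMap.snd ℝ X X + a • LinearMap.fst ℝ X X)
  have hφ : ∀ p, p ∈ G.comap φ ↔ (p.1, p.2 + a • p.1) ∈ G := fun p => Iff.rfl
  have hφ' : ∀ p ∈ G, (p.1, p.2 - a • p.1) ∈ G.comap φ := fun p hp => by
    rw [hφ]; simpa using hp
  have hd' : ∀ p ∈ G.comap φ, ∀ r : ℝ, 0 < r → r * ‖p.1‖ ≤ ‖r • p.1 - p.2‖ := by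
    intro p hp r hr
    have := hd _ ((hφ p).1 hp) r hr
    simpa only [add_sub_cancel_right] using this
  have hdense' : Dense {x | ∃ y, (x, y) ∈ G.comap φ} :=
    hdense.mono (by rintro x ⟨y, hy⟩; exact ⟨_, hφ' _ hy⟩)
  have hs' : ∀ r, r₀ - a ≤ r → ∀ z, ∃ p ∈ G.comap φ, r • p.1 - p.2 = z := by
    intro r hr z
    obtain ⟨p, hp, hz⟩ := hs (r + a) (by linarith) z
    exact ⟨_, hφ' p hp, by rw [← hz]; module⟩
  obtain ⟨T, hT1, hT0, hTadd, hTlip, hTder⟩ := exists_contraction_family hd' hdense' hs'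
  have hTcont : ∀ x, Continuous fun t : ℝ≥0 => T t x := by
    have hstep : ∀ x ∈ {x | ∃ y, (x, y) ∈ G.comap φ}, Continuous fun t : ℝ≥0 => T t x := by
      rintro x ⟨y, hy⟩
      have hmono : ∀ t r : ℝ≥0, t ≤ r → dist (T t x) (T r x) ≤ ‖y‖ * dist t r := by
        intro t r htr
        have h1 : (r : ℝ) = t + (r - t) := by ring
        have h2 : (0 : ℝ) ≤ r - t := sub_nonneg.2 (by exact_mod_cast htr)
        rw [h1, hTadd _ _ t.coe_nonneg h2, dist_comm, dist_eq_norm]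
        change ‖T t (T (r - t) x) - T t x‖ ≤ _
        rw [← map_sub]
        refine ((T t).le_of_opNorm_le (hT1 _ t.2) _).trans ?_
        rw [one_mul, NNReal.dist_eq, abs_sub_comm, abs_of_nonneg h2]
        exact hTlip _ hy _ h2
      have : LipschitzWith ⟨‖y‖, norm_nonneg _⟩ fun t : ℝ≥0 => T t x := by
        refine LipschitzWith.of_dist_le_mul fun t r => ?_
        rcases le_total t r with h | h
        · exact hmono t r h
        · rw [dist_comm, dist_comm t r]; exact hmono r t h
      exact this.continuous
    intro x
    refine continuous_of_uniform_approx_of_continuous fun u hu => ?_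
    obtain ⟨ε, hε, hεu⟩ := Metric.mem_uniformity_dist.1 hu
    obtain ⟨z, hz, hxz⟩ := Metric.dense_iff.1 hdense' x ε hε
    refine ⟨fun t : ℝ≥0 => T t z, hstep z hxz, fun t => hεu ?_⟩
    rw [dist_eq_norm, ← map_sub]
    refine ((T t).le_of_opNorm_le (hT1 _ t.2) _).trans_lt ?_
    rw [one_mul, ← dist_eq_norm, dist_comm]; exact hz
  let S : ℝ≥0 → X →L[ℝ] X := fun t => Real.exp (a * t) • T t
  have hSx : ∀ (t : ℝ≥0) x, S t x = Real.exp (a * t) • T t x := fun t x => rfl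
  have htend : ∀ p ∈ G, Tendsto (fun t : ℝ≥0 => (t : ℝ)⁻¹ • (S t p.1 - p.1)) (𝓝[>] 0)
      (𝓝 p.2) := by
    intro p hp
    have hT : Tendsto (fun t : ℝ≥0 => (t : ℝ)⁻¹ • (T t p.1 - p.1)) (𝓝[>] 0)
        (𝓝 (p.2 - a • p.1)) := by
      rw [Metric.tendsto_nhds]
      intro ε hε
      obtain ⟨z, hz, y, hy⟩ := Metric.dense_iff.1 hdense' (p.2 - a • p.1) (ε / 4) (by positivity)
      have hlim : Tendsto (fun t : ℝ≥0 => ‖y‖ * (t : ℝ)) (𝓝[>] 0) (𝓝 0) := by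
        have h : Continuous fun t : ℝ≥0 => ‖y‖ * (t : ℝ) := by fun_prop
        have := h.tendsto 0
        simp only [NNReal.coe_zero, mul_zero] at this
        exact this.mono_left nhdsWithin_le_nhds
      filter_upwards [hlim.eventually (gt_mem_nhds (show (0 : ℝ) < ε / 4 by positivity)),
        self_mem_nhdsWithin] with t ht1 ht2
      have ht : (0 : ℝ) < t := ht2
      have h := hTder _ (hφ' p hp) _ hy t t.2
      rw [dist_eq_norm]
      have e : (t : ℝ)⁻¹ • (T t p.1 - p.1) - (p.2 - a • p.1)
          = (t : ℝ)⁻¹ • (T t p.1 - p.1 - (t : ℝ) • (p.2 - a • p.1)) := by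
        rw [smul_sub _ (T t p.1 - p.1), smul_smul, inv_mul_cancel₀ ht.ne', one_smul]
      rw [e, norm_smul, norm_inv, Real.norm_of_nonneg ht.le, inv_mul_lt_iff₀ ht]
      refine h.trans_lt ?_
      rw [mul_comm]
      rw [Metric.mem_ball, dist_comm, dist_eq_norm] at hz
      have : 2 * ‖p.2 - a • p.1 - z‖ + ‖y‖ * t < ε := by linarith
      exact mul_lt_mul_of_pos_left this ht
    have he := tendsto_inv_mul_exp_sub_one a
    have h4 : Tendsto (fun t : ℝ≥0 => T t p.1) (𝓝[>] 0) (𝓝 p.1) := by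
      have := (hTcont p.1).tendsto 0
      simp only [NNReal.coe_zero, hT0, one_apply_eq_self] at this
      exact this.mono_left nhdsWithin_le_nhds
    have h5 := hT.add (he.smul h4)
    rw [sub_add_cancel] at h5
    refine h5.congr fun t => ?_
    rw [hSx]
    module
  have hSnorm : ∀ t : ℝ≥0, ‖S t‖ ≤ Real.exp (a * t) := fun t => by
    change ‖Real.exp (a * t) • T t‖ ≤ _
    rw [norm_smul, Real.norm_of_nonneg (Real.exp_pos _).le]
    exact mul_le_of_le_one_right (Real.exp_pos _).le (hT1 _ t.2)
  refine ⟨S, ⟨?_, ?_, ?_⟩, ?_, hSnorm⟩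
  · ext x; simp [hSx, hT0]
  · intro t r
    ext x
    rw [ContinuousLinearMap.comp_apply, hSx, hSx, hSx, NNReal.coe_add, hTadd _ _ t.coe_nonneg r.coe_nonneg, mul_add,
      Real.exp_add, map_smul, smul_smul]
    rfl
  · intro x
    have := hTcont x
    simp only [hSx]
    exact Continuous.smul (by fun_prop) this
  · refine Set.Subset.antisymm (fun p hp => ?_) htend
    obtain ⟨q, hq, hqe⟩ := hs (max r₀ (a + 1)) (le_max_left _ _)
      (max r₀ (a + 1) • p.1 - p.2)
    set r := max r₀ (a + 1)
    have hra : 0 < r - a := by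
      have := le_max_right r₀ (a + 1)
      change a + 1 ≤ r at this
      linarith
    have hdiff : Tendsto (fun t : ℝ≥0 => (t : ℝ)⁻¹ • (S t (p.1 - q.1) - (p.1 - q.1))) (𝓝[>] 0)
        (𝓝 (p.2 - q.2)) := by
      refine (Tendsto.sub hp (htend q hq)).congr fun t => ?_
      rw [map_sub]; module
    have hpq : p.2 - q.2 = r • (p.1 - q.1) := by
      rw [smul_sub, ← sub_eq_zero, ← sub_eq_zero.2 hqe]; abel
    have hle : ∀ᶠ t : ℝ≥0 in 𝓝[>] 0, r * ‖p.1 - q.1‖ - 0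
        ≤ ‖r • (p.1 - q.1) - (t : ℝ)⁻¹ • (S t (p.1 - q.1) - (p.1 - q.1))‖
          + (t : ℝ)⁻¹ * (Real.exp (a * t) - 1) * ‖p.1 - q.1‖ := by
      filter_upwards [self_mem_nhdsWithin] with t ht2
      have ht : (0 : ℝ) < t := ht2
      set x := p.1 - q.1
      have e : (r + (t : ℝ)⁻¹) • x = (r • x - (t : ℝ)⁻¹ • (S t x - x)) + (t : ℝ)⁻¹ • S t x := by
        module
      have h1 := norm_add_le (r • x - (t : ℝ)⁻¹ • (S t x - x)) ((t : ℝ)⁻¹ • S t x)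
      rw [← e, norm_smul, norm_smul, norm_inv, Real.norm_of_nonneg ht.le] at h1
      have h2 : (t : ℝ)⁻¹ * ‖S t x‖ ≤ (t : ℝ)⁻¹ * (Real.exp (a * t) * ‖x‖) := by
        gcongr
        exact (S t).le_of_opNorm_le (hSnorm t) x
      have h3 : r + (t : ℝ)⁻¹ ≤ ‖r + (t : ℝ)⁻¹‖ := le_abs_self _
      have h4 := mul_le_mul_of_nonneg_right h3 (norm_nonneg x)
      linarith
    have he := tendsto_inv_mul_exp_sub_one a
    rw [hpq] at hdiff
    have hlim := ((hdiff.const_sub (r • (p.1 - q.1))).norm).add (he.mul_const ‖p.1 - q.1‖)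
    have hfin := ge_of_tendsto hlim hle
    rw [sub_self, norm_zero] at hfin
    have hx : ‖p.1 - q.1‖ ≤ 0 := by
      by_contra hc
      push Not at hc
      have := mul_pos hra hc
      linarith
    have hx1 : p.1 = q.1 := sub_eq_zero.1 (norm_le_zero_iff.1 hx)
    have hx2 : p.2 = q.2 := by
      rw [hx1, sub_self, smul_zero] at hpq
      exact sub_eq_zero.1 hpq
    have : p = q := Prod.ext hx1 hx2
    rw [this]
    exact hq

end Generation
end Boltzmann
end

noncomputable section
namespace Boltzmann

open scoped ENNReal Pointwise

instance : IsFiniteMeasure surf := by unfold surf; infer_instance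
instance : surf.IsOpenPosMeasure := by unfold surf; infer_instance
instance : SigmaFinite collMeasure := by unfold collMeasure; infer_instance

theorem norm_sph (σ : Sph) : ‖(σ : Vel)‖ = 1 := norm_eq_of_mem_sphere σ

/-- Action of linear isometries on the sphere. -/
def sphMap (U : Vel ≃ₗᵢ[ℝ] Vel) (σ : Sph) : Sph :=
  ⟨U σ, by rw [mem_sphere_zero_iff_norm, U.norm_map, norm_sph]⟩

@[simp] theorem coe_sphMap (U : Vel ≃ₗᵢ[ℝ] Vel) (σ : Sph) : (sphMap U σ : Vel) = U σ := rfl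

theorem continuous_sphMap (U : Vel ≃ₗᵢ[ℝ] Vel) : Continuous (sphMap U) :=
  Continuous.subtype_mk (U.continuous.comp continuous_subtype_val) _

theorem measurePreserving_sphMap (U : Vel ≃ₗᵢ[ℝ] Vel) :
    MeasurePreserving (sphMap U) surf surf := by
  refine ⟨(continuous_sphMap U).measurable, ?_⟩
  ext s hs
  rw [Measure.map_apply (continuous_sphMap U).measurable hs, surf, Measure.toSphere_apply' _ hs,
    Measure.toSphere_apply' _ ((continuous_sphMap U).measurable hs)]
  have h : Ioo (0 : ℝ) 1 • (((↑) : Sph → Vel) '' (sphMap U ⁻¹' s))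
      = U ⁻¹' (Ioo (0 : ℝ) 1 • (((↑) : Sph → Vel) '' s)) := by
    ext x
    simp only [Set.mem_smul, mem_image, mem_preimage]
    constructor
    · rintro ⟨r, hr, y, ⟨σ, hσ, rfl⟩, rfl⟩
      exact ⟨r, hr, _, ⟨_, hσ, rfl⟩, by simp⟩
    · rintro ⟨r, hr, y, ⟨σ, hσ, rfl⟩, h⟩
      refine ⟨r, hr, U.symm σ, ⟨sphMap U.symm σ, ?_, rfl⟩, ?_⟩
      · convert hσ
        ext1; simp
      · apply U.injective
        rw [← h]; simp
  rw [h, ← U.coe_toHomeomorph]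
  congr 1
  exact (U.measurePreserving).measure_preimage_emb U.toHomeomorph.measurableEmbedding _

theorem exists_sphMap_eq (x y : Sph) : ∃ U : Vel ≃ₗᵢ[ℝ] Vel, sphMap U x = y := by
  refine ⟨(ℝ ∙ ((x : Vel) - y))ᗮ.reflection, ?_⟩
  ext1
  exact Submodule.reflection_sub (by rw [norm_sph, norm_sph])

theorem inner_sphMap (U : Vel ≃ₗᵢ[ℝ] Vel) (x y : Sph) :
    inner ℝ (sphMap U x : Vel) (sphMap U y : Vel) = inner ℝ (x : Vel) y := by
  simp

/-- Polar coordinates in `ℝ³`. -/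
theorem lintegral_polar {F : Vel → ℝ≥0∞} (hF : Measurable F) :
    ∫⁻ x, F x = ∫⁻ σ : Sph, (∫⁻ r in Ioi (0 : ℝ), ENNReal.ofReal (r ^ 2) * F (r • (σ : Vel))) ∂surf := by
  have h1 : ∫⁻ x, F x = ∫⁻ x in ({0}ᶜ : Set Vel), F x := by
    rw [restrict_compl_singleton]
  have h2 : MeasurePreserving (homeomorphUnitSphereProd Vel)
      ((volume : Measure Vel).comap (↑)) (surf.prod (.volumeIoiPow (3 - 1))) := by
    have := (volume : Measure Vel).measurePreserving_homeomorphUnitSphereProd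
    rwa [finrank_euclideanSpace_fin] at this
  have h3 : Measurable fun p : Sph × Ioi (0 : ℝ) => F ((p.2 : ℝ) • (p.1 : Vel)) := by
    fun_prop
  rw [h1, ← lintegral_subtype_comap (measurableSet_singleton _).compl]
  have h4 : ∀ x : ({0}ᶜ : Set Vel), F x
      = F (((homeomorphUnitSphereProd Vel x).2 : ℝ) • ((homeomorphUnitSphereProd Vel x).1 : Vel)) := by
    intro x
    have := (homeomorphUnitSphereProd Vel).symm_apply_apply x
    conv_lhs => rw [← this]
    rfl
  simp_rw [h4]
  rw [h2.lintegral_comp h3, lintegral_prod _ h3.aemeasurable]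
  refine lintegral_congr fun σ => ?_
  rw [Measure.volumeIoiPow, lintegral_withDensity_eq_lintegral_mul _ (by fun_prop) (by fun_prop)]
  simp only [Pi.mul_apply]
  exact lintegral_subtype_comap measurableSet_Ioi
    fun r : ℝ => ENNReal.ofReal (r ^ 2) * F (r • (σ : Vel))

theorem lintegral_radial_scale {c : ℝ} (hc : 0 < c) (G : ℝ → ℝ≥0∞) :
    ∫⁻ r in Ioi (0 : ℝ), ENNReal.ofReal (r ^ 2) * G (c * r)
      = ENNReal.ofReal ((c ^ 3)⁻¹) * ∫⁻ r in Ioi (0 : ℝ), ENNReal.ofReal (r ^ 2) * G r := by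
  have h := MeasurableEmbedding.lintegral_map (μ := (volume : Measure ℝ).restrict (Ioi 0))
    (measurableEmbedding_mulLeft₀ hc.ne') (fun r => ENNReal.ofReal (r ^ 2) * G r)
  have hm : Measure.map (c * ·) ((volume : Measure ℝ).restrict (Ioi 0))
      = ENNReal.ofReal c⁻¹ • (volume : Measure ℝ).restrict (Ioi 0) := by
    have h1 : (Ioi (0 : ℝ)) = (c * ·) ⁻¹' Ioi 0 := by
      ext r; simp [hc]
    conv_lhs => rw [h1]
    rw [← Measure.restrict_map (measurable_const_mul c) measurableSet_Ioi,
      Real.map_volume_mul_left hc.ne', Measure.restrict_smul, abs_of_pos (inv_pos.2 hc)]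
  rw [hm, lintegral_smul_measure] at h
  have h2 : ∀ r : ℝ, ENNReal.ofReal ((c * r) ^ 2) * G (c * r)
      = ENNReal.ofReal (c ^ 2) * (ENNReal.ofReal (r ^ 2) * G (c * r)) := fun r => by
    rw [mul_pow, ENNReal.ofReal_mul (by positivity), mul_assoc]
  simp_rw [h2] at h
  rw [lintegral_const_mul' _ _ ENNReal.ofReal_ne_top] at h
  have h3 : (c ^ 3)⁻¹ = (c ^ 2)⁻¹ * c⁻¹ := by field_simp
  rw [h3, ENNReal.ofReal_mul (by positivity), mul_assoc]
  rw [smul_eq_mul] at h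
  rw [h, ← mul_assoc, ← ENNReal.ofReal_mul (by positivity), inv_mul_cancel₀ (by positivity)]
  simp

/-- Finite measures on the sphere which are invariant under isometries are determined by their
mass. -/
theorem eq_smul_surf_of_invariant {ρ : Measure Sph} [IsFiniteMeasure ρ]
    (hρ : ∀ U, ρ.map (sphMap U) = ρ) :
    ρ = (ρ univ / surf univ) • surf := by
  have e : Sph := ⟨EuclideanSpace.single 0 1, by simp⟩
  have hball : ∀ (m : Measure Sph), (∀ U, m.map (sphMap U) = m) → ∀ (η : ℝ) (x y : Sph),
      m (Metric.ball x η) = m (Metric.ball y η) := by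
    intro m hm η x y
    obtain ⟨U, hU⟩ := exists_sphMap_eq x y
    conv_rhs => rw [← hm U]
    rw [Measure.map_apply (continuous_sphMap U).measurable Metric.isOpen_ball.measurableSet]
    congr 1
    ext z
    rw [mem_preimage, Metric.mem_ball, Metric.mem_ball, ← hU]
    simp only [Subtype.dist_eq, coe_sphMap, U.dist_map]
  have hsurf : surf univ ≠ 0 := (isOpen_univ.measure_pos surf ⟨e, trivial⟩).ne'
  have hc : ρ univ / surf univ ≠ ⊤ := ENNReal.div_ne_top (measure_ne_top _ _) hsurf
  have : IsFiniteMeasure ((ρ univ / surf univ) • surf) := surf.smul_finite hc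
  refine ext_of_forall_integral_eq_of_IsFiniteMeasure fun f => ?_
  have hfc : UniformContinuous f := CompactSpace.uniformContinuous_of_continuous f.continuous
  obtain ⟨B, hB⟩ : ∃ B, ∀ x, ‖f x‖ ≤ B := ⟨‖f‖, f.norm_coe_le_norm⟩
  -- comparison of the two averages of `f` against the kernel `𝟙_{|x - y| < η}`
  have key : ∀ ε > 0, |surf.real univ * ∫ x, f x ∂ρ - ρ.real univ * ∫ y, f y ∂surf|
      ≤ ε * (ρ.real univ * surf.real univ) := by
    intro ε hε
    obtain ⟨η, hη, hfη⟩ := Metric.uniformContinuous_iff.1 hfc ε hε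
    set κ := surf.real (Metric.ball e η) with hκdef
    set κ' := ρ.real (Metric.ball e η) with hκ'def
    have hκ : 0 < κ := ENNReal.toReal_pos
      (Metric.isOpen_ball.measure_pos surf ⟨e, Metric.mem_ball_self hη⟩).ne' (measure_ne_top _ _)
    let K : Sph × Sph → ℝ := fun p => (Metric.ball p.1 η).indicator (fun _ => 1) p.2
    have hKset : MeasurableSet {p : Sph × Sph | dist p.2 p.1 < η} :=
      (isOpen_lt (by fun_prop) continuous_const).measurableSet
    have hKm : Measurable K := measurable_const.indicator hKset
    have hK01 : ∀ p, ‖K p‖ ≤ 1 := fun p => by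
      simp only [K]
      exact (norm_indicator_le_norm_self _ _).trans (by simp)
    have hKsymm : ∀ x y, K (x, y) = K (y, x) := fun x y => by
      simp [K, Set.indicator, Metric.mem_ball, dist_comm]
    have hK1 : ∀ x, ∫ y, K (x, y) ∂surf = κ := fun x => by
      simp only [K]
      rw [integral_indicator_const _ Metric.isOpen_ball.measurableSet, smul_eq_mul, mul_one,
        measureReal_def, hball surf (fun U => (measurePreserving_sphMap U).map_eq) η x e]
      rfl
    have hK2 : ∀ y, ∫ x, K (x, y) ∂ρ = κ' := fun y => by
      simp only [hKsymm _ y]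
      simp only [K]
      rw [integral_indicator_const _ Metric.isOpen_ball.measurableSet, smul_eq_mul, mul_one,
        measureReal_def, hball ρ hρ η y e]
      rfl
    have hint : ∀ g : Sph × Sph → ℝ, Measurable g → (∀ p, ‖g p‖ ≤ B) →
        Integrable (fun p => g p * K p) (ρ.prod surf) := fun g hg hgB =>
      Integrable.of_bound (hg.mul hKm).aestronglyMeasurable B (Eventually.of_forall fun p => by
        rw [norm_mul]
        calc ‖g p‖ * ‖K p‖ ≤ B * 1 := mul_le_mul (hgB p) (hK01 p) (norm_nonneg _)
              ((norm_nonneg _).trans (hgB p))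
          _ = B := mul_one B)
    have hi1 := hint (fun p => f p.1) (f.continuous.measurable.comp measurable_fst) fun p => hB p.1
    have hi2 := hint (fun p => f p.2) (f.continuous.measurable.comp measurable_snd) fun p => hB p.2
    have hiK : Integrable K (ρ.prod surf) :=
      Integrable.of_bound hKm.aestronglyMeasurable 1 (Eventually.of_forall hK01)
    have e1 : ∫ p, f p.1 * K p ∂(ρ.prod surf) = κ * ∫ x, f x ∂ρ := by
      rw [integral_prod _ hi1]
      simp only [integral_const_mul, hK1]
      rw [integral_mul_const, mul_comm]
    have e2 : ∫ p, f p.2 * K p ∂(ρ.prod surf) = κ' * ∫ x, f x ∂surf := by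
      rw [integral_prod_symm _ hi2]
      simp only [integral_const_mul, hK2]
      rw [integral_mul_const, mul_comm]
    have e3 : ∫ p, K p ∂(ρ.prod surf) = κ * ρ.real univ := by
      rw [integral_prod _ hiK]
      simp [hK1, mul_comm]
    have e4 : ∫ p, K p ∂(ρ.prod surf) = κ' * surf.real univ := by
      rw [integral_prod_symm _ hiK]
      simp [hK2, mul_comm]
    have hdiff : |κ * ∫ x, f x ∂ρ - κ' * ∫ x, f x ∂surf| ≤ ε * (κ * ρ.real univ) := by
      rw [← e1, ← e2, ← integral_sub hi1 hi2, ← e3, ← integral_const_mul]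
      refine (abs_integral_le_integral_abs).trans
        (integral_mono (hi1.sub hi2).abs (hiK.const_mul ε) fun p => ?_)
      simp only
      rw [← sub_mul, abs_mul]
      simp only [K, Set.indicator]
      split_ifs with h
      · rw [Metric.mem_ball, dist_comm] at h
        have := (hfη h).le
        rw [Real.dist_eq] at this
        simpa using this
      · simp
    have hκ'e : κ' * surf.real univ = κ * ρ.real univ := by rw [← e3, e4]
    have hs0 : 0 ≤ surf.real univ := measureReal_nonneg
    have e5 : surf.real univ * ∫ x, f x ∂ρ - ρ.real univ * ∫ y, f y ∂surf
        = surf.real univ / κ * (κ * ∫ x, f x ∂ρ - κ' * ∫ x, f x ∂surf) := by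
      have : ρ.real univ = κ' * surf.real univ / κ := by rw [hκ'e]; field_simp
      rw [this]; field_simp
    rw [e5, abs_mul, abs_of_nonneg (by positivity)]
    calc surf.real univ / κ * |κ * ∫ x, f x ∂ρ - κ' * ∫ x, f x ∂surf|
        ≤ surf.real univ / κ * (ε * (κ * ρ.real univ)) := by gcongr
      _ = _ := by field_simp
  have hz : surf.real univ * ∫ x, f x ∂ρ - ρ.real univ * ∫ y, f y ∂surf = 0 := by
    rw [← abs_nonpos_iff]
    refine le_of_forall_pos_le_add fun ε hε => ?_
    have h0 : 0 ≤ ρ.real univ * surf.real univ := by positivity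
    refine (key (ε / (ρ.real univ * surf.real univ + 1)) (by positivity)).trans ?_
    rw [zero_add, div_mul_eq_mul_div, div_le_iff₀ (by positivity)]
    nlinarith
  have hs' : surf.real univ ≠ 0 := (ENNReal.toReal_pos hsurf (measure_ne_top _ _)).ne'
  rw [integral_smul_measure, ENNReal.toReal_div, smul_eq_mul]
  change _ = ρ.real univ / surf.real univ * _
  rw [div_mul_eq_mul_div, eq_div_iff hs', mul_comm]
  linarith

end Boltzmann
end

noncomputable section
namespace Boltzmann

open scoped ENNReal Pointwise

/-- Cosine of the angle between two unit vectors. -/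
def dot (x y : Sph) : ℝ := inner ℝ (x : Vel) (y : Vel)

theorem measurable_dot : Measurable fun p : Sph × Sph => dot p.1 p.2 := by
  unfold dot
  fun_prop

theorem measurable_dot_right (e : Sph) : Measurable (dot e) := by
  unfold dot
  fun_prop

theorem dot_sphMap (U : Vel ≃ₗᵢ[ℝ] Vel) (x y : Sph) : dot (sphMap U x) (sphMap U y) = dot x y :=
  inner_sphMap U x y

theorem dot_le_one (x y : Sph) : dot x y ≤ 1 := by
  have := real_inner_le_norm (x : Vel) y
  rwa [norm_sph, norm_sph, one_mul] at this

theorem neg_one_le_dot (x y : Sph) : -1 ≤ dot x y := by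
  have := neg_le_of_abs_le (abs_real_inner_le_norm (x : Vel) y)
  rwa [norm_sph, norm_sph, one_mul] at this

theorem norm_add_sph_sq (x y : Sph) : ‖(x : Vel) + y‖ ^ 2 = 2 * (1 + dot x y) := by
  rw [norm_add_sq_real, norm_sph, norm_sph]
  unfold dot
  ring

/-- The midpoint of two points on the sphere. -/
def mid (x y : Sph) : Sph :=
  if h : (x : Vel) + y = 0 then x else ⟨‖(x : Vel) + y‖⁻¹ • ((x : Vel) + y), by
    rw [mem_sphere_zero_iff_norm, norm_smul, norm_inv, norm_norm,
      inv_mul_cancel₀ (norm_ne_zero_iff.2 h)]⟩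

theorem coe_mid (x y : Sph) : (mid x y : Vel)
    = if (x : Vel) + y = 0 then (x : Vel) else ‖(x : Vel) + y‖⁻¹ • ((x : Vel) + y) := by
  unfold mid
  split_ifs <;> rfl

theorem norm_smul_mid (x y : Sph) : ‖(x : Vel) + y‖ • (mid x y : Vel) = (x : Vel) + y := by
  rw [coe_mid]
  split_ifs with h
  · rw [h, norm_zero, zero_smul]
  · rw [smul_smul, mul_inv_cancel₀ (norm_ne_zero_iff.2 h), one_smul]

theorem measurable_mid : Measurable fun p : Sph × Sph => mid p.1 p.2 := by
  refine (MeasurableEmbedding.subtype_coe Metric.isClosed_sphere.measurableSet).measurable_comp_iff.1 ?_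
  simp only [Function.comp_def]
  simp only [coe_mid]
  refine Measurable.ite ?_ (by fun_prop) (by fun_prop)
  exact measurableSet_eq_fun (by fun_prop) measurable_const

theorem mid_sphMap (U : Vel ≃ₗᵢ[ℝ] Vel) (x y : Sph) :
    mid (sphMap U x) (sphMap U y) = sphMap U (mid x y) := by
  ext1
  rw [coe_sphMap, coe_mid, coe_mid]
  simp only [coe_sphMap, ← map_add, map_eq_zero_iff U U.injective, U.norm_map]
  split_ifs <;> simp

theorem map_equivariant_invariant {g : Sph × Sph → Sph} (hg : Measurable g)
    (hgU : ∀ (U : Vel ≃ₗᵢ[ℝ] Vel) p, g (sphMap U p.1, sphMap U p.2) = sphMap U (g p)) {B : Set ℝ}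
    (hB : MeasurableSet B) (U : Vel ≃ₗᵢ[ℝ] Vel) :
    (((surf.prod surf).restrict {p | dot p.1 p.2 ∈ B}).map g).map (sphMap U)
      = ((surf.prod surf).restrict {p | dot p.1 p.2 ∈ B}).map g := by
  have hS : MeasurableSet {p : Sph × Sph | dot p.1 p.2 ∈ B} := measurable_dot hB
  have hU := (measurePreserving_sphMap U).prod (measurePreserving_sphMap U)
  have hUm := hU.restrict_preimage hS
  have hpre : Prod.map (sphMap U) (sphMap U) ⁻¹' {p : Sph × Sph | dot p.1 p.2 ∈ B}
      = {p : Sph × Sph | dot p.1 p.2 ∈ B} := by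
    ext p; simp [dot_sphMap]
  rw [hpre] at hUm
  rw [Measure.map_map (continuous_sphMap U).measurable hg]
  conv_rhs => rw [← hUm.map_eq]
  rw [Measure.map_map hg hU.measurable]
  congr 1
  funext p
  exact (hgU U p).symm

/-- The midpoint of two random unit vectors is uniformly distributed, independently of their
angle. -/
theorem lintegral_mid {F : Sph → ℝ → ℝ≥0∞} (hF : Measurable (Function.uncurry F)) :
    ∫⁻ p, F (mid p.1 p.2) (dot p.1 p.2) ∂(surf.prod surf)
      = ∫⁻ p, F p.1 (dot p.1 p.2) ∂(surf.prod surf) := by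
  have hm1 : Measurable fun p : Sph × Sph => (mid p.1 p.2, dot p.1 p.2) :=
    measurable_mid.prodMk measurable_dot
  have hm2 : Measurable fun p : Sph × Sph => (p.1, dot p.1 p.2) :=
    measurable_fst.prodMk measurable_dot
  have key : (surf.prod surf).map (fun p : Sph × Sph => (mid p.1 p.2, dot p.1 p.2))
      = (surf.prod surf).map fun p : Sph × Sph => (p.1, dot p.1 p.2) := by
    refine Measure.ext_prod fun {A B} hA hB => ?_
    rw [Measure.map_apply hm1 (hA.prod hB), Measure.map_apply hm2 (hA.prod hB)]
    have hS : MeasurableSet {p : Sph × Sph | dot p.1 p.2 ∈ B} := measurable_dot hB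
    have e1 := eq_smul_surf_of_invariant (map_equivariant_invariant measurable_mid
      (fun U p => mid_sphMap U p.1 p.2) hB)
    have e2 := eq_smul_surf_of_invariant (map_equivariant_invariant measurable_fst
      (fun U p => rfl) hB)
    have hmass : ((surf.prod surf).restrict {p : Sph × Sph | dot p.1 p.2 ∈ B}).map
          (fun p : Sph × Sph => mid p.1 p.2) univ
        = ((surf.prod surf).restrict {p : Sph × Sph | dot p.1 p.2 ∈ B}).map Prod.fst univ := by
      rw [Measure.map_apply measurable_mid .univ, Measure.map_apply measurable_fst .univ]
      rfl
    rw [hmass] at e1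
    have e3 := congrArg (fun m => m A) (e1.trans e2.symm)
    rw [Measure.map_apply measurable_mid hA, Measure.map_apply measurable_fst hA,
      Measure.restrict_apply (measurable_mid hA), Measure.restrict_apply (measurable_fst hA)] at e3
    exact e3
  have h1 := lintegral_map (μ := surf.prod surf) hF hm1
  have h2 := lintegral_map (μ := surf.prod surf) hF hm2
  rw [key] at h1
  exact h1.symm.trans h2

/-- The sine of half of the angle whose cosine is `x`. -/
def hsin (x : ℝ) : ℝ := Real.sqrt ((1 - x) / 2)

/-- The cosine of half of the angle whose cosine is `x`. -/
def hcos (x : ℝ) : ℝ := Real.sqrt ((1 + x) / 2)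

theorem hcos_pos {x : ℝ} (hx : 0 ≤ x) : 0 < hcos x := Real.sqrt_pos.2 (by linarith)

theorem hcos_dot (x y : Sph) : hcos (dot x y) = ‖(x : Vel) + y‖ / 2 := by
  have h : (1 + dot x y) / 2 = (‖(x : Vel) + y‖ / 2) ^ 2 := by
    rw [div_pow, norm_add_sph_sq]; ring
  rw [hcos, h, Real.sqrt_sq (by positivity)]

theorem lintegral_coll_polar (v : Vel) {Q : Vel × Sph → ℝ≥0∞} (hQ : Measurable Q) :
    ∫⁻ p, Q p ∂collMeasure
      = ∫⁻ r in Ioi (0 : ℝ), ENNReal.ofReal (r ^ 2) *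
        ∫⁻ q, Q (v - r • (q.1 : Vel), q.2) ∂(surf.prod surf) := by
  have h0 : Measurable fun w => ∫⁻ σ, Q (w, σ) ∂surf := hQ.lintegral_prod_right'
  have h1 : Measurable fun x : Vel => ∫⁻ σ, Q (v - x, σ) ∂surf := h0.comp (by fun_prop)
  rw [collMeasure, lintegral_prod _ hQ.aemeasurable,
    ← lintegral_sub_left_eq_self (fun w => ∫⁻ σ, Q (w, σ) ∂surf) v, lintegral_polar h1,
    lintegral_lintegral_swap]
  · refine lintegral_congr fun r => ?_
    rw [lintegral_const_mul _ (by fun_prop), lintegral_prod _ (by fun_prop)]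
  · refine Measurable.aemeasurable ?_
    simp only [Function.uncurry_def]
    have : Measurable fun q : Sph × ℝ => v - q.2 • (q.1 : Vel) := by fun_prop
    exact Measurable.mul (by fun_prop) (h0.comp this)

/-- Direction of the relative velocity. -/
def dir (v w : Vel) : Sph :=
  if h : v - w = 0 then ⟨EuclideanSpace.single 0 1, by simp⟩ else ⟨‖v - w‖⁻¹ • (v - w), by
    rw [mem_sphere_zero_iff_norm, norm_smul, norm_inv, norm_norm,
      inv_mul_cancel₀ (norm_ne_zero_iff.2 h)]⟩

theorem coe_dir {v w : Vel} (h : v ≠ w) : (dir v w : Vel) = ‖v - w‖⁻¹ • (v - w) := by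
  rw [dir, dif_neg (sub_ne_zero.2 h)]

theorem norm_smul_dir (v w : Vel) : ‖v - w‖ • (dir v w : Vel) = v - w := by
  rcases eq_or_ne v w with rfl | h
  · simp
  · rw [coe_dir h, smul_smul, mul_inv_cancel₀ (norm_ne_zero_iff.2 (sub_ne_zero.2 h)), one_smul]

theorem dir_of_sub_eq {v w : Vel} {r : ℝ} (hr : 0 < r) {x : Sph} (h : v - w = r • (x : Vel)) :
    dir v w = x := by
  have hn : ‖v - w‖ = r := by rw [h, norm_smul, norm_sph, mul_one, Real.norm_of_nonneg hr.le]
  have hne : v ≠ w := by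
    rintro rfl
    rw [sub_self, norm_zero] at hn
    exact hr.ne hn
  ext1
  rw [coe_dir hne, hn, h, smul_smul, inv_mul_cancel₀ hr.ne', one_smul]

theorem cosDev_eq_dot {v w : Vel} (h : v ≠ w) (σ : Sph) : cosDev v w σ = dot (dir v w) σ := by
  rw [cosDev, dot, coe_dir h]

theorem cosDev_self (v : Vel) (σ : Sph) : cosDev v v σ = 0 := by simp [cosDev]

theorem measurable_dir : Measurable fun p : Vel × Vel => dir p.1 p.2 := by
  refine (MeasurableEmbedding.subtype_coe Metric.isClosed_sphere.measurableSet).measurable_comp_iff.1 ?_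
  simp only [Function.comp_def]
  have : ∀ p : Vel × Vel, (dir p.1 p.2 : Vel)
      = if p.1 - p.2 = 0 then EuclideanSpace.single 0 1 else ‖p.1 - p.2‖⁻¹ • (p.1 - p.2) := by
    intro p
    unfold dir
    split_ifs <;> rfl
  simp only [this]
  refine Measurable.ite ?_ (by fun_prop) (by fun_prop)
  exact measurableSet_eq_fun (by fun_prop) measurable_const

theorem measurable_cosDev :
    Measurable fun p : Vel × Vel × Sph => cosDev p.1 p.2.1 p.2.2 := by
  unfold cosDev
  fun_prop

theorem measurable_post : Measurable fun p : Vel × Vel × Sph => post p.1 p.2.1 p.2.2 := by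
  unfold post
  fun_prop

theorem measurable_postStar :
    Measurable fun p : Vel × Vel × Sph => postStar p.1 p.2.1 p.2.2 := by
  unfold postStar
  fun_prop

theorem measurable_cosDev_right (v : Vel) :
    Measurable fun p : Vel × Sph => cosDev v p.1 p.2 := by
  unfold cosDev
  fun_prop

theorem measurable_post_right (v : Vel) : Measurable fun p : Vel × Sph => post v p.1 p.2 := by
  unfold post
  fun_prop

theorem measurable_postStar_right (v : Vel) :
    Measurable fun p : Vel × Sph => postStar v p.1 p.2 := by
  unfold postStar
  fun_prop

/-- Change of variables `v_* → v'_*` for fixed `v`. -/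
theorem lintegral_postStar (v : Vel) {F : Vel × ℝ × ℝ → ℝ≥0∞} (hF : Measurable F)
    (hF0 : ∀ y r x, x < 0 → F (y, r, x) = 0) :
    ∫⁻ p, F (postStar v p.1 p.2, ‖v - p.1‖, cosDev v p.1 p.2) ∂collMeasure
      = ∫⁻ p, ENNReal.ofReal ((hcos (cosDev v p.1 p.2) ^ 3)⁻¹) *
          F (p.1, ‖v - p.1‖ / hcos (cosDev v p.1 p.2), cosDev v p.1 p.2) ∂collMeasure := by
  have hcosm : Measurable hcos := by unfold hcos; fun_prop
  have mcos := measurable_cosDev_right v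
  have mps := measurable_postStar_right v
  have hdot : Measurable fun q : Sph × Sph => dot q.1 q.2 := measurable_dot
  have mQ1 : Measurable fun p : Vel × Sph => F (postStar v p.1 p.2, ‖v - p.1‖, cosDev v p.1 p.2) :=
    hF.comp (mps.prodMk ((measurable_const.sub measurable_fst).norm.prodMk mcos))
  have mQ2 : Measurable fun p : Vel × Sph => ENNReal.ofReal ((hcos (cosDev v p.1 p.2) ^ 3)⁻¹) *
      F (p.1, ‖v - p.1‖ / hcos (cosDev v p.1 p.2), cosDev v p.1 p.2) :=
    ((hcosm.comp mcos).pow_const 3).inv.ennreal_ofReal.mul (hF.comp (measurable_fst.prodMk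
      (((measurable_const.sub measurable_fst).norm.div (hcosm.comp mcos)).prodMk mcos)))
  have mF1 : Measurable fun z : ℝ × Sph × Sph =>
      F (v - (hcos (dot z.2.1 z.2.2) * z.1) • (z.2.1 : Vel), z.1, dot z.2.1 z.2.2) := by
    have hd : Measurable fun z : ℝ × Sph × Sph => dot z.2.1 z.2.2 := hdot.comp measurable_snd
    refine hF.comp (Measurable.prodMk ?_ (measurable_fst.prodMk hd))
    exact measurable_const.sub (((hcosm.comp hd).mul measurable_fst).smul
      (measurable_subtype_coe.comp (measurable_fst.comp measurable_snd)))
  have mF2 : Measurable fun z : ℝ × Sph × Sph =>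
      ENNReal.ofReal ((hcos (dot z.2.1 z.2.2) ^ 3)⁻¹) *
      F (v - z.1 • (z.2.1 : Vel), z.1 / hcos (dot z.2.1 z.2.2), dot z.2.1 z.2.2) := by
    have hd : Measurable fun z : ℝ × Sph × Sph => dot z.2.1 z.2.2 := hdot.comp measurable_snd
    refine ((hcosm.comp hd).pow_const 3).inv.ennreal_ofReal.mul
      (hF.comp (Measurable.prodMk ?_ ((measurable_fst.div (hcosm.comp hd)).prodMk hd)))
    exact measurable_const.sub (measurable_fst.smul
      (measurable_subtype_coe.comp (measurable_fst.comp measurable_snd)))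
  have mr : Measurable fun z : ℝ × Sph × Sph => ENNReal.ofReal (z.1 ^ 2) :=
    (measurable_fst.pow_const 2).ennreal_ofReal
  rw [lintegral_coll_polar v mQ1, lintegral_coll_polar v mQ2]
  have sub1 : ∀ (r : ℝ) (q : Sph × Sph), v - (v - r • (q.1 : Vel)) = r • (q.1 : Vel) :=
    fun r q => sub_sub_cancel _ _
  have cos1 : ∀ r : ℝ, 0 < r → ∀ q : Sph × Sph,
      cosDev v (v - r • (q.1 : Vel)) q.2 = dot q.1 q.2 := by
    intro r hr q
    rw [cosDev, sub1, norm_smul, norm_sph, mul_one, Real.norm_of_nonneg hr.le, smul_smul,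
      inv_mul_cancel₀ hr.ne', one_smul, dot]
  have nrm1 : ∀ r : ℝ, 0 < r → ∀ q : Sph × Sph, ‖v - (v - r • (q.1 : Vel))‖ = r := by
    intro r hr q
    rw [sub1, norm_smul, norm_sph, mul_one, Real.norm_of_nonneg hr.le]
  have ps1 : ∀ r : ℝ, 0 < r → ∀ q : Sph × Sph, postStar v (v - r • (q.1 : Vel)) q.2
      = v - (hcos (dot q.1 q.2) * r) • (mid q.1 q.2 : Vel) := by
    intro r hr q
    have h := norm_smul_mid q.1 q.2
    have h2 : (hcos (dot q.1 q.2) * r) • (mid q.1 q.2 : Vel)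
        = (r / 2) • ((q.1 : Vel) + q.2) := by
      rw [← h, hcos_dot, smul_smul]
      congr 1; ring
    rw [h2, postStar, nrm1 r hr]
    module
  calc _ = ∫⁻ r in Ioi (0 : ℝ), ENNReal.ofReal (r ^ 2) *
        ∫⁻ q, F (v - (hcos (dot q.1 q.2) * r) • (q.1 : Vel), r, dot q.1 q.2)
          ∂(surf.prod surf) := by
        refine setLIntegral_congr_fun measurableSet_Ioi fun r hr => ?_
        simp only
        congr 1
        simp only [cos1 r hr, nrm1 r hr, ps1 r hr]
        refine lintegral_mid (F := fun e x => F (v - (hcos x * r) • (e : Vel), r, x)) (hF.comp ?_)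
        exact (measurable_const.sub (((hcosm.comp measurable_snd).mul_const r).smul
          (measurable_subtype_coe.comp measurable_fst))).prodMk
            (measurable_const.prodMk measurable_snd)
    _ = ∫⁻ r in Ioi (0 : ℝ), ∫⁻ q : Sph × Sph, ENNReal.ofReal (r ^ 2) *
        F (v - (hcos (dot q.1 q.2) * r) • (q.1 : Vel), r, dot q.1 q.2) ∂(surf.prod surf) := by
        refine lintegral_congr fun r => ?_
        rw [lintegral_const_mul' _ _ ENNReal.ofReal_ne_top]
    _ = ∫⁻ q : Sph × Sph, (∫⁻ r in Ioi (0 : ℝ), ENNReal.ofReal (r ^ 2) *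
          F (v - (hcos (dot q.1 q.2) * r) • (q.1 : Vel), r, dot q.1 q.2)) ∂(surf.prod surf) :=
        lintegral_lintegral_swap (mr.mul mF1).aemeasurable
    _ = ∫⁻ q : Sph × Sph, (∫⁻ r in Ioi (0 : ℝ), ENNReal.ofReal (r ^ 2) *
          (ENNReal.ofReal ((hcos (dot q.1 q.2) ^ 3)⁻¹) *
          F (v - r • (q.1 : Vel), r / hcos (dot q.1 q.2), dot q.1 q.2))) ∂(surf.prod surf) := by
        refine lintegral_congr fun q => ?_
        by_cases hx : dot q.1 q.2 < 0
        · simp [hF0 _ _ _ hx]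
        · have hc := hcos_pos (not_lt.1 hx)
          have := lintegral_radial_scale hc
            (fun r => F (v - r • (q.1 : Vel), r / hcos (dot q.1 q.2), dot q.1 q.2))
          simp only [mul_div_cancel_left₀ _ hc.ne'] at this
          rw [this, ← lintegral_const_mul' _ _ ENNReal.ofReal_ne_top]
          refine lintegral_congr fun r => ?_
          ring
    _ = ∫⁻ r in Ioi (0 : ℝ), ∫⁻ q : Sph × Sph, ENNReal.ofReal (r ^ 2) *
          (ENNReal.ofReal ((hcos (dot q.1 q.2) ^ 3)⁻¹) *
          F (v - r • (q.1 : Vel), r / hcos (dot q.1 q.2), dot q.1 q.2)) ∂(surf.prod surf) :=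
        (lintegral_lintegral_swap (mr.mul mF2).aemeasurable).symm
    _ = _ := by
        refine setLIntegral_congr_fun measurableSet_Ioi fun r hr => ?_
        simp only [cos1 r hr, nrm1 r hr]
        rw [lintegral_const_mul' _ _ ENNReal.ofReal_ne_top]

/-- The measure `d(v, v_*, σ)`. -/
def phaseMeasure : Measure (Vel × Vel × Sph) := (volume : Measure Vel).prod collMeasure

theorem lintegral_phase_polar {Q : Vel × Vel × Sph → ℝ≥0∞} (hQ : Measurable Q) :
    ∫⁻ q, Q q ∂phaseMeasure
      = ∫⁻ r in Ioi (0 : ℝ), ENNReal.ofReal (r ^ 2) * ∫⁻ c : Vel,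
        ∫⁻ q, Q (c + (r / 2) • (q.1 : Vel), c - (r / 2) • (q.1 : Vel), q.2)
          ∂(surf.prod surf) := by
  have hQ0 : Measurable fun z : (Vel × Vel) × Sph => Q (z.1.1, z.1.2, z.2) :=
    hQ.comp ((measurable_fst.comp measurable_fst).prodMk
      ((measurable_snd.comp measurable_fst).prodMk measurable_snd))
  have hQ1 : Measurable fun z : Vel × Vel => ∫⁻ σ, Q (z.1, z.2, σ) ∂surf :=
    hQ0.lintegral_prod_right'
  set Q1 : Vel × Vel → ℝ≥0∞ := fun z => ∫⁻ σ, Q (z.1, z.2, σ) ∂surf with hQ1def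
  have hA : Measurable fun z : Vel × Vel => Q1 (z.1, z.1 - z.2) := hQ1.comp (by fun_prop)
  have hB : Measurable fun z : Vel × Vel => Q1 (z.2 + (1 / 2 : ℝ) • z.1, z.2 - (1 / 2 : ℝ) • z.1) :=
    hQ1.comp (by fun_prop)
  have hC : Measurable fun x : Vel =>
      ∫⁻ c : Vel, Q1 (c + (1 / 2 : ℝ) • x, c - (1 / 2 : ℝ) • x) := hB.lintegral_prod_right'
  calc ∫⁻ q, Q q ∂phaseMeasure = ∫⁻ v : Vel, ∫⁻ w : Vel, Q1 (v, w) := by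
        rw [phaseMeasure, lintegral_prod _ hQ.aemeasurable]
        refine lintegral_congr fun v => ?_
        rw [collMeasure]
        exact lintegral_prod _ (hQ.comp measurable_prodMk_left).aemeasurable
    _ = ∫⁻ v : Vel, ∫⁻ x : Vel, Q1 (v, v - x) := by
        refine lintegral_congr fun v => ?_
        exact (lintegral_sub_left_eq_self (fun w => Q1 (v, w)) v).symm
    _ = ∫⁻ x : Vel, ∫⁻ v : Vel, Q1 (v, v - x) := lintegral_lintegral_swap hA.aemeasurable
    _ = ∫⁻ x : Vel, ∫⁻ c : Vel, Q1 (c + (1 / 2 : ℝ) • x, c - (1 / 2 : ℝ) • x) := by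
        refine lintegral_congr fun x => ?_
        rw [← lintegral_add_right_eq_self (fun v => Q1 (v, v - x)) ((1 / 2 : ℝ) • x)]
        refine lintegral_congr fun c => ?_
        congr 2
        module
    _ = ∫⁻ σ : Sph, (∫⁻ r in Ioi (0 : ℝ), ENNReal.ofReal (r ^ 2) * ∫⁻ c : Vel,
          Q1 (c + (r / 2) • (σ : Vel), c - (r / 2) • (σ : Vel))) ∂surf := by
        rw [lintegral_polar hC]
        simp only [smul_smul, one_div_mul_eq_div]
    _ = ∫⁻ r in Ioi (0 : ℝ), ∫⁻ σ : Sph, (ENNReal.ofReal (r ^ 2) * ∫⁻ c : Vel,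
          Q1 (c + (r / 2) • (σ : Vel), c - (r / 2) • (σ : Vel))) ∂surf := by
        refine lintegral_lintegral_swap (Measurable.aemeasurable ?_)
        have : Measurable fun z : Sph × ℝ => ∫⁻ c : Vel,
            Q1 (c + (1 / 2 : ℝ) • (z.2 • (z.1 : Vel)), c - (1 / 2 : ℝ) • (z.2 • (z.1 : Vel))) :=
          hC.comp (measurable_snd.smul (measurable_subtype_coe.comp measurable_fst))
        simp only [smul_smul, one_div_mul_eq_div] at this
        exact (measurable_snd.pow_const 2).ennreal_ofReal.mul this
    _ = _ := by
        refine lintegral_congr fun r => ?_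
        rw [lintegral_const_mul' _ _ ENNReal.ofReal_ne_top]
        congr 1
        have hD : Measurable fun z : Sph × Vel => Q1 (z.2 + (r / 2) • (z.1 : Vel),
            z.2 - (r / 2) • (z.1 : Vel)) := by
          refine hQ1.comp (Measurable.prodMk ?_ ?_)
          · fun_prop
          · fun_prop
        rw [lintegral_lintegral_swap hD.aemeasurable]
        refine lintegral_congr fun c => ?_
        have hE : Measurable fun q : Sph × Sph =>
            Q (c + (r / 2) • (q.1 : Vel), c - (r / 2) • (q.1 : Vel), q.2) := by
          have h1 : Measurable fun q : Sph × Sph => (r / 2) • (q.1 : Vel) := by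
            fun_prop
          exact hQ.comp ((measurable_const.add h1).prodMk
            ((measurable_const.sub h1).prodMk measurable_snd))
        rw [lintegral_prod _ hE.aemeasurable]

/-- The pre-post collisional involution. -/
def prePost (q : Vel × Vel × Sph) : Vel × Vel × Sph :=
  (post q.1 q.2.1 q.2.2, postStar q.1 q.2.1 q.2.2, dir q.1 q.2.1)

theorem measurable_prePost : Measurable prePost := by
  have h : Measurable fun q : Vel × Vel × Sph => dir q.1 q.2.1 :=
    measurable_dir.comp (measurable_fst.prodMk (measurable_fst.comp measurable_snd))
  exact measurable_post.prodMk (measurable_postStar.prodMk h)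

theorem prePost_eq {r : ℝ} (hr : 0 < r) (c : Vel) (x y : Sph) :
    prePost (c + (r / 2) • (x : Vel), c - (r / 2) • (x : Vel), y)
      = (c + (r / 2) • (y : Vel), c - (r / 2) • (y : Vel), x) := by
  have h : c + (r / 2) • (x : Vel) - (c - (r / 2) • (x : Vel)) = r • (x : Vel) := by module
  have hn : ‖c + (r / 2) • (x : Vel) - (c - (r / 2) • (x : Vel))‖ = r := by
    rw [h, norm_smul, norm_sph, mul_one, Real.norm_of_nonneg hr.le]
  simp only [prePost, post, postStar, hn, dir_of_sub_eq hr h]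
  refine Prod.ext ?_ (Prod.ext ?_ rfl)
  · simp only; module
  · simp only; module

theorem measurePreserving_prePost : MeasurePreserving prePost phaseMeasure phaseMeasure := by
  refine ⟨measurable_prePost, Measure.ext_of_lintegral _ fun Q hQ => ?_⟩
  rw [lintegral_map hQ measurable_prePost, lintegral_phase_polar (Q := fun q => Q (prePost q)) (hQ.comp measurable_prePost),
    lintegral_phase_polar hQ]
  refine setLIntegral_congr_fun measurableSet_Ioi fun r hr => ?_
  congr 1
  refine lintegral_congr fun c => ?_
  simp only [prePost_eq (mem_Ioi.1 hr)]
  exact lintegral_prod_swap (μ := surf) (ν := surf)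
    (fun q : Sph × Sph => Q (c + (r / 2) • (q.1 : Vel), c - (r / 2) • (q.1 : Vel), q.2))

/-- The antipodal map. -/
def antipode (σ : Sph) : Sph := sphMap (LinearIsometryEquiv.neg ℝ) σ

@[simp] theorem coe_antipode (σ : Sph) : (antipode σ : Vel) = -σ := rfl

/-- Exchange of the two particles. -/
def exchange (q : Vel × Vel × Sph) : Vel × Vel × Sph := (q.2.1, q.1, antipode q.2.2)

theorem measurePreserving_exchange : MeasurePreserving exchange phaseMeasure phaseMeasure := by
  have h1 : MeasurePreserving antipode surf surf := measurePreserving_sphMap _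
  have h2 : MeasurePreserving (Prod.map (Prod.swap : Vel × Vel → Vel × Vel) antipode)
      (((volume : Measure Vel).prod (volume : Measure Vel)).prod surf)
      (((volume : Measure Vel).prod (volume : Measure Vel)).prod surf) :=
    Measure.measurePreserving_swap.prod h1
  have h3 := measurePreserving_prodAssoc (volume : Measure Vel) (volume : Measure Vel) surf
  exact (h3.comp h2).comp h3.symm

theorem post_exchange (v w : Vel) (σ : Sph) : post w v (antipode σ) = postStar v w σ := by
  simp only [post, postStar, coe_antipode, norm_sub_rev w v]
  module

theorem postStar_exchange (v w : Vel) (σ : Sph) : postStar w v (antipode σ) = post v w σ := by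
  simp only [post, postStar, coe_antipode, norm_sub_rev w v]
  module

theorem cosDev_exchange (v w : Vel) (σ : Sph) : cosDev w v (antipode σ) = cosDev v w σ := by
  rw [cosDev, cosDev, coe_antipode, norm_sub_rev w v, ← neg_sub v w, smul_neg, inner_neg_neg]

theorem post_sub_postStar (v w : Vel) (σ : Sph) :
    post v w σ - postStar v w σ = ‖v - w‖ • (σ : Vel) := by
  simp only [post, postStar]
  module

theorem norm_post_sub_postStar (v w : Vel) (σ : Sph) :
    ‖post v w σ - postStar v w σ‖ = ‖v - w‖ := by
  rw [post_sub_postStar, norm_smul, norm_sph, mul_one, norm_norm]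

theorem post_prePost (v w : Vel) (σ : Sph) :
    post (post v w σ) (postStar v w σ) (dir v w) = v := by
  rw [post, norm_post_sub_postStar]
  have h := norm_smul_dir v w
  have : (‖v - w‖ / 2) • (dir v w : Vel) = (1 / 2 : ℝ) • (v - w) := by
    rw [← h, norm_smul, norm_norm, norm_sph]; module
  rw [this, post, postStar]
  module

theorem postStar_prePost (v w : Vel) (σ : Sph) :
    postStar (post v w σ) (postStar v w σ) (dir v w) = w := by
  rw [postStar, norm_post_sub_postStar]
  have h := norm_smul_dir v w
  have : (‖v - w‖ / 2) • (dir v w : Vel) = (1 / 2 : ℝ) • (v - w) := by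
    rw [← h, norm_smul, norm_norm, norm_sph]; module
  rw [this, post, postStar]
  module

theorem cosDev_prePost {v w : Vel} (h : v ≠ w) (σ : Sph) :
    cosDev (post v w σ) (postStar v w σ) (dir v w) = cosDev v w σ := by
  have hn : ‖v - w‖ ≠ 0 := norm_ne_zero_iff.2 (sub_ne_zero.2 h)
  rw [cosDev, norm_post_sub_postStar, post_sub_postStar, smul_smul, inv_mul_cancel₀ hn, one_smul,
    cosDev, coe_dir h, real_inner_comm]

end Boltzmann
end

noncomputable section
namespace Boltzmann

open scoped ENNReal

theorem measurable_hsin : Measurable hsin := by unfold hsin; fun_prop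
theorem measurable_hcos : Measurable hcos := by unfold hcos; fun_prop
theorem hsin_nonneg (x : ℝ) : 0 ≤ hsin x := Real.sqrt_nonneg _
theorem hcos_nonneg (x : ℝ) : 0 ≤ hcos x := Real.sqrt_nonneg _
theorem hsin_sq {x : ℝ} (hx : x ≤ 1) : hsin x ^ 2 = (1 - x) / 2 := Real.sq_sqrt (by linarith)
theorem hcos_sq {x : ℝ} (hx : -1 ≤ x) : hcos x ^ 2 = (1 + x) / 2 := Real.sq_sqrt (by linarith)
theorem hsin_le_one {x : ℝ} (hx : -1 ≤ x) : hsin x ≤ 1 := Real.sqrt_le_one.2 (by linarith)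
theorem hcos_le_one {x : ℝ} (hx : x ≤ 1) : hcos x ≤ 1 := Real.sqrt_le_one.2 (by linarith)

/-- A reference direction. -/
def axis : Sph := ⟨EuclideanSpace.single 0 1, by simp⟩

theorem dot_axis (σ : Sph) : dot axis σ = (σ : Vel) 0 := by
  simp [dot, axis, EuclideanSpace.inner_single_left]

/-- Integral over the sphere of a function of the angle with a fixed direction. -/
def sphInt (β : ℝ → ℝ) : ℝ := ∫ σ, β (dot axis σ) ∂surf

/-- Integrability over the sphere of a function of the angle with a fixed direction. -/
def SphIntegrable (β : ℝ → ℝ) : Prop := Integrable (fun σ => β (dot axis σ)) surf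

theorem measurableEmbedding_sphMap (U : Vel ≃ₗᵢ[ℝ] Vel) : MeasurableEmbedding (sphMap U) := by
  refine ((continuous_sphMap U).isClosedEmbedding fun x y h => ?_).measurableEmbedding
  ext1
  exact U.injective (congrArg Subtype.val h)

theorem integral_dot (e : Sph) (β : ℝ → ℝ) : ∫ σ, β (dot e σ) ∂surf = sphInt β := by
  obtain ⟨U, hU⟩ := exists_sphMap_eq axis e
  rw [← (measurePreserving_sphMap U).integral_comp (measurableEmbedding_sphMap U)]
  simp only [← hU, dot_sphMap]
  rfl

theorem SphIntegrable.dot {β : ℝ → ℝ} (h : SphIntegrable β) (e : Sph) :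
    Integrable (fun σ => β (dot e σ)) surf := by
  obtain ⟨U, hU⟩ := exists_sphMap_eq axis e
  rw [← (measurePreserving_sphMap U).integrable_comp_emb (measurableEmbedding_sphMap U)]
  simp only [← hU, Function.comp_def, dot_sphMap]
  exact h

theorem ae_ne_vel (v : Vel) : ∀ᵐ w : Vel, v ≠ w := by
  have : ({v}ᶜ : Set Vel) ∈ ae (volume : Measure Vel) := compl_mem_ae_iff.2 (measure_singleton v)
  filter_upwards [this] with w hw h
  exact hw h.symm

theorem SphIntegrable.collision {H : Vel → ℝ} {β : ℝ → ℝ} (hβ : SphIntegrable β)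
    (hβm : Measurable β) (hH : Integrable H) (v : Vel) :
    Integrable (fun p : Vel × Sph => H p.1 * β (cosDev v p.1 p.2)) collMeasure ∧
      ∫ p, H p.1 * β (cosDev v p.1 p.2) ∂collMeasure = (∫ w, H w) * sphInt β := by
  have hm : AEStronglyMeasurable (fun p : Vel × Sph => H p.1 * β (cosDev v p.1 p.2))
      collMeasure :=
    (hH.aestronglyMeasurable.comp_fst).mul
      (hβm.comp (measurable_cosDev_right v)).aestronglyMeasurable
  have h1 : ∀ w, v ≠ w → (fun σ => β (cosDev v w σ)) = fun σ => β (Boltzmann.dot (dir v w) σ) := by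
    intro w hw
    simp only [cosDev_eq_dot hw]
  have hint : Integrable (fun p : Vel × Sph => H p.1 * β (cosDev v p.1 p.2)) collMeasure := by
    refine (integrable_prod_iff hm).2 ⟨?_, ?_⟩
    · filter_upwards [ae_ne_vel v] with w hw
      refine Integrable.const_mul ?_ _
      rw [h1 w hw]
      exact hβ.dot _
    · refine (hH.norm.mul_const (sphInt fun x => ‖β x‖)).congr ?_
      filter_upwards [ae_ne_vel v] with w hw
      simp only [norm_mul, cosDev_eq_dot hw]
      rw [integral_const_mul, integral_dot _ fun x => ‖β x‖]
  refine ⟨hint, ?_⟩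
  rw [collMeasure, integral_prod _ hint, ← integral_mul_const]
  refine integral_congr_ae ?_
  filter_upwards [ae_ne_vel v] with w hw
  simp only [cosDev_eq_dot hw]
  rw [integral_const_mul, integral_dot]

theorem SphIntegrable.phase {K H : Vel → ℝ} {β : ℝ → ℝ} (hβ : SphIntegrable β)
    (hβm : Measurable β) (hK : Integrable K) (hH : Integrable H) :
    Integrable (fun q : Vel × Vel × Sph => K q.1 * (H q.2.1 * β (cosDev q.1 q.2.1 q.2.2)))
        phaseMeasure ∧
      ∫ q, K q.1 * (H q.2.1 * β (cosDev q.1 q.2.1 q.2.2)) ∂phaseMeasure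
        = (∫ v, K v) * ((∫ w, H w) * sphInt β) := by
  have hm : AEStronglyMeasurable
      (fun q : Vel × Vel × Sph => K q.1 * (H q.2.1 * β (cosDev q.1 q.2.1 q.2.2)))
      phaseMeasure :=
    (hK.aestronglyMeasurable.comp_fst).mul (((hH.aestronglyMeasurable.comp_fst (ν := surf)).comp_snd
      (μ := (volume : Measure Vel))).mul (hβm.comp measurable_cosDev).aestronglyMeasurable)
  have hn : SphIntegrable fun x => ‖β x‖ := Integrable.norm hβ
  have hint : Integrable
      (fun q : Vel × Vel × Sph => K q.1 * (H q.2.1 * β (cosDev q.1 q.2.1 q.2.2))) phaseMeasure := by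
    refine (integrable_prod_iff hm).2 ⟨Eventually.of_forall fun v => ?_, ?_⟩
    · exact (hβ.collision hβm hH v).1.const_mul (K v)
    · refine (hK.norm.mul_const ((∫ w, ‖H w‖) * sphInt fun x => ‖β x‖)).congr
        (Eventually.of_forall fun v => ?_)
      simp only [norm_mul]
      rw [integral_const_mul, (hn.collision hβm.norm hH.norm v).2]
  refine ⟨hint, ?_⟩
  rw [phaseMeasure, integral_prod _ hint, ← integral_mul_const]
  refine integral_congr_ae (Eventually.of_forall fun v => ?_)
  simp only
  rw [integral_const_mul, (hβ.collision hβm hH v).2]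

theorem integrable_abs_rpow_mul_exp {a : ℝ} (ha : a < 1) :
    Integrable fun t : ℝ => |t| ^ (-a) * Real.exp (-1 * |t| ^ 2) := by
  have h := integrableOn_rpow_mul_exp_neg_mul_sq one_pos (s := -a) (by linarith)
  have h2 := (integrable_fun_norm_addHaar (E := ℝ) (volume : Measure ℝ)
    (f := fun y : ℝ => y ^ (-a) * Real.exp (-1 * y ^ 2))).2 (by simpa using h)
  simpa using h2

theorem integrable_axis_singularity {a : ℝ} (ha : a < 1) (ha0 : 0 ≤ a) :
    Integrable fun x : Vel => (x 1 ^ 2 + x 2 ^ 2) ^ (-a) * Real.exp (-‖x‖ ^ 2) := by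
  let f : Fin 3 → ℝ → ℝ := fun i t =>
    |t| ^ (-(if i = 0 then 0 else a)) * Real.exp (-1 * |t| ^ 2)
  have hf : ∀ i, Integrable (f i) := fun i =>
    integrable_abs_rpow_mul_exp (by split_ifs <;> linarith)
  have h1 : Integrable (fun x : Fin 3 → ℝ => ∏ i, f i (x i)) :=
    Integrable.fintype_prod hf
  have h2 : Integrable (fun x : Vel => ∏ i, f i (x i)) :=
    (PiLp.volume_preserving_ofLp (Fin 3)).integrable_comp_of_integrable h1
  refine h2.mono' (by fun_prop) ?_
  have hne : ∀ i : Fin 3, ∀ᵐ x : Vel, x i ≠ 0 := by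
    intro i
    have h := (PiLp.volume_preserving_ofLp (Fin 3)).quasiMeasurePreserving.ae
      (Measure.ae_eval_ne (μ := fun _ : Fin 3 => (volume : Measure ℝ)) i 0)
    exact h
  filter_upwards [hne 1, hne 2] with x h1 h2
  rw [Real.norm_of_nonneg (by positivity), EuclideanSpace.norm_sq_eq]
  simp only [f, Fin.prod_univ_three, Fin.sum_univ_three, Real.norm_eq_abs]
  have h1' := abs_pos.2 h1
  have h2' := abs_pos.2 h2
  have e : Real.exp (-(|x 0| ^ 2 + |x 1| ^ 2 + |x 2| ^ 2))
      = Real.exp (-1 * |x 0| ^ 2) * Real.exp (-1 * |x 1| ^ 2) * Real.exp (-1 * |x 2| ^ 2) := by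
    rw [← Real.exp_add, ← Real.exp_add]; congr 1; ring
  have h3 : (x 1 ^ 2 + x 2 ^ 2) ^ (-a) ≤ |x 1| ^ (-a) * |x 2| ^ (-a) := by
    rw [← Real.mul_rpow h1'.le h2'.le]
    refine Real.rpow_le_rpow_of_nonpos (by positivity) ?_ (by linarith)
    rw [← sq_abs (x 1), ← sq_abs (x 2)]
    nlinarith [sq_nonneg (|x 1| - |x 2|), mul_pos h1' h2']
  rw [e]
  simp only [if_true, Fin.isValue, one_ne_zero, if_false, neg_zero, Real.rpow_zero, one_mul,
    show (2 : Fin 3) ≠ 0 by decide]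
  calc _ ≤ |x 1| ^ (-a) * |x 2| ^ (-a) * (Real.exp (-1 * |x 0| ^ 2) * Real.exp (-1 * |x 1| ^ 2)
        * Real.exp (-1 * |x 2| ^ 2)) := by gcongr
    _ = _ := by ring

theorem sphIntegrable_one_sub_sq_rpow {a : ℝ} (ha : a < 1) (ha0 : 0 ≤ a) :
    SphIntegrable fun x => (1 - x ^ 2) ^ (-a) := by
  have hm : Measurable fun σ : Sph => (1 - dot axis σ ^ 2) ^ (-a) :=
    (measurable_const.sub ((measurable_dot_right axis).pow_const 2)).pow_const (-a)
  have h1 := integrable_axis_singularity ha ha0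
  have hm1 : Measurable fun x : Vel => (x 1 ^ 2 + x 2 ^ 2) ^ (-a) * Real.exp (-‖x‖ ^ 2) := by
    fun_prop
  have h2 := h1.lintegral_lt_top
  rw [lintegral_polar hm1.ennreal_ofReal] at h2
  have key : ∀ σ : Sph, ∫⁻ r in Ioi (0 : ℝ), ENNReal.ofReal (r ^ 2) * ENNReal.ofReal
      (((r • (σ : Vel)) 1 ^ 2 + (r • (σ : Vel)) 2 ^ 2) ^ (-a) * Real.exp (-‖r • (σ : Vel)‖ ^ 2))
      = ENNReal.ofReal ((1 - dot axis σ ^ 2) ^ (-a)) * ∫⁻ r in Ioi (0 : ℝ),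
        ENNReal.ofReal (r ^ 2 * (r ^ 2) ^ (-a) * Real.exp (-r ^ 2)) := by
    intro σ
    rw [← lintegral_const_mul' _ _ ENNReal.ofReal_ne_top]
    refine setLIntegral_congr_fun measurableSet_Ioi fun r hr => ?_
    have hr' : (0 : ℝ) < r := hr
    have hσ : (σ : Vel) 1 ^ 2 + (σ : Vel) 2 ^ 2 = 1 - dot axis σ ^ 2 := by
      have := EuclideanSpace.norm_sq_eq (σ : Vel)
      rw [norm_sph, Fin.sum_univ_three] at this
      simp only [Real.norm_eq_abs, sq_abs] at this
      rw [dot_axis]; linarith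
    have hσ0 : 0 ≤ 1 - dot axis σ ^ 2 := by rw [← hσ]; positivity
    simp only [PiLp.smul_apply, smul_eq_mul, norm_smul, norm_sph, mul_one,
      Real.norm_of_nonneg hr'.le]
    rw [← ENNReal.ofReal_mul (by positivity), ← ENNReal.ofReal_mul (by positivity)]
    congr 1
    have : (r * (σ : Vel) 1) ^ 2 + (r * (σ : Vel) 2) ^ 2 = r ^ 2 * (1 - dot axis σ ^ 2) := by
      rw [← hσ]; ring
    rw [this, Real.mul_rpow (by positivity) hσ0]
    ring
  simp only [key] at h2
  set c := ∫⁻ r in Ioi (0 : ℝ), ENNReal.ofReal (r ^ 2 * (r ^ 2) ^ (-a) * Real.exp (-r ^ 2)) with hc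
  have hc0 : c ≠ 0 := by
    rw [hc, Ne, lintegral_eq_zero_iff (by fun_prop)]
    intro h0
    rw [Filter.EventuallyEq, ae_restrict_iff' measurableSet_Ioi] at h0
    have : (volume : Measure ℝ) (Ioi 0) = 0 := by
      refine measure_mono_null ?_ (ae_iff.1 h0)
      intro r hr
      simp only [mem_ofPred_eq, Classical.not_imp]
      have hr' : (0 : ℝ) < r := hr
      refine ⟨hr, ?_⟩
      simp only [Pi.zero_apply, ENNReal.ofReal_eq_zero, not_le]
      positivity
    simp at this
  rw [lintegral_mul_const _ hm.ennreal_ofReal] at h2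
  have h3 : ∫⁻ σ, ENNReal.ofReal ((1 - dot axis σ ^ 2) ^ (-a)) ∂surf < ⊤ := by
    by_contra hcon
    rw [not_lt, top_le_iff] at hcon
    rw [hcon, ENNReal.top_mul hc0] at h2
    exact lt_irrefl _ h2
  refine ⟨hm.aestronglyMeasurable, ?_⟩
  rw [hasFiniteIntegral_iff_ofReal (Eventually.of_forall fun σ => ?_)]
  · exact h3
  · have h1 := dot_le_one axis σ
    have h2 := neg_one_le_dot axis σ
    exact Real.rpow_nonneg (by nlinarith) _

end Boltzmann
end

noncomputable section
namespace Boltzmann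

/-! ### Elementary inequalities for powers -/

theorem rpow_sub_rpow_le {a b k : ℝ} (hb : 0 ≤ b) (hab : b ≤ a) (hk : 1 ≤ k) :
    a ^ k - b ^ k ≤ k * (a - b) * a ^ (k - 1) := by
  rcases (hb.trans hab).eq_or_lt with h0 | ha
  · have hb0 : b = 0 := le_antisymm (hab.trans h0.symm.le) hb
    rw [← h0, hb0]; simp
  have h := one_add_mul_self_le_rpow_one_add (s := b / a - 1)
    (by have : 0 ≤ b / a := by positivity
        linarith) hk
  rw [add_sub_cancel, Real.div_rpow hb ha.le] at h
  have hak : 0 < a ^ k := Real.rpow_pos_of_pos ha k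
  rw [le_div_iff₀ hak] at h
  have e : a ^ k = a ^ (k - 1) * a := by
    rw [← Real.rpow_add_one ha.ne', sub_add_cancel]
  have e2 : (1 + k * (b / a - 1)) * a ^ k = a ^ k - k * (a - b) * a ^ (k - 1) := by
    have : b / a * a ^ k = b * a ^ (k - 1) := by rw [e]; field_simp
    have h2 : a * a ^ (k - 1) = a ^ k := by rw [e]; ring
    linear_combination k * this + k * h2
  linarith

theorem abs_rpow_sub_rpow_le {a b c k : ℝ} (hb : 0 ≤ b) (ha : 0 ≤ a) (hac : a ≤ c) (hbc : b ≤ c)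
    (hk : 1 ≤ k) : |a ^ k - b ^ k| ≤ k * |a - b| * c ^ (k - 1) := by
  have key : ∀ a b : ℝ, 0 ≤ b → b ≤ a → a ≤ c → |a ^ k - b ^ k| ≤ k * |a - b| * c ^ (k - 1) := by
    intro a b hb hab hac
    rw [abs_of_nonneg (sub_nonneg.2 (Real.rpow_le_rpow hb hab (by linarith))),
      abs_of_nonneg (sub_nonneg.2 hab)]
    refine (rpow_sub_rpow_le hb hab hk).trans ?_
    have h1 : 0 ≤ k * (a - b) := mul_nonneg (by linarith) (sub_nonneg.2 hab)
    exact mul_le_mul_of_nonneg_left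
      (Real.rpow_le_rpow (hb.trans hab) hac (by linarith)) h1
  rcases le_total b a with h | h
  · exact key a b hb h hac
  · rw [abs_sub_comm, abs_sub_comm a b]; exact key b a ha h hbc

theorem add_rpow_le_two_rpow_mul {a b k : ℝ} (ha : 0 ≤ a) (hb : 0 ≤ b) (hk : 0 ≤ k) :
    (a + b) ^ k ≤ 2 ^ k * (a ^ k + b ^ k) := by
  have h1 := Real.rpow_nonneg ha k
  have h2 := Real.rpow_nonneg hb k
  rcases le_total a b with h | h
  · calc (a + b) ^ k ≤ (2 * b) ^ k := Real.rpow_le_rpow (by positivity) (by linarith) hk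
      _ = 2 ^ k * b ^ k := Real.mul_rpow (by norm_num) hb
      _ ≤ _ := by gcongr; linarith
  · calc (a + b) ^ k ≤ (2 * a) ^ k := Real.rpow_le_rpow (by positivity) (by linarith) hk
      _ = 2 ^ k * a ^ k := Real.mul_rpow (by norm_num) ha
      _ ≤ _ := by gcongr; linarith

/-! ### The weight -/

theorem one_le_jap (v : Vel) : 1 ≤ jap v := Real.one_le_sqrt.2 (by nlinarith [norm_nonneg v])
theorem jap_pos (v : Vel) : 0 < jap v := one_pos.trans_le (one_le_jap v)
theorem jap_nonneg (v : Vel) : 0 ≤ jap v := (jap_pos v).le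
theorem jap_sq (v : Vel) : jap v ^ 2 = 1 + ‖v‖ ^ 2 := Real.sq_sqrt (by positivity)
theorem norm_le_jap (v : Vel) : ‖v‖ ≤ jap v := Real.le_sqrt_of_sq_le (by linarith)
theorem jap_le_one_add_norm (v : Vel) : jap v ≤ 1 + ‖v‖ :=
  (Real.sqrt_le_left (by positivity)).2 (by nlinarith [norm_nonneg v])

theorem continuous_jap : Continuous jap := by unfold jap; fun_prop
theorem measurable_jap : Measurable jap := continuous_jap.measurable
theorem continuous_jap_rpow (m : ℝ) : Continuous fun v => jap v ^ m :=
  continuous_jap.rpow_const fun v => Or.inl (jap_pos v).ne'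

theorem one_le_jap_rpow (v : Vel) {m : ℝ} (hm : 0 ≤ m) : 1 ≤ jap v ^ m :=
  Real.one_le_rpow (one_le_jap v) hm

theorem jap_rpow_pos (v : Vel) (m : ℝ) : 0 < jap v ^ m := Real.rpow_pos_of_pos (jap_pos v) m

theorem jap_rpow_le_jap_rpow (v : Vel) {m n : ℝ} (h : m ≤ n) : jap v ^ m ≤ jap v ^ n :=
  Real.rpow_le_rpow_of_exponent_le (one_le_jap v) h

theorem jap_le_jap_add (v w : Vel) : jap v ≤ jap w + ‖v - w‖ := by
  refine (Real.sqrt_le_left (add_nonneg (jap_nonneg w) (norm_nonneg _))).2 ?_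
  have h1 : ‖v‖ ≤ ‖w‖ + ‖v - w‖ := by
    have := norm_add_le w (v - w)
    rwa [add_sub_cancel] at this
  have h2 := norm_le_jap w
  have h3 := jap_sq w
  have h4 := norm_nonneg (v - w)
  nlinarith [norm_nonneg v, norm_nonneg w]

theorem abs_jap_sub_jap_le (v w : Vel) : |jap v - jap w| ≤ ‖v - w‖ := by
  rw [abs_le]
  have h1 := jap_le_jap_add v w
  have h2 := jap_le_jap_add w v
  rw [norm_sub_rev] at h2
  constructor <;> linarith

theorem one_le_jap_mul_jap (v w : Vel) : 1 ≤ jap v * jap w :=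
  one_le_mul_of_one_le_of_one_le (one_le_jap v) (one_le_jap w)

theorem jap_le_jap_mul_jap_left (v w : Vel) : jap v ≤ jap v * jap w :=
  le_mul_of_one_le_right (jap_nonneg v) (one_le_jap w)

theorem jap_le_jap_mul_jap_right (v w : Vel) : jap w ≤ jap v * jap w :=
  le_mul_of_one_le_left (jap_nonneg w) (one_le_jap v)

theorem norm_sub_le_two_mul_jap (v w : Vel) : ‖v - w‖ ≤ 2 * (jap v * jap w) := by
  have h1 := norm_sub_le v w
  have h2 := norm_le_jap v
  have h3 := norm_le_jap w
  have h4 := jap_le_jap_mul_jap_left v w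
  have h5 := jap_le_jap_mul_jap_right v w
  linarith

theorem norm_sub_rpow_le (v w : Vel) {p : ℝ} (hp : 0 ≤ p) :
    ‖v - w‖ ^ p ≤ 2 ^ p * (jap v ^ p * jap w ^ p) := by
  rw [← Real.mul_rpow (jap_nonneg v) (jap_nonneg w),
    ← Real.mul_rpow (by norm_num) (mul_nonneg (jap_nonneg v) (jap_nonneg w))]
  exact Real.rpow_le_rpow (norm_nonneg _) (norm_sub_le_two_mul_jap v w) hp

/-! ### Geometry of collisions -/

theorem norm_mul_cosDev (v w : Vel) (σ : Sph) :
    ‖v - w‖ * cosDev v w σ = inner ℝ (v - w) (σ : Vel) := by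
  rcases eq_or_ne v w with rfl | h
  · simp
  · rw [cosDev, real_inner_smul_left, mul_inv_cancel_left₀ (norm_ne_zero_iff.2 (sub_ne_zero.2 h))]

theorem abs_cosDev_le_one (v w : Vel) (σ : Sph) : |cosDev v w σ| ≤ 1 := by
  rcases eq_or_ne v w with rfl | h
  · simp [cosDev_self]
  · rw [cosDev_eq_dot h, abs_le]
    exact ⟨neg_one_le_dot _ _, dot_le_one _ _⟩

theorem cosDev_le_one (v w : Vel) (σ : Sph) : cosDev v w σ ≤ 1 := (abs_le.1 (abs_cosDev_le_one v w σ)).2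
theorem neg_one_le_cosDev (v w : Vel) (σ : Sph) : -1 ≤ cosDev v w σ :=
  (abs_le.1 (abs_cosDev_le_one v w σ)).1

theorem norm_smul_sub_sq (v w : Vel) (σ : Sph) :
    ‖‖v - w‖ • (σ : Vel) - (v - w)‖ ^ 2 = 2 * ‖v - w‖ ^ 2 * (1 - cosDev v w σ) := by
  rw [norm_sub_sq_real, norm_smul, norm_norm, norm_sph, real_inner_smul_left, real_inner_comm,
    ← norm_mul_cosDev]
  ring

theorem norm_smul_add_sq (v w : Vel) (σ : Sph) :
    ‖‖v - w‖ • (σ : Vel) + (v - w)‖ ^ 2 = 2 * ‖v - w‖ ^ 2 * (1 + cosDev v w σ) := by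
  rw [norm_add_sq_real, norm_smul, norm_norm, norm_sph, real_inner_smul_left, real_inner_comm,
    ← norm_mul_cosDev]
  ring

theorem norm_half_smul_sub (v w : Vel) (σ : Sph) :
    ‖(1 / 2 : ℝ) • (‖v - w‖ • (σ : Vel) - (v - w))‖ = ‖v - w‖ * hsin (cosDev v w σ) := by
  have h0 : 0 ≤ ‖v - w‖ * hsin (cosDev v w σ) := mul_nonneg (norm_nonneg _) (hsin_nonneg _)
  rw [← Real.sqrt_sq (norm_nonneg _), ← Real.sqrt_sq h0, norm_smul, mul_pow, mul_pow,
    norm_smul_sub_sq, hsin_sq (cosDev_le_one v w σ)]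
  congr 1
  norm_num
  ring

theorem norm_half_smul_add (v w : Vel) (σ : Sph) :
    ‖(1 / 2 : ℝ) • (‖v - w‖ • (σ : Vel) + (v - w))‖ = ‖v - w‖ * hcos (cosDev v w σ) := by
  have h0 : 0 ≤ ‖v - w‖ * hcos (cosDev v w σ) := mul_nonneg (norm_nonneg _) (hcos_nonneg _)
  rw [← Real.sqrt_sq (norm_nonneg _), ← Real.sqrt_sq h0, norm_smul, mul_pow, mul_pow,
    norm_smul_add_sq, hcos_sq (neg_one_le_cosDev v w σ)]
  congr 1
  norm_num
  ring

theorem norm_post_sub (v w : Vel) (σ : Sph) :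
    ‖post v w σ - v‖ = ‖v - w‖ * hsin (cosDev v w σ) := by
  rw [← norm_half_smul_sub]
  congr 1
  rw [post]; module

theorem norm_postStar_sub (v w : Vel) (σ : Sph) :
    ‖postStar v w σ - w‖ = ‖v - w‖ * hsin (cosDev v w σ) := by
  rw [← norm_half_smul_sub, ← norm_neg]
  congr 1
  rw [postStar]; module

theorem norm_post_sub_right (v w : Vel) (σ : Sph) :
    ‖post v w σ - w‖ = ‖v - w‖ * hcos (cosDev v w σ) := by
  rw [← norm_half_smul_add]
  congr 1
  rw [post]; module

theorem norm_postStar_sub_left (v w : Vel) (σ : Sph) :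
    ‖postStar v w σ - v‖ = ‖v - w‖ * hcos (cosDev v w σ) := by
  rw [← norm_half_smul_add, ← norm_neg]
  congr 1
  rw [postStar]; module

theorem energy (v w : Vel) (σ : Sph) :
    ‖post v w σ‖ ^ 2 + ‖postStar v w σ‖ ^ 2 = ‖v‖ ^ 2 + ‖w‖ ^ 2 := by
  have h1 := parallelogram_law_with_norm ℝ ((1 / 2 : ℝ) • (v + w)) ((‖v - w‖ / 2) • (σ : Vel))
  have h2 := parallelogram_law_with_norm ℝ v w
  have h3 : ‖(1 / 2 : ℝ) • (v + w)‖ = ‖v + w‖ / 2 := by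
    rw [norm_smul]; norm_num; ring
  have h4 : ‖(‖v - w‖ / 2) • (σ : Vel)‖ = ‖v - w‖ / 2 := by
    rw [norm_smul, norm_sph, mul_one, Real.norm_of_nonneg (by positivity)]
  rw [h3, h4] at h1
  rw [post, postStar]
  linarith

theorem jap_post_le (v w : Vel) (σ : Sph) : jap (post v w σ) ≤ jap v * jap w := by
  refine (Real.sqrt_le_left (mul_nonneg (jap_nonneg v) (jap_nonneg w))).2 ?_
  rw [mul_pow, jap_sq, jap_sq]
  nlinarith [energy v w σ, sq_nonneg ‖postStar v w σ‖, mul_nonneg (sq_nonneg ‖v‖) (sq_nonneg ‖w‖)]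

theorem jap_postStar_le (v w : Vel) (σ : Sph) : jap (postStar v w σ) ≤ jap v * jap w := by
  refine (Real.sqrt_le_left (mul_nonneg (jap_nonneg v) (jap_nonneg w))).2 ?_
  rw [mul_pow, jap_sq, jap_sq]
  nlinarith [energy v w σ, sq_nonneg ‖post v w σ‖, mul_nonneg (sq_nonneg ‖v‖) (sq_nonneg ‖w‖)]

theorem jap_post_rpow_le (v w : Vel) (σ : Sph) {q : ℝ} (hq : 0 ≤ q) :
    jap (post v w σ) ^ q ≤ jap v ^ q * jap w ^ q := by
  rw [← Real.mul_rpow (jap_nonneg v) (jap_nonneg w)]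
  exact Real.rpow_le_rpow (jap_nonneg _) (jap_post_le v w σ) hq

theorem jap_postStar_rpow_le (v w : Vel) (σ : Sph) {q : ℝ} (hq : 0 ≤ q) :
    jap (postStar v w σ) ^ q ≤ jap v ^ q * jap w ^ q := by
  rw [← Real.mul_rpow (jap_nonneg v) (jap_nonneg w)]
  exact Real.rpow_le_rpow (jap_nonneg _) (jap_postStar_le v w σ) hq

theorem jap_post_le_hcos (v w : Vel) (σ : Sph) :
    jap (post v w σ) ≤ hcos (cosDev v w σ) * jap v + 3 * jap w := by
  have h1 := jap_le_one_add_norm (post v w σ)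
  have h2 : ‖post v w σ‖ ≤ ‖w‖ + ‖v - w‖ * hcos (cosDev v w σ) := by
    rw [← norm_post_sub_right]
    have := norm_add_le w (post v w σ - w)
    rwa [add_sub_cancel] at this
  have h3 : ‖v - w‖ * hcos (cosDev v w σ) ≤ hcos (cosDev v w σ) * jap v + jap w := by
    have h4 := hcos_nonneg (cosDev v w σ)
    have h5 := hcos_le_one (cosDev_le_one v w σ)
    have h6 := norm_sub_le v w
    have h7 := norm_le_jap v
    have h8 := norm_le_jap w
    have h9 := norm_nonneg w
    nlinarith
  have h4 := one_le_jap w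
  have h5 := norm_le_jap w
  linarith

theorem jap_postStar_le_hsin (v w : Vel) (σ : Sph) :
    jap (postStar v w σ) ≤ hsin (cosDev v w σ) * jap v + 3 * jap w := by
  have h1 := jap_le_one_add_norm (postStar v w σ)
  have h2 : ‖postStar v w σ‖ ≤ ‖w‖ + ‖v - w‖ * hsin (cosDev v w σ) := by
    rw [← norm_postStar_sub]
    have := norm_add_le w (postStar v w σ - w)
    rwa [add_sub_cancel] at this
  have h3 : ‖v - w‖ * hsin (cosDev v w σ) ≤ hsin (cosDev v w σ) * jap v + jap w := by
    have h4 := hsin_nonneg (cosDev v w σ)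
    have h5 := hsin_le_one (neg_one_le_cosDev v w σ)
    have h6 := norm_sub_le v w
    have h7 := norm_le_jap v
    have h8 := norm_le_jap w
    have h9 := norm_nonneg w
    nlinarith
  have h4 := one_le_jap w
  have h5 := norm_le_jap w
  linarith

theorem rpow_le_of_le_mul_add {x c q : ℝ} {v w : Vel} (hx : 0 ≤ x) (hc : 0 ≤ c) (hc1 : c ≤ 1)
    (hq : 1 ≤ q) (h : x ≤ c * jap v + 3 * jap w) :
    x ^ q ≤ c ^ q * jap v ^ q + 3 * q * 4 ^ (q - 1) * (jap w ^ q * jap v ^ (q - 1)) := by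
  have hv := jap_nonneg v
  have hw := jap_nonneg w
  have h1 : x ^ q ≤ (c * jap v + 3 * jap w) ^ q := Real.rpow_le_rpow hx h (by linarith)
  have h2 := rpow_sub_rpow_le (a := c * jap v + 3 * jap w) (b := c * jap v) (by positivity)
    (by linarith) hq
  have h3 : c * jap v + 3 * jap w ≤ 4 * (jap v * jap w) := by
    have := jap_le_jap_mul_jap_left v w
    have := jap_le_jap_mul_jap_right v w
    nlinarith
  have h4 : (c * jap v + 3 * jap w) ^ (q - 1) ≤ 4 ^ (q - 1) * (jap v ^ (q - 1) * jap w ^ (q - 1)) := by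
    rw [← Real.mul_rpow hv hw, ← Real.mul_rpow (by norm_num) (mul_nonneg hv hw)]
    exact Real.rpow_le_rpow (by positivity) h3 (by linarith)
  have h5 : jap w ^ q = jap w ^ (q - 1) * jap w := by
    rw [← Real.rpow_add_one (jap_pos w).ne', sub_add_cancel]
  have h6 : q * (c * jap v + 3 * jap w - c * jap v) * (c * jap v + 3 * jap w) ^ (q - 1)
      ≤ q * (3 * jap w) * (4 ^ (q - 1) * (jap v ^ (q - 1) * jap w ^ (q - 1))) := by
    rw [add_sub_cancel_left]
    exact mul_le_mul_of_nonneg_left h4 (by positivity)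
  rw [Real.mul_rpow hc hv] at h2
  rw [h5]
  linarith

theorem jap_post_rpow_sub_le (v w : Vel) (σ : Sph) {q : ℝ} (hq : 1 ≤ q) :
    |jap (post v w σ) ^ q - jap v ^ q| ≤
      2 * q * hsin (cosDev v w σ) * (jap v ^ q * jap w ^ q) := by
  have h1 := abs_rpow_sub_rpow_le (jap_nonneg v) (jap_nonneg (post v w σ)) (jap_post_le v w σ)
    (jap_le_jap_mul_jap_left v w) hq
  refine h1.trans ?_
  have h2 : |jap (post v w σ) - jap v| ≤ 2 * (jap v * jap w) * hsin (cosDev v w σ) := by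
    refine (abs_jap_sub_jap_le _ _).trans ?_
    rw [norm_post_sub]
    exact mul_le_mul_of_nonneg_right (norm_sub_le_two_mul_jap v w) (hsin_nonneg _)
  have hvw : 0 < jap v * jap w := mul_pos (jap_pos v) (jap_pos w)
  have h3 : (jap v * jap w) ^ q = (jap v * jap w) ^ (q - 1) * (jap v * jap w) := by
    rw [← Real.rpow_add_one hvw.ne', sub_add_cancel]
  rw [← Real.mul_rpow (jap_nonneg v) (jap_nonneg w), h3]
  have h4 : 0 ≤ (jap v * jap w) ^ (q - 1) := Real.rpow_nonneg hvw.le _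
  calc q * |jap (post v w σ) - jap v| * (jap v * jap w) ^ (q - 1)
      ≤ q * (2 * (jap v * jap w) * hsin (cosDev v w σ)) * (jap v * jap w) ^ (q - 1) := by gcongr
    _ = _ := by ring

end Boltzmann
end

noncomputable section
namespace Boltzmann

/-! ### Gaussian bounds -/

/-- The Gaussian `e^{-c|x|²}`. -/
def gauss (c : ℝ) (x : Vel) : ℝ := Real.exp (-(c * ‖x‖ ^ 2))

theorem gauss_pos (c : ℝ) (x : Vel) : 0 < gauss c x := Real.exp_pos _
theorem continuous_gauss (c : ℝ) : Continuous (gauss c) := by unfold gauss; fun_prop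
theorem measurable_gauss (c : ℝ) : Measurable (gauss c) := (continuous_gauss c).measurable

theorem gauss_le_one {c : ℝ} (hc : 0 ≤ c) (x : Vel) : gauss c x ≤ 1 :=
  Real.exp_le_one_iff.2 (by have := mul_nonneg hc (sq_nonneg ‖x‖); linarith)

theorem gauss_anti {c d : ℝ} (h : c ≤ d) (x : Vel) : gauss d x ≤ gauss c x :=
  Real.exp_le_exp.2 (by have := mul_le_mul_of_nonneg_right h (sq_nonneg ‖x‖); linarith)

theorem integrable_gauss {c : ℝ} (hc : 0 < c) : Integrable (gauss c) := by
  have h := GaussianFourier.integrable_cexp_neg_mul_sq_norm_add (V := Vel) (b := c)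
    (by simpa using hc) 0 0
  refine h.norm.congr (Eventually.of_forall fun x => ?_)
  simp [Complex.norm_exp, gauss, ← Complex.ofReal_pow]

theorem exists_jap_rpow_le (m : ℝ) {b : ℝ} (hb : 0 < b) :
    ∃ C, 0 < C ∧ ∀ x : Vel, jap x ^ m ≤ C * Real.exp (b * ‖x‖ ^ 2) := by
  obtain ⟨n, hn⟩ := exists_nat_ge m
  refine ⟨n.factorial / b ^ n * Real.exp b, by positivity, fun x => ?_⟩
  have h1 : jap x ^ m ≤ (jap x ^ 2) ^ n := by
    calc jap x ^ m ≤ jap x ^ ((2 * n : ℕ) : ℝ) :=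
          jap_rpow_le_jap_rpow x (by push_cast; nlinarith [(Nat.cast_nonneg n : (0 : ℝ) ≤ n)])
      _ = _ := by rw [Real.rpow_natCast, pow_mul]
  have h2 := Real.pow_div_factorial_le_exp (b * jap x ^ 2) (by positivity) n
  rw [div_le_iff₀ (by positivity), mul_pow] at h2
  have h3 : Real.exp (b * jap x ^ 2) = Real.exp b * Real.exp (b * ‖x‖ ^ 2) := by
    rw [← Real.exp_add, jap_sq]; congr 1; ring
  rw [h3] at h2
  refine h1.trans ?_
  have hbn : 0 < b ^ n := by positivity
  rw [← mul_le_mul_iff_right₀ hbn]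
  refine h2.trans_eq ?_
  field_simp

theorem exists_jap_rpow_mul_gauss_le (m : ℝ) {c : ℝ} (hc : 0 < c) :
    ∃ C, 0 < C ∧ ∀ x : Vel, jap x ^ m * gauss c x ≤ C * gauss (c / 2) x := by
  obtain ⟨C, hC, h⟩ := exists_jap_rpow_le m (b := c / 2) (by positivity)
  refine ⟨C, hC, fun x => ?_⟩
  calc jap x ^ m * gauss c x ≤ C * Real.exp (c / 2 * ‖x‖ ^ 2) * gauss c x :=
        mul_le_mul_of_nonneg_right (h x) (gauss_pos _ _).le
    _ = C * gauss (c / 2) x := by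
        rw [gauss, gauss, mul_assoc, ← Real.exp_add]; congr 2; ring

theorem integrable_jap_rpow_mul_gauss (m : ℝ) {c : ℝ} (hc : 0 < c) :
    Integrable fun x : Vel => jap x ^ m * gauss c x := by
  obtain ⟨C, hC, h⟩ := exists_jap_rpow_mul_gauss_le m hc
  refine ((integrable_gauss (half_pos hc)).const_mul C).mono'
    ((continuous_jap_rpow m).mul (continuous_gauss c)).aestronglyMeasurable
    (Eventually.of_forall fun x => ?_)
  rw [Real.norm_of_nonneg (mul_nonneg (jap_rpow_pos x m).le (gauss_pos c x).le)]
  exact h x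

/-- The normalization constant of the Maxwellian. -/
def maxwConst : ℝ := (2 * Real.pi) ^ (-(3 / 2) : ℝ)

theorem maxwConst_pos : 0 < maxwConst := Real.rpow_pos_of_pos (by positivity) _

theorem maxw_eq (v : Vel) : maxw v = maxwConst * gauss (1 / 2) v := by
  rw [maxw, maxwConst, gauss]; congr 2; ring

theorem maxw_pos (v : Vel) : 0 < maxw v := by
  rw [maxw_eq]; exact mul_pos maxwConst_pos (gauss_pos _ _)

theorem continuous_maxw : Continuous maxw := by unfold maxw; fun_prop
theorem measurable_maxw : Measurable maxw := continuous_maxw.measurable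

theorem integrable_maxw_mul_jap (m : ℝ) : Integrable fun x : Vel => maxw x * jap x ^ m := by
  refine ((integrable_jap_rpow_mul_gauss m (c := 1 / 2) (by norm_num)).const_mul maxwConst).congr
    (Eventually.of_forall fun x => ?_)
  simp only [maxw_eq]
  ring

theorem maxw_mul_maxw_post (v w : Vel) (σ : Sph) {c : ℝ} :
    gauss c (post v w σ) * gauss c (postStar v w σ) = gauss c v * gauss c w := by
  simp only [gauss, ← Real.exp_add]
  congr 1
  linear_combination (-c) * energy v w σ

/-- Functions which, together with their difference quotients, have Gaussian decay. -/
structure GaussLip (f : Vel → ℝ) (C : ℝ) : Prop where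
  bound : ∀ x, |f x| ≤ C * gauss (1 / 4) x
  lip : ∀ x y, |f x - f y| ≤ C * (‖x - y‖ * (gauss (1 / 4) x + gauss (1 / 4) y))

theorem GaussLip.nonneg {f : Vel → ℝ} {C : ℝ} (h : GaussLip f C) : 0 ≤ C := by
  have := (abs_nonneg _).trans (h.bound 0)
  exact nonneg_of_mul_nonneg_left this (gauss_pos _ _)

theorem exp_neg_sq_sub_le {a b : ℝ} (hb : 0 ≤ b) (hab : b ≤ a) :
    Real.exp (-(1 / 2 * b ^ 2)) - Real.exp (-(1 / 2 * a ^ 2))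
      ≤ 2 * (a - b) * Real.exp (-(1 / 4 * b ^ 2)) := by
  have e1 : Real.exp (-(1 / 2 * b ^ 2)) = Real.exp (-(1 / 4 * b ^ 2)) * Real.exp (-(1 / 4 * b ^ 2)) := by
    rw [← Real.exp_add]; congr 1; ring
  have h4 := Real.exp_pos (-(1 / 4 * b ^ 2))
  have h5 : Real.exp (-(1 / 4 * b ^ 2)) ≤ 1 := Real.exp_le_one_iff.2 (by nlinarith [sq_nonneg b])
  rcases le_total 1 (a - b) with h | h
  · have := Real.exp_pos (-(1 / 2 * a ^ 2))
    rw [e1]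
    nlinarith
  · have e2 : Real.exp (-(1 / 2 * a ^ 2))
        = Real.exp (-(1 / 2 * b ^ 2)) * Real.exp (-((a - b) * ((a + b) / 2))) := by
      rw [← Real.exp_add]; congr 1; ring
    have h1 := Real.add_one_le_exp (-((a - b) * ((a + b) / 2)))
    have h2 : (b + 1 / 2) * Real.exp (-(1 / 4 * b ^ 2)) ≤ 2 := by
      have := Real.add_one_le_exp (1 / 4 * b ^ 2)
      have hp := Real.exp_pos (1 / 4 * b ^ 2)
      rw [Real.exp_neg, ← div_eq_mul_inv, div_le_iff₀ hp]
      nlinarith [sq_nonneg (b - 1)]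
    have h3 : Real.exp (-(1 / 2 * b ^ 2)) - Real.exp (-(1 / 2 * a ^ 2))
        ≤ Real.exp (-(1 / 2 * b ^ 2)) * ((a - b) * ((a + b) / 2)) := by
      rw [e2]
      have := Real.exp_pos (-(1 / 2 * b ^ 2))
      nlinarith
    refine h3.trans ?_
    rw [e1]
    have h6 : (a - b) * ((a + b) / 2) ≤ (a - b) * (b + 1 / 2) :=
      mul_le_mul_of_nonneg_left (by linarith) (by linarith)
    calc Real.exp (-(1 / 4 * b ^ 2)) * Real.exp (-(1 / 4 * b ^ 2)) * ((a - b) * ((a + b) / 2))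
        ≤ Real.exp (-(1 / 4 * b ^ 2)) * Real.exp (-(1 / 4 * b ^ 2)) * ((a - b) * (b + 1 / 2)) := by
          gcongr
      _ = (a - b) * Real.exp (-(1 / 4 * b ^ 2)) * ((b + 1 / 2) * Real.exp (-(1 / 4 * b ^ 2))) := by
          ring
      _ ≤ (a - b) * Real.exp (-(1 / 4 * b ^ 2)) * 2 := by
          have : 0 ≤ a - b := by linarith
          gcongr
      _ = _ := by ring

theorem gaussLip_maxw : GaussLip maxw (2 * maxwConst) where
  bound x := by
    rw [abs_of_pos (maxw_pos x), maxw_eq]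
    have h1 := gauss_anti (show (1 / 4 : ℝ) ≤ 1 / 2 by norm_num) x
    have h2 := gauss_pos (1 / 4) x
    have h3 := maxwConst_pos
    nlinarith [mul_le_mul_of_nonneg_left h1 h3.le, mul_pos h3 h2]
  lip x y := by
    have key : ∀ x y : Vel, ‖y‖ ≤ ‖x‖ → |maxw x - maxw y|
        ≤ 2 * maxwConst * (‖x - y‖ * (gauss (1 / 4) x + gauss (1 / 4) y)) := by
      intro x y hxy
      rw [maxw_eq, maxw_eq, ← mul_sub, abs_mul, abs_of_pos maxwConst_pos, abs_sub_comm]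
      have h1 := exp_neg_sq_sub_le (norm_nonneg y) hxy
      have h2 : gauss (1 / 2) x ≤ gauss (1 / 2) y := by
        rw [gauss, gauss, Real.exp_le_exp]
        nlinarith [norm_nonneg x, norm_nonneg y]
      rw [abs_of_nonneg (sub_nonneg.2 h2)]
      have h3 : ‖x‖ - ‖y‖ ≤ ‖x - y‖ := norm_sub_norm_le x y
      have h4 := gauss_pos (1 / 4) x
      have h5 := gauss_pos (1 / 4) y
      have h6 := maxwConst_pos
      have h7 : gauss (1 / 2) y - gauss (1 / 2) x
          ≤ 2 * (‖x - y‖ * (gauss (1 / 4) x + gauss (1 / 4) y)) := by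
        refine h1.trans ?_
        change 2 * (‖x‖ - ‖y‖) * gauss (1 / 4) y ≤ _
        nlinarith [mul_le_mul_of_nonneg_right h3 h5.le, mul_nonneg (norm_nonneg (x - y)) h4.le]
      calc _ ≤ maxwConst * (2 * (‖x - y‖ * (gauss (1 / 4) x + gauss (1 / 4) y))) := by gcongr
        _ = _ := by ring
    rcases le_total ‖y‖ ‖x‖ with h | h
    · exact key x y h
    · rw [abs_sub_comm, norm_sub_rev, add_comm (gauss _ x)]
      exact key y x h

theorem gauss_add_le {c : ℝ} (hc : 0 ≤ c) (w : Vel) {y : Vel} (hy : ‖y‖ ≤ 1) :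
    gauss c (w + y) ≤ Real.exp c * gauss (c / 2) w := by
  rw [gauss, gauss, ← Real.exp_add, Real.exp_le_exp]
  have h1 : ‖w‖ ≤ ‖w + y‖ + ‖y‖ := by
    have := norm_sub_le (w + y) y
    rwa [add_sub_cancel_right] at this
  have h2 : ‖w‖ ^ 2 ≤ 2 * ‖w + y‖ ^ 2 + 2 := by
    nlinarith [sq_nonneg (‖w + y‖ - ‖y‖), norm_nonneg w, norm_nonneg y, norm_nonneg (w + y)]
  nlinarith [mul_le_mul_of_nonneg_left h2 hc]

theorem half_le_hcos_sq {x : ℝ} (hx : 0 ≤ x) : 1 / 2 ≤ hcos x ^ 2 := by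
  rw [hcos_sq (by linarith)]; linarith

theorem gauss_mul_gauss_postStar_le (v w : Vel) (σ : Sph) {c : ℝ} (hc : 0 ≤ c)
    (hx : 0 ≤ cosDev v w σ) :
    gauss c v * gauss c (postStar v w σ) ≤ gauss (c / 12) v * gauss (c / 12) w := by
  simp only [gauss, ← Real.exp_add, Real.exp_le_exp]
  have h1 := norm_postStar_sub_left v w σ
  have h2 : ‖v - w‖ ^ 2 ≤ 2 * ‖postStar v w σ - v‖ ^ 2 := by
    rw [h1, mul_pow]
    nlinarith [half_le_hcos_sq hx, sq_nonneg ‖v - w‖]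
  have h3 := norm_sub_le (postStar v w σ) v
  have h4 : ‖w‖ ≤ ‖v‖ + ‖v - w‖ := by
    have := norm_sub_le v (v - w)
    rwa [sub_sub_cancel] at this
  have h5 : ‖postStar v w σ - v‖ ^ 2 ≤ 2 * (‖postStar v w σ‖ ^ 2 + ‖v‖ ^ 2) := by
    nlinarith [sq_nonneg (‖postStar v w σ‖ - ‖v‖), norm_nonneg (postStar v w σ - v)]
  have h6 : ‖w‖ ^ 2 ≤ 2 * (‖v‖ ^ 2 + ‖v - w‖ ^ 2) := by
    nlinarith [sq_nonneg (‖v‖ - ‖v - w‖), norm_nonneg w]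
  have h7 : ‖v‖ ^ 2 + ‖w‖ ^ 2 ≤ 12 * (‖v‖ ^ 2 + ‖postStar v w σ‖ ^ 2) := by
    nlinarith [sq_nonneg ‖v‖, sq_nonneg ‖postStar v w σ‖]
  nlinarith [mul_le_mul_of_nonneg_left h7 hc]

theorem GaussLip.bilinear {f g : Vel → ℝ} {C D : ℝ} (hf : GaussLip f C) (hg : GaussLip g D)
    (v w : Vel) (σ : Sph) (hx : 0 ≤ cosDev v w σ) :
    |f (post v w σ) * g (postStar v w σ) - f v * g w|
      ≤ 4 * C * D * (‖v - w‖ * hsin (cosDev v w σ) * (gauss (1 / 48) v * gauss (1 / 48) w)) := by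
  set d := ‖v - w‖ * hsin (cosDev v w σ) with hd
  have hd0 : 0 ≤ d := mul_nonneg (norm_nonneg _) (hsin_nonneg _)
  have hC := hf.nonneg
  have hD := hg.nonneg
  have h1 := hf.lip (post v w σ) v
  have h2 := hg.lip (postStar v w σ) w
  rw [norm_post_sub, ← hd] at h1
  rw [norm_postStar_sub, ← hd] at h2
  have h3 := hg.bound (postStar v w σ)
  have h4 := hf.bound v
  have e : f (post v w σ) * g (postStar v w σ) - f v * g w
      = (f (post v w σ) - f v) * g (postStar v w σ) + f v * (g (postStar v w σ) - g w) := by ring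
  have g1 := maxw_mul_maxw_post v w σ (c := 1 / 4)
  have g2 := gauss_mul_gauss_postStar_le v w σ (c := 1 / 4) (by norm_num) hx
  have g3 : gauss (1 / 4) v * gauss (1 / 4) w ≤ gauss (1 / 4 / 12) v * gauss (1 / 4 / 12) w :=
    mul_le_mul (gauss_anti (by norm_num) v) (gauss_anti (by norm_num) w) (gauss_pos _ _).le
      (gauss_pos _ _).le
  rw [show (1 / 48 : ℝ) = 1 / 4 / 12 by norm_num]
  rw [e]
  calc |(f (post v w σ) - f v) * g (postStar v w σ) + f v * (g (postStar v w σ) - g w)|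
      ≤ |f (post v w σ) - f v| * |g (postStar v w σ)| + |f v| * |g (postStar v w σ) - g w| := by
        rw [← abs_mul, ← abs_mul]; exact abs_add_le _ _
    _ ≤ (C * (d * (gauss (1 / 4) (post v w σ) + gauss (1 / 4) v)))
          * (D * gauss (1 / 4) (postStar v w σ))
        + (C * gauss (1 / 4) v)
          * (D * (d * (gauss (1 / 4) (postStar v w σ) + gauss (1 / 4) w))) := by
        have p1 := (gauss_pos (1 / 4) v).le
        have p2 := (gauss_pos (1 / 4) (post v w σ)).le
        gcongr
    _ = C * D * d * (gauss (1 / 4) (post v w σ) * gauss (1 / 4) (postStar v w σ)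
          + 2 * (gauss (1 / 4) v * gauss (1 / 4) (postStar v w σ))
          + gauss (1 / 4) v * gauss (1 / 4) w) := by ring
    _ ≤ C * D * d * (4 * (gauss (1 / 4 / 12) v * gauss (1 / 4 / 12) w)) := by
        rw [g1]
        gcongr
        linarith
    _ = _ := by ring

theorem exists_gaussLip_of_isTest {f : Vel → ℝ} (hf : IsTest f) : ∃ C, GaussLip f C := by
  obtain ⟨B, hB⟩ := hf.2.exists_bound_of_continuous hf.1.continuous
  obtain ⟨L, hL⟩ := ContDiff.lipschitzWith_of_hasCompactSupport hf.2 hf.1 (by simp)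
  obtain ⟨R, hR⟩ := hf.2.isCompact.isBounded.exists_norm_le
  have hsupp : ∀ x, f x ≠ 0 → 1 ≤ Real.exp (1 / 4 * R ^ 2) * gauss (1 / 4) x := by
    intro x hx
    have h := hR x (subset_tsupport f hx)
    rw [gauss, ← Real.exp_add, Real.one_le_exp_iff]
    nlinarith [norm_nonneg x]
  set K := Real.exp (1 / 4 * R ^ 2)
  have hK : 0 < K := Real.exp_pos _
  have hB0 : 0 ≤ B := (norm_nonneg _).trans (hB 0)
  have hL0 : (0 : ℝ) ≤ L := L.2
  refine ⟨(B + L) * K, fun x => ?_, fun x y => ?_⟩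
  · have g := gauss_pos (1 / 4) x
    by_cases hx : f x = 0
    · rw [hx, abs_zero]; positivity
    · have h1 := hsupp x hx
      have h2 : |f x| ≤ B := hB x
      calc |f x| ≤ (B + L) * 1 := by linarith
        _ ≤ (B + L) * (K * gauss (1 / 4) x) := by gcongr
        _ = _ := by ring
  · have g := gauss_pos (1 / 4) x
    have g' := gauss_pos (1 / 4) y
    by_cases h0 : f x = 0 ∧ f y = 0
    · rw [h0.1, h0.2, sub_zero, abs_zero]; positivity
    · have h1 : 1 ≤ K * (gauss (1 / 4) x + gauss (1 / 4) y) := by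
        rcases not_and_or.1 h0 with h | h
        · have := hsupp x h
          nlinarith
        · have := hsupp y h
          nlinarith
      have h2 := hL.dist_le_mul x y
      rw [Real.dist_eq, dist_eq_norm] at h2
      calc |f x - f y| ≤ (B + L) * ‖x - y‖ * 1 := by nlinarith [norm_nonneg (x - y)]
        _ ≤ (B + L) * ‖x - y‖ * (K * (gauss (1 / 4) x + gauss (1 / 4) y)) := by gcongr
        _ = _ := by ring

end Boltzmann
end

noncomputable section
namespace Boltzmann

open scoped ENNReal

/-! ### Integrals over collisions -/

/-- Integrable angular kernels supported in `cos θ ≥ 0`. -/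
structure Cutoff (β : ℝ → ℝ) : Prop where
  measurable : Measurable β
  nonneg : ∀ x, 0 ≤ β x
  supp : ∀ x, x < 0 → β x = 0
  int : SphIntegrable β

theorem SphIntegrable.mono {β β' : ℝ → ℝ} (h : SphIntegrable β) (hm : Measurable β')
    (hle : ∀ x, -1 ≤ x → x ≤ 1 → |β' x| ≤ β x) : SphIntegrable β' :=
  Integrable.mono' h (hm.comp (measurable_dot_right axis)).aestronglyMeasurable
    (Eventually.of_forall fun σ => hle _ (neg_one_le_dot _ _) (dot_le_one _ _))

theorem sphInt_mono {β β' : ℝ → ℝ} (h : SphIntegrable β) (h' : SphIntegrable β')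
    (hle : ∀ x, -1 ≤ x → x ≤ 1 → β x ≤ β' x) : sphInt β ≤ sphInt β' :=
  integral_mono h h' fun _ => hle _ (neg_one_le_dot _ _) (dot_le_one _ _)

theorem sphInt_nonneg {β : ℝ → ℝ} (h : ∀ x, -1 ≤ x → x ≤ 1 → 0 ≤ β x) : 0 ≤ sphInt β :=
  integral_nonneg fun _ => h _ (neg_one_le_dot _ _) (dot_le_one _ _)

theorem Cutoff.mul {β g : ℝ → ℝ} (h : Cutoff β) (hg : Measurable g) (hg0 : ∀ x, 0 ≤ g x) {C : ℝ}
    (hgC : ∀ x, 0 ≤ x → x ≤ 1 → g x ≤ C) : Cutoff fun x => β x * g x where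
  measurable := h.measurable.mul hg
  nonneg x := mul_nonneg (h.nonneg x) (hg0 x)
  supp x hx := by rw [h.supp x hx, zero_mul]
  int := (Integrable.mul_const h.int C).mono'
    ((h.measurable.mul hg).comp (measurable_dot_right axis)).aestronglyMeasurable
    (Eventually.of_forall fun σ => by
      simp only
      rw [Real.norm_of_nonneg (mul_nonneg (h.nonneg _) (hg0 _))]
      by_cases hx : dot axis σ < 0
      · rw [h.supp _ hx, zero_mul, zero_mul]
      · exact mul_le_mul_of_nonneg_left (hgC _ (not_lt.1 hx) (dot_le_one _ _)) (h.nonneg _))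

theorem Cutoff.mul_hsin {β : ℝ → ℝ} (h : Cutoff β) : Cutoff fun x => β x * hsin x :=
  h.mul measurable_hsin hsin_nonneg fun _ hx _ => hsin_le_one (by linarith)

theorem half_le_hcos {x : ℝ} (hx : 0 ≤ x) : 1 / 2 ≤ hcos x := by
  have := half_le_hcos_sq hx
  nlinarith [hcos_nonneg x]

theorem hcos_rpow_neg_le {x m : ℝ} (hx : 0 ≤ x) (hm : 0 ≤ m) : hcos x ^ (-m) ≤ 2 ^ m := by
  have h := Real.rpow_le_rpow_of_nonpos (by norm_num) (half_le_hcos hx) (neg_nonpos.2 hm)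
  have h2 : ((1 : ℝ) / 2) ^ (-m) = 2 ^ m := by
    rw [one_div, Real.inv_rpow (by norm_num), Real.rpow_neg (by norm_num), inv_inv]
  rwa [h2] at h

theorem Cutoff.mul_hcos {β : ℝ → ℝ} (h : Cutoff β) {m : ℝ} (hm : 0 ≤ m) :
    Cutoff fun x => β x * hcos x ^ (-m) :=
  h.mul (measurable_hcos.pow_const _) (fun x => Real.rpow_nonneg (hcos_nonneg x) _)
    fun _ hx _ => hcos_rpow_neg_le hx hm

theorem abs_hcos_rpow_neg_sub_one_le {x m : ℝ} (hx : 0 ≤ x) (hx1 : x ≤ 1) (hm : 1 ≤ m) :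
    |hcos x ^ (-m) - 1| ≤ m * 2 ^ m * hsin x := by
  have hc := hcos_pos hx
  have h1 := hcos_le_one hx1
  have h2 := hcos_rpow_neg_le hx (zero_le_one.trans hm)
  have h3 := rpow_sub_rpow_le hc.le h1 hm
  rw [Real.one_rpow, Real.one_rpow, mul_one] at h3
  have h4 : 1 - hcos x ≤ hsin x := by
    have e1 := hcos_sq (x := x) (by linarith)
    have e2 := hsin_sq hx1
    have e3 := hsin_le_one (x := x) (by linarith)
    nlinarith [hsin_nonneg x]
  have h5 : hcos x ^ (-m) - 1 = hcos x ^ (-m) * (1 - hcos x ^ m) := by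
    rw [mul_sub, mul_one, ← Real.rpow_add hc, neg_add_cancel, Real.rpow_zero]
  have h6 : 0 ≤ 1 - hcos x ^ m := by
    have := Real.rpow_le_one hc.le h1 (zero_le_one.trans hm)
    linarith
  have h7 : (0 : ℝ) ≤ hcos x ^ (-m) := Real.rpow_nonneg hc.le _
  rw [h5, abs_of_nonneg (mul_nonneg h7 h6)]
  calc hcos x ^ (-m) * (1 - hcos x ^ m) ≤ 2 ^ m * (m * hsin x) := by
        refine mul_le_mul h2 (h3.trans ?_) h6 (by positivity)
        exact mul_le_mul_of_nonneg_left h4 (by linarith)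
    _ = _ := by ring

/-- Dominated integrals over collisions. -/
theorem SphIntegrable.dominated {F : Vel × Sph → ℝ} {H : Vel → ℝ} {β : ℝ → ℝ} {v : Vel}
    (hβ : SphIntegrable β) (hβm : Measurable β) (hH : Integrable H)
    (hF : AEStronglyMeasurable F collMeasure)
    (hle : ∀ w σ, |F (w, σ)| ≤ H w * β (cosDev v w σ)) :
    Integrable F collMeasure ∧ |∫ p, F p ∂collMeasure| ≤ (∫ w, H w) * sphInt β := by
  obtain ⟨h1, h2⟩ := hβ.collision hβm hH v
  have hi : Integrable F collMeasure :=
    h1.mono' hF (Eventually.of_forall fun p => hle p.1 p.2)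
  refine ⟨hi, ?_⟩
  rw [← h2]
  exact abs_integral_le_integral_abs.trans (integral_mono hi.abs h1 fun p => hle p.1 p.2)

/-- Weighted collision integrals. -/
theorem Cutoff.weighted {β : ℝ → ℝ} (hβ : Cutoff β) {H : Vel → ℝ} {p : ℝ} (hp : 0 ≤ p)
    (hH0 : ∀ w, 0 ≤ H w) (hHm : Measurable H) (hH : Integrable fun w => H w * jap w ^ p) (v : Vel) :
    Integrable (fun z : Vel × Sph => H z.1 * (‖v - z.1‖ ^ p * β (cosDev v z.1 z.2))) collMeasure ∧
      ∫ z, H z.1 * (‖v - z.1‖ ^ p * β (cosDev v z.1 z.2)) ∂collMeasure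
        ≤ 2 ^ p * (∫ w, H w * jap w ^ p) * sphInt β * jap v ^ p := by
  have hm : AEStronglyMeasurable
      (fun z : Vel × Sph => H z.1 * (‖v - z.1‖ ^ p * β (cosDev v z.1 z.2))) collMeasure := by
    refine Measurable.aestronglyMeasurable ?_
    exact (hHm.comp measurable_fst).mul (((measurable_const.sub measurable_fst).norm.pow_const p).mul
      (hβ.measurable.comp (measurable_cosDev_right v)))
  have hH' : Integrable fun w => 2 ^ p * jap v ^ p * (H w * jap w ^ p) := hH.const_mul _
  have hle : ∀ w σ, |H w * (‖v - w‖ ^ p * β (cosDev v w σ))|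
      ≤ 2 ^ p * jap v ^ p * (H w * jap w ^ p) * β (cosDev v w σ) := by
    intro w σ
    have h0 := hβ.nonneg (cosDev v w σ)
    have h1 := norm_sub_rpow_le v w hp
    have h2 := Real.rpow_nonneg (norm_nonneg (v - w)) p
    have h3 := hH0 w
    rw [abs_of_nonneg (by positivity)]
    calc H w * (‖v - w‖ ^ p * β (cosDev v w σ))
        ≤ H w * (2 ^ p * (jap v ^ p * jap w ^ p) * β (cosDev v w σ)) := by gcongr
      _ = _ := by ring
  obtain ⟨h1, h2⟩ := hβ.int.dominated hβ.measurable hH' hm hle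
  refine ⟨h1, (le_abs_self _).trans (h2.trans_eq ?_)⟩
  rw [integral_const_mul]; ring

theorem map_postStar (v : Vel) {β : ℝ → ℝ} (hβm : Measurable β) (hβ : ∀ x, x < 0 → β x = 0)
    {p : ℝ} :
    (collMeasure.withDensity fun z =>
        ENNReal.ofReal (‖v - z.1‖ ^ p * β (cosDev v z.1 z.2))).map (fun z => postStar v z.1 z.2)
      = (collMeasure.withDensity fun z => ENNReal.ofReal (‖v - z.1‖ ^ p *
          (β (cosDev v z.1 z.2) * hcos (cosDev v z.1 z.2) ^ (-(3 + p))))).map Prod.fst := by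
  have hpm := measurable_postStar_right v
  have hcm := measurable_cosDev_right v
  have hum : Measurable fun z : Vel × Sph => ‖v - z.1‖ ^ p :=
    (measurable_const.sub measurable_fst).norm.pow_const p
  have hd1 : Measurable fun z : Vel × Sph =>
      ENNReal.ofReal (‖v - z.1‖ ^ p * β (cosDev v z.1 z.2)) :=
    (hum.mul (hβm.comp hcm)).ennreal_ofReal
  ext s hs
  rw [Measure.map_apply hpm hs, Measure.map_apply measurable_fst hs,
    withDensity_apply _ (hpm hs), withDensity_apply _ (measurable_fst hs),
    ← lintegral_indicator (hpm hs), ← lintegral_indicator (measurable_fst hs)]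
  have h := lintegral_postStar v (F := fun y => s.indicator 1 y.1 * ENNReal.ofReal (y.2.1 ^ p * β y.2.2))
    (((measurable_one.indicator hs).comp measurable_fst).mul
      (((measurable_fst.comp measurable_snd).pow_const p).mul
        (hβm.comp (measurable_snd.comp measurable_snd))).ennreal_ofReal)
    (fun y r x hx => by simp [hβ x hx])
  simp only at h
  convert h using 1
  · refine lintegral_congr fun z => ?_
    by_cases hz : postStar v z.1 z.2 ∈ s
    · rw [indicator_of_mem (show z ∈ (fun z : Vel × Sph => postStar v z.1 z.2) ⁻¹' s from hz),
        indicator_of_mem hz]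
      simp
    · rw [indicator_of_notMem (show z ∉ (fun z : Vel × Sph => postStar v z.1 z.2) ⁻¹' s from hz),
        indicator_of_notMem hz]
      simp
  · refine lintegral_congr fun z => ?_
    by_cases hz : z.1 ∈ s
    · rw [indicator_of_mem (show z ∈ (Prod.fst : Vel × Sph → Vel) ⁻¹' s from hz),
        indicator_of_mem hz]
      simp only [Pi.one_apply, one_mul]
      by_cases hx : cosDev v z.1 z.2 < 0
      · simp [hβ _ hx]
      · have hc := hcos_pos (not_lt.1 hx)
        rw [← ENNReal.ofReal_mul (by positivity)]
        congr 1
        rw [Real.div_rpow (norm_nonneg _) hc.le, neg_add, Real.rpow_add hc,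
          Real.rpow_neg hc.le 3, Real.rpow_neg hc.le p]
        have : hcos (cosDev v z.1 z.2) ^ (3 : ℝ) = hcos (cosDev v z.1 z.2) ^ 3 := by
          exact_mod_cast Real.rpow_natCast _ 3
        rw [this]
        field_simp
    · rw [indicator_of_notMem (show z ∉ (Prod.fst : Vel × Sph → Vel) ⁻¹' s from hz),
        indicator_of_notMem hz]
      simp

/-- Change of variables `v_* → v'_*` in collision integrals. -/
theorem Cutoff.integral_postStar {β : ℝ → ℝ} (hβ : Cutoff β) (v : Vel) {p : ℝ} {ψ : Vel → ℝ}
    (hψ : Measurable ψ) :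
    (Integrable (fun z : Vel × Sph => ψ (postStar v z.1 z.2) *
        (‖v - z.1‖ ^ p * β (cosDev v z.1 z.2))) collMeasure ↔
      Integrable (fun z : Vel × Sph => ψ z.1 * (‖v - z.1‖ ^ p *
        (β (cosDev v z.1 z.2) * hcos (cosDev v z.1 z.2) ^ (-(3 + p))))) collMeasure) ∧
    ∫ z, ψ (postStar v z.1 z.2) * (‖v - z.1‖ ^ p * β (cosDev v z.1 z.2)) ∂collMeasure
      = ∫ z, ψ z.1 * (‖v - z.1‖ ^ p *
        (β (cosDev v z.1 z.2) * hcos (cosDev v z.1 z.2) ^ (-(3 + p)))) ∂collMeasure := by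
  have hmap := map_postStar v hβ.measurable hβ.supp (p := p)
  have hpm := measurable_postStar_right v
  have hcm := measurable_cosDev_right v
  have hum : Measurable fun z : Vel × Sph => ‖v - z.1‖ ^ p :=
    (measurable_const.sub measurable_fst).norm.pow_const p
  have hd1 : Measurable fun z : Vel × Sph => ‖v - z.1‖ ^ p * β (cosDev v z.1 z.2) :=
    hum.mul (hβ.measurable.comp hcm)
  have hd2 : Measurable fun z : Vel × Sph => ‖v - z.1‖ ^ p *
      (β (cosDev v z.1 z.2) * hcos (cosDev v z.1 z.2) ^ (-(3 + p))) :=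
    hum.mul ((hβ.measurable.comp hcm).mul ((measurable_hcos.comp hcm).pow_const _))
  have hn1 : ∀ z : Vel × Sph, 0 ≤ ‖v - z.1‖ ^ p * β (cosDev v z.1 z.2) := fun z =>
    mul_nonneg (Real.rpow_nonneg (norm_nonneg _) _) (hβ.nonneg _)
  have hn2 : ∀ z : Vel × Sph, 0 ≤ ‖v - z.1‖ ^ p *
      (β (cosDev v z.1 z.2) * hcos (cosDev v z.1 z.2) ^ (-(3 + p))) := fun z =>
    mul_nonneg (Real.rpow_nonneg (norm_nonneg _) _) (mul_nonneg (hβ.nonneg _)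
      (Real.rpow_nonneg (hcos_nonneg _) _))
  have i1 := integrable_map_measure (μ := collMeasure.withDensity fun z =>
    ENNReal.ofReal (‖v - z.1‖ ^ p * β (cosDev v z.1 z.2))) (f := fun z => postStar v z.1 z.2)
    (g := ψ) hψ.aestronglyMeasurable hpm.aemeasurable
  have i2 := integrable_map_measure (μ := collMeasure.withDensity fun z =>
    ENNReal.ofReal (‖v - z.1‖ ^ p * (β (cosDev v z.1 z.2) *
      hcos (cosDev v z.1 z.2) ^ (-(3 + p))))) (f := Prod.fst)
    (g := ψ) hψ.aestronglyMeasurable measurable_fst.aemeasurable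
  have e1 := integral_map (μ := collMeasure.withDensity fun z =>
    ENNReal.ofReal (‖v - z.1‖ ^ p * β (cosDev v z.1 z.2))) (φ := fun z => postStar v z.1 z.2)
    hpm.aemeasurable (f := ψ) hψ.aestronglyMeasurable
  have e2 := integral_map (μ := collMeasure.withDensity fun z =>
    ENNReal.ofReal (‖v - z.1‖ ^ p * (β (cosDev v z.1 z.2) *
      hcos (cosDev v z.1 z.2) ^ (-(3 + p))))) (φ := Prod.fst)
    measurable_fst.aemeasurable (f := ψ) hψ.aestronglyMeasurable
  rw [hmap] at i1 e1
  rw [i1] at i2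
  rw [e1] at e2
  rw [integrable_withDensity_iff_integrable_smul' hd1.ennreal_ofReal (by simp),
    integrable_withDensity_iff_integrable_smul' hd2.ennreal_ofReal (by simp)] at i2
  rw [integral_withDensity_eq_integral_toReal_smul hd1.ennreal_ofReal (by simp),
    integral_withDensity_eq_integral_toReal_smul hd2.ennreal_ofReal (by simp)] at e2
  simp only [ENNReal.toReal_ofReal (hn1 _), ENNReal.toReal_ofReal (hn2 _), smul_eq_mul,
    Function.comp_apply] at i2 e2
  constructor
  · convert i2 using 3 <;> exact mul_comm _ _
  · convert e2 using 3 <;> exact mul_comm _ _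

end Boltzmann
end

noncomputable section
namespace Boltzmann

/-! ### The dual estimate for grazing collisions -/

theorem measurable_norm_sub_rpow (v : Vel) (p : ℝ) :
    Measurable fun z : Vel × Sph => ‖v - z.1‖ ^ p :=
  (measurable_const.sub measurable_fst).norm.pow_const p

theorem Cutoff.weighted_le {β : ℝ → ℝ} (hβ : Cutoff β) {H : Vel → ℝ} {p m : ℝ} (hp : 0 ≤ p)
    (hpm : p ≤ m) (hH0 : ∀ w, 0 ≤ H w) (hHm : Measurable H)
    (hH : Integrable fun w => H w * jap w ^ p) (v : Vel) :
    ∫ z, H z.1 * (‖v - z.1‖ ^ p * β (cosDev v z.1 z.2)) ∂collMeasure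
        ≤ 2 ^ p * (∫ w, H w * jap w ^ p) * sphInt β * jap v ^ m := by
  refine (hβ.weighted hp hH0 hHm hH v).2.trans ?_
  have h1 : 0 ≤ ∫ w, H w * jap w ^ p :=
    integral_nonneg fun w => mul_nonneg (hH0 w) (jap_rpow_pos _ _).le
  have h2 : 0 ≤ sphInt β := sphInt_nonneg fun x _ _ => hβ.nonneg x
  have h3 := jap_rpow_le_jap_rpow v hpm
  gcongr

theorem Cutoff.integrable_of_le {β : ℝ → ℝ} (hβ : Cutoff β) {γ q C : ℝ} (hγ : 0 ≤ γ)
    (v : Vel) {F : Vel × Sph → ℝ} (hF : Measurable F) (hle : ∀ w σ, |F (w, σ)| ≤ C * jap w ^ q) :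
    Integrable (fun z => maxw z.1 * (‖v - z.1‖ ^ γ * β (cosDev v z.1 z.2)) * F z) collMeasure := by
  have hi : Integrable fun w => (maxw w * jap w ^ q) * jap w ^ γ := by
    refine (integrable_maxw_mul_jap (q + γ)).congr (Eventually.of_forall fun w => ?_)
    simp only [Real.rpow_add (jap_pos w)]; ring
  have hm1 : Measurable fun w => maxw w * jap w ^ q :=
    measurable_maxw.mul (measurable_jap.pow_const q)
  have h := (hβ.weighted hγ (fun w => mul_nonneg (maxw_pos w).le (jap_rpow_pos w q).le)
    hm1 hi v).1.const_mul C
  have hcm := measurable_cosDev_right v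
  refine h.mono' ?_ (Eventually.of_forall fun z => ?_)
  · exact (((measurable_maxw.comp measurable_fst).mul ((measurable_norm_sub_rpow v γ).mul
      (hβ.measurable.comp hcm))).mul hF).aestronglyMeasurable
  · have h1 := hle z.1 z.2
    have h2 := (maxw_pos z.1).le
    have h3 := hβ.nonneg (cosDev v z.1 z.2)
    have h4 := Real.rpow_nonneg (norm_nonneg (v - z.1)) γ
    rw [norm_mul, Real.norm_of_nonneg (by positivity), Real.norm_eq_abs]
    calc maxw z.1 * (‖v - z.1‖ ^ γ * β (cosDev v z.1 z.2)) * |F z|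
        ≤ maxw z.1 * (‖v - z.1‖ ^ γ * β (cosDev v z.1 z.2)) * (C * jap z.1 ^ q) := by gcongr
      _ = _ := by ring

theorem integrable_gauss_mul_jap_mul {q p : ℝ} :
    Integrable fun w => (gauss (1 / 4) w * jap w ^ q) * jap w ^ p := by
  refine (integrable_jap_rpow_mul_gauss (q + p) (c := 1 / 4) (by norm_num)).congr
    (Eventually.of_forall fun w => ?_)
  simp only [Real.rpow_add (jap_pos w)]; ring

/-- The bound on the gain term of the deviation of the colliding particle. -/
theorem Cutoff.integral_post_sub_le {q γ : ℝ} (hq : 1 ≤ q) (hγ : 0 ≤ γ) :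
    ∃ C, 0 ≤ C ∧ ∀ (β : ℝ → ℝ), Cutoff β → ∀ (v : Vel) (φ : Vel → ℝ), Measurable φ →
      (∀ y, |φ y| ≤ jap y ^ q) → φ v = jap v ^ q →
      Integrable (fun z : Vel × Sph => maxw z.1 * (‖v - z.1‖ ^ γ * β (cosDev v z.1 z.2)) *
        (φ (post v z.1 z.2) - φ v)) collMeasure ∧
      ∫ z, maxw z.1 * (‖v - z.1‖ ^ γ * β (cosDev v z.1 z.2)) *
        (φ (post v z.1 z.2) - φ v) ∂collMeasure
          ≤ C * sphInt (fun x => β x * hsin x) * jap v ^ (q + γ) := by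
  have hi : Integrable fun w => (maxw w * jap w ^ q) * jap w ^ γ := by
    refine (integrable_maxw_mul_jap (q + γ)).congr (Eventually.of_forall fun w => ?_)
    simp only [Real.rpow_add (jap_pos w)]; ring
  have hm1 : Measurable fun w => maxw w * jap w ^ q :=
    measurable_maxw.mul (measurable_jap.pow_const q)
  have h0 : ∀ w, 0 ≤ maxw w * jap w ^ q := fun w =>
    mul_nonneg (maxw_pos w).le (jap_rpow_pos w q).le
  have hI : 0 ≤ ∫ w, (maxw w * jap w ^ q) * jap w ^ γ :=
    integral_nonneg fun w => mul_nonneg (h0 w) (jap_rpow_pos w γ).le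
  refine ⟨2 * q * (2 ^ γ * ∫ w, (maxw w * jap w ^ q) * jap w ^ γ), by positivity, ?_⟩
  intro β hβ v φ hφ hb hv
  have hpm := measurable_post_right v
  have hint : Integrable (fun z : Vel × Sph => maxw z.1 * (‖v - z.1‖ ^ γ *
      β (cosDev v z.1 z.2)) * (φ (post v z.1 z.2) - φ v)) collMeasure := by
    refine hβ.integrable_of_le (q := q) (C := 2 * jap v ^ q) hγ v
      ((hφ.comp hpm).sub_const _) fun w σ => ?_
    have h1 := hb (post v w σ)
    have h2 := hb v
    have h3 := jap_post_rpow_le v w σ (zero_le_one.trans hq)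
    have h4 := one_le_jap_rpow w (zero_le_one.trans hq)
    have h5 := jap_rpow_pos v q
    calc |φ (post v w σ) - φ v| ≤ |φ (post v w σ)| + |φ v| := abs_sub _ _
      _ ≤ jap v ^ q * jap w ^ q + jap v ^ q * jap w ^ q := by nlinarith
      _ = _ := by ring
  refine ⟨hint, ?_⟩
  have hw := hβ.mul_hsin.weighted hγ h0 hm1 hi v
  have hle := integral_mono hint (hw.1.const_mul (2 * q * jap v ^ q)) fun z => ?_
  · refine hle.trans ?_
    rw [integral_const_mul]
    have := mul_le_mul_of_nonneg_left hw.2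
      (show 0 ≤ 2 * q * jap v ^ q by have := jap_rpow_pos v q; positivity)
    refine this.trans_eq ?_
    rw [Real.rpow_add (jap_pos v)]; ring
  · have h1 := (abs_le.1 (hb (post v z.1 z.2))).2
    have h2 := (abs_le.1 (jap_post_rpow_sub_le v z.1 z.2 hq)).2
    have h3 := (maxw_pos z.1).le
    have h4 := hβ.nonneg (cosDev v z.1 z.2)
    have h5 := Real.rpow_nonneg (norm_nonneg (v - z.1)) γ
    simp only
    calc _ ≤ maxw z.1 * (‖v - z.1‖ ^ γ * β (cosDev v z.1 z.2)) *
          (2 * q * hsin (cosDev v z.1 z.2) * (jap v ^ q * jap z.1 ^ q)) := by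
          refine mul_le_mul_of_nonneg_left ?_ (by positivity)
          linarith
      _ = _ := by ring

theorem abs_maxw_sub_maxw_le (x y : Vel) : |maxw x - maxw y| ≤ 2 * maxwConst *
    (‖x - y‖ * gauss (1 / 4) y + min 1 ‖x - y‖ * gauss (1 / 4) x) := by
  have hc := maxwConst_pos
  have gx := gauss_pos (1 / 4) x
  have gy := gauss_pos (1 / 4) y
  rcases le_total 1 ‖x - y‖ with h | h
  · rw [min_eq_left h]
    have h1 := gaussLip_maxw.bound x
    have h2 := gaussLip_maxw.bound y
    calc |maxw x - maxw y| ≤ |maxw x| + |maxw y| := abs_sub _ _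
      _ ≤ 2 * maxwConst * (1 * gauss (1 / 4) y + 1 * gauss (1 / 4) x) := by linarith
      _ ≤ _ := by gcongr
  · rw [min_eq_right h]
    refine (gaussLip_maxw.lip x y).trans_eq ?_
    ring

theorem sphInt_mul_hcos_le {β : ℝ → ℝ} (hβ : Cutoff β) {m : ℝ} (hm : 0 ≤ m) :
    sphInt (fun x => β x * hcos x ^ (-m)) ≤ 2 ^ m * sphInt β := by
  rw [sphInt, sphInt, ← integral_const_mul]
  refine integral_mono (hβ.mul_hcos hm).int (Integrable.const_mul hβ.int _) fun σ => ?_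
  simp only
  by_cases hx : dot axis σ < 0
  · rw [hβ.supp _ hx, zero_mul, mul_zero]
  · rw [mul_comm]
    exact mul_le_mul_of_nonneg_right (hcos_rpow_neg_le (not_lt.1 hx) hm) (hβ.nonneg _)

/-- The bound on the difference created by the Maxwellian after the collision. -/
theorem Cutoff.integral_maxw_sub_le {q γ : ℝ} (hq : 1 ≤ q) (hγ : 0 ≤ γ) :
    ∃ C, 0 ≤ C ∧ ∀ (β : ℝ → ℝ), Cutoff β → ∀ (v : Vel) (φ : Vel → ℝ), Measurable φ →
      (∀ y, |φ y| ≤ jap y ^ q) →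
      Integrable (fun z : Vel × Sph => (maxw z.1 - maxw (postStar v z.1 z.2)) *
        φ (postStar v z.1 z.2) * (‖v - z.1‖ ^ γ * β (cosDev v z.1 z.2))) collMeasure ∧
      ∫ z, (maxw z.1 - maxw (postStar v z.1 z.2)) *
        φ (postStar v z.1 z.2) * (‖v - z.1‖ ^ γ * β (cosDev v z.1 z.2)) ∂collMeasure
          ≤ C * sphInt (fun x => β x * hsin x) * jap v ^ (q + γ) := by
  set g : Vel → ℝ := fun w => gauss (1 / 4) w * jap w ^ q with hg
  have hg0 : ∀ w, 0 ≤ g w := fun w => mul_nonneg (gauss_pos _ w).le (jap_rpow_pos w q).le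
  have hgm : Measurable g := (measurable_gauss _).mul (measurable_jap.pow_const q)
  have hgi : ∀ p : ℝ, Integrable fun w => g w * jap w ^ p := fun p => by
    simpa only [hg] using integrable_gauss_mul_jap_mul (q := q) (p := p)
  have hI : ∀ p : ℝ, 0 ≤ ∫ w, g w * jap w ^ p := fun p =>
    integral_nonneg fun w => mul_nonneg (hg0 w) (jap_rpow_pos w p).le
  have hc := maxwConst_pos
  set K₁ := 2 ^ (1 + γ) * ∫ w, g w * jap w ^ (1 + γ) with hK₁
  set K₂ := 2 ^ (q + γ) * ∫ w, g w * jap w ^ (q + γ) with hK₂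
  have hK₁0 : 0 ≤ K₁ := by have := hI (1 + γ); positivity
  have hK₂0 : 0 ≤ K₂ := by have := hI (q + γ); positivity
  refine ⟨2 * maxwConst * (K₁ * 2 ^ (3 + (1 + γ)) + 2 ^ q * K₁ + 2 ^ q * K₂), by positivity, ?_⟩
  intro β hβ v φ hφ hb
  have hβ₁ := hβ.mul_hsin
  have hpm := measurable_postStar_right v
  have hcm := measurable_cosDev_right v
  set G : Vel × Sph → ℝ := fun z => 2 * maxwConst *
    (g (postStar v z.1 z.2) * (‖v - z.1‖ ^ (1 + γ) *
        (β (cosDev v z.1 z.2) * hsin (cosDev v z.1 z.2))) +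
      2 ^ q * (g z.1 * (‖v - z.1‖ ^ (1 + γ) *
        (β (cosDev v z.1 z.2) * hsin (cosDev v z.1 z.2)))) +
      2 ^ q * (g z.1 * (‖v - z.1‖ ^ (q + γ) *
        (β (cosDev v z.1 z.2) * hsin (cosDev v z.1 z.2))))) with hG
  have hs := hβ₁.integral_postStar v (p := 1 + γ) hgm
  have hβ₂ := hβ₁.mul_hcos (m := 3 + (1 + γ)) (by linarith)
  have i1 := hs.1.2 (hβ₂.weighted (by linarith) hg0 hgm (hgi _) v).1
  have i2 := (hβ₁.weighted (p := 1 + γ) (by linarith) hg0 hgm (hgi _) v).1.const_mul (2 ^ q)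
  have i3 := (hβ₁.weighted (p := q + γ) (by linarith) hg0 hgm (hgi _) v).1.const_mul (2 ^ q)
  have hGi : Integrable G collMeasure := ((i1.add i2).add i3).const_mul _
  have hle : ∀ z : Vel × Sph, |(maxw z.1 - maxw (postStar v z.1 z.2)) *
      φ (postStar v z.1 z.2) * (‖v - z.1‖ ^ γ * β (cosDev v z.1 z.2))| ≤ G z := by
    rintro ⟨w, σ⟩
    simp only [hG]
    set y := postStar v w σ
    set x := cosDev v w σ
    set u := ‖v - w‖ with hu
    have hu0 : 0 ≤ u := norm_nonneg _
    have hx0 := hsin_nonneg x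
    have hx1 : hsin x ≤ 1 := hsin_le_one (neg_one_le_cosDev v w σ)
    have hβ0 := hβ.nonneg x
    have hd : ‖w - y‖ = u * hsin x := by rw [norm_sub_rev]; exact norm_postStar_sub v w σ
    have h1 := abs_maxw_sub_maxw_le w y
    rw [hd] at h1
    have hd0 : 0 ≤ u * hsin x := by positivity
    have hm0 : 0 ≤ min 1 (u * hsin x) := le_min zero_le_one hd0
    have h2 : jap y ^ q ≤ 2 ^ q * (jap w ^ q + (u * hsin x) ^ q) := by
      have : jap y ≤ jap w + u * hsin x := by
        have := jap_le_jap_add y w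
        rwa [norm_sub_rev, hd] at this
      exact (Real.rpow_le_rpow (jap_nonneg y) this (by linarith)).trans
        (add_rpow_le_two_rpow_mul (jap_nonneg w) hd0 (by linarith))
    have h3 : (u * hsin x) ^ q ≤ u ^ q * hsin x := by
      rw [Real.mul_rpow hu0 hx0]
      have := Real.rpow_le_rpow_of_exponent_ge_of_imp hx0 hx1 hq (fun _ h => by linarith)
      rw [Real.rpow_one] at this
      gcongr
    have h4 : min 1 (u * hsin x) * jap y ^ q ≤
        2 ^ q * (u * hsin x * jap w ^ q + u ^ q * hsin x) := by
      have a1 := min_le_right 1 (u * hsin x)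
      have a2 := min_le_left 1 (u * hsin x)
      have a3 := jap_rpow_pos w q
      have a4 := Real.rpow_nonneg hd0 q
      calc min 1 (u * hsin x) * jap y ^ q
          ≤ min 1 (u * hsin x) * (2 ^ q * (jap w ^ q + (u * hsin x) ^ q)) := by gcongr
        _ = 2 ^ q * (min 1 (u * hsin x) * jap w ^ q + min 1 (u * hsin x) * (u * hsin x) ^ q) := by
          ring
        _ ≤ 2 ^ q * (u * hsin x * jap w ^ q + 1 * (u ^ q * hsin x)) := by gcongr
        _ = _ := by ring
    have gw := (gauss_pos (1 / 4) w).le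
    have gy := (gauss_pos (1 / 4) y).le
    have hy := jap_rpow_pos y q
    have hγ0 := Real.rpow_nonneg hu0 γ
    rw [abs_mul, abs_mul, abs_of_nonneg (show 0 ≤ u ^ γ * β x by positivity)]
    calc |maxw w - maxw y| * |φ y| * (u ^ γ * β x)
        ≤ (2 * maxwConst * (u * hsin x * gauss (1 / 4) y + min 1 (u * hsin x) * gauss (1 / 4) w)) *
          jap y ^ q * (u ^ γ * β x) := by
          have := hb y
          gcongr
      _ = 2 * maxwConst * (u * hsin x * gauss (1 / 4) y * jap y ^ q +
          gauss (1 / 4) w * (min 1 (u * hsin x) * jap y ^ q)) * (u ^ γ * β x) := by ring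
      _ ≤ 2 * maxwConst * (u * hsin x * gauss (1 / 4) y * jap y ^ q +
          gauss (1 / 4) w * (2 ^ q * (u * hsin x * jap w ^ q + u ^ q * hsin x * 1))) *
            (u ^ γ * β x) := by
          rw [mul_one]
          gcongr
      _ ≤ 2 * maxwConst * (u * hsin x * gauss (1 / 4) y * jap y ^ q +
          gauss (1 / 4) w * (2 ^ q * (u * hsin x * jap w ^ q + u ^ q * hsin x * jap w ^ q))) *
            (u ^ γ * β x) := by
          have := one_le_jap_rpow w (show 0 ≤ q by linarith)
          gcongr
      _ = _ := by
          have e1 : u ^ (1 + γ) = u * u ^ γ := by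
            rw [Real.rpow_add_of_nonneg hu0 zero_le_one hγ, Real.rpow_one]
          have e2 : u ^ (q + γ) = u ^ q * u ^ γ :=
            Real.rpow_add_of_nonneg hu0 (by linarith) hγ
          rw [e1, e2]; ring
  have hmeas : Measurable fun z : Vel × Sph => (maxw z.1 - maxw (postStar v z.1 z.2)) *
      φ (postStar v z.1 z.2) * (‖v - z.1‖ ^ γ * β (cosDev v z.1 z.2)) :=
    (((measurable_maxw.comp measurable_fst).sub (measurable_maxw.comp hpm)).mul
      (hφ.comp hpm)).mul ((measurable_norm_sub_rpow v γ).mul (hβ.measurable.comp hcm))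
  have hint := hGi.mono' hmeas.aestronglyMeasurable (Eventually.of_forall hle)
  refine ⟨hint, ?_⟩
  refine (integral_mono hint hGi fun z => (le_abs_self _).trans (hle z)).trans ?_
  have hκ : 0 ≤ sphInt fun x => β x * hsin x := sphInt_nonneg fun x _ _ => hβ₁.nonneg x
  have hjv := jap_rpow_pos v (q + γ)
  have l1 := hβ₂.weighted_le (p := 1 + γ) (m := q + γ) (by linarith) (by linarith) hg0 hgm (hgi _) v
  have l2 := hβ₁.weighted_le (p := 1 + γ) (m := q + γ) (by linarith) (by linarith) hg0 hgm (hgi _) v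
  have l3 := hβ₁.weighted_le (p := q + γ) (m := q + γ) (by linarith) le_rfl hg0 hgm (hgi _) v
  have l4 := sphInt_mul_hcos_le hβ₁ (m := 3 + (1 + γ)) (by linarith)
  rw [← hs.2, ← hK₁] at l1
  rw [← hK₁] at l2
  rw [← hK₂] at l3
  have l5 : K₁ * sphInt (fun x => β x * hsin x * hcos x ^ (-(3 + (1 + γ)))) * jap v ^ (q + γ) ≤
      K₁ * (2 ^ (3 + (1 + γ)) * sphInt (fun x => β x * hsin x)) * jap v ^ (q + γ) := by gcongr
  have l6 := l1.trans l5
  have hsum : ∫ z, G z ∂collMeasure = 2 * maxwConst *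
      ((∫ z, g (postStar v z.1 z.2) * (‖v - z.1‖ ^ (1 + γ) *
        (β (cosDev v z.1 z.2) * hsin (cosDev v z.1 z.2))) ∂collMeasure) +
      2 ^ q * (∫ z, g z.1 * (‖v - z.1‖ ^ (1 + γ) *
        (β (cosDev v z.1 z.2) * hsin (cosDev v z.1 z.2))) ∂collMeasure) +
      2 ^ q * (∫ z, g z.1 * (‖v - z.1‖ ^ (q + γ) *
        (β (cosDev v z.1 z.2) * hsin (cosDev v z.1 z.2))) ∂collMeasure)) := by
    rw [hG, integral_const_mul]
    congr 1
    have e1 := integral_add (i1.add i2) i3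
    have e2 := integral_add i1 i2
    simp only [Pi.add_apply] at e1 e2
    rw [e1, e2, integral_const_mul, integral_const_mul]
  rw [hsum]
  calc _ ≤ 2 * maxwConst * (K₁ * (2 ^ (3 + (1 + γ)) * sphInt (fun x => β x * hsin x)) *
        jap v ^ (q + γ) + 2 ^ q * (K₁ * sphInt (fun x => β x * hsin x) * jap v ^ (q + γ)) +
        2 ^ q * (K₂ * sphInt (fun x => β x * hsin x) * jap v ^ (q + γ))) := by gcongr
    _ = _ := by ring

/-- The dual estimate for an angular kernel: its size is measured by `∫ β sin(θ/2) dσ`. -/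
theorem Cutoff.integral_dual_le {q γ : ℝ} (hq : 1 ≤ q) (hγ : 0 ≤ γ) :
    ∃ C, 0 ≤ C ∧ ∀ (β : ℝ → ℝ), Cutoff β → ∀ (v : Vel) (φ : Vel → ℝ), Measurable φ →
      (∀ y, |φ y| ≤ jap y ^ q) → φ v = jap v ^ q →
      ∫ z, maxw z.1 * (‖v - z.1‖ ^ γ * β (cosDev v z.1 z.2)) *
        (φ (post v z.1 z.2) - φ v + φ (postStar v z.1 z.2) - φ z.1) ∂collMeasure
          ≤ C * sphInt (fun x => β x * hsin x) * jap v ^ (q + γ) := by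
  obtain ⟨C₁, hC₁, h₁⟩ := Cutoff.integral_post_sub_le hq hγ
  obtain ⟨C₂, hC₂, h₂⟩ := Cutoff.integral_maxw_sub_le hq hγ
  have hm1 : Measurable fun w => maxw w * jap w ^ q :=
    measurable_maxw.mul (measurable_jap.pow_const q)
  have h0 : ∀ w, 0 ≤ maxw w * jap w ^ q := fun w =>
    mul_nonneg (maxw_pos w).le (jap_rpow_pos w q).le
  have hi : Integrable fun w => (maxw w * jap w ^ q) * jap w ^ γ := by
    refine (integrable_maxw_mul_jap (q + γ)).congr (Eventually.of_forall fun w => ?_)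
    simp only [Real.rpow_add (jap_pos w)]; ring
  set K := (3 + γ) * 2 ^ (3 + γ) * (2 ^ γ * ∫ w, (maxw w * jap w ^ q) * jap w ^ γ) with hK
  have hK0 : 0 ≤ K := by
    have : 0 ≤ ∫ w, (maxw w * jap w ^ q) * jap w ^ γ :=
      integral_nonneg fun w => mul_nonneg (h0 w) (jap_rpow_pos w γ).le
    positivity
  refine ⟨C₁ + K + C₂, by positivity, ?_⟩
  intro β hβ v φ hφ hb hv
  obtain ⟨i₁, l₁⟩ := h₁ β hβ v φ hφ hb hv
  obtain ⟨i₂, l₂⟩ := h₂ β hβ v φ hφ hb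
  have hψm : Measurable fun y => maxw y * φ y := measurable_maxw.mul hφ
  have hs := hβ.integral_postStar v (p := γ) hψm
  have hcm := measurable_cosDev_right v
  have hβc := hβ.mul_hcos (m := 3 + γ) (by linarith)
  have hψ : ∀ y, |maxw y * φ y| ≤ maxw y * jap y ^ q := fun y => by
    rw [abs_mul, abs_of_pos (maxw_pos y)]
    exact mul_le_mul_of_nonneg_left (hb y) (maxw_pos y).le
  have j₁ : Integrable (fun z : Vel × Sph => maxw z.1 * φ z.1 * (‖v - z.1‖ ^ γ *
      (β (cosDev v z.1 z.2) * hcos (cosDev v z.1 z.2) ^ (-(3 + γ))))) collMeasure := by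
    refine (hβc.weighted hγ h0 hm1 hi v).1.mono' ?_ (Eventually.of_forall fun z => ?_)
    · exact ((hψm.comp measurable_fst).mul ((measurable_norm_sub_rpow v γ).mul
        (hβc.measurable.comp hcm))).aestronglyMeasurable
    · have := hβc.nonneg (cosDev v z.1 z.2)
      have := Real.rpow_nonneg (norm_nonneg (v - z.1)) γ
      rw [norm_mul, Real.norm_eq_abs, Real.norm_of_nonneg (by positivity)]
      exact mul_le_mul_of_nonneg_right (hψ _) (by positivity)
  have j₂ : Integrable (fun z : Vel × Sph => maxw z.1 * φ z.1 * (‖v - z.1‖ ^ γ *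
      β (cosDev v z.1 z.2))) collMeasure := by
    refine (hβ.weighted hγ h0 hm1 hi v).1.mono' ?_ (Eventually.of_forall fun z => ?_)
    · exact ((hψm.comp measurable_fst).mul ((measurable_norm_sub_rpow v γ).mul
        (hβ.measurable.comp hcm))).aestronglyMeasurable
    · have := hβ.nonneg (cosDev v z.1 z.2)
      have := Real.rpow_nonneg (norm_nonneg (v - z.1)) γ
      rw [norm_mul, Real.norm_eq_abs, Real.norm_of_nonneg (by positivity)]
      exact mul_le_mul_of_nonneg_right (hψ _) (by positivity)
  have j₀ := hs.1.2 j₁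
  have hκ : 0 ≤ sphInt fun x => β x * hsin x :=
    sphInt_nonneg fun x _ _ => hβ.mul_hsin.nonneg x
  have l₃ : ∫ z, maxw (postStar v z.1 z.2) * φ (postStar v z.1 z.2) * (‖v - z.1‖ ^ γ *
      β (cosDev v z.1 z.2)) ∂collMeasure - ∫ z, maxw z.1 * φ z.1 * (‖v - z.1‖ ^ γ *
      β (cosDev v z.1 z.2)) ∂collMeasure ≤
        K * sphInt (fun x => β x * hsin x) * jap v ^ (q + γ) := by
    rw [hs.2, ← integral_sub j₁ j₂]
    have k := (hβ.mul_hsin.weighted hγ h0 hm1 hi v).1.const_mul ((3 + γ) * 2 ^ (3 + γ))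
    refine (integral_mono (j₁.sub j₂) k fun z => ?_).trans ?_
    · simp only [Pi.sub_apply]
      by_cases hx : cosDev v z.1 z.2 < 0
      · simp [hβ.supp _ hx]
      have e := abs_hcos_rpow_neg_sub_one_le (not_lt.1 hx) (cosDev_le_one v z.1 z.2)
        (m := 3 + γ) (by linarith)
      have a1 := hβ.nonneg (cosDev v z.1 z.2)
      have a2 := Real.rpow_nonneg (norm_nonneg (v - z.1)) γ
      have a3 := h0 z.1
      calc _ = maxw z.1 * φ z.1 * (hcos (cosDev v z.1 z.2) ^ (-(3 + γ)) - 1) *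
            (‖v - z.1‖ ^ γ * β (cosDev v z.1 z.2)) := by ring
        _ ≤ maxw z.1 * jap z.1 ^ q * ((3 + γ) * 2 ^ (3 + γ) * hsin (cosDev v z.1 z.2)) *
            (‖v - z.1‖ ^ γ * β (cosDev v z.1 z.2)) := by
            refine mul_le_mul_of_nonneg_right ((le_abs_self _).trans ?_) (by positivity)
            rw [abs_mul]
            exact mul_le_mul (hψ _) e (abs_nonneg _) (h0 _)
        _ = _ := by ring
    · rw [integral_const_mul]
      have a := hβ.mul_hsin.weighted_le (m := q + γ) hγ (by linarith) h0 hm1 hi v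
      calc _ ≤ (3 + γ) * 2 ^ (3 + γ) * _ := mul_le_mul_of_nonneg_left a (by positivity)
        _ = _ := by rw [hK]; ring
  have hsplit : ∫ z, maxw z.1 * (‖v - z.1‖ ^ γ * β (cosDev v z.1 z.2)) *
        (φ (post v z.1 z.2) - φ v + φ (postStar v z.1 z.2) - φ z.1) ∂collMeasure
      = ∫ z, maxw z.1 * (‖v - z.1‖ ^ γ * β (cosDev v z.1 z.2)) *
          (φ (post v z.1 z.2) - φ v) ∂collMeasure
        + (∫ z, maxw (postStar v z.1 z.2) * φ (postStar v z.1 z.2) * (‖v - z.1‖ ^ γ *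
            β (cosDev v z.1 z.2)) ∂collMeasure - ∫ z, maxw z.1 * φ z.1 * (‖v - z.1‖ ^ γ *
            β (cosDev v z.1 z.2)) ∂collMeasure)
        + ∫ z, (maxw z.1 - maxw (postStar v z.1 z.2)) *
            φ (postStar v z.1 z.2) * (‖v - z.1‖ ^ γ * β (cosDev v z.1 z.2)) ∂collMeasure := by
    have e₁ := integral_sub j₀ j₂
    have e₂ := integral_add i₁ (j₀.sub j₂)
    have e₃ := integral_add (i₁.add (j₀.sub j₂)) i₂
    simp only [Pi.add_apply, Pi.sub_apply] at e₁ e₂ e₃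
    rw [← e₁, ← e₂, ← e₃]
    refine integral_congr_ae (Eventually.of_forall fun z => ?_)
    simp only
    ring
  rw [hsplit]
  calc _ ≤ C₁ * sphInt (fun x => β x * hsin x) * jap v ^ (q + γ) +
        K * sphInt (fun x => β x * hsin x) * jap v ^ (q + γ) +
        C₂ * sphInt (fun x => β x * hsin x) * jap v ^ (q + γ) := by gcongr
    _ = _ := by ring

end Boltzmann
end

noncomputable section
namespace Boltzmann

/-! ### The angular kernel -/

open Classical in
/-- The restriction of an angular kernel to `0 ≤ cos θ < 1`. -/
def core (b : ℝ → ℝ) (x : ℝ) : ℝ := if 0 ≤ x ∧ x < 1 then b x else 0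

theorem hsin_anti {x y : ℝ} (h : x ≤ y) : hsin y ≤ hsin x :=
  Real.sqrt_le_sqrt (by linarith)

theorem hsin_pos {x : ℝ} (h : x < 1) : 0 < hsin x := Real.sqrt_pos.2 (by linarith)

theorem core_of_neg {b : ℝ → ℝ} {x : ℝ} (h : x < 0) : core b x = 0 :=
  if_neg fun h' => not_lt.2 h'.1 h

theorem core_of_one_le {b : ℝ → ℝ} {x : ℝ} (h : 1 ≤ x) : core b x = 0 :=
  if_neg fun h' => not_lt.2 h h'.2

theorem measurable_core {b : ℝ → ℝ} (hb : Measurable b) : Measurable (core b) :=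
  Measurable.ite (measurableSet_Ici.inter measurableSet_Iio) hb measurable_const

theorem measurable_bGraz {b : ℝ → ℝ} (hb : Measurable b) (δ : ℝ) : Measurable (bGraz b δ) :=
  Measurable.ite (measurableSet_le Real.continuous_arccos.measurable measurable_const) hb
    measurable_const

theorem measurable_bCut {b : ℝ → ℝ} (hb : Measurable b) (δ : ℝ) : Measurable (bCut b δ) :=
  Measurable.ite (measurableSet_le measurable_const Real.continuous_arccos.measurable) hb
    measurable_const

section Kernel

variable {s cb : ℝ} {b : ℝ → ℝ}

theorem IsAngularKernel.pos (hb : IsAngularKernel s cb b) (hcb : 0 < cb) {x : ℝ} (hx : 0 ≤ x)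
    (hx1 : x < 1) : 0 < b x := by
  have h1 : 0 < Real.arccos x := Real.arccos_pos.2 hx1
  have h2 : Real.arccos x ≤ Real.pi / 2 := Real.arccos_le_pi_div_two.2 hx
  have h := hb.lower _ ⟨h1, h2⟩
  rw [Real.cos_arccos (by linarith) hx1.le] at h
  have h3 : 0 < cb / Real.arccos x ^ (1 + 2 * s) := by positivity
  have h4 := Real.sin_pos_of_pos_of_lt_pi h1 (by linarith [Real.pi_pos])
  exact (pos_iff_pos_of_mul_pos (h3.trans_le h)).1 h4

theorem IsAngularKernel.le (hb : IsAngularKernel s cb b) (hs : 0 < s) (hcb : 0 < cb) {x : ℝ}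
    (hx : 0 ≤ x) (hx1 : x < 1) : b x ≤ cb⁻¹ * (1 - x ^ 2) ^ (-(1 + s)) := by
  have h1 : 0 < Real.arccos x := Real.arccos_pos.2 hx1
  have h2 : Real.arccos x ≤ Real.pi / 2 := Real.arccos_le_pi_div_two.2 hx
  have h := hb.upper _ ⟨h1, h2⟩
  rw [Real.cos_arccos (by linarith) hx1.le] at h
  have h4 := Real.sin_pos_of_pos_of_lt_pi h1 (by linarith [Real.pi_pos])
  have h5 := Real.sin_le h1.le
  set S := Real.sin (Real.arccos x) with hS
  have h6 : S ^ 2 = 1 - x ^ 2 := by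
    rw [hS, Real.sin_arccos, Real.sq_sqrt (by nlinarith)]
  have h7 : S ^ (1 + 2 * s) ≤ Real.arccos x ^ (1 + 2 * s) :=
    Real.rpow_le_rpow h4.le h5 (by linarith)
  have h8 : S * b x ≤ 1 / (cb * S ^ (1 + 2 * s)) := by
    refine h.trans (one_div_le_one_div_of_le (by positivity) ?_)
    gcongr
  have h9 : (1 - x ^ 2) ^ (-(1 + s)) = (S ^ (1 + 2 * s) * S)⁻¹ := by
    rw [← h6, ← Real.rpow_natCast, ← Real.rpow_mul h4.le, ← Real.rpow_add_one h4.ne',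
      ← Real.rpow_neg h4.le]
    congr 1
    push_cast; ring
  rw [h9]
  have h10 := mul_le_mul_of_nonneg_left h8 (inv_nonneg.2 h4.le)
  rw [inv_mul_cancel_left₀ h4.ne'] at h10
  refine h10.trans_eq ?_
  field_simp

theorem IsAngularKernel.core_nonneg (hb : IsAngularKernel s cb b) (hcb : 0 < cb) (x : ℝ) :
    0 ≤ core b x := by
  rw [core]
  split_ifs with h
  · exact (hb.pos hcb h.1 h.2).le
  · exact le_rfl

theorem IsAngularKernel.sphIntegrable_core (hb : IsAngularKernel s cb b) (hs : 0 < s)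
    (hcb : 0 < cb) {p : ℝ} (hp : 2 * s < p) (hp2 : p ≤ 2) :
    SphIntegrable fun x => core b x * hsin x ^ p := by
  have h := (sphIntegrable_one_sub_sq_rpow (a := 1 + s - p / 2) (by linarith)
    (by linarith)).const_mul cb⁻¹
  refine SphIntegrable.mono (β := fun x => cb⁻¹ * (1 - x ^ 2) ^ (-(1 + s - p / 2))) h
    ((measurable_core hb.measurable).mul (measurable_hsin.pow_const p)) fun x hx hx1 => ?_
  rw [abs_of_nonneg (mul_nonneg (hb.core_nonneg hcb x) (Real.rpow_nonneg (hsin_nonneg x) p))]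
  have hq : 0 ≤ 1 - x ^ 2 := by nlinarith
  by_cases h0 : 0 ≤ x ∧ x < 1
  · have e1 := hb.le hs hcb h0.1 h0.2
    have e2 : hsin x ^ p ≤ (1 - x ^ 2) ^ (p / 2) := by
      have : hsin x ^ p = (hsin x ^ 2) ^ (p / 2) := by
        rw [← Real.rpow_natCast, ← Real.rpow_mul (hsin_nonneg x)]
        congr 1
        push_cast; ring
      rw [this, hsin_sq hx1]
      exact Real.rpow_le_rpow (by linarith) (by nlinarith) (by linarith)
    have hq' : 0 < 1 - x ^ 2 := by nlinarith
    rw [core, if_pos h0]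
    calc b x * hsin x ^ p ≤ cb⁻¹ * (1 - x ^ 2) ^ (-(1 + s)) * (1 - x ^ 2) ^ (p / 2) := by
          have := Real.rpow_nonneg (hsin_nonneg x) p
          gcongr
      _ = cb⁻¹ * (1 - x ^ 2) ^ (-(1 + s - p / 2)) := by
          rw [mul_assoc, ← Real.rpow_add hq']; congr 2; ring
  · rw [core, if_neg h0, zero_mul]
    positivity

theorem IsAngularKernel.cutoff_bCut (hb : IsAngularKernel s cb b) (hs : 0 < s) (hs' : s < 1 / 2)
    (hcb : 0 < cb) {δ : ℝ} (hδ : 0 < δ) (hδ1 : δ ≤ 1) : Cutoff (bCut (core b) δ) where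
  measurable := measurable_bCut (measurable_core hb.measurable) δ
  nonneg x := by rw [bCut]; split_ifs; exacts [hb.core_nonneg hcb x, le_rfl]
  supp x hx := by rw [bCut, core_of_neg hx, ite_self]
  int := by
    have hc1 : Real.cos δ < 1 := by
      have := Real.cos_lt_cos_of_nonneg_of_le_pi le_rfl (by linarith [Real.pi_gt_three]) hδ
      rwa [Real.cos_zero] at this
    have hpos := hsin_pos hc1
    have h := (hb.sphIntegrable_core hs hcb (p := 1) (by linarith) (by norm_num)).const_mul
      (hsin (Real.cos δ))⁻¹
    refine SphIntegrable.mono (β := fun x => (hsin (Real.cos δ))⁻¹ * (core b x * hsin x ^ (1 : ℝ)))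
      h (measurable_bCut (measurable_core hb.measurable) δ) fun x hx hx1 => ?_
    have hn := hb.core_nonneg hcb x
    have h0 := hsin_nonneg x
    rw [bCut]
    split_ifs with h'
    · rw [abs_of_nonneg hn, Real.rpow_one]
      have hle : x ≤ Real.cos δ := by
        have := Real.cos_le_cos_of_nonneg_of_le_pi hδ.le (Real.arccos_le_pi x) h'
        rwa [Real.cos_arccos hx hx1] at this
      have := hsin_anti hle
      rw [inv_mul_eq_div, le_div_iff₀ hpos]
      gcongr
    · rw [abs_zero]; positivity

theorem bCut_core {b : ℝ → ℝ} (hb : ∀ x, x < 0 → b x = 0) {δ : ℝ} (hδ : 0 < δ) (x : ℝ) :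
    bCut (core b) δ x = bCut b δ x := by
  rw [bCut, bCut]
  split_ifs with h
  · rw [core]
    split_ifs with h'
    · rfl
    · rcases lt_or_ge x 0 with h0 | h0
      · exact (hb x h0).symm
      · have : 1 ≤ x := by
          by_contra hc
          exact h' ⟨h0, not_le.1 hc⟩
        rw [Real.arccos_of_one_le this] at h
        exact absurd h (not_le.2 hδ)
  · rfl

theorem bGraz_core {b : ℝ → ℝ} (hb : ∀ x, x < 0 → b x = 0) {δ : ℝ} {x : ℝ} (hx : x < 1) :
    bGraz (core b) δ x = bGraz b δ x := by
  rw [bGraz, bGraz, core]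
  split_ifs with h h'
  · rfl
  · refine (hb x ?_).symm
    by_contra hc
    exact h' ⟨not_lt.1 hc, hx⟩
  · rfl

theorem IsAngularKernel.bGraz_core_nonneg (hb : IsAngularKernel s cb b) (hcb : 0 < cb) (δ x : ℝ) :
    0 ≤ bGraz (core b) δ x := by
  rw [bGraz]; split_ifs; exacts [hb.core_nonneg hcb x, le_rfl]

theorem IsAngularKernel.bGraz_core_le (hb : IsAngularKernel s cb b) (hcb : 0 < cb) (δ x : ℝ) :
    bGraz (core b) δ x ≤ core b x := by
  rw [bGraz]; split_ifs; exacts [le_rfl, hb.core_nonneg hcb x]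

theorem IsAngularKernel.sphIntegrable_bGraz (hb : IsAngularKernel s cb b) (hs : 0 < s)
    (hcb : 0 < cb) {p : ℝ} (hp : 2 * s < p) (hp2 : p ≤ 2) (δ : ℝ) :
    SphIntegrable fun x => bGraz (core b) δ x * hsin x ^ p := by
  refine (hb.sphIntegrable_core hs hcb hp hp2).mono
    ((measurable_bGraz (measurable_core hb.measurable) δ).mul (measurable_hsin.pow_const p))
    fun x _ _ => ?_
  have h := Real.rpow_nonneg (hsin_nonneg x) p
  rw [abs_of_nonneg (mul_nonneg (hb.bGraz_core_nonneg hcb δ x) h)]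
  exact mul_le_mul_of_nonneg_right (hb.bGraz_core_le hcb δ x) h

theorem IsAngularKernel.sphIntegrable_bGraz_one (hb : IsAngularKernel s cb b) (hs : 0 < s)
    (hs' : s < 1 / 2) (hcb : 0 < cb) (δ : ℝ) :
    SphIntegrable fun x => bGraz (core b) δ x * hsin x := by
  simpa only [Real.rpow_one] using
    hb.sphIntegrable_bGraz hs hcb (p := 1) (by linarith) (by norm_num) δ

theorem IsAngularKernel.tendsto_sphInt_bGraz (hb : IsAngularKernel s cb b) (hs : 0 < s)
    (hs' : s < 1 / 2) (hcb : 0 < cb) :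
    Tendsto (fun δ => sphInt fun x => bGraz (core b) δ x * hsin x) (𝓝[>] 0) (𝓝 0) := by
  have h := tendsto_integral_filter_of_dominated_convergence (μ := surf) (l := 𝓝[>] (0 : ℝ))
    (F := fun δ σ => bGraz (core b) δ (dot axis σ) * hsin (dot axis σ)) (f := fun _ => 0)
    (fun σ => core b (dot axis σ) * hsin (dot axis σ) ^ (1 : ℝ))
    (Eventually.of_forall fun δ => (((measurable_bGraz (measurable_core hb.measurable) δ).mul
      measurable_hsin).comp (measurable_dot_right axis)).aestronglyMeasurable)
    (Eventually.of_forall fun δ => Eventually.of_forall fun σ => ?_)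
    (hb.sphIntegrable_core hs hcb (p := 1) (by linarith) (by norm_num))
    (Eventually.of_forall fun σ => ?_)
  · simpa [sphInt] using h
  · rw [Real.rpow_one, norm_mul, Real.norm_of_nonneg (hb.bGraz_core_nonneg hcb _ _),
      Real.norm_of_nonneg (hsin_nonneg _)]
    exact mul_le_mul_of_nonneg_right (hb.bGraz_core_le hcb _ _) (hsin_nonneg _)
  · refine tendsto_const_nhds.congr' ?_
    rcases lt_or_ge (dot axis σ) 1 with h1 | h1
    · have := Real.arccos_pos.2 h1
      filter_upwards [Ioo_mem_nhdsGT this] with δ hδ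
      rw [bGraz, if_neg (not_le.2 hδ.2), zero_mul]
    · refine Eventually.of_forall fun δ => ?_
      simp only
      rw [bGraz, core_of_one_le h1, ite_self, zero_mul]

/-- Angular truncations of the grazing kernel. -/
def grazTrunc (b : ℝ → ℝ) (δ : ℝ) (n : ℕ) : ℝ → ℝ := bGraz (bCut (core b) (1 / (n + 1))) δ

theorem IsAngularKernel.cutoff_grazTrunc (hb : IsAngularKernel s cb b) (hs : 0 < s)
    (hs' : s < 1 / 2) (hcb : 0 < cb) (δ : ℝ) (n : ℕ) : Cutoff (grazTrunc b δ n) := by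
  have h := hb.cutoff_bCut hs hs' hcb (δ := 1 / (n + 1)) (by positivity)
    ((div_le_one (by positivity)).2 (by linarith [(n.cast_nonneg : (0 : ℝ) ≤ n)]))
  have hm : Measurable (grazTrunc b δ n) := measurable_bGraz h.measurable δ
  refine ⟨hm, fun x => ?_, fun x hx => ?_, h.int.mono hm fun x _ _ => ?_⟩
  · rw [grazTrunc, bGraz]; split_ifs; exacts [h.nonneg x, le_rfl]
  · rw [grazTrunc, bGraz, h.supp x hx, ite_self]
  · rw [grazTrunc, bGraz]; split_ifs
    exacts [(abs_of_nonneg (h.nonneg x)).le, by rw [abs_zero]; exact h.nonneg x]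

theorem IsAngularKernel.grazTrunc_le (hb : IsAngularKernel s cb b) (hcb : 0 < cb) (δ : ℝ) (n : ℕ)
    (x : ℝ) : grazTrunc b δ n x ≤ bGraz (core b) δ x := by
  rw [grazTrunc, bGraz, bGraz]
  split_ifs
  · rw [bCut]; split_ifs; exacts [le_rfl, hb.core_nonneg hcb x]
  · exact le_rfl

theorem tendsto_grazTrunc (b : ℝ → ℝ) (δ x : ℝ) :
    Tendsto (fun n => grazTrunc b δ n x) atTop (𝓝 (bGraz (core b) δ x)) := by
  refine tendsto_const_nhds.congr' ?_
  rcases lt_or_ge x 1 with h1 | h1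
  · have := Real.arccos_pos.2 h1
    filter_upwards [tendsto_one_div_add_atTop_nhds_zero_nat.eventually (gt_mem_nhds this)] with n hn
    rw [grazTrunc, bGraz, bGraz, bCut, if_pos hn.le]
  · refine Eventually.of_forall fun n => ?_
    change bGraz (core b) δ x = grazTrunc b δ n x
    rw [grazTrunc, bGraz, bGraz, bCut, core_of_one_le h1]
    simp

theorem one_sub_hcos_sub_hsin_pos {q x : ℝ} (hq : 2 < q) (hx : -1 < x) (hx1 : x < 1) :
    0 < 1 - hcos x ^ q - hsin x ^ q := by
  have h1 : 0 < hsin x := hsin_pos hx1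
  have h2 : 0 < hcos x := Real.sqrt_pos.2 (by linarith)
  have e1 := hsin_sq hx1.le
  have e2 := hcos_sq hx.le
  have h3 : hsin x < 1 := by nlinarith
  have h4 : hcos x < 1 := by nlinarith
  have e3 := Real.rpow_lt_rpow_of_exponent_gt h1 h3 hq
  have e4 := Real.rpow_lt_rpow_of_exponent_gt h2 h4 hq
  rw [Real.rpow_two] at e3 e4
  linarith

theorem one_sub_hcos_sub_hsin_nonneg {q x : ℝ} (hq : 2 < q) (hx : -1 ≤ x) (hx1 : x ≤ 1) :
    0 ≤ 1 - hcos x ^ q - hsin x ^ q := by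
  have e1 := hsin_sq hx1
  have e2 := hcos_sq hx
  have e3 := Real.rpow_le_rpow_of_exponent_ge_of_imp (hsin_nonneg x) (hsin_le_one hx) hq.le
    (fun _ h => by linarith)
  have e4 := Real.rpow_le_rpow_of_exponent_ge_of_imp (hcos_nonneg x) (hcos_le_one hx1) hq.le
    (fun _ h => by linarith)
  rw [Real.rpow_two] at e3 e4
  linarith

theorem exists_dot_axis_eq_half : ∃ σ : Sph, dot axis σ = 1 / 2 := by
  refine ⟨⟨!₂[1 / 2, Real.sqrt (3 / 4), 0], ?_⟩, ?_⟩
  · rw [mem_sphere_zero_iff_norm, EuclideanSpace.norm_eq, Fin.sum_univ_three]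
    simp
    rw [div_pow, sq_abs, sq_abs, Real.sq_sqrt (by norm_num), Real.sq_sqrt (by norm_num)]
    norm_num
  · rw [dot_axis]; rfl

theorem sphInt_pos {f : ℝ → ℝ} (hf : SphIntegrable f) (h0 : ∀ x, -1 ≤ x → x ≤ 1 → 0 ≤ f x)
    {c d : ℝ} (hc : c < 1 / 2) (hd : 1 / 2 < d) (h : ∀ x, c < x → x < d → 0 < f x) :
    0 < sphInt f := by
  refine (integral_pos_iff_support_of_nonneg
    (fun σ => h0 _ (neg_one_le_dot _ _) (dot_le_one _ _)) hf).2 ?_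
  have hcont : Continuous fun σ : Sph => dot axis σ := by unfold dot; fun_prop
  have hopen : IsOpen ((fun σ : Sph => dot axis σ) ⁻¹' Ioo c d) := isOpen_Ioo.preimage hcont
  obtain ⟨σ, hσ⟩ := exists_dot_axis_eq_half
  refine (hopen.measure_pos surf ⟨σ, ?_⟩).trans_le (measure_mono fun τ hτ => ?_)
  · simp only [mem_preimage, hσ]; exact ⟨hc, hd⟩
  · exact (h _ hτ.1 hτ.2).ne'

theorem IsAngularKernel.exists_sphInt_bCut_ge (hb : IsAngularKernel s cb b) (hs : 0 < s)
    (hs' : s < 1 / 2) (hcb : 0 < cb) {q : ℝ} (hq : 2 < q) :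
    ∃ Λ, 0 < Λ ∧ ∀ δ, 0 < δ → δ ≤ 1 →
      Λ ≤ sphInt fun x => bCut (core b) δ x * (1 - hcos x ^ q - hsin x ^ q) := by
  have hm : Measurable fun x => 1 - hcos x ^ q - hsin x ^ q :=
    (measurable_const.sub (measurable_hcos.pow_const q)).sub (measurable_hsin.pow_const q)
  have hi : ∀ δ, 0 < δ → δ ≤ 1 →
      SphIntegrable fun x => bCut (core b) δ x * (1 - hcos x ^ q - hsin x ^ q) := by
    intro δ hδ hδ1
    have h := hb.cutoff_bCut hs hs' hcb hδ hδ1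
    refine h.int.mono (h.measurable.mul hm) fun x hx hx1 => ?_
    have h1 := one_sub_hcos_sub_hsin_nonneg hq hx hx1
    have h2 := Real.rpow_nonneg (hcos_nonneg x) q
    have h3 := Real.rpow_nonneg (hsin_nonneg x) q
    rw [abs_of_nonneg (mul_nonneg (h.nonneg x) h1)]
    exact mul_le_of_le_one_right (h.nonneg x) (by linarith)
  refine ⟨sphInt fun x => bCut (core b) 1 x * (1 - hcos x ^ q - hsin x ^ q), ?_, ?_⟩
  · have hc := hb.cutoff_bCut hs hs' hcb one_pos le_rfl
    have hcos : 1 / 2 < Real.cos 1 := by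
      rw [← Real.cos_pi_div_three]
      exact Real.cos_lt_cos_of_nonneg_of_le_pi zero_le_one (by linarith [Real.pi_pos])
        (by linarith [Real.pi_gt_three])
    refine sphInt_pos (hi 1 one_pos le_rfl)
      (fun x hx hx1 => mul_nonneg (hc.nonneg x) (one_sub_hcos_sub_hsin_nonneg hq hx hx1))
      (c := 0) (by norm_num) hcos fun x hx hx1 => ?_
    have h1 : x < 1 := hx1.trans_le (Real.cos_le_one 1)
    refine mul_pos ?_ (one_sub_hcos_sub_hsin_pos hq (by linarith) h1)
    have h2 : 1 ≤ Real.arccos x := by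
      rw [← Real.arccos_cos zero_le_one (by linarith [Real.pi_gt_three])]
      exact Real.arccos_le_arccos hx1.le
    rw [bCut, if_pos h2, core, if_pos ⟨hx.le, h1⟩]
    exact hb.pos hcb hx.le h1
  · intro δ hδ hδ1
    refine sphInt_mono (hi 1 one_pos le_rfl) (hi δ hδ hδ1) fun x hx hx1 => ?_
    refine mul_le_mul_of_nonneg_right ?_ (one_sub_hcos_sub_hsin_nonneg hq hx hx1)
    rw [bCut, bCut]
    split_ifs with h1 h2 h2
    · exact le_rfl
    · exact absurd (hδ1.trans h1) h2
    · exact hb.core_nonneg hcb x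
    · exact le_rfl

end Kernel

end Boltzmann
end

noncomputable section
namespace Boltzmann

/-! ### The dual estimate for non-grazing collisions -/

theorem integrable_maxw_mul_norm_sub {γ : ℝ} (hγ : 0 ≤ γ) (v : Vel) :
    Integrable fun w => maxw w * ‖v - w‖ ^ γ := by
  refine ((integrable_maxw_mul_jap γ).const_mul (2 ^ γ * jap v ^ γ)).mono'
    (measurable_maxw.mul ((measurable_const.sub measurable_id).norm.pow_const γ)).aestronglyMeasurable
    (Eventually.of_forall fun w => ?_)
  have h1 := (maxw_pos w).le
  have h2 := Real.rpow_nonneg (norm_nonneg (v - w)) γ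
  rw [Real.norm_of_nonneg (mul_nonneg h1 h2)]
  calc maxw w * ‖v - w‖ ^ γ ≤ maxw w * (2 ^ γ * (jap v ^ γ * jap w ^ γ)) :=
        mul_le_mul_of_nonneg_left (norm_sub_rpow_le v w hγ) h1
    _ = _ := by ring

theorem maxw_neg (w : Vel) : maxw (-w) = maxw w := by rw [maxw, maxw, norm_neg]

theorem jap_rpow_le_of_one_le_norm {γ : ℝ} (hγ : 0 ≤ γ) (hγ1 : γ ≤ 1) (v : Vel) {w : Vel}
    (hw : 1 ≤ ‖w‖) : jap v ^ γ ≤ ‖v - w‖ ^ γ + ‖v + w‖ ^ γ := by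
  have h1 : jap v ≤ ‖v - w‖ + ‖v + w‖ := by
    have h2 := jap_le_one_add_norm v
    have h3 : 2 * ‖v‖ ≤ ‖v - w‖ + ‖v + w‖ := by
      have := norm_add_le (v - w) (v + w)
      rwa [show (v - w) + (v + w) = (2 : ℝ) • v by module, norm_smul, Real.norm_two] at this
    have h4 : 2 * ‖w‖ ≤ ‖v - w‖ + ‖v + w‖ := by
      have := norm_sub_le (v + w) (v - w)
      rw [show (v + w) - (v - w) = (2 : ℝ) • w by module, norm_smul, Real.norm_two] at this
      linarith
    linarith
  exact (Real.rpow_le_rpow (jap_nonneg v) h1 hγ).trans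
    (Real.rpow_add_le_add_rpow (norm_nonneg _) (norm_nonneg _) hγ hγ1)

/-- Coercivity of the collision frequency of the Maxwellian. -/
theorem exists_integral_maxw_mul_norm_sub_ge {γ : ℝ} (hγ : 0 ≤ γ) (hγ1 : γ ≤ 1) :
    ∃ c, 0 < c ∧ ∀ v, c * jap v ^ γ ≤ ∫ w, maxw w * ‖v - w‖ ^ γ := by
  set A : Set Vel := {w | 1 < ‖w‖} with hA
  have hAo : IsOpen A := isOpen_lt continuous_const continuous_norm
  have hAm : MeasurableSet A := hAo.measurableSet
  have hmi : Integrable maxw := by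
    simpa using integrable_maxw_mul_jap 0
  have hne : A.Nonempty := by
    obtain ⟨x, hx⟩ := NormedSpace.exists_lt_norm ℝ Vel 1
    exact ⟨x, hx⟩
  have hpos : 0 < ∫ w in A, maxw w := by
    rw [setIntegral_pos_iff_support_of_nonneg_ae (Eventually.of_forall fun w => (maxw_pos w).le)
      hmi.integrableOn]
    have : Function.support maxw ∩ A = A := by
      rw [inter_eq_right]
      exact fun w _ => (maxw_pos w).ne'
    rw [this]
    exact hAo.measure_pos volume hne
  refine ⟨(∫ w in A, maxw w) / 2, by positivity, fun v => ?_⟩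
  have i1 := integrable_maxw_mul_norm_sub hγ v
  have i2 : Integrable fun w => maxw w * ‖v + w‖ ^ γ := by
    have := i1.comp_neg
    simpa only [maxw_neg, sub_neg_eq_add] using this
  have e : ∫ w, maxw w * ‖v + w‖ ^ γ = ∫ w, maxw w * ‖v - w‖ ^ γ := by
    have := integral_neg_eq_self (fun w => maxw w * ‖v - w‖ ^ γ) (volume : Measure Vel)
    simpa only [maxw_neg, sub_neg_eq_add] using this
  have h2 : (∫ w in A, maxw w) * jap v ^ γ ≤
      ∫ w, (maxw w * ‖v - w‖ ^ γ + maxw w * ‖v + w‖ ^ γ) := by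
    rw [← integral_mul_const, ← integral_indicator hAm]
    refine integral_mono ((hmi.mul_const _).indicator hAm) (i1.add i2) fun w => ?_
    have h3 := (maxw_pos w).le
    by_cases hw : w ∈ A
    · rw [indicator_of_mem hw]
      simp only
      rw [← mul_add]
      exact mul_le_mul_of_nonneg_left (jap_rpow_le_of_one_le_norm hγ hγ1 v (le_of_lt hw)) h3
    · rw [indicator_of_notMem hw]
      have := Real.rpow_nonneg (norm_nonneg (v - w)) γ
      have := Real.rpow_nonneg (norm_nonneg (v + w)) γ
      simp only
      positivity
  rw [integral_add i1 i2, e] at h2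
  linarith

theorem jap_collision_sum_le {q : ℝ} (hq : 2 < q) (v w : Vel) (σ : Sph) :
    jap (post v w σ) ^ q + jap (postStar v w σ) ^ q + jap w ^ q - jap v ^ q ≤
      -(1 - hcos (cosDev v w σ) ^ q - hsin (cosDev v w σ) ^ q) * jap v ^ q +
        (6 * q * 4 ^ (q - 1) + 1) * jap v ^ (q - 1) * jap w ^ q := by
  have hx := neg_one_le_cosDev v w σ
  have hx1 := cosDev_le_one v w σ
  have h1 := rpow_le_of_le_mul_add (jap_nonneg _) (hcos_nonneg _) (hcos_le_one hx1)
    (by linarith : 1 ≤ q) (jap_post_le_hcos v w σ)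
  have h2 := rpow_le_of_le_mul_add (jap_nonneg _) (hsin_nonneg _) (hsin_le_one hx)
    (by linarith : 1 ≤ q) (jap_postStar_le_hsin v w σ)
  have h3 := one_le_jap_rpow v (show 0 ≤ q - 1 by linarith)
  have h4 := jap_rpow_pos w q
  nlinarith

theorem Cutoff.integral_cut_le {q γ : ℝ} (hq : 2 < q) (hγ : 0 ≤ γ) :
    ∃ C, 0 ≤ C ∧ ∀ (β : ℝ → ℝ), Cutoff β → ∀ (v : Vel) (F : Vel × Sph → ℝ) (D : ℝ), Measurable F →
      (∀ w σ, |F (w, σ)| ≤ D * jap w ^ q) →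
      (∀ w σ, F (w, σ) ≤
        jap (post v w σ) ^ q + jap (postStar v w σ) ^ q + jap w ^ q - jap v ^ q) →
      ∫ z, maxw z.1 * (‖v - z.1‖ ^ γ * β (cosDev v z.1 z.2)) * F z ∂collMeasure ≤
        -((∫ w, maxw w * ‖v - w‖ ^ γ) *
          sphInt fun x => β x * (1 - hcos x ^ q - hsin x ^ q)) * jap v ^ q +
        C * sphInt β * jap v ^ (q - 1 + γ) := by
  have hm1 : Measurable fun w => maxw w * jap w ^ q :=
    measurable_maxw.mul (measurable_jap.pow_const q)
  have h0 : ∀ w, 0 ≤ maxw w * jap w ^ q := fun w =>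
    mul_nonneg (maxw_pos w).le (jap_rpow_pos w q).le
  have hi : Integrable fun w => (maxw w * jap w ^ q) * jap w ^ γ := by
    refine (integrable_maxw_mul_jap (q + γ)).congr (Eventually.of_forall fun w => ?_)
    simp only [Real.rpow_add (jap_pos w)]; ring
  have hI : 0 ≤ ∫ w, (maxw w * jap w ^ q) * jap w ^ γ :=
      integral_nonneg fun w => mul_nonneg (h0 w) (jap_rpow_pos w γ).le
  refine ⟨(6 * q * 4 ^ (q - 1) + 1) * (2 ^ γ * ∫ w, (maxw w * jap w ^ q) * jap w ^ γ),
    by positivity, ?_⟩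
  intro β hβ v F D hF hFD hFle
  have hint := hβ.integrable_of_le hγ v hF hFD
  have hpm : Measurable fun x => 1 - hcos x ^ q - hsin x ^ q :=
    (measurable_const.sub (measurable_hcos.pow_const q)).sub (measurable_hsin.pow_const q)
  have hβm : Measurable fun x => β x * (1 - hcos x ^ q - hsin x ^ q) := hβ.measurable.mul hpm
  have hβi : SphIntegrable fun x => β x * (1 - hcos x ^ q - hsin x ^ q) := by
    refine hβ.int.mono hβm fun x hx hx1 => ?_
    have h1 := one_sub_hcos_sub_hsin_nonneg hq hx hx1
    have h2 := Real.rpow_nonneg (hcos_nonneg x) q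
    have h3 := Real.rpow_nonneg (hsin_nonneg x) q
    rw [abs_of_nonneg (mul_nonneg (hβ.nonneg x) h1)]
    exact mul_le_of_le_one_right (hβ.nonneg x) (by linarith)
  obtain ⟨j1, l1⟩ := hβi.collision hβm (integrable_maxw_mul_norm_sub hγ v) v
  have hw := hβ.weighted hγ h0 hm1 hi v
  set Q := (6 * q * 4 ^ (q - 1) + 1) * jap v ^ (q - 1) with hQ
  have hQ0 : 0 ≤ Q := by have := jap_rpow_pos v (q - 1); positivity
  have hle : ∫ z, maxw z.1 * (‖v - z.1‖ ^ γ * β (cosDev v z.1 z.2)) * F z ∂collMeasure ≤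
      ∫ z : Vel × Sph, (-jap v ^ q * (maxw z.1 * ‖v - z.1‖ ^ γ * (β (cosDev v z.1 z.2) *
        (1 - hcos (cosDev v z.1 z.2) ^ q - hsin (cosDev v z.1 z.2) ^ q))) +
        Q * (maxw z.1 * jap z.1 ^ q * (‖v - z.1‖ ^ γ * β (cosDev v z.1 z.2)))) ∂collMeasure := by
    refine integral_mono hint ((j1.const_mul _).add (hw.1.const_mul _)) fun z => ?_
    have h1 := hFle z.1 z.2
    have h2 := jap_collision_sum_le hq v z.1 z.2
    have h3 := (maxw_pos z.1).le
    have h4 := hβ.nonneg (cosDev v z.1 z.2)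
    have h5 := Real.rpow_nonneg (norm_nonneg (v - z.1)) γ
    simp only
    calc _ ≤ maxw z.1 * (‖v - z.1‖ ^ γ * β (cosDev v z.1 z.2)) *
        (-(1 - hcos (cosDev v z.1 z.2) ^ q - hsin (cosDev v z.1 z.2) ^ q) * jap v ^ q +
        Q * jap z.1 ^ q) := by
          refine mul_le_mul_of_nonneg_left ?_ (by positivity)
          exact h1.trans h2
      _ = _ := by ring
  refine hle.trans ?_
  rw [integral_add (j1.const_mul _) (hw.1.const_mul _), integral_const_mul, integral_const_mul, l1]
  have := mul_le_mul_of_nonneg_left hw.2 hQ0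
  have e : jap v ^ (q - 1 + γ) = jap v ^ (q - 1) * jap v ^ γ := Real.rpow_add (jap_pos v) _ _
  rw [e]
  have e2 : Q * (2 ^ γ * (∫ w, maxw w * jap w ^ q * jap w ^ γ) * sphInt β * jap v ^ γ) =
      (6 * q * 4 ^ (q - 1) + 1) * (2 ^ γ * ∫ w, maxw w * jap w ^ q * jap w ^ γ) * sphInt β *
        (jap v ^ (q - 1) * jap v ^ γ) := by rw [hQ]; ring
  rw [e2] at this
  linarith

/-- The factors created by a truncation function in the weak form of the remainder operator. -/
structure IsAlmostOne (ε : ℝ) (v : Vel) (θ : Vel × Sph → ℝ) : Prop where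
  measurable : Measurable θ
  nonneg : ∀ z, 0 ≤ θ z
  le_one : ∀ z, θ z ≤ 1
  eq_one : ∀ w σ, ‖v‖ + ‖w‖ ≤ ε⁻¹ → 2 * ε ≤ ‖v - w‖ → |cosDev v w σ| ≤ 1 - 2 * ε → θ (w, σ) = 1

theorem IsAlmostOne.one_sub_mul_le {ε γ : ℝ} {v : Vel} {θ : Vel × Sph → ℝ} (h : IsAlmostOne ε v θ)
    (hγ : 0 ≤ γ) (hγ1 : γ ≤ 1) (hε : 0 < ε) (hε1 : ε ≤ 1 / 2) (w : Vel) (σ : Sph)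
    (hx : |cosDev v w σ| ≤ 1 - 2 * ε) :
    (1 - θ (w, σ)) * ‖v - w‖ ^ γ ≤ 2 * (2 * ε) ^ γ * (jap v ^ (2 : ℝ) * jap w ^ (2 : ℝ)) := by
  have h0 := h.nonneg (w, σ)
  have h1 := h.le_one (w, σ)
  have hu := Real.rpow_nonneg (norm_nonneg (v - w)) γ
  have hε0 : 0 ≤ (2 * ε) ^ γ := by positivity
  have a1 := one_le_jap_rpow v (show (0 : ℝ) ≤ 2 by norm_num)
  have a2 := one_le_jap_rpow w (show (0 : ℝ) ≤ 2 by norm_num)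
  have a3 : 1 ≤ jap v ^ (2 : ℝ) * jap w ^ (2 : ℝ) :=
    one_le_mul_of_one_le_of_one_le a1 a2
  by_cases c1 : ‖v‖ + ‖w‖ ≤ ε⁻¹
  · by_cases c2 : 2 * ε ≤ ‖v - w‖
    · rw [h.eq_one w σ c1 c2 hx, sub_self, zero_mul]
      positivity
    · have : ‖v - w‖ ^ γ ≤ (2 * ε) ^ γ :=
        Real.rpow_le_rpow (norm_nonneg _) (not_le.1 c2).le hγ
      calc (1 - θ (w, σ)) * ‖v - w‖ ^ γ ≤ 1 * (2 * ε) ^ γ := by gcongr; linarith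
        _ ≤ 2 * (2 * ε) ^ γ * 1 := by linarith
        _ ≤ _ := by gcongr
  · rw [not_le, inv_lt_iff_one_lt_mul₀ hε] at c1
    have c2 : 1 ≤ (2 * ε) * (jap v * jap w) := by
      have b1 := norm_le_jap v
      have b2 := norm_le_jap w
      have b3 := jap_le_jap_mul_jap_left v w
      have b4 := jap_le_jap_mul_jap_right v w
      nlinarith
    have c3 : 1 ≤ (2 * ε) ^ γ * (jap v * jap w) := by
      refine c2.trans (mul_le_mul_of_nonneg_right ?_ (mul_nonneg (jap_nonneg v) (jap_nonneg w)))
      have := Real.rpow_le_rpow_of_exponent_ge (show 0 < 2 * ε by linarith) (by linarith) hγ1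
      rwa [Real.rpow_one] at this
    have c4 : ‖v - w‖ ^ γ ≤ 2 * (jap v * jap w) := by
      refine (norm_sub_rpow_le v w hγ).trans ?_
      rw [← Real.mul_rpow (jap_nonneg v) (jap_nonneg w)]
      have p1 : (2 : ℝ) ^ γ ≤ 2 := by
        simpa using Real.rpow_le_rpow_of_exponent_le (show (1 : ℝ) ≤ 2 by norm_num) hγ1
      have p2 : (jap v * jap w) ^ γ ≤ jap v * jap w := by
        simpa using Real.rpow_le_rpow_of_exponent_le (one_le_jap_mul_jap v w) hγ1
      have := one_le_jap_mul_jap v w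
      gcongr
    have hp : 0 ≤ jap v * jap w := mul_nonneg (jap_nonneg v) (jap_nonneg w)
    calc (1 - θ (w, σ)) * ‖v - w‖ ^ γ ≤ 1 * (2 * (jap v * jap w)) := by gcongr; linarith
      _ ≤ (2 * ε) ^ γ * (jap v * jap w) * (2 * (jap v * jap w)) := by gcongr
      _ = _ := by rw [Real.rpow_two, Real.rpow_two]; ring

theorem bCut_core_eq_zero {b : ℝ → ℝ} {δ x : ℝ} (hδ : 0 ≤ δ) (hx1 : x ≤ 1)
    (hx : x < 0 ∨ Real.cos δ < x) : bCut (core b) δ x = 0 := by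
  rcases hx with hx | hx
  · rw [bCut, core_of_neg hx, ite_self]
  · rw [bCut]
    split_ifs with h
    · rw [core]
      split_ifs with h'
      · have := Real.cos_le_cos_of_nonneg_of_le_pi hδ (Real.arccos_le_pi x) h
        rw [Real.cos_arccos (by linarith [h'.1]) hx1] at this
        exact absurd this (not_le.2 hx)
      · rfl
    · rfl

/-- The bracket of the dual remainder operator, with truncation factors. -/
def dualRem (θ₁ θ₂ θ₃ : Vel × Sph → ℝ) (φ : Vel → ℝ) (v : Vel) (z : Vel × Sph) : ℝ :=
  (1 - θ₁ z) * φ (post v z.1 z.2) + (1 - θ₂ z) * φ (postStar v z.1 z.2) - (1 - θ₃ z) * φ z.1 - φ v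

theorem measurable_dualRem {θ₁ θ₂ θ₃ : Vel × Sph → ℝ} (h₁ : Measurable θ₁) (h₂ : Measurable θ₂)
    (h₃ : Measurable θ₃) {φ : Vel → ℝ} (hφ : Measurable φ) (v : Vel) :
    Measurable (dualRem θ₁ θ₂ θ₃ φ v) :=
  (((measurable_const.sub h₁).mul (hφ.comp (measurable_post_right v))).add
    ((measurable_const.sub h₂).mul (hφ.comp (measurable_postStar_right v)))).sub
    ((measurable_const.sub h₃).mul (hφ.comp measurable_fst)) |>.sub_const _

theorem mul_le_of_abs_le {t x y : ℝ} (h0 : 0 ≤ t) (h1 : t ≤ 1) (h : |x| ≤ y) : |t * x| ≤ y := by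
  rw [abs_mul, abs_of_nonneg h0]
  exact (mul_le_of_le_one_left (abs_nonneg x) h1).trans h

theorem abs_dualRem_le {ε q : ℝ} {v : Vel} {θ₁ θ₂ θ₃ : Vel × Sph → ℝ} (h₁ : IsAlmostOne ε v θ₁)
    (h₂ : IsAlmostOne ε v θ₂) (h₃ : IsAlmostOne ε v θ₃) (hq : 0 ≤ q) {φ : Vel → ℝ}
    (hφ : ∀ y, |φ y| ≤ jap y ^ q) (w : Vel) (σ : Sph) :
    |dualRem θ₁ θ₂ θ₃ φ v (w, σ)| ≤ 4 * jap v ^ q * jap w ^ q := by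
  have e1 := mul_le_of_abs_le (t := 1 - θ₁ (w, σ)) (by linarith [h₁.le_one (w, σ)])
    (by linarith [h₁.nonneg (w, σ)]) (hφ (post v w σ))
  have e2 := mul_le_of_abs_le (t := 1 - θ₂ (w, σ)) (by linarith [h₂.le_one (w, σ)])
    (by linarith [h₂.nonneg (w, σ)]) (hφ (postStar v w σ))
  have e3 := mul_le_of_abs_le (t := 1 - θ₃ (w, σ)) (by linarith [h₃.le_one (w, σ)])
    (by linarith [h₃.nonneg (w, σ)]) (hφ w)
  have e4 := hφ v
  have f1 := jap_post_rpow_le v w σ hq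
  have f2 := jap_postStar_rpow_le v w σ hq
  have f3 := one_le_jap_rpow v hq
  have f4 := one_le_jap_rpow w hq
  have f5 : jap v ^ q ≤ jap v ^ q * jap w ^ q := le_mul_of_one_le_right (by linarith) f4
  have f6 : jap w ^ q ≤ jap v ^ q * jap w ^ q := le_mul_of_one_le_left (by linarith) f3
  rw [abs_le] at *
  simp only [dualRem]
  constructor <;> linarith

theorem dualRem_le {ε q : ℝ} {v : Vel} {θ₁ θ₂ θ₃ : Vel × Sph → ℝ} (h₁ : IsAlmostOne ε v θ₁)
    (h₂ : IsAlmostOne ε v θ₂) (h₃ : IsAlmostOne ε v θ₃) {φ : Vel → ℝ}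
    (hφ : ∀ y, |φ y| ≤ jap y ^ q) (hv : φ v = jap v ^ q) (w : Vel) (σ : Sph) :
    dualRem θ₁ θ₂ θ₃ φ v (w, σ) ≤
      jap (post v w σ) ^ q + jap (postStar v w σ) ^ q + jap w ^ q - jap v ^ q := by
  have e1 := mul_le_of_abs_le (t := 1 - θ₁ (w, σ)) (by linarith [h₁.le_one (w, σ)])
    (by linarith [h₁.nonneg (w, σ)]) (hφ (post v w σ))
  have e2 := mul_le_of_abs_le (t := 1 - θ₂ (w, σ)) (by linarith [h₂.le_one (w, σ)])
    (by linarith [h₂.nonneg (w, σ)]) (hφ (postStar v w σ))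
  have e3 := mul_le_of_abs_le (t := 1 - θ₃ (w, σ)) (by linarith [h₃.le_one (w, σ)])
    (by linarith [h₃.nonneg (w, σ)]) (hφ w)
  rw [abs_le] at *
  simp only [dualRem]
  linarith

/-- For small `ε` the truncated dual remainder is controlled by the collision frequency. -/
theorem IsAngularKernel.integral_dualRem_le {s cb : ℝ} {b : ℝ → ℝ} (hb : IsAngularKernel s cb b)
    (hs : 0 < s) (hs' : s < 1 / 2) (hcb : 0 < cb) {q γ : ℝ} (hq : 0 ≤ q) (hγ : 0 ≤ γ) (hγ1 : γ ≤ 1)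
    {δ : ℝ} (hδ : 0 < δ) (hδ1 : δ ≤ 1) {ε : ℝ} (hε : 0 < ε) (hε1 : 2 * ε ≤ 1 - Real.cos δ)
    {v : Vel} {θ₁ θ₂ θ₃ : Vel × Sph → ℝ} (h₁ : IsAlmostOne ε v θ₁)
    (h₂ : IsAlmostOne ε v θ₂) (h₃ : IsAlmostOne ε v θ₃) {φ : Vel → ℝ} (hφm : Measurable φ)
    (hφ : ∀ y, |φ y| ≤ jap y ^ q) (hv : φ v = jap v ^ q) :
    ∫ z, maxw z.1 * (‖v - z.1‖ ^ γ * bCut (core b) δ (cosDev v z.1 z.2)) *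
        dualRem θ₁ θ₂ θ₃ φ v z ∂collMeasure ≤
      6 * (2 * ε) ^ γ * (∫ w, maxw w * jap w ^ (q + 2)) * sphInt (bCut (core b) δ) *
        jap v ^ (q + 2) -
      (∫ w, maxw w * ‖v - w‖ ^ γ) * sphInt (bCut (core b) δ) * jap v ^ q := by
  have hβ := hb.cutoff_bCut hs hs' hcb hδ hδ1
  set β := bCut (core b) δ with hβdef
  have hint := hβ.integrable_of_le hγ v (measurable_dualRem h₁.measurable h₂.measurable
    h₃.measurable hφm v) (abs_dualRem_le h₁ h₂ h₃ hq hφ)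
  obtain ⟨j1, l1⟩ := hβ.int.collision hβ.measurable (integrable_maxw_mul_norm_sub hγ v) v
  obtain ⟨j2, l2⟩ := hβ.int.collision hβ.measurable (integrable_maxw_mul_jap (q + 2)) v
  set K := 6 * (2 * ε) ^ γ * jap v ^ (q + 2) with hK
  have hle : ∫ z, maxw z.1 * (‖v - z.1‖ ^ γ * β (cosDev v z.1 z.2)) *
        dualRem θ₁ θ₂ θ₃ φ v z ∂collMeasure ≤
      ∫ z : Vel × Sph, (K * (maxw z.1 * jap z.1 ^ (q + 2) * β (cosDev v z.1 z.2)) -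
        jap v ^ q * (maxw z.1 * ‖v - z.1‖ ^ γ * β (cosDev v z.1 z.2))) ∂collMeasure := by
    refine integral_mono hint ((j2.const_mul _).sub (j1.const_mul _)) ?_
    rintro ⟨w, σ⟩
    simp only
    set x := cosDev v w σ with hx
    by_cases hx0 : x < 0 ∨ Real.cos δ < x
    · rw [hβdef, bCut_core_eq_zero hδ.le (cosDev_le_one v w σ) hx0]
      simp
    push Not at hx0
    have hxε : |cosDev v w σ| ≤ 1 - 2 * ε := by
      rw [← hx, abs_of_nonneg hx0.1]; linarith [hx0.2]
    have hε2 : ε ≤ 1 / 2 := by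
      have := abs_nonneg (cosDev v w σ)
      linarith
    have m0 := (maxw_pos w).le
    have b0 := hβ.nonneg x
    have u0 := Real.rpow_nonneg (norm_nonneg (v - w)) γ
    set T := 2 * (2 * ε) ^ γ * (jap v ^ (2 : ℝ) * jap w ^ (2 : ℝ)) with hT
    have key : ∀ θ : Vel × Sph → ℝ, IsAlmostOne ε v θ → ∀ y Y : ℝ, |y| ≤ Y →
        Y ≤ jap v ^ q * jap w ^ q →
        |(1 - θ (w, σ)) * y * ‖v - w‖ ^ γ| ≤ T * (jap v ^ q * jap w ^ q) := by
      intro θ hθ y Y hy hY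
      have t0 : 0 ≤ 1 - θ (w, σ) := by linarith [hθ.le_one (w, σ)]
      have t1 := hθ.one_sub_mul_le hγ hγ1 hε hε2 w σ hxε
      rw [show (1 - θ (w, σ)) * y * ‖v - w‖ ^ γ = (1 - θ (w, σ)) * ‖v - w‖ ^ γ * y by ring,
        abs_mul, abs_of_nonneg (mul_nonneg t0 u0)]
      exact mul_le_mul t1 (hy.trans hY) (abs_nonneg _) ((mul_nonneg t0 u0).trans t1)
    have f3 := one_le_jap_rpow v hq
    have k1 := (abs_le.1 (key θ₁ h₁ _ _ (hφ (post v w σ)) (jap_post_rpow_le v w σ hq))).2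
    have k2 := (abs_le.1 (key θ₂ h₂ _ _ (hφ (postStar v w σ)) (jap_postStar_rpow_le v w σ hq))).2
    have k3 := (abs_le.1 (key θ₃ h₃ _ _ (hφ w)
      (le_mul_of_one_le_left (jap_rpow_pos w q).le f3))).1
    have e1 : ‖v - w‖ ^ γ * dualRem θ₁ θ₂ θ₃ φ v (w, σ) ≤
        3 * (T * (jap v ^ q * jap w ^ q)) - jap v ^ q * ‖v - w‖ ^ γ := by
      simp only [dualRem, hv]
      linarith
    calc _ = maxw w * β x * (‖v - w‖ ^ γ * dualRem θ₁ θ₂ θ₃ φ v (w, σ)) := by ring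
      _ ≤ maxw w * β x * (3 * (T * (jap v ^ q * jap w ^ q)) - jap v ^ q * ‖v - w‖ ^ γ) := by
        gcongr
      _ = _ := by
        rw [hT, hK, Real.rpow_add (jap_pos v), Real.rpow_add (jap_pos w)]; ring
  refine hle.trans_eq ?_
  rw [integral_sub (j2.const_mul _) (j1.const_mul _), integral_const_mul, integral_const_mul,
    l1, l2, hK]
  ring

end Boltzmann
end

noncomputable section
namespace Boltzmann

/-! ### Decay rate of the dual operator -/

/-- The bracket of the dual grazing operator. -/
def dualGraz (φ : Vel → ℝ) (v : Vel) (z : Vel × Sph) : ℝ :=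
  φ (post v z.1 z.2) - φ v + φ (postStar v z.1 z.2) - φ z.1

/-- The dual operator, with angular kernels `β` and `β'`. -/
def dualOp (γ : ℝ) (β β' : ℝ → ℝ) (θ₁ θ₂ θ₃ : Vel × Sph → ℝ) (φ : Vel → ℝ) (v : Vel) : ℝ :=
  ∫ z, maxw z.1 * (‖v - z.1‖ ^ γ * β (cosDev v z.1 z.2)) * dualGraz φ v z ∂collMeasure +
  ∫ z, maxw z.1 * (‖v - z.1‖ ^ γ * β' (cosDev v z.1 z.2)) *
    dualRem θ₁ θ₂ θ₃ φ v z ∂collMeasure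

theorem isAlmostOne_zero {v : Vel} : IsAlmostOne (-1) v 0 where
  measurable := measurable_const
  nonneg _ := le_rfl
  le_one _ := zero_le_one
  eq_one w σ h := by
    have := norm_nonneg v
    have := norm_nonneg w
    norm_num at h
    linarith

/-- The dual operator is bounded above at maximum points of `φ / ⟨v⟩^q`, and dissipative there when
the truncation parameter is small. -/
theorem IsAngularKernel.exists_dual_rate {s cb : ℝ} {b : ℝ → ℝ} (hb : IsAngularKernel s cb b)
    (hs : 0 < s) (hs' : s < 1 / 2) (hcb : 0 < cb) {q γ : ℝ} (hq : 2 < q) (hγ : 0 < γ)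
    (hγ1 : γ ≤ 1) :
    ∃ lam, 0 < lam ∧ ∃ δ₀, 0 < δ₀ ∧ δ₀ ≤ 1 ∧ ∀ δ, 0 < δ → δ < δ₀ →
      (∃ C, 0 ≤ C ∧ ∀ β, Cutoff β → (∀ x, β x ≤ bGraz (core b) δ x) → ∀ v φ, Measurable φ →
        (∀ y, |φ y| ≤ jap y ^ q) → φ v = jap v ^ q →
        dualOp γ β (bCut (core b) δ) 0 0 0 φ v ≤ C) ∧
      ∃ ε₀, 0 < ε₀ ∧ ∀ ε, 0 < ε → ε < ε₀ →
        ∀ β, Cutoff β → (∀ x, β x ≤ bGraz (core b) δ x) → ∀ v φ, Measurable φ →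
        (∀ y, |φ y| ≤ jap y ^ q) → φ v = jap v ^ q → ∀ θ₁ θ₂ θ₃, IsAlmostOne ε v θ₁ →
        IsAlmostOne ε v θ₂ → IsAlmostOne ε v θ₃ →
        dualOp γ β (bCut (core b) δ) θ₁ θ₂ θ₃ φ v ≤ -lam * jap v ^ q := by
  obtain ⟨C₁, hC₁, h₁⟩ := Cutoff.integral_dual_le (q := q) (γ := γ) (by linarith) hγ.le
  obtain ⟨C₂, hC₂, h₂⟩ := Cutoff.integral_cut_le hq hγ.le
  obtain ⟨c, hc, hc'⟩ := exists_integral_maxw_mul_norm_sub_ge hγ.le hγ1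
  obtain ⟨Λ, hΛ, hΛ'⟩ := hb.exists_sphInt_bCut_ge hs hs' hcb hq
  set lam := c * Λ / 8 with hlam
  have hlam0 : 0 < lam := by positivity
  have hev : ∀ᶠ δ in 𝓝[>] (0 : ℝ), C₁ * (sphInt fun x => bGraz (core b) δ x * hsin x) < lam := by
    have := (hb.tendsto_sphInt_bGraz hs hs' hcb).const_mul C₁
    rw [mul_zero] at this
    exact this.eventually (gt_mem_nhds hlam0)
  obtain ⟨δ₁, hδ₁, hδ₁'⟩ := (mem_nhdsGT_iff_exists_Ioo_subset.1 hev)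
  refine ⟨lam, hlam0, min δ₁ 1, lt_min hδ₁ one_pos, min_le_right _ _, fun δ hδ hδ' => ?_⟩
  have hδ1 : δ ≤ 1 := hδ'.le.trans (min_le_right _ _)
  have hsmall : C₁ * (sphInt fun x => bGraz (core b) δ x * hsin x) < lam :=
    hδ₁' ⟨hδ, hδ'.trans_le (min_le_left _ _)⟩
  have hB := hb.cutoff_bCut hs hs' hcb hδ hδ1
  set B := bCut (core b) δ with hBdef
  have hB0 : 0 ≤ sphInt B := sphInt_nonneg fun x _ _ => hB.nonneg x
  -- the grazing part
  have hgraz : ∀ β, Cutoff β → (∀ x, β x ≤ bGraz (core b) δ x) → ∀ v φ, Measurable φ →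
      (∀ y, |φ y| ≤ jap y ^ q) → φ v = jap v ^ q →
      ∫ z, maxw z.1 * (‖v - z.1‖ ^ γ * β (cosDev v z.1 z.2)) * dualGraz φ v z ∂collMeasure ≤
        lam * jap v ^ (q + γ) := by
    intro β hβ hle v φ hφ hφb hv
    refine (h₁ β hβ v φ hφ hφb hv).trans ?_
    have : sphInt (fun x => β x * hsin x) ≤ sphInt fun x => bGraz (core b) δ x * hsin x :=
      sphInt_mono hβ.mul_hsin.int (hb.sphIntegrable_bGraz_one hs hs' hcb δ) fun x _ _ =>
        mul_le_mul_of_nonneg_right (hle x) (hsin_nonneg x)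
    have h3 := jap_rpow_pos v (q + γ)
    refine mul_le_mul_of_nonneg_right ?_ h3.le
    exact (mul_le_mul_of_nonneg_left this hC₁).trans hsmall.le
  -- coercivity
  have hfreq : ∀ v, 8 * lam * jap v ^ γ ≤ (∫ w, maxw w * ‖v - w‖ ^ γ) *
      sphInt fun x => B x * (1 - hcos x ^ q - hsin x ^ q) := by
    intro v
    have h1 := hc' v
    have h2 := hΛ' δ hδ hδ1
    have h3 := jap_rpow_pos v γ
    calc 8 * lam * jap v ^ γ = (c * jap v ^ γ) * Λ := by rw [hlam]; ring
      _ ≤ _ := mul_le_mul h1 h2 hΛ.le ((by positivity : 0 ≤ c * jap v ^ γ).trans h1)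
  have hΛB : Λ ≤ sphInt B := by
    refine (hΛ' δ hδ hδ1).trans ?_
    have hpm : Measurable fun x => 1 - hcos x ^ q - hsin x ^ q :=
      (measurable_const.sub (measurable_hcos.pow_const q)).sub (measurable_hsin.pow_const q)
    have hp : ∀ x, -1 ≤ x → x ≤ 1 → B x * (1 - hcos x ^ q - hsin x ^ q) ≤ B x := fun x _ _ => by
      have h2 := Real.rpow_nonneg (hcos_nonneg x) q
      have h3 := Real.rpow_nonneg (hsin_nonneg x) q
      exact mul_le_of_le_one_right (hB.nonneg x) (by linarith)
    refine sphInt_mono (hB.int.mono (hB.measurable.mul hpm) fun x hx hx1 => ?_) hB.int hp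
    exact (abs_of_nonneg (mul_nonneg (hB.nonneg x)
      (one_sub_hcos_sub_hsin_nonneg hq hx hx1))).le.trans (hp x hx hx1)
  set K := C₂ * sphInt B with hK
  have hK0 : 0 ≤ K := by positivity
  set R := max 1 (K / lam) with hR
  have hR1 : 1 ≤ R := le_max_left _ _
  have hrem : ∀ (v : Vel) (F : Vel × Sph → ℝ) (D : ℝ), Measurable F →
      (∀ w σ, |F (w, σ)| ≤ D * jap w ^ q) →
      (∀ w σ, F (w, σ) ≤
        jap (post v w σ) ^ q + jap (postStar v w σ) ^ q + jap w ^ q - jap v ^ q) →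
      ∫ z, maxw z.1 * (‖v - z.1‖ ^ γ * B (cosDev v z.1 z.2)) * F z ∂collMeasure ≤
        -(8 * lam) * jap v ^ (q + γ) + K * jap v ^ (q - 1 + γ) := by
    intro v F D hF hFD hFle
    refine (h₂ B hB v F D hF hFD hFle).trans ?_
    have h3 := jap_rpow_pos v q
    have h4 := mul_le_mul_of_nonneg_right (hfreq v) h3.le
    have h5 : jap v ^ (q + γ) = jap v ^ q * jap v ^ γ := Real.rpow_add (jap_pos v) _ _
    rw [h5]
    linarith
  have hlarge : ∀ v, R ≤ jap v → K * jap v ^ (q - 1 + γ) ≤ lam * jap v ^ (q + γ) := by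
    intro v hv
    have h1 : K ≤ lam * jap v := by
      have := (le_max_right 1 (K / lam)).trans hv
      rwa [div_le_iff₀' hlam0] at this
    have h2 : jap v ^ (q + γ) = jap v * jap v ^ (q - 1 + γ) := by
      rw [← Real.rpow_one_add' (jap_nonneg v) (by linarith)]; congr 1; ring
    have h3 := jap_rpow_pos v (q - 1 + γ)
    rw [h2, ← mul_assoc]
    gcongr
  refine ⟨⟨K * R ^ (q - 1 + γ), by positivity, fun β hβ hle v φ hφ hφb hv => ?_⟩, ?_⟩
  · have h1 := hgraz β hβ hle v φ hφ hφb hv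
    have z := isAlmostOne_zero (v := v)
    have h2 := hrem v (dualRem 0 0 0 φ v) _ (measurable_dualRem measurable_const measurable_const
      measurable_const hφ v) (abs_dualRem_le z z z (by linarith) hφb) (dualRem_le z z z hφb hv)
    have h3 := jap_rpow_pos v (q + γ)
    have h4 : 0 < lam * jap v ^ (q + γ) := by positivity
    have h5 : 0 ≤ K * R ^ (q - 1 + γ) := by positivity
    rw [dualOp]
    rcases le_total R (jap v) with h | h
    · have := hlarge v h
      linarith
    · have : K * jap v ^ (q - 1 + γ) ≤ K * R ^ (q - 1 + γ) := by
        have := Real.rpow_le_rpow (jap_nonneg v) h (show 0 ≤ q - 1 + γ by linarith)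
        gcongr
      linarith
  · have hcos : 0 < 1 - Real.cos δ := by
      have := Real.cos_lt_cos_of_nonneg_of_le_pi le_rfl (by linarith [Real.pi_gt_three]) hδ
      rw [Real.cos_zero] at this
      linarith
    set M := ∫ w, maxw w * jap w ^ (q + 2) with hM
    have hM0 : 0 ≤ M := integral_nonneg fun w => mul_nonneg (maxw_pos w).le (jap_rpow_pos w _).le
    set N := 6 * M * sphInt B * R ^ (2 : ℝ) + 1 with hN
    have hN0 : 0 < N := by positivity
    refine ⟨min ((1 - Real.cos δ) / 2) ((lam / N) ^ γ⁻¹ / 2), by positivity, ?_⟩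
    intro ε hε hε' β hβ hle v φ hφ hφb hv θ₁ θ₂ θ₃ t₁ t₂ t₃
    have h1 := hgraz β hβ hle v φ hφ hφb hv
    have h3 := jap_rpow_pos v q
    have h3' := one_le_jap_rpow v hγ.le
    have h5 : jap v ^ (q + γ) = jap v ^ q * jap v ^ γ := Real.rpow_add (jap_pos v) _ _
    have h6 : jap v ^ q ≤ jap v ^ (q + γ) := by
      rw [h5]; exact le_mul_of_one_le_right h3.le h3'
    have h7 : lam * jap v ^ q ≤ lam * jap v ^ (q + γ) := by gcongr
    have h8 : 0 < lam * jap v ^ q := by positivity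
    rw [dualOp]
    rcases le_total R (jap v) with h | h
    · have h2 := hrem v (dualRem θ₁ θ₂ θ₃ φ v) _ (measurable_dualRem t₁.measurable t₂.measurable
        t₃.measurable hφ v) (abs_dualRem_le t₁ t₂ t₃ (by linarith) hφb)
        (dualRem_le t₁ t₂ t₃ hφb hv)
      have := hlarge v h
      linarith
    · have h2 := hb.integral_dualRem_le hs hs' hcb (by linarith : 0 ≤ q) hγ.le hγ1 hδ hδ1 hε
        (by linarith [hε'.trans_le (min_le_left _ _)]) t₁ t₂ t₃ hφ hφb hv
      have k1 : (2 * ε) ^ γ ≤ lam / N := by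
        have a1 : 2 * ε ≤ (lam / N) ^ γ⁻¹ := by linarith [hε'.trans_le (min_le_right _ _)]
        have a2 := Real.rpow_le_rpow (by positivity) a1 hγ.le
        rwa [← Real.rpow_mul (by positivity), inv_mul_cancel₀ hγ.ne', Real.rpow_one] at a2
      have k2 : jap v ^ (q + 2) ≤ jap v ^ q * R ^ (2 : ℝ) := by
        rw [Real.rpow_add (jap_pos v)]
        have := Real.rpow_le_rpow (jap_nonneg v) h (show (0 : ℝ) ≤ 2 by norm_num)
        gcongr
      have k2' := (jap_rpow_pos v (q + 2)).le
      have k3 : 6 * (2 * ε) ^ γ * M * sphInt B * jap v ^ (q + 2) ≤ lam * jap v ^ q := by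
        calc _ ≤ 6 * (lam / N) * M * sphInt B * (jap v ^ q * R ^ (2 : ℝ)) := by gcongr
          _ = (N - 1) / N * lam * jap v ^ q := by rw [hN]; ring
          _ ≤ 1 * lam * jap v ^ q := by
            gcongr
            rw [div_le_one hN0]; linarith
          _ = _ := by ring
      have k4 : 8 * lam * jap v ^ (q + γ) ≤
          (∫ w, maxw w * ‖v - w‖ ^ γ) * sphInt B * jap v ^ q := by
        rw [h5]
        calc 8 * lam * (jap v ^ q * jap v ^ γ) = (c * jap v ^ γ) * Λ * jap v ^ q := by
              rw [hlam]; ring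
          _ ≤ _ := by
              have a1 := hc' v
              have a2 : 0 ≤ c * jap v ^ γ := by positivity
              have := a2.trans a1
              gcongr
      linarith

end Boltzmann
end

noncomputable section
namespace Boltzmann

/-! ### Weak form of the collision operators -/

/-- Integrand of a collision operator with angular kernel `β`. -/
def gainLoss (γ : ℝ) (β : ℝ → ℝ) (f : Vel → ℝ) (v : Vel) (p : Vel × Sph) : ℝ :=
  (maxw (postStar v p.1 p.2) * f (post v p.1 p.2) - maxw p.1 * f v
    + f (postStar v p.1 p.2) * maxw (post v p.1 p.2) - f p.1 * maxw v)
    * β (cosDev v p.1 p.2) * ‖v - p.1‖ ^ γ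

/-- Integrand of a truncated collision operator with angular kernel `β`. -/
def truncGain (γ : ℝ) (β : ℝ → ℝ) (Θ : Vel → Vel → Sph → ℝ) (f : Vel → ℝ) (v : Vel)
    (p : Vel × Sph) : ℝ :=
  (1 - Θ v p.1 p.2)
    * (maxw (postStar v p.1 p.2) * f (post v p.1 p.2)
      + maxw (post v p.1 p.2) * f (postStar v p.1 p.2) - maxw v * f p.1)
    * β (cosDev v p.1 p.2) * ‖v - p.1‖ ^ γ

/-- Integrand of a collision frequency with angular kernel `β`. -/
def lossRate (γ : ℝ) (β : ℝ → ℝ) (v : Vel) (p : Vel × Sph) : ℝ :=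
  maxw p.1 * β (cosDev v p.1 p.2) * ‖v - p.1‖ ^ γ

/-- The factor `β(cos θ) |v - v_*|^γ`. -/
def collKernel (γ : ℝ) (β : ℝ → ℝ) (q : Vel × Vel × Sph) : ℝ :=
  ‖q.1 - q.2.1‖ ^ γ * β (cosDev q.1 q.2.1 q.2.2)

theorem measurable_collKernel (γ : ℝ) {β : ℝ → ℝ} (hβ : Measurable β) :
    Measurable (collKernel γ β) :=
  ((measurable_fst.sub (measurable_fst.comp measurable_snd)).norm.pow_const γ).mul
    (hβ.comp measurable_cosDev)

theorem collKernel_prePost {γ : ℝ} (hγ : 0 < γ) (β : ℝ → ℝ) (q : Vel × Vel × Sph) :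
    collKernel γ β (prePost q) = collKernel γ β q := by
  simp only [collKernel, prePost, norm_post_sub_postStar]
  by_cases h : q.1 = q.2.1
  · rw [h, sub_self, norm_zero, Real.zero_rpow hγ.ne', zero_mul, zero_mul]
  · rw [cosDev_prePost h]

theorem collKernel_exchange (γ : ℝ) (β : ℝ → ℝ) (q : Vel × Vel × Sph) :
    collKernel γ β (exchange q) = collKernel γ β q := by
  simp only [collKernel, exchange, cosDev_exchange, norm_sub_rev q.2.1 q.1]

theorem prePost_exchange (q : Vel × Vel × Sph) : prePost (exchange q) =
    (postStar q.1 q.2.1 q.2.2, post q.1 q.2.1 q.2.2, dir q.2.1 q.1) := by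
  simp only [prePost, exchange, post_exchange, postStar_exchange]

theorem integral_comp_of_measurePreserving {T : Vel × Vel × Sph → Vel × Vel × Sph}
    (hT : MeasurePreserving T phaseMeasure phaseMeasure) {F G : Vel × Vel × Sph → ℝ}
    (hF : Measurable F) (hFG : ∀ q, F (T q) = G q) (hG : Integrable G phaseMeasure) :
    Integrable F phaseMeasure ∧ ∫ q, F q ∂phaseMeasure = ∫ q, G q ∂phaseMeasure := by
  have e : F ∘ T = G := funext hFG
  constructor
  · rw [← e] at hG
    exact (hT.integrable_comp hF.aestronglyMeasurable).1 hG
  · have := integral_map hT.measurable.aemeasurable (f := F) (μ := phaseMeasure)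
      hF.aestronglyMeasurable
    rw [hT.map_eq] at this
    rw [this]
    exact integral_congr_ae (Eventually.of_forall hFG)

theorem Cutoff.integrable_phase {β : ℝ → ℝ} (hβ : Cutoff β) {γ m C D : ℝ} (hγ : 0 ≤ γ)
    {f : Vel → ℝ} (hf : Measurable f) (hfC : ∀ x, |f x| ≤ C * gauss (1 / 4) x)
    {Y : Vel × Vel × Sph → ℝ} (hY : Measurable Y)
    (hYD : ∀ q, |Y q| ≤ D * (jap q.1 ^ m * jap q.2.1 ^ m)) :
    Integrable (fun q : Vel × Vel × Sph => Y q * (maxw q.2.1 * f q.1 * collKernel γ β q))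
      phaseMeasure := by
  have hK : Integrable fun v => jap v ^ (m + γ) * gauss (1 / 4) v :=
    integrable_jap_rpow_mul_gauss _ (by norm_num)
  have hH : Integrable fun w => maxw w * jap w ^ (m + γ) := integrable_maxw_mul_jap _
  have h := (hβ.int.phase hβ.measurable hK hH).1.const_mul (D * C * 2 ^ γ)
  refine h.mono' ?_ (Eventually.of_forall fun q => ?_)
  · exact (hY.mul (((measurable_maxw.comp (measurable_fst.comp measurable_snd)).mul
      (hf.comp measurable_fst)).mul (measurable_collKernel γ hβ.measurable))).aestronglyMeasurable
  · have h1 := hYD q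
    have h2 := hfC q.1
    have h3 := norm_sub_rpow_le q.1 q.2.1 hγ
    have h4 := (maxw_pos q.2.1).le
    have h5 := hβ.nonneg (cosDev q.1 q.2.1 q.2.2)
    have h6 := Real.rpow_nonneg (norm_nonneg (q.1 - q.2.1)) γ
    rw [collKernel, norm_mul, norm_mul, norm_mul, Real.norm_eq_abs, Real.norm_eq_abs,
      Real.norm_eq_abs, Real.norm_eq_abs, abs_of_nonneg h4, abs_of_nonneg (mul_nonneg h6 h5)]
    have h7 := (abs_nonneg _).trans h1
    have h8 := (abs_nonneg _).trans h2
    calc |Y q| * (maxw q.2.1 * |f q.1| * (‖q.1 - q.2.1‖ ^ γ * β (cosDev q.1 q.2.1 q.2.2)))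
        ≤ D * (jap q.1 ^ m * jap q.2.1 ^ m) * (maxw q.2.1 * (C * gauss (1 / 4) q.1) *
          (2 ^ γ * (jap q.1 ^ γ * jap q.2.1 ^ γ) * β (cosDev q.1 q.2.1 q.2.2))) := by
          gcongr
      _ = _ := by
          rw [Real.rpow_add (jap_pos _), Real.rpow_add (jap_pos _)]; ring

/-- The truncation function before the collision. -/
def thetaPost (Θ : Vel → Vel → Sph → ℝ) (v : Vel) (z : Vel × Sph) : ℝ :=
  Θ (post v z.1 z.2) (postStar v z.1 z.2) (dir v z.1)

/-- The truncation function before the collision, for the exchanged pair. -/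
def thetaPostStar (Θ : Vel → Vel → Sph → ℝ) (v : Vel) (z : Vel × Sph) : ℝ :=
  Θ (postStar v z.1 z.2) (post v z.1 z.2) (dir z.1 v)

/-- The truncation function for the exchanged pair. -/
def thetaSwap (Θ : Vel → Vel → Sph → ℝ) (v : Vel) (z : Vel × Sph) : ℝ :=
  Θ z.1 v (antipode z.2)

section WeakForm

variable {γ m C D : ℝ} {β : ℝ → ℝ} {f φ : Vel → ℝ} {t : Vel × Vel × Sph → ℝ}

/-- The gain and loss terms in weak form. -/
theorem Cutoff.weak_terms (hβ : Cutoff β) (hγ : 0 < γ) (hm : 0 ≤ m) (hf : Measurable f)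
    (hfC : ∀ x, |f x| ≤ C * gauss (1 / 4) x) (hφ : Measurable φ)
    (hφD : ∀ y, |φ y| ≤ D * jap y ^ m) (ht : Measurable t) (ht1 : ∀ q, |t q| ≤ 1) :
    Integrable (fun q : Vel × Vel × Sph => φ q.1 * (t q * (maxw (postStar q.1 q.2.1 q.2.2) *
        f (post q.1 q.2.1 q.2.2) + maxw (post q.1 q.2.1 q.2.2) * f (postStar q.1 q.2.1 q.2.2) -
        maxw q.1 * f q.2.1) * collKernel γ β q)) phaseMeasure ∧
    Integrable (fun q : Vel × Vel × Sph => (t (prePost q) * φ (post q.1 q.2.1 q.2.2) +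
        t (prePost (exchange q)) * φ (postStar q.1 q.2.1 q.2.2) - t (exchange q) * φ q.2.1) *
        (maxw q.2.1 * f q.1 * collKernel γ β q)) phaseMeasure ∧
    ∫ q, φ q.1 * (t q * (maxw (postStar q.1 q.2.1 q.2.2) *
        f (post q.1 q.2.1 q.2.2) + maxw (post q.1 q.2.1 q.2.2) * f (postStar q.1 q.2.1 q.2.2) -
        maxw q.1 * f q.2.1) * collKernel γ β q) ∂phaseMeasure =
    ∫ q, (t (prePost q) * φ (post q.1 q.2.1 q.2.2) +
        t (prePost (exchange q)) * φ (postStar q.1 q.2.1 q.2.2) - t (exchange q) * φ q.2.1) *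
        (maxw q.2.1 * f q.1 * collKernel γ β q) ∂phaseMeasure := by
  have m1 : Measurable fun q : Vel × Vel × Sph => q.2.1 := measurable_fst.comp measurable_snd
  have mK := measurable_collKernel γ hβ.measurable
  have hD : 0 ≤ D := nonneg_of_mul_nonneg_left ((abs_nonneg _).trans (hφD 0)) (jap_rpow_pos 0 m)
  have mp := measurable_prePost
  have mx := measurePreserving_exchange.measurable
  have bound : ∀ (a y Y : ℝ) (q : Vel × Vel × Sph), |a| ≤ 1 → |y| ≤ D * Y →
      Y ≤ jap q.1 ^ m * jap q.2.1 ^ m → |a * y| ≤ D * (jap q.1 ^ m * jap q.2.1 ^ m) := by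
    intro a y Y q ha hy hY
    rw [abs_mul]
    calc |a| * |y| ≤ 1 * |y| := by gcongr
      _ ≤ D * Y := by rwa [one_mul]
      _ ≤ _ := by gcongr
  have g1 := hβ.integrable_phase (m := m) (D := D) hγ.le hf hfC
    (Y := fun q => t (prePost q) * φ (post q.1 q.2.1 q.2.2))
    ((ht.comp mp).mul (hφ.comp measurable_post)) fun q =>
      bound _ _ _ q (ht1 _) (hφD _) (jap_post_rpow_le q.1 q.2.1 q.2.2 hm)
  have g2 := hβ.integrable_phase (m := m) (D := D) hγ.le hf hfC
    (Y := fun q => t (prePost (exchange q)) * φ (postStar q.1 q.2.1 q.2.2))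
    ((ht.comp (mp.comp mx)).mul (hφ.comp measurable_postStar)) fun q =>
      bound _ _ _ q (ht1 _) (hφD _) (jap_postStar_rpow_le q.1 q.2.1 q.2.2 hm)
  have g3 := hβ.integrable_phase (m := m) (D := D) hγ.le hf hfC
    (Y := fun q => t (exchange q) * φ q.2.1)
    ((ht.comp mx).mul (hφ.comp m1)) fun q =>
      bound _ _ _ q (ht1 _) (hφD _) (le_mul_of_one_le_left (jap_rpow_pos _ m).le
        (one_le_jap_rpow q.1 hm))
  have f1 := integral_comp_of_measurePreserving measurePreserving_prePost
    (F := fun q => φ q.1 * t q * (maxw (postStar q.1 q.2.1 q.2.2) * f (post q.1 q.2.1 q.2.2)) *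
      collKernel γ β q)
    ((((hφ.comp measurable_fst).mul ht).mul ((measurable_maxw.comp measurable_postStar).mul
      (hf.comp measurable_post))).mul mK) (fun q => ?_) g1
  swap
  · simp only [collKernel_prePost hγ]
    simp only [prePost, post_prePost, postStar_prePost]
    ring
  have f2 := integral_comp_of_measurePreserving
    (measurePreserving_prePost.comp measurePreserving_exchange)
    (F := fun q => φ q.1 * t q * (maxw (post q.1 q.2.1 q.2.2) * f (postStar q.1 q.2.1 q.2.2)) *
      collKernel γ β q)
    ((((hφ.comp measurable_fst).mul ht).mul ((measurable_maxw.comp measurable_post).mul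
      (hf.comp measurable_postStar))).mul mK) (fun q => ?_) g2
  swap
  · simp only [Function.comp_apply, collKernel_prePost hγ, collKernel_exchange]
    simp only [prePost, post_prePost, postStar_prePost]
    simp only [exchange, post_exchange, postStar_exchange]
    ring
  have f3 := integral_comp_of_measurePreserving measurePreserving_exchange
    (F := fun q => φ q.1 * t q * (maxw q.1 * f q.2.1) * collKernel γ β q)
    ((((hφ.comp measurable_fst).mul ht).mul ((measurable_maxw.comp measurable_fst).mul
      (hf.comp m1))).mul mK) (fun q => ?_) g3
  swap
  · simp only [collKernel_exchange]
    simp only [exchange]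
    ring
  have e1 : (fun q : Vel × Vel × Sph => φ q.1 * (t q * (maxw (postStar q.1 q.2.1 q.2.2) *
        f (post q.1 q.2.1 q.2.2) + maxw (post q.1 q.2.1 q.2.2) * f (postStar q.1 q.2.1 q.2.2) -
        maxw q.1 * f q.2.1) * collKernel γ β q)) = fun q =>
      φ q.1 * t q * (maxw (postStar q.1 q.2.1 q.2.2) * f (post q.1 q.2.1 q.2.2)) *
        collKernel γ β q + φ q.1 * t q * (maxw (post q.1 q.2.1 q.2.2) *
        f (postStar q.1 q.2.1 q.2.2)) * collKernel γ β q -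
      φ q.1 * t q * (maxw q.1 * f q.2.1) * collKernel γ β q := by
    funext q; ring
  have e2 : (fun q : Vel × Vel × Sph => (t (prePost q) * φ (post q.1 q.2.1 q.2.2) +
        t (prePost (exchange q)) * φ (postStar q.1 q.2.1 q.2.2) - t (exchange q) * φ q.2.1) *
        (maxw q.2.1 * f q.1 * collKernel γ β q)) = fun q =>
      t (prePost q) * φ (post q.1 q.2.1 q.2.2) * (maxw q.2.1 * f q.1 * collKernel γ β q) +
      t (prePost (exchange q)) * φ (postStar q.1 q.2.1 q.2.2) *
        (maxw q.2.1 * f q.1 * collKernel γ β q) -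
      t (exchange q) * φ q.2.1 * (maxw q.2.1 * f q.1 * collKernel γ β q) := by
    funext q; ring
  rw [e1, e2]
  refine ⟨(f1.1.add f2.1).sub f3.1, (g1.add g2).sub g3, ?_⟩
  have a1 := integral_sub (f1.1.add f2.1) f3.1
  have a2 := integral_add f1.1 f2.1
  have b1 := integral_sub (g1.add g2) g3
  have b2 := integral_add g1 g2
  simp only [Pi.add_apply] at a1 a2 b1 b2
  rw [a1, a2, b1, b2, f1.2, f2.2, f3.2]

end WeakForm

end Boltzmann
end

noncomputable section
namespace Boltzmann

section WeakForm

variable {γ m C D : ℝ} {β β' : ℝ → ℝ} {f φ : Vel → ℝ} {Θ : Vel → Vel → Sph → ℝ}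

/-- The full collision integrand. -/
def collIntegrand (γ : ℝ) (β β' : ℝ → ℝ) (Θ : Vel → Vel → Sph → ℝ) (f : Vel → ℝ)
    (q : Vel × Vel × Sph) : ℝ :=
  gainLoss γ β f q.1 q.2 + truncGain γ β' Θ f q.1 q.2 - lossRate γ β' q.1 q.2 * f q.1

theorem Cutoff.weak_form (hβ : Cutoff β) (hβ' : Cutoff β') (hγ : 0 < γ) (hm : 0 ≤ m)
    (hf : Measurable f) (hfC : ∀ x, |f x| ≤ C * gauss (1 / 4) x) (hφ : Measurable φ)
    (hφD : ∀ y, |φ y| ≤ D * jap y ^ m)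
    (hΘ : Measurable fun q : Vel × Vel × Sph => Θ q.1 q.2.1 q.2.2) (hΘ0 : ∀ v w σ, 0 ≤ Θ v w σ)
    (hΘ1 : ∀ v w σ, Θ v w σ ≤ 1) :
    Integrable (fun q => φ q.1 * collIntegrand γ β β' Θ f q) phaseMeasure ∧
    Integrable (fun v => f v * dualOp γ β β' (thetaPost Θ v) (thetaPostStar Θ v) (thetaSwap Θ v)
      φ v) ∧
    ∫ q, φ q.1 * collIntegrand γ β β' Θ f q ∂phaseMeasure =
      ∫ v, f v * dualOp γ β β' (thetaPost Θ v) (thetaPostStar Θ v) (thetaSwap Θ v) φ v := by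
  obtain ⟨i1, j1, e1⟩ := hβ.weak_terms hγ hm hf hfC hφ hφD (t := fun _ => 1) measurable_const
    (fun _ => by simp)
  obtain ⟨i2, j2, e2⟩ := hβ'.weak_terms hγ hm hf hfC hφ hφD
    (t := fun q => 1 - Θ q.1 q.2.1 q.2.2) (measurable_const.sub hΘ)
    (fun q => abs_le.2 ⟨by linarith [hΘ1 q.1 q.2.1 q.2.2], by linarith [hΘ0 q.1 q.2.1 q.2.2]⟩)
  have hY : ∀ q : Vel × Vel × Sph, |φ q.1| ≤ D * (jap q.1 ^ m * jap q.2.1 ^ m) := fun q => by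
    have hD : 0 ≤ D := nonneg_of_mul_nonneg_left ((abs_nonneg _).trans (hφD 0)) (jap_rpow_pos 0 m)
    refine (hφD q.1).trans (mul_le_mul_of_nonneg_left ?_ hD)
    exact le_mul_of_one_le_right (jap_rpow_pos _ m).le (one_le_jap_rpow q.2.1 hm)
  have k1 := hβ.integrable_phase hγ.le hf hfC (hφ.comp measurable_fst) hY
  have k2 := hβ'.integrable_phase hγ.le hf hfC (hφ.comp measurable_fst) hY
  have d1 : (fun q => φ q.1 * collIntegrand γ β β' Θ f q) = fun q =>
      (φ q.1 * (1 * (maxw (postStar q.1 q.2.1 q.2.2) *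
        f (post q.1 q.2.1 q.2.2) + maxw (post q.1 q.2.1 q.2.2) * f (postStar q.1 q.2.1 q.2.2) -
        maxw q.1 * f q.2.1) * collKernel γ β q) -
      φ q.1 * (maxw q.2.1 * f q.1 * collKernel γ β q)) +
      (φ q.1 * ((1 - Θ q.1 q.2.1 q.2.2) * (maxw (postStar q.1 q.2.1 q.2.2) *
        f (post q.1 q.2.1 q.2.2) + maxw (post q.1 q.2.1 q.2.2) * f (postStar q.1 q.2.1 q.2.2) -
        maxw q.1 * f q.2.1) * collKernel γ β' q) -
      φ q.1 * (maxw q.2.1 * f q.1 * collKernel γ β' q)) := by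
    funext q
    simp only [collIntegrand, gainLoss, truncGain, lossRate, collKernel]
    ring
  have I := (i1.sub k1).add (i2.sub k2)
  have J1 : Integrable (fun q : Vel × Vel × Sph => f q.1 * (maxw q.2.1 * (‖q.1 - q.2.1‖ ^ γ *
      β (cosDev q.1 q.2.1 q.2.2)) * dualGraz φ q.1 q.2)) phaseMeasure := by
    refine (j1.sub k1).congr (Eventually.of_forall fun q => ?_)
    simp only [Pi.sub_apply, Function.comp_apply, dualGraz, collKernel]
    ring
  have J2 : Integrable (fun q : Vel × Vel × Sph => f q.1 * (maxw q.2.1 * (‖q.1 - q.2.1‖ ^ γ *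
      β' (cosDev q.1 q.2.1 q.2.2)) * dualRem (thetaPost Θ q.1) (thetaPostStar Θ q.1)
        (thetaSwap Θ q.1) φ q.1 q.2)) phaseMeasure := by
    refine (j2.sub k2).congr (Eventually.of_forall fun q => ?_)
    simp only [Pi.sub_apply, Function.comp_apply, dualRem, thetaPost, thetaPostStar, thetaSwap,
      collKernel, prePost_exchange]
    simp only [prePost, exchange]
    ring
  have hv : (fun v => ∫ z, (f v * (maxw z.1 * (‖v - z.1‖ ^ γ * β (cosDev v z.1 z.2)) *
      dualGraz φ v z) + f v * (maxw z.1 * (‖v - z.1‖ ^ γ * β' (cosDev v z.1 z.2)) *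
      dualRem (thetaPost Θ v) (thetaPostStar Θ v) (thetaSwap Θ v) φ v z)) ∂collMeasure)
      =ᵐ[volume] fun v => f v * dualOp γ β β' (thetaPost Θ v) (thetaPostStar Θ v) (thetaSwap Θ v)
        φ v := by
    filter_upwards [J1.prod_right_ae, J2.prod_right_ae] with v h1 h2
    rw [integral_add h1 h2, integral_const_mul, integral_const_mul, dualOp, mul_add]
  refine ⟨by rw [d1]; exact I, (J1.add J2).integral_prod_left.congr hv, ?_⟩
  rw [d1]
  have a1 := integral_add (i1.sub k1) (i2.sub k2)
  have a2 := integral_sub i1 k1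
  have a3 := integral_sub i2 k2
  simp only [Pi.sub_apply, Function.comp_apply] at a1 a2 a3
  rw [a1, a2, a3, e1, e2, ← integral_congr_ae hv]
  have b1 := integral_sub j1 k1
  have b2 := integral_sub j2 k2
  have b3 := integral_add J1 J2
  simp only [Function.comp_apply] at b1 b2
  rw [← b1, ← b2]
  have c := integral_prod _ (J1.add J2)
  simp only [Pi.add_apply] at c
  rw [← c]
  change _ = ∫ q, _ ∂phaseMeasure
  rw [integral_add J1 J2]
  congr 1
  · refine integral_congr_ae (Eventually.of_forall fun q => ?_)
    simp only [dualGraz, collKernel]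
    ring
  · refine integral_congr_ae (Eventually.of_forall fun q => ?_)
    simp only [dualRem, thetaPost, thetaPostStar, thetaSwap, collKernel, prePost_exchange]
    simp only [prePost, exchange]
    ring

end WeakForm

/-! ### The operators on test functions -/

/-- Kernels with an integrable singularity after multiplication by `sin (θ / 2)`. -/
structure Grazing (β : ℝ → ℝ) : Prop where
  measurable : Measurable β
  nonneg : ∀ x, 0 ≤ β x
  supp : ∀ x, x < 0 → β x = 0
  int : SphIntegrable fun x => β x * hsin x

theorem Cutoff.grazing {β : ℝ → ℝ} (h : Cutoff β) : Grazing β :=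
  ⟨h.measurable, h.nonneg, h.supp, h.mul_hsin.int⟩

/-- A rapidly decaying weight. -/
def decay (v : Vel) : ℝ := jap v ^ (2 : ℝ) * gauss (1 / 48) v

theorem decay_nonneg (v : Vel) : 0 ≤ decay v :=
  mul_nonneg (jap_rpow_pos v _).le (gauss_pos _ v).le

theorem integrable_jap_mul_decay (m : ℝ) : Integrable fun v => jap v ^ m * decay v := by
  refine (integrable_jap_rpow_mul_gauss (m + 2) (c := 1 / 48) (by norm_num)).congr
    (Eventually.of_forall fun v => ?_)
  simp only [decay, Real.rpow_add (jap_pos v)]; ring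

theorem integrable_decay : Integrable decay := by
  simpa using integrable_jap_mul_decay 0

theorem norm_sub_rpow_mul_gauss_le {p : ℝ} (hp : 0 ≤ p) (hp2 : p ≤ 2) (v w : Vel) :
    ‖v - w‖ ^ p * (gauss (1 / 48) v * gauss (1 / 48) w) ≤ 4 * (decay v * decay w) := by
  have h1 := norm_sub_rpow_le v w hp
  have h2 := jap_rpow_le_jap_rpow v hp2
  have h3 := jap_rpow_le_jap_rpow w hp2
  have h4 : (2 : ℝ) ^ p ≤ 4 := by
    have := Real.rpow_le_rpow_of_exponent_le (show (1 : ℝ) ≤ 2 by norm_num) hp2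
    rw [Real.rpow_two] at this; linarith
  have g1 := (gauss_pos (1 / 48) v).le
  have g2 := (gauss_pos (1 / 48) w).le
  have a1 := (jap_rpow_pos v p).le
  have a2 := (jap_rpow_pos w p).le
  have a3 := (jap_rpow_pos v 2).le
  calc ‖v - w‖ ^ p * (gauss (1 / 48) v * gauss (1 / 48) w)
      ≤ 4 * (jap v ^ (2 : ℝ) * jap w ^ (2 : ℝ)) * (gauss (1 / 48) v * gauss (1 / 48) w) := by
        refine mul_le_mul_of_nonneg_right (h1.trans ?_) (by positivity)
        gcongr
    _ = _ := by rw [decay, decay]; ring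

section Bounds

variable {γ C : ℝ} {β : ℝ → ℝ} {f : Vel → ℝ}

theorem GaussLip.abs_gainLoss_le (hf : GaussLip f C) (hβ : Grazing β) (hγ : 0 ≤ γ) (hγ1 : γ ≤ 1)
    (v w : Vel) (σ : Sph) :
    |gainLoss γ β f v (w, σ)| ≤ 64 * C * maxwConst * (decay v * (decay w *
      (β (cosDev v w σ) * hsin (cosDev v w σ)))) := by
  have hC := hf.nonneg
  have hM := maxwConst_pos
  by_cases hx : cosDev v w σ < 0
  · simp [gainLoss, hβ.supp _ hx]
  rw [not_lt] at hx
  have h1 := hf.bilinear gaussLip_maxw v w σ hx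
  have h2 := gaussLip_maxw.bilinear hf v w σ hx
  have h3 : |maxw (postStar v w σ) * f (post v w σ) - maxw w * f v
      + f (postStar v w σ) * maxw (post v w σ) - f w * maxw v| ≤ 16 * C * maxwConst *
        (‖v - w‖ * hsin (cosDev v w σ) * (gauss (1 / 48) v * gauss (1 / 48) w)) := by
    rw [abs_le] at *
    constructor <;> linarith
  have hs := hsin_nonneg (cosDev v w σ)
  have hb := hβ.nonneg (cosDev v w σ)
  have hu := Real.rpow_nonneg (norm_nonneg (v - w)) γ
  have hp : ‖v - w‖ ^ (1 + γ) = ‖v - w‖ * ‖v - w‖ ^ γ := by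
    rw [Real.rpow_add_of_nonneg (norm_nonneg _) zero_le_one hγ, Real.rpow_one]
  have h4 := norm_sub_rpow_mul_gauss_le (p := 1 + γ) (by linarith) (by linarith) v w
  rw [hp] at h4
  simp only [gainLoss]
  rw [abs_mul, abs_mul, abs_of_nonneg hb, abs_of_nonneg hu]
  calc _ ≤ 16 * C * maxwConst *
        (‖v - w‖ * hsin (cosDev v w σ) * (gauss (1 / 48) v * gauss (1 / 48) w)) *
        β (cosDev v w σ) * ‖v - w‖ ^ γ := by gcongr
    _ = 16 * C * maxwConst * (β (cosDev v w σ) * hsin (cosDev v w σ)) *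
        (‖v - w‖ * ‖v - w‖ ^ γ * (gauss (1 / 48) v * gauss (1 / 48) w)) := by ring
    _ ≤ 16 * C * maxwConst * (β (cosDev v w σ) * hsin (cosDev v w σ)) *
        (4 * (decay v * decay w)) := by gcongr
    _ = _ := by ring

theorem GaussLip.abs_truncGain_le (hf : GaussLip f C) (hβ : Cutoff β) (hγ : 0 ≤ γ) (hγ1 : γ ≤ 1)
    {Θ : Vel → Vel → Sph → ℝ} (hΘ0 : ∀ v w σ, 0 ≤ Θ v w σ) (hΘ1 : ∀ v w σ, Θ v w σ ≤ 1)
    (v w : Vel) (σ : Sph) :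
    |truncGain γ β Θ f v (w, σ)| ≤ 24 * C * maxwConst * (decay v * (decay w *
      β (cosDev v w σ))) := by
  have hC := hf.nonneg
  have hM := maxwConst_pos
  have ga : ∀ x, gauss (1 / 4) x ≤ gauss (1 / 48) x := gauss_anti (by norm_num)
  have g0 : ∀ x, 0 ≤ gauss (1 / 4) x := fun x => (gauss_pos _ x).le
  have key : ∀ x y, gauss (1 / 4) x * gauss (1 / 4) y = gauss (1 / 4) v * gauss (1 / 4) w →
      |maxw x * f y| ≤ 2 * C * maxwConst * (gauss (1 / 48) v * gauss (1 / 48) w) := by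
    intro x y h
    rw [abs_mul]
    calc |maxw x| * |f y| ≤ 2 * maxwConst * gauss (1 / 4) x * (C * gauss (1 / 4) y) :=
          mul_le_mul (gaussLip_maxw.bound x) (hf.bound y) (abs_nonneg _)
            (by have := g0 x; positivity)
      _ = 2 * C * maxwConst * (gauss (1 / 4) x * gauss (1 / 4) y) := by ring
      _ = 2 * C * maxwConst * (gauss (1 / 4) v * gauss (1 / 4) w) := by rw [h]
      _ ≤ _ := by
          have := ga v
          have := ga w
          have := g0 v
          have := g0 w
          have := (gauss_pos (1 / 48) v).le
          gcongr
  have e := maxw_mul_maxw_post v w σ (c := 1 / 4)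
  have k1 := key (postStar v w σ) (post v w σ) (by rw [mul_comm]; exact e)
  have k2 := key (post v w σ) (postStar v w σ) e
  have k3 := key v w rfl
  have h3 : |maxw (postStar v w σ) * f (post v w σ) + maxw (post v w σ) * f (postStar v w σ)
      - maxw v * f w| ≤ 6 * C * maxwConst * (gauss (1 / 48) v * gauss (1 / 48) w) := by
    rw [abs_le] at *
    constructor <;> linarith
  have hb := hβ.nonneg (cosDev v w σ)
  have hu := Real.rpow_nonneg (norm_nonneg (v - w)) γ
  have h4 := norm_sub_rpow_mul_gauss_le (p := γ) hγ (by linarith) v w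
  have ht : |1 - Θ v w σ| ≤ 1 :=
    abs_le.2 ⟨by linarith [hΘ1 v w σ], by linarith [hΘ0 v w σ]⟩
  simp only [truncGain]
  rw [abs_mul, abs_mul, abs_mul, abs_of_nonneg hb, abs_of_nonneg hu]
  have gg : 0 ≤ gauss (1 / 48) v * gauss (1 / 48) w :=
    mul_nonneg (gauss_pos _ v).le (gauss_pos _ w).le
  calc _ ≤ 1 * (6 * C * maxwConst * (gauss (1 / 48) v * gauss (1 / 48) w)) *
        β (cosDev v w σ) * ‖v - w‖ ^ γ := by gcongr
    _ = 6 * C * maxwConst * β (cosDev v w σ) *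
        (‖v - w‖ ^ γ * (gauss (1 / 48) v * gauss (1 / 48) w)) := by ring
    _ ≤ 6 * C * maxwConst * β (cosDev v w σ) * (4 * (decay v * decay w)) := by gcongr
    _ = _ := by ring

theorem measurable_gainLoss (hβ : Measurable β) (hf : Measurable f) :
    Measurable fun q : Vel × Vel × Sph => gainLoss γ β f q.1 q.2 := by
  have m1 : Measurable fun q : Vel × Vel × Sph => q.2.1 := measurable_fst.comp measurable_snd
  exact (((((measurable_maxw.comp measurable_postStar).mul (hf.comp measurable_post)).sub
    ((measurable_maxw.comp m1).mul (hf.comp measurable_fst))).add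
    ((hf.comp measurable_postStar).mul (measurable_maxw.comp measurable_post))).sub
    ((hf.comp m1).mul (measurable_maxw.comp measurable_fst))).mul
    (hβ.comp measurable_cosDev) |>.mul ((measurable_fst.sub m1).norm.pow_const γ)

theorem measurable_truncGain (hβ : Measurable β) (hf : Measurable f) {Θ : Vel → Vel → Sph → ℝ}
    (hΘ : Measurable fun q : Vel × Vel × Sph => Θ q.1 q.2.1 q.2.2) :
    Measurable fun q : Vel × Vel × Sph => truncGain γ β Θ f q.1 q.2 := by
  have m1 : Measurable fun q : Vel × Vel × Sph => q.2.1 := measurable_fst.comp measurable_snd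
  exact ((measurable_const.sub hΘ).mul
    ((((measurable_maxw.comp measurable_postStar).mul (hf.comp measurable_post)).add
    ((measurable_maxw.comp measurable_post).mul (hf.comp measurable_postStar))).sub
    ((measurable_maxw.comp measurable_fst).mul (hf.comp m1)))).mul
    (hβ.comp measurable_cosDev) |>.mul ((measurable_fst.sub m1).norm.pow_const γ)

theorem measurable_lossRate (hβ : Measurable β) :
    Measurable fun q : Vel × Vel × Sph => lossRate γ β q.1 q.2 := by
  have m1 : Measurable fun q : Vel × Vel × Sph => q.2.1 := measurable_fst.comp measurable_snd
  exact ((measurable_maxw.comp m1).mul (hβ.comp measurable_cosDev)).mul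
    ((measurable_fst.sub m1).norm.pow_const γ)

theorem GaussLip.integrable_gainLoss (hf : GaussLip f C) (hfm : Measurable f) (hβ : Grazing β)
    (hγ : 0 ≤ γ) (hγ1 : γ ≤ 1) (v : Vel) : Integrable (gainLoss γ β f v) collMeasure := by
  have h := (hβ.int.collision (hβ.measurable.mul measurable_hsin) integrable_decay v).1.const_mul
    (64 * C * maxwConst * decay v)
  refine h.mono' ((measurable_gainLoss hβ.measurable hfm).comp
    measurable_prodMk_left).aestronglyMeasurable (Eventually.of_forall fun z => ?_)
  refine (hf.abs_gainLoss_le hβ hγ hγ1 v z.1 z.2).trans_eq ?_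
  ring

theorem GaussLip.integrable_truncGain (hf : GaussLip f C) (hfm : Measurable f) (hβ : Cutoff β)
    (hγ : 0 ≤ γ) (hγ1 : γ ≤ 1) {Θ : Vel → Vel → Sph → ℝ}
    (hΘ : Measurable fun q : Vel × Vel × Sph => Θ q.1 q.2.1 q.2.2)
    (hΘ0 : ∀ v w σ, 0 ≤ Θ v w σ) (hΘ1 : ∀ v w σ, Θ v w σ ≤ 1) (v : Vel) :
    Integrable (truncGain γ β Θ f v) collMeasure := by
  have h := (hβ.int.collision hβ.measurable integrable_decay v).1.const_mul
    (24 * C * maxwConst * decay v)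
  refine h.mono' ((measurable_truncGain hβ.measurable hfm hΘ).comp
    measurable_prodMk_left).aestronglyMeasurable (Eventually.of_forall fun z => ?_)
  refine (hf.abs_truncGain_le hβ hγ hγ1 hΘ0 hΘ1 v z.1 z.2).trans_eq ?_
  ring

theorem Cutoff.integrable_lossRate (hβ : Cutoff β) (hγ : 0 ≤ γ) (v : Vel) :
    Integrable (lossRate γ β v) collMeasure := by
  refine (hβ.int.collision hβ.measurable (integrable_maxw_mul_norm_sub hγ v) v).1.congr
    (Eventually.of_forall fun z => ?_)
  simp only [lossRate]
  ring

theorem GaussLip.integrable_phase_gainLoss (hf : GaussLip f C) (hfm : Measurable f)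
    (hβ : Grazing β) (hγ : 0 ≤ γ) (hγ1 : γ ≤ 1) {φ : Vel → ℝ} (hφ : Measurable φ) {D m : ℝ}
    (hφD : ∀ y, |φ y| ≤ D * jap y ^ m) {κ : ℝ → ℝ} (hκ : Grazing κ) (hle : ∀ x, κ x ≤ β x) :
    (∀ q : Vel × Vel × Sph, ‖φ q.1 * gainLoss γ κ f q.1 q.2‖ ≤ D * (64 * C * maxwConst) *
      (jap q.1 ^ m * decay q.1 * (decay q.2.1 * (β (cosDev q.1 q.2.1 q.2.2) *
        hsin (cosDev q.1 q.2.1 q.2.2))))) ∧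
    Integrable (fun q : Vel × Vel × Sph => D * (64 * C * maxwConst) *
      (jap q.1 ^ m * decay q.1 * (decay q.2.1 * (β (cosDev q.1 q.2.1 q.2.2) *
        hsin (cosDev q.1 q.2.1 q.2.2))))) phaseMeasure ∧
    Integrable (fun q : Vel × Vel × Sph => φ q.1 * gainLoss γ κ f q.1 q.2) phaseMeasure := by
  have hC := hf.nonneg
  have hM := maxwConst_pos
  have h1 : ∀ q : Vel × Vel × Sph, ‖φ q.1 * gainLoss γ κ f q.1 q.2‖ ≤ D * (64 * C * maxwConst) *
      (jap q.1 ^ m * decay q.1 * (decay q.2.1 * (β (cosDev q.1 q.2.1 q.2.2) *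
        hsin (cosDev q.1 q.2.1 q.2.2)))) := by
    intro q
    have a1 := hφD q.1
    have a2 := hf.abs_gainLoss_le hκ hγ hγ1 q.1 q.2.1 q.2.2
    have a3 := (abs_nonneg _).trans a1
    have a4 := decay_nonneg q.1
    have a5 := decay_nonneg q.2.1
    have a6 := hsin_nonneg (cosDev q.1 q.2.1 q.2.2)
    have a7 := hle (cosDev q.1 q.2.1 q.2.2)
    rw [norm_mul, Real.norm_eq_abs, Real.norm_eq_abs]
    calc _ ≤ D * jap q.1 ^ m * (64 * C * maxwConst * (decay q.1 * (decay q.2.1 *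
          (κ (cosDev q.1 q.2.1 q.2.2) * hsin (cosDev q.1 q.2.1 q.2.2))))) :=
          mul_le_mul a1 a2 (abs_nonneg _) a3
      _ ≤ D * jap q.1 ^ m * (64 * C * maxwConst * (decay q.1 * (decay q.2.1 *
          (β (cosDev q.1 q.2.1 q.2.2) * hsin (cosDev q.1 q.2.1 q.2.2))))) := by gcongr
      _ = _ := by ring
  have h2 := (hβ.int.phase (hβ.measurable.mul measurable_hsin) (integrable_jap_mul_decay m)
    integrable_decay).1.const_mul (D * (64 * C * maxwConst))
  exact ⟨h1, h2, h2.mono' ((hφ.comp measurable_fst).mul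
    (measurable_gainLoss hκ.measurable hfm)).aestronglyMeasurable (Eventually.of_forall h1)⟩

end Bounds

end Boltzmann
end

noncomputable section
namespace Boltzmann

/-! ### The weighted space -/

section Weighted

variable {k : ℝ}

theorem measurable_weight (k : ℝ) : Measurable fun v => ENNReal.ofReal (jap v ^ k) :=
  (measurable_jap.pow_const k).ennreal_ofReal

theorem ae_wMeasure {p : Vel → Prop} : (∀ᵐ v ∂wMeasure k, p v) ↔ ∀ᵐ v, p v := by
  rw [wMeasure, ae_withDensity_iff (measurable_weight k)]
  have : ∀ v, ENNReal.ofReal (jap v ^ k) ≠ 0 := fun v => by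
    simpa using jap_rpow_pos v k
  simp [this]

theorem aestronglyMeasurable_wMeasure {f : Vel → ℝ} :
    AEStronglyMeasurable f (wMeasure k) ↔ AEStronglyMeasurable f := by
  have h1 : wMeasure k ≪ volume := withDensity_absolutelyContinuous _ _
  have h2 : (volume : Measure Vel) ≪ wMeasure k := fun s hs => by
    have : ∀ᵐ v ∂wMeasure k, v ∉ s := measure_eq_zero_iff_ae_notMem.1 hs
    exact measure_eq_zero_iff_ae_notMem.2 (ae_wMeasure.1 this)
  exact ⟨fun h => h.mono_ac h2, fun h => h.mono_ac h1⟩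

theorem integrable_wMeasure {f : Vel → ℝ} :
    Integrable f (wMeasure k) ↔ Integrable fun v => f v * jap v ^ k := by
  rw [wMeasure, integrable_withDensity_iff_integrable_smul' (measurable_weight k) (by simp)]
  simp only [ENNReal.toReal_ofReal (jap_rpow_pos _ k).le, smul_eq_mul, mul_comm]

theorem integral_wMeasure (f : Vel → ℝ) :
    ∫ v, f v ∂wMeasure k = ∫ v, f v * jap v ^ k := by
  rw [wMeasure, integral_withDensity_eq_integral_toReal_smul (measurable_weight k) (by simp)]
  simp only [ENNReal.toReal_ofReal (jap_rpow_pos _ k).le, smul_eq_mul, mul_comm]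

theorem L1w.norm_eq {F : L1w k} {f : Vel → ℝ} (h : F =ᵐ[wMeasure k] f) :
    ‖F‖ = ∫ v, |f v| * jap v ^ k := by
  rw [L1.norm_eq_integral_norm, ← integral_wMeasure fun v => |f v|]
  refine integral_congr_ae ?_
  filter_upwards [h] with v hv
  rw [hv, Real.norm_eq_abs]

theorem integrable_mul_of_le {φ f : Vel → ℝ} {D : ℝ} (hφ : Measurable φ)
    (hφD : ∀ y, |φ y| ≤ D * jap y ^ k) (hf : Integrable fun v => f v * jap v ^ k) :
    Integrable fun v => φ v * f v := by
  have h1 : AEStronglyMeasurable f :=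
    aestronglyMeasurable_wMeasure.1 (integrable_wMeasure.2 hf).aestronglyMeasurable
  refine (hf.abs.const_mul D).mono' (hφ.aestronglyMeasurable.mul h1)
    (Eventually.of_forall fun v => ?_)
  rw [norm_mul, Real.norm_eq_abs, Real.norm_eq_abs, abs_mul, abs_of_pos (jap_rpow_pos v k)]
  have := mul_le_mul_of_nonneg_right (hφD v) (abs_nonneg (f v))
  linarith

end Weighted

/-! ### The operator on test functions -/

theorem hsin_one : hsin 1 = 0 := by simp [hsin]

theorem gainLoss_of_cosDev_eq_one {γ : ℝ} {β : ℝ → ℝ} {f : Vel → ℝ} {v w : Vel} {σ : Sph}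
    (h : cosDev v w σ = 1) : gainLoss γ β f v (w, σ) = 0 := by
  have h1 : post v w σ = v := by
    have := norm_post_sub v w σ
    rwa [h, hsin_one, mul_zero, norm_eq_zero, sub_eq_zero] at this
  have h2 : postStar v w σ = w := by
    have := norm_postStar_sub v w σ
    rwa [h, hsin_one, mul_zero, norm_eq_zero, sub_eq_zero] at this
  simp only [gainLoss, h1, h2]
  ring

section Operator

variable {s cb γ k : ℝ} {b : ℝ → ℝ} {δ : ℝ} {f : Vel → ℝ} {Θ : Vel → Vel → Sph → ℝ}

theorem grazIntegrand_eq (hb : ∀ x, x < 0 → b x = 0) (v : Vel) :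
    grazIntegrand b γ δ f v = gainLoss γ (bGraz (core b) δ) f v := by
  funext z
  rcases (cosDev_le_one v z.1 z.2).lt_or_eq with h | h
  · rw [grazIntegrand, gainLoss, bGraz_core hb h]
  · rw [show gainLoss γ (bGraz (core b) δ) f v z = 0 from gainLoss_of_cosDev_eq_one h]
    exact gainLoss_of_cosDev_eq_one (γ := γ) (β := bGraz b δ) (f := f) h

theorem remIntegrand_eq (hb : ∀ x, x < 0 → b x = 0) (hδ : 0 < δ) (v : Vel) :
    remIntegrand b γ δ Θ f v = truncGain γ (bCut (core b) δ) Θ f v := by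
  funext z
  rw [remIntegrand, truncGain, bCut_core hb hδ]

theorem freqIntegrand_eq (hb : ∀ x, x < 0 → b x = 0) (hδ : 0 < δ) (v : Vel) :
    freqIntegrand b γ δ v = lossRate γ (bCut (core b) δ) v := by
  funext z
  rw [freqIntegrand, lossRate, bCut_core hb hδ]

theorem BOp_eq (hb : ∀ x, x < 0 → b x = 0) (hδ : 0 < δ) (v : Vel) :
    BOp b γ δ Θ f v = ∫ z, gainLoss γ (bGraz (core b) δ) f v z ∂collMeasure +
      ∫ z, truncGain γ (bCut (core b) δ) Θ f v z ∂collMeasure -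
      (∫ z, lossRate γ (bCut (core b) δ) v z ∂collMeasure) * f v := by
  simp only [BOp, grazOp, remOp, freq, grazIntegrand_eq hb, remIntegrand_eq hb hδ,
    freqIntegrand_eq hb hδ]

theorem IsAngularKernel.grazing (hb : IsAngularKernel s cb b) (hs : 0 < s) (hs' : s < 1 / 2)
    (hcb : 0 < cb) (δ : ℝ) : Grazing (bGraz (core b) δ) where
  measurable := measurable_bGraz (measurable_core hb.measurable) δ
  nonneg := hb.bGraz_core_nonneg hcb δ
  supp x hx := by rw [bGraz, core_of_neg hx, ite_self]
  int := hb.sphIntegrable_bGraz_one hs hs' hcb δ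

theorem Cutoff.abs_integral_lossRate_le {β : ℝ → ℝ} (hβ : Cutoff β) (hγ : 0 ≤ γ) :
    ∃ K, 0 ≤ K ∧ ∀ v, |∫ z, lossRate γ β v z ∂collMeasure| ≤ K * jap v ^ γ := by
  have hI : 0 ≤ ∫ w, maxw w * jap w ^ γ :=
    integral_nonneg fun w => mul_nonneg (maxw_pos w).le (jap_rpow_pos w _).le
  have hB : 0 ≤ sphInt β := sphInt_nonneg fun x _ _ => hβ.nonneg x
  refine ⟨2 ^ γ * (∫ w, maxw w * jap w ^ γ) * sphInt β, by positivity, fun v => ?_⟩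
  have h := (hβ.weighted hγ (fun w => (maxw_pos w).le) measurable_maxw
    (integrable_maxw_mul_jap γ) v).2
  rw [abs_of_nonneg]
  · refine le_trans (le_of_eq ?_) h
    refine integral_congr_ae (Eventually.of_forall fun z => ?_)
    simp only [lossRate]; ring
  · exact integral_nonneg fun z => mul_nonneg (mul_nonneg (maxw_pos _).le (hβ.nonneg _))
      (Real.rpow_nonneg (norm_nonneg _) _)

/-- The standing assumptions on the collision operator and on its truncation. -/
structure OperatorData (s cb γ : ℝ) (b : ℝ → ℝ) (δ : ℝ) (Θ : Vel → Vel → Sph → ℝ) : Prop where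
  kernel : IsAngularKernel s cb b
  s_pos : 0 < s
  s_lt : s < 1 / 2
  cb_pos : 0 < cb
  γ_pos : 0 < γ
  γ_le : γ ≤ 1
  δ_pos : 0 < δ
  δ_le : δ ≤ 1
  meas : Measurable fun q : Vel × Vel × Sph => Θ q.1 q.2.1 q.2.2
  nonneg : ∀ v w σ, 0 ≤ Θ v w σ
  le_one : ∀ v w σ, Θ v w σ ≤ 1

namespace OperatorData

theorem cutoff (h : OperatorData s cb γ b δ Θ) : Cutoff (bCut (core b) δ) :=
  h.kernel.cutoff_bCut h.s_pos h.s_lt h.cb_pos h.δ_pos h.δ_le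

theorem grazing (h : OperatorData s cb γ b δ Θ) : Grazing (bGraz (core b) δ) :=
  h.kernel.grazing h.s_pos h.s_lt h.cb_pos δ

theorem cutoff_trunc (h : OperatorData s cb γ b δ Θ) (n : ℕ) : Cutoff (grazTrunc b δ n) :=
  h.kernel.cutoff_grazTrunc h.s_pos h.s_lt h.cb_pos δ n

theorem trunc_le (h : OperatorData s cb γ b δ Θ) (n : ℕ) (x : ℝ) : grazTrunc b δ n x ≤ bGraz (core b) δ x :=
  h.kernel.grazTrunc_le h.cb_pos δ n x

end OperatorData

end Operator

end Boltzmann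
end

noncomputable section
namespace Boltzmann

section Operator

variable {s cb γ k C : ℝ} {b : ℝ → ℝ} {δ : ℝ} {f : Vel → ℝ} {Θ : Vel → Vel → Sph → ℝ}

namespace OperatorData

theorem stronglyMeasurable_BOp (h : OperatorData s cb γ b δ Θ) (hf : Measurable f) :
    Measurable (BOp b γ δ Θ f) := by
  have e : BOp b γ δ Θ f = fun v => ∫ z, gainLoss γ (bGraz (core b) δ) f v z ∂collMeasure +
      ∫ z, truncGain γ (bCut (core b) δ) Θ f v z ∂collMeasure -
      (∫ z, lossRate γ (bCut (core b) δ) v z ∂collMeasure) * f v :=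
    funext (BOp_eq h.kernel.supp h.δ_pos)
  rw [e]
  have m1 := (measurable_gainLoss (γ := γ) h.grazing.measurable hf).stronglyMeasurable
  have m2 := (measurable_truncGain (γ := γ) h.cutoff.measurable hf h.meas).stronglyMeasurable
  have m3 := (measurable_lossRate (γ := γ) h.cutoff.measurable).stronglyMeasurable
  exact ((m1.integral_prod_right (ν := collMeasure)).measurable.add
    (m2.integral_prod_right (ν := collMeasure)).measurable).sub
    ((m3.integral_prod_right (ν := collMeasure)).measurable.mul hf)

theorem exists_abs_BOp_le (h : OperatorData s cb γ b δ Θ) (hf : GaussLip f C) (hfm : Measurable f) :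
    ∃ K, ∀ v, |BOp b γ δ Θ f v| ≤ K * decay v := by
  have hγ := h.γ_pos.le
  obtain ⟨K, hK, hK'⟩ := h.cutoff.abs_integral_lossRate_le hγ
  have hC := hf.nonneg
  refine ⟨64 * C * maxwConst * ((∫ w, decay w) * sphInt fun x => bGraz (core b) δ x * hsin x) +
    24 * C * maxwConst * ((∫ w, decay w) * sphInt (bCut (core b) δ)) + K * C, fun v => ?_⟩
  rw [BOp_eq h.kernel.supp h.δ_pos]
  have a1 : |∫ z, gainLoss γ (bGraz (core b) δ) f v z ∂collMeasure| ≤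
      64 * C * maxwConst * ((∫ w, decay w) * sphInt fun x => bGraz (core b) δ x * hsin x) *
        decay v := by
    have := (h.grazing.int.dominated (h.grazing.measurable.mul measurable_hsin)
      (integrable_decay.const_mul (64 * C * maxwConst * decay v))
      (hf.integrable_gainLoss hfm h.grazing hγ h.γ_le v).aestronglyMeasurable
      (fun w σ => (hf.abs_gainLoss_le h.grazing hγ h.γ_le v w σ).trans_eq (by ring))).2
    rw [integral_const_mul] at this
    refine this.trans_eq ?_
    ring
  have a2 : |∫ z, truncGain γ (bCut (core b) δ) Θ f v z ∂collMeasure| ≤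
      24 * C * maxwConst * ((∫ w, decay w) * sphInt (bCut (core b) δ)) * decay v := by
    have := (h.cutoff.int.dominated h.cutoff.measurable
      (integrable_decay.const_mul (24 * C * maxwConst * decay v))
      (hf.integrable_truncGain hfm h.cutoff hγ h.γ_le h.meas h.nonneg h.le_one v).aestronglyMeasurable
      (fun w σ => (hf.abs_truncGain_le h.cutoff hγ h.γ_le h.nonneg h.le_one v w σ).trans_eq
        (by ring))).2
    rw [integral_const_mul] at this
    refine this.trans_eq ?_
    ring
  have a3 : |(∫ z, lossRate γ (bCut (core b) δ) v z ∂collMeasure) * f v| ≤ K * C * decay v := by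
    rw [abs_mul]
    have b1 := hf.bound v
    have b2 := gauss_anti (show (1 / 48 : ℝ) ≤ 1 / 4 by norm_num) v
    have b3 := jap_rpow_le_jap_rpow v (show γ ≤ 2 by linarith [h.γ_le])
    have b4 := (gauss_pos (1 / 4) v).le
    have b5 := (jap_rpow_pos v γ).le
    have b6 := (jap_rpow_pos v 2).le
    calc _ ≤ K * jap v ^ γ * (C * gauss (1 / 4) v) :=
          mul_le_mul (hK' v) b1 (abs_nonneg _) (by positivity)
      _ ≤ K * jap v ^ (2 : ℝ) * (C * gauss (1 / 48) v) := by gcongr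
      _ = _ := by rw [decay]; ring
  rw [abs_le] at *
  constructor <;> linarith

theorem integrable_BOp (h : OperatorData s cb γ b δ Θ) (hf : GaussLip f C) (hfm : Measurable f)
    (m : ℝ) : Integrable fun v => BOp b γ δ Θ f v * jap v ^ m := by
  obtain ⟨K, hK⟩ := h.exists_abs_BOp_le hf hfm
  refine ((integrable_jap_mul_decay m).const_mul K).mono'
    ((h.stronglyMeasurable_BOp hfm).mul (measurable_jap.pow_const m)).aestronglyMeasurable
    (Eventually.of_forall fun v => ?_)
  have := jap_rpow_pos v m
  rw [norm_mul, Real.norm_eq_abs, Real.norm_of_nonneg this.le]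
  calc _ ≤ K * decay v * jap v ^ m := mul_le_mul_of_nonneg_right (hK v) this.le
    _ = _ := by ring

theorem memLp_BOp (h : OperatorData s cb γ b δ Θ) (hf : GaussLip f C) (hfm : Measurable f) :
    MemLp (BOp b γ δ Θ f) 1 (wMeasure k) :=
  memLp_one_iff_integrable.2 (integrable_wMeasure.2 (h.integrable_BOp hf hfm k))

theorem integrable_integrands (h : OperatorData s cb γ b δ Θ) (hf : GaussLip f C)
    (hfm : Measurable f) (v : Vel) : Integrable (grazIntegrand b γ δ f v) collMeasure ∧
      Integrable (remIntegrand b γ δ Θ f v) collMeasure ∧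
      Integrable (freqIntegrand b γ δ v) collMeasure := by
  rw [grazIntegrand_eq h.kernel.supp, remIntegrand_eq h.kernel.supp h.δ_pos,
    freqIntegrand_eq h.kernel.supp h.δ_pos]
  exact ⟨hf.integrable_gainLoss hfm h.grazing h.γ_pos.le h.γ_le v,
    hf.integrable_truncGain hfm h.cutoff h.γ_pos.le h.γ_le h.meas h.nonneg h.le_one v,
    h.cutoff.integrable_lossRate h.γ_pos.le v⟩

/-- The weak form of the collision operator, as a limit over angular truncations. -/
theorem tendsto_dualOp (h : OperatorData s cb γ b δ Θ) (hf : GaussLip f C) (hfm : Measurable f)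
    {φ : Vel → ℝ} (hφ : Measurable φ) {D m : ℝ} (hm : 0 ≤ m) (hφD : ∀ y, |φ y| ≤ D * jap y ^ m) :
    Tendsto (fun n => ∫ v, f v * dualOp γ (grazTrunc b δ n) (bCut (core b) δ) (thetaPost Θ v)
      (thetaPostStar Θ v) (thetaSwap Θ v) φ v) atTop (𝓝 (∫ v, φ v * BOp b γ δ Θ f v)) := by
  have hγ := h.γ_pos
  have W := fun n => (h.cutoff_trunc n).weak_form h.cutoff hγ hm hfm hf.bound hφ hφD h.meas
    h.nonneg h.le_one
  have G := fun n => hf.integrable_phase_gainLoss hfm h.grazing hγ.le h.γ_le hφ hφD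
    (h.cutoff_trunc n).grazing (h.trunc_le n)
  have G' := hf.integrable_phase_gainLoss hfm h.grazing hγ.le h.γ_le hφ hφD
    h.grazing (fun _ => le_rfl)
  set R : Vel × Vel × Sph → ℝ := fun q => φ q.1 * (truncGain γ (bCut (core b) δ) Θ f q.1 q.2 -
    lossRate γ (bCut (core b) δ) q.1 q.2 * f q.1) with hR
  have hRi : Integrable R phaseMeasure := by
    refine ((W 0).1.sub (G 0).2.2).congr (Eventually.of_forall fun q => ?_)
    simp only [Pi.sub_apply, collIntegrand, hR]
    ring
  have e1 : ∀ n, ∫ v, f v * dualOp γ (grazTrunc b δ n) (bCut (core b) δ) (thetaPost Θ v)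
      (thetaPostStar Θ v) (thetaSwap Θ v) φ v =
      ∫ q, φ q.1 * gainLoss γ (grazTrunc b δ n) f q.1 q.2 ∂phaseMeasure +
        ∫ q, R q ∂phaseMeasure := by
    intro n
    rw [← (W n).2.2, ← integral_add (G n).2.2 hRi]
    refine integral_congr_ae (Eventually.of_forall fun q => ?_)
    simp only [collIntegrand, hR]
    ring
  have e2 : ∫ v, φ v * BOp b γ δ Θ f v =
      ∫ q, φ q.1 * gainLoss γ (bGraz (core b) δ) f q.1 q.2 ∂phaseMeasure +
        ∫ q, R q ∂phaseMeasure := by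
    rw [← integral_add G'.2.2 hRi]
    have c := integral_prod _ (G'.2.2.add hRi)
    simp only [Pi.add_apply] at c
    refine Eq.trans ?_ c.symm
    refine integral_congr_ae (Eventually.of_forall fun v => ?_)
    simp only [hR]
    rw [BOp_eq h.kernel.supp h.δ_pos]
    have i1 := hf.integrable_gainLoss hfm h.grazing hγ.le h.γ_le v
    have i2 := hf.integrable_truncGain hfm h.cutoff hγ.le h.γ_le h.meas h.nonneg h.le_one v
    have i3 := h.cutoff.integrable_lossRate hγ.le v
    have b1 := integral_add (i1.const_mul (φ v)) ((i2.sub (i3.mul_const (f v))).const_mul (φ v))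
    have b2 := integral_sub i2 (i3.mul_const (f v))
    simp only [Pi.sub_apply] at b1
    rw [b1, integral_const_mul, integral_const_mul, b2, integral_mul_const]
    ring
  rw [e2]
  simp only [e1]
  refine Tendsto.add_const _ ?_
  refine tendsto_integral_of_dominated_convergence _ (fun n => (G n).2.2.aestronglyMeasurable)
    G'.2.1 (fun n => Eventually.of_forall (G n).1) (Eventually.of_forall fun q => ?_)
  refine Tendsto.const_mul _ (Tendsto.mul_const _ (Tendsto.const_mul _ ?_))
  exact tendsto_grazTrunc b δ _

end OperatorData

/-! ### Truncation factors -/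

theorem norm_post_le (v w : Vel) (σ : Sph) : ‖post v w σ‖ ≤ ‖v‖ + ‖w‖ := by
  have := energy v w σ
  refine abs_le_of_sq_le_sq' ?_ (by positivity) |>.2
  nlinarith [norm_nonneg v, norm_nonneg w, sq_nonneg ‖postStar v w σ‖]

theorem norm_postStar_le (v w : Vel) (σ : Sph) : ‖postStar v w σ‖ ≤ ‖v‖ + ‖w‖ := by
  have := energy v w σ
  refine abs_le_of_sq_le_sq' ?_ (by positivity) |>.2
  nlinarith [norm_nonneg v, norm_nonneg w, sq_nonneg ‖post v w σ‖]

variable {ε : ℝ}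

theorem measurable_thetaPost (hΘ : Measurable fun q : Vel × Vel × Sph => Θ q.1 q.2.1 q.2.2)
    (v : Vel) : Measurable (thetaPost Θ v) := by
  change Measurable fun z => thetaPost Θ v z
  have := (hΘ.comp measurable_prePost).comp (measurable_prodMk_left (x := v))
  simpa only [Function.comp_def, prePost, thetaPost] using this

theorem measurable_thetaPostStar (hΘ : Measurable fun q : Vel × Vel × Sph => Θ q.1 q.2.1 q.2.2)
    (v : Vel) : Measurable (thetaPostStar Θ v) := by
  change Measurable fun z => thetaPostStar Θ v z
  have := (hΘ.comp (measurable_prePost.comp measurePreserving_exchange.measurable)).comp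
    (measurable_prodMk_left (x := v))
  simpa only [Function.comp_def, prePost_exchange, thetaPostStar] using this

theorem measurable_thetaSwap (hΘ : Measurable fun q : Vel × Vel × Sph => Θ q.1 q.2.1 q.2.2)
    (v : Vel) : Measurable (thetaSwap Θ v) := by
  change Measurable fun z => thetaSwap Θ v z
  have := (hΘ.comp measurePreserving_exchange.measurable).comp (measurable_prodMk_left (x := v))
  simpa only [Function.comp_def, exchange, thetaSwap] using this

theorem IsTruncation.isAlmostOne_post (hΘ : IsTruncation ε Θ) (hε : 0 < ε) (v : Vel) :
    IsAlmostOne ε v (thetaPost Θ v) := by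
  refine ⟨measurable_thetaPost hΘ.measurable v, fun z => ?_, fun z => ?_, fun w σ h1 h2 h3 => ?_⟩
  · rw [thetaPost]; exact hΘ.nonneg _ _ _
  · rw [thetaPost]; exact hΘ.le_one _ _ _
  have hne : v ≠ w := by rintro rfl; rw [sub_self, norm_zero] at h2; linarith
  rw [thetaPost]
  refine hΘ.eq_one _ _ _ ((norm_post_le v w σ).trans h1) ?_ ?_ ?_
  · rwa [norm_post_sub_postStar]
  · rw [norm_post_sub_postStar]; exact (norm_sub_le v w).trans h1
  · rwa [cosDev_prePost hne]

theorem IsTruncation.isAlmostOne_swap (hΘ : IsTruncation ε Θ) (v : Vel) :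
    IsAlmostOne ε v (thetaSwap Θ v) := by
  refine ⟨measurable_thetaSwap hΘ.measurable v, fun z => ?_, fun z => ?_, fun w σ h1 h2 h3 => ?_⟩
  · rw [thetaSwap]; exact hΘ.nonneg _ _ _
  · rw [thetaSwap]; exact hΘ.le_one _ _ _
  rw [thetaSwap]
  refine hΘ.eq_one _ _ _ (by have := norm_nonneg v; simp only; linarith) ?_ ?_ ?_
  · rwa [norm_sub_rev]
  · rw [norm_sub_rev]; exact (norm_sub_le v w).trans h1
  · rwa [cosDev_exchange]

theorem IsTruncation.isAlmostOne_postStar (hΘ : IsTruncation ε Θ) (hε : 0 < ε) (v : Vel) :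
    IsAlmostOne ε v (thetaPostStar Θ v) := by
  refine ⟨measurable_thetaPostStar hΘ.measurable v, fun z => ?_, fun z => ?_,
    fun w σ h1 h2 h3 => ?_⟩
  · rw [thetaPostStar]; exact hΘ.nonneg _ _ _
  · rw [thetaPostStar]; exact hΘ.le_one _ _ _
  have hne : w ≠ v := by rintro rfl; rw [sub_self, norm_zero] at h2; linarith
  have e := cosDev_prePost hne (antipode σ)
  rw [post_exchange, postStar_exchange, cosDev_exchange] at e
  have e2 : ‖postStar v w σ - post v w σ‖ = ‖v - w‖ := by
    rw [norm_sub_rev, norm_post_sub_postStar]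
  rw [thetaPostStar]
  refine hΘ.eq_one _ _ _ ((norm_postStar_le v w σ).trans h1) ?_ ?_ ?_
  · rwa [e2]
  · rw [e2]; exact (norm_sub_le v w).trans h1
  · rwa [e]

end Operator

end Boltzmann
end

noncomputable section
namespace Boltzmann

/-! ### Dissipativity -/

section

variable {X : Type*} [NormedAddCommGroup X] [NormedSpace ℝ X]

theorem IsDissipativeSub.closure {G : Set (X × X)} {a : ℝ} (h : IsDissipativeSub G a) :
    IsDissipativeSub (closure G) a := by
  intro p hp r hr
  have hc : IsClosed {p : X × X | r * ‖p.1‖ ≤ ‖r • p.1 - (p.2 - a • p.1)‖} :=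
    isClosed_le (by fun_prop) (by fun_prop)
  exact closure_minimal (fun q hq => h q hq r hr) hc hp

end

theorem IsTest.measurable {f : Vel → ℝ} (hf : IsTest f) : Measurable f := hf.1.continuous.measurable

theorem IsTest.integrable {f : Vel → ℝ} (hf : IsTest f) (m : ℝ) :
    Integrable fun v => f v * jap v ^ m :=
  (hf.1.continuous.mul (continuous_jap_rpow m)).integrable_of_hasCompactSupport hf.2.mul_right

theorem IsTest.add {f g : Vel → ℝ} (hf : IsTest f) (hg : IsTest g) : IsTest (f + g) :=
  ⟨hf.1.add hg.1, hf.2.add hg.2⟩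

theorem IsTest.smul {f : Vel → ℝ} (hf : IsTest f) (c : ℝ) : IsTest (c • f) :=
  ⟨contDiff_const.smul hf.1, hf.2.smul_left⟩

theorem isTest_zero : IsTest 0 := ⟨contDiff_const, HasCompactSupport.zero⟩

theorem dualOp_neg (γ : ℝ) (β β' : ℝ → ℝ) (θ₁ θ₂ θ₃ : Vel × Sph → ℝ) (φ : Vel → ℝ) (v : Vel) :
    dualOp γ β β' θ₁ θ₂ θ₃ (fun y => -φ y) v = -dualOp γ β β' θ₁ θ₂ θ₃ φ v := by
  rw [dualOp, dualOp, neg_add, ← integral_neg, ← integral_neg]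
  congr 1
  · refine integral_congr_ae (Eventually.of_forall fun z => ?_)
    simp only [dualGraz]; ring
  · refine integral_congr_ae (Eventually.of_forall fun z => ?_)
    simp only [dualRem]; ring

open Classical in
/-- `⟨v⟩^k` with the sign of `f`. -/
def signWeight (k : ℝ) (f : Vel → ℝ) (v : Vel) : ℝ := if 0 ≤ f v then jap v ^ k else -jap v ^ k

theorem measurable_signWeight (k : ℝ) {f : Vel → ℝ} (hf : Measurable f) :
    Measurable (signWeight k f) :=
  Measurable.ite (measurableSet_le measurable_const hf) (measurable_jap.pow_const k)
    (measurable_jap.pow_const k).neg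

theorem abs_signWeight (k : ℝ) (f : Vel → ℝ) (v : Vel) : |signWeight k f v| = jap v ^ k := by
  rw [signWeight]
  split_ifs
  · exact abs_of_pos (jap_rpow_pos v k)
  · rw [abs_neg]; exact abs_of_pos (jap_rpow_pos v k)

theorem signWeight_mul (k : ℝ) (f : Vel → ℝ) (v : Vel) :
    signWeight k f v * f v = |f v| * jap v ^ k := by
  rw [signWeight]
  split_ifs with h
  · rw [abs_of_nonneg h, mul_comm]
  · rw [abs_of_neg (not_le.1 h)]; ring

section Operator

variable {s cb γ k : ℝ} {b : ℝ → ℝ} {δ : ℝ} {Θ : Vel → Vel → Sph → ℝ}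

/-- The dual operators decay at rate `lam` in the weight `⟨v⟩^k`. -/
def DualDecay (γ k lam : ℝ) (b : ℝ → ℝ) (δ : ℝ) (Θ : Vel → Vel → Sph → ℝ) : Prop :=
  ∀ n v φ, Measurable φ → (∀ y, |φ y| ≤ jap y ^ k) → φ v = jap v ^ k →
    dualOp γ (grazTrunc b δ n) (bCut (core b) δ) (thetaPost Θ v) (thetaPostStar Θ v)
      (thetaSwap Θ v) φ v ≤ -lam * jap v ^ k

namespace OperatorData

theorem integral_signWeight_mul_BOp_le (h : OperatorData s cb γ b δ Θ) {lam : ℝ}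
    (hd : DualDecay γ k lam b δ Θ) (hk : 0 ≤ k) {f : Vel → ℝ} (hf : IsTest f) :
    ∫ v, signWeight k f v * BOp b γ δ Θ f v ≤ -lam * ∫ v, |f v| * jap v ^ k := by
  obtain ⟨C, hC⟩ := exists_gaussLip_of_isTest hf
  have hm := measurable_signWeight k hf.measurable
  have hD : ∀ y, |signWeight k f y| ≤ 1 * jap y ^ k := fun y => by
    rw [abs_signWeight, one_mul]
  refine le_of_tendsto' (h.tendsto_dualOp hC hf.measurable hm hk hD) fun n => ?_
  have W := (h.cutoff_trunc n).weak_form h.cutoff h.γ_pos hk hf.measurable hC.bound hm hD h.meas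
    h.nonneg h.le_one
  rw [← integral_const_mul]
  have hi : Integrable fun v => |f v| * jap v ^ k := by
    refine (hf.integrable k).abs.congr (Eventually.of_forall fun v => ?_)
    simp only
    rw [abs_mul, abs_of_pos (jap_rpow_pos v k)]
  refine integral_mono W.2.1 (hi.const_mul _) fun v => ?_
  simp only
  rcases le_or_gt 0 (f v) with h0 | h0
  · have h1 := hd n v _ hm (fun y => (abs_signWeight k f y).le) (by rw [signWeight, if_pos h0])
    rw [abs_of_nonneg h0]
    have := mul_le_mul_of_nonneg_left h1 h0
    linarith
  · have h1 := hd n v (fun y => -signWeight k f y) hm.neg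
      (fun y => by rw [abs_neg]; exact (abs_signWeight k f y).le)
      (by rw [signWeight, if_neg (not_le.2 h0), neg_neg])
    rw [dualOp_neg] at h1
    rw [abs_of_neg h0]
    have := mul_le_mul_of_nonneg_left h1 (neg_pos.2 h0).le
    linarith

theorem isDissipativeSub (h : OperatorData s cb γ b δ Θ) {lam : ℝ}
    (hd : DualDecay γ k lam b δ Θ) (hk : 0 ≤ k) {a : ℝ} (ha : -lam ≤ a) :
    IsDissipativeSub (testGraph k (BOp b γ δ Θ)) a := by
  rintro ⟨F, G⟩ ⟨f, hf, hF, hG⟩ r hr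
  obtain ⟨C, hC⟩ := exists_gaussLip_of_isTest hf
  simp only at hF hG ⊢
  have hE : (r • F - (G - a • F) : L1w k) =ᵐ[wMeasure k]
      fun v => r * f v - (BOp b γ δ Θ f v - a * f v) := by
    filter_upwards [Lp.coeFn_sub (r • F) (G - a • F), Lp.coeFn_sub G (a • F),
      Lp.coeFn_smul r F, Lp.coeFn_smul a F, hF, hG] with v h1 h2 h3 h4 h5 h6
    rw [h1, Pi.sub_apply, h2, Pi.sub_apply, h3, h4, Pi.smul_apply, Pi.smul_apply, h5, h6,
      smul_eq_mul, smul_eq_mul]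
  rw [L1w.norm_eq hF, L1w.norm_eq hE]
  have i1 := hf.integrable k
  have i2 := h.integrable_BOp hC hf.measurable k
  have hm := measurable_signWeight k hf.measurable
  have hD : ∀ y, |signWeight k f y| ≤ 1 * jap y ^ k := fun y => by
    rw [abs_signWeight, one_mul]
  have j1 := integrable_mul_of_le hm hD i1
  have j2 := integrable_mul_of_le hm hD i2
  have hi : Integrable fun v => |f v| * jap v ^ k := by
    refine j1.congr (Eventually.of_forall fun v => ?_)
    exact signWeight_mul k f v
  have hle := h.integral_signWeight_mul_BOp_le hd hk hf
  have e0 : ∫ v, signWeight k f v * f v = ∫ v, |f v| * jap v ^ k :=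
    integral_congr_ae (Eventually.of_forall fun v => signWeight_mul k f v)
  have e1 : ∫ v, ((r + a) * (signWeight k f v * f v) - signWeight k f v * BOp b γ δ Θ f v) =
      (r + a) * (∫ v, |f v| * jap v ^ k) - ∫ v, signWeight k f v * BOp b γ δ Θ f v := by
    rw [integral_sub (j1.const_mul _) j2, integral_const_mul, e0]
  have e2 : ∫ v, ((r + a) * (signWeight k f v * f v) - signWeight k f v * BOp b γ δ Θ f v) ≤
      ∫ v, |r * f v - (BOp b γ δ Θ f v - a * f v)| * jap v ^ k := by
    refine integral_mono ((j1.const_mul _).sub j2) ?_ fun v => ?_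
    · have := (((i1.const_mul r).sub (i2.sub (i1.const_mul a)))).abs
      refine this.congr (Eventually.of_forall fun v => ?_)
      simp only [Pi.sub_apply]
      rw [← abs_of_pos (jap_rpow_pos v k), ← abs_mul, abs_of_pos (jap_rpow_pos v k)]
      congr 1
      ring
    · simp only
      rw [← abs_signWeight k f v, ← abs_mul]
      refine le_trans (le_of_eq ?_) (le_abs_self _)
      ring
  have h0 : 0 ≤ ∫ v, |f v| * jap v ^ k :=
    integral_nonneg fun v => mul_nonneg (abs_nonneg _) (jap_rpow_pos v k).le
  nlinarith

theorem BOp_add (h : OperatorData s cb γ b δ Θ) {f g : Vel → ℝ} (hf : IsTest f) (hg : IsTest g) :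
    BOp b γ δ Θ (f + g) = BOp b γ δ Θ f + BOp b γ δ Θ g := by
  obtain ⟨C, hC⟩ := exists_gaussLip_of_isTest hf
  obtain ⟨D, hD⟩ := exists_gaussLip_of_isTest hg
  funext v
  obtain ⟨f1, f2, -⟩ := h.integrable_integrands hC hf.measurable v
  obtain ⟨g1, g2, -⟩ := h.integrable_integrands hD hg.measurable v
  have e1 : grazOp b γ δ (f + g) v = grazOp b γ δ f v + grazOp b γ δ g v := by
    rw [grazOp, grazOp, grazOp, ← integral_add f1 g1]
    refine integral_congr_ae (Eventually.of_forall fun z => ?_)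
    simp only [grazIntegrand, Pi.add_apply]; ring
  have e2 : remOp b γ δ Θ (f + g) v = remOp b γ δ Θ f v + remOp b γ δ Θ g v := by
    rw [remOp, remOp, remOp, ← integral_add f2 g2]
    refine integral_congr_ae (Eventually.of_forall fun z => ?_)
    simp only [remIntegrand, Pi.add_apply]; ring
  simp only [BOp, Pi.add_apply, e1, e2]
  ring

end OperatorData

theorem BOp_smul (c : ℝ) (f : Vel → ℝ) : BOp b γ δ Θ (c • f) = c • BOp b γ δ Θ f := by
  funext v
  have e1 : grazOp b γ δ (c • f) v = c * grazOp b γ δ f v := by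
    rw [grazOp, grazOp, ← integral_const_mul]
    refine integral_congr_ae (Eventually.of_forall fun z => ?_)
    simp only [grazIntegrand, Pi.smul_apply, smul_eq_mul]; ring
  have e2 : remOp b γ δ Θ (c • f) v = c * remOp b γ δ Θ f v := by
    rw [remOp, remOp, ← integral_const_mul]
    refine integral_congr_ae (Eventually.of_forall fun z => ?_)
    simp only [remIntegrand, Pi.smul_apply, smul_eq_mul]; ring
  simp only [BOp, Pi.smul_apply, smul_eq_mul, e1, e2]
  ring

/-- The graph on test functions, as a subspace. -/
def OperatorData.graph (h : OperatorData s cb γ b δ Θ) (k : ℝ) : Submodule ℝ (L1w k × L1w k) where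
  carrier := testGraph k (BOp b γ δ Θ)
  zero_mem' := by
    refine ⟨0, isTest_zero, Lp.coeFn_zero _ _ _, ?_⟩
    have := BOp_smul (b := b) (γ := γ) (δ := δ) (Θ := Θ) 0 0
    rw [zero_smul, zero_smul] at this
    rw [this]
    exact Lp.coeFn_zero _ _ _
  add_mem' := by
    rintro ⟨F, G⟩ ⟨F', G'⟩ ⟨f, hf, hF, hG⟩ ⟨g, hg, hF', hG'⟩
    refine ⟨f + g, hf.add hg, (Lp.coeFn_add F F').trans (hF.add hF'), ?_⟩
    rw [h.BOp_add hf hg]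
    exact (Lp.coeFn_add G G').trans (hG.add hG')
  smul_mem' := by
    rintro c ⟨F, G⟩ ⟨f, hf, hF, hG⟩
    refine ⟨c • f, hf.smul c, (Lp.coeFn_smul c F).trans (hF.const_smul c), ?_⟩
    rw [BOp_smul]
    exact (Lp.coeFn_smul c G).trans (hG.const_smul c)

theorem OperatorData.mem_graph (h : OperatorData s cb γ b δ Θ) {f : Vel → ℝ} (hf : IsTest f) :
    ∃ p ∈ h.graph k, p.1 =ᵐ[wMeasure k] f ∧ p.2 =ᵐ[wMeasure k] BOp b γ δ Θ f := by
  obtain ⟨C, hC⟩ := exists_gaussLip_of_isTest hf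
  have h1 : MemLp f 1 (wMeasure k) :=
    memLp_one_iff_integrable.2 (integrable_wMeasure.2 (hf.integrable k))
  have h2 : MemLp (BOp b γ δ Θ f) 1 (wMeasure k) := h.memLp_BOp hC hf.measurable
  exact ⟨(h1.toLp f, h2.toLp _), ⟨f, hf, h1.coeFn_toLp, h2.coeFn_toLp⟩, h1.coeFn_toLp,
    h2.coeFn_toLp⟩

instance : IsFiniteMeasureOnCompacts (wMeasure k) where
  lt_top_of_isCompact K hK := by
    rw [wMeasure, withDensity_apply _ hK.measurableSet]
    have : IntegrableOn (fun v => jap v ^ k) K :=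
      (continuous_jap_rpow k).continuousOn.integrableOn_compact hK
    have h := this.2
    rw [hasFiniteIntegral_iff_ofReal (Eventually.of_forall fun v => (jap_rpow_pos v k).le)] at h
    exact h

theorem OperatorData.dense_domain (h : OperatorData s cb γ b δ Θ) :
    Dense {x : L1w k | ∃ y, (x, y) ∈ (h.graph k).topologicalClosure} := by
  refine (Lp.dense_hasCompactSupport_contDiff (F := ℝ) (μ := wMeasure k) (p := 1)
    ENNReal.one_ne_top).mono ?_
  rintro F ⟨f, hF, hc, hs⟩
  obtain ⟨p, hp, h1, -⟩ := h.mem_graph (k := k) ⟨hs, hc⟩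
  have : p.1 = F := Lp.ext (h1.trans hF.symm)
  refine ⟨p.2, ?_⟩
  rw [← this]
  exact Submodule.le_topologicalClosure _ hp

end Operator

end Boltzmann
end

noncomputable section
namespace Boltzmann

open scoped ENNReal

/-! ### Surjectivity from triviality of the annihilator of the range -/

section

variable {X : Type*} [NormedAddCommGroup X] [NormedSpace ℝ X]

theorem surjective_of_isDissipativeSub [CompleteSpace X] {G : Submodule ℝ (X × X)} {a r : ℝ}
    (hcl : IsClosed (G : Set (X × X))) (hd : IsDissipativeSub (G : Set (X × X)) a) (hr : a < r)
    (hann : ∀ ψ : StrongDual ℝ X, (∀ p ∈ G, ψ (r • p.1 - p.2) = 0) → ψ = 0) (z : X) :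
    ∃ p ∈ G, r • p.1 - p.2 = z := by
  have : CompleteSpace G := hcl.completeSpace_coe
  let L₀ : X × X →L[ℝ] X := r • ContinuousLinearMap.fst ℝ X X - ContinuousLinearMap.snd ℝ X X
  let L : G →L[ℝ] X := L₀.comp G.subtypeL
  have hL : ∀ p : G, L p = r • (p : X × X).1 - (p : X × X).2 := fun p => rfl
  have hbd : ∀ p : G, ‖p‖ ≤ (Real.toNNReal ((r - a)⁻¹ + (1 + |r| * (r - a)⁻¹)) : ℝ≥0) * ‖L p‖ := by
    rintro ⟨p, hp⟩
    have hra : 0 < r - a := by linarith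
    have h1 := hd p hp (r - a) hra
    rw [show (r - a) • p.1 - (p.2 - a • p.1) = r • p.1 - p.2 by module] at h1
    have h2 : ‖p.1‖ ≤ (r - a)⁻¹ * ‖r • p.1 - p.2‖ := by
      rwa [inv_mul_eq_div, le_div_iff₀' hra]
    have h3 : ‖p.2‖ ≤ ‖r • p.1 - p.2‖ + |r| * ‖p.1‖ := by
      have := norm_sub_le (r • p.1) (r • p.1 - p.2)
      rw [sub_sub_cancel, norm_smul, Real.norm_eq_abs] at this
      linarith
    have hi : 0 ≤ (r - a)⁻¹ := (inv_pos.2 hra).le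
    rw [hL, Real.coe_toNNReal _ (by positivity)]
    have h4 : |r| * ‖p.1‖ ≤ |r| * ((r - a)⁻¹ * ‖r • p.1 - p.2‖) := by gcongr
    have h5 : ‖(⟨p, hp⟩ : G)‖ = max ‖p.1‖ ‖p.2‖ := rfl
    have h6 := norm_nonneg (r • p.1 - p.2)
    have h7 : 0 ≤ (r - a)⁻¹ * ‖r • p.1 - p.2‖ := by positivity
    have h8 : 0 ≤ |r| * ((r - a)⁻¹ * ‖r • p.1 - p.2‖) := by positivity
    rw [h5]
    simp only
    refine max_le ?_ ?_
    · nlinarith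
    · nlinarith
  have hclosed : IsClosed (range L) :=
    (L.antilipschitz_of_bound hbd).isClosed_range L.uniformContinuous
  by_contra hz
  have hz' : z ∉ range L := by
    rintro ⟨p, hp⟩
    exact hz ⟨p, p.2, by rw [← hp, hL]⟩
  have hconv : Convex ℝ (range L) := by
    have := (LinearMap.range (L : G →ₗ[ℝ] X)).convex
    rwa [LinearMap.coe_range] at this
  obtain ⟨ψ, u, h1, h2⟩ := geometric_hahn_banach_closed_point hconv hclosed hz'
  have h0 : ∀ p : G, ψ (L p) = 0 := by
    intro p
    by_contra hne
    have := h1 (L (((u + 1) / ψ (L p)) • p)) ⟨_, rfl⟩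
    rw [map_smul, map_smul, smul_eq_mul, div_mul_cancel₀ _ hne] at this
    linarith
  have hψ : ψ = 0 := hann ψ fun p hp => h0 ⟨p, hp⟩
  have hu : 0 < u := by
    have := h1 (L 0) ⟨0, rfl⟩
    rwa [map_zero, map_zero] at this
  rw [hψ] at h2
  simp only [zero_apply] at h2
  linarith

end

/-! ### Functionals on the weighted space -/

section Dual

variable {k : ℝ}

/-- The Gaussian as a nonnegative density. -/
def gaussNN (v : Vel) : ℝ≥0 := ⟨gauss 1 v, (gauss_pos 1 v).le⟩

theorem measurable_gaussNN : Measurable gaussNN := (measurable_gauss 1).subtype_mk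

/-- A finite measure, equivalent to `⟨v⟩^k dv`. -/
def gaussMeasure (k : ℝ) : Measure Vel := (wMeasure k).withDensity fun v => (gaussNN v : ℝ≥0∞)

theorem coe_gaussNN (v : Vel) : (gaussNN v : ℝ) = gauss 1 v := rfl

theorem coe_gaussNN' (v : Vel) : (gaussNN v : ℝ≥0∞) = ENNReal.ofReal (gauss 1 v) := by
  rw [← coe_gaussNN, ENNReal.ofReal_coe_nnreal]

instance : IsFiniteMeasure (gaussMeasure k) := by
  refine ⟨?_⟩
  rw [gaussMeasure, withDensity_apply _ MeasurableSet.univ, setLIntegral_univ]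
  have h : Integrable (gauss 1) (wMeasure k) := by
    refine integrable_wMeasure.2 ?_
    simpa only [mul_comm] using integrable_jap_rpow_mul_gauss k (c := 1) one_pos
  have h2 := h.2
  rw [hasFiniteIntegral_iff_ofReal (Eventually.of_forall fun v => (gauss_pos 1 v).le)] at h2
  simpa only [coe_gaussNN'] using h2

theorem ae_gaussMeasure {p : Vel → Prop} : (∀ᵐ v ∂gaussMeasure k, p v) ↔ ∀ᵐ v ∂wMeasure k, p v := by
  rw [gaussMeasure, ae_withDensity_iff measurable_gaussNN.coe_nnreal_ennreal]
  have : ∀ v, (gaussNN v : ℝ≥0∞) ≠ 0 := fun v => by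
    rw [coe_gaussNN']; simpa using gauss_pos 1 v
  simp [this]

theorem integral_gaussMeasure (f : Vel → ℝ) :
    ∫ v, f v ∂gaussMeasure k = ∫ v, gauss 1 v * f v ∂wMeasure k := by
  rw [gaussMeasure, integral_withDensity_eq_integral_smul measurable_gaussNN]
  rfl

/-- Multiplication by the Gaussian, an isometry of `L¹` spaces. -/
def gaussSMul (k : ℝ) : Lp ℝ 1 (gaussMeasure k) →ₗᵢ[ℝ] L1w k :=
  withDensitySMulLI (E := ℝ) (wMeasure k) measurable_gaussNN

theorem norm_gaussSMul (u : Lp ℝ 1 (gaussMeasure k)) : ‖gaussSMul k u‖ = ‖u‖ :=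
  LinearIsometry.norm_map _ _

theorem coeFn_gaussSMul (u : Lp ℝ 1 (gaussMeasure k)) :
    gaussSMul k u =ᵐ[wMeasure k] fun v => gauss 1 v * u v :=
  (memL1_smul_of_L1_withDensity measurable_gaussNN u).coeFn_toLp

/-- The inclusion of `L²` in `L¹` of a finite measure. -/
def inclL2 {α : Type*} [MeasurableSpace α] (m : Measure α) [IsFiniteMeasure m] :
    Lp ℝ 2 m →ₗ[ℝ] Lp ℝ 1 m where
  toFun u := ⟨u.1, Lp.antitone one_le_two u.2⟩
  map_add' _ _ := rfl
  map_smul' _ _ := rfl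

theorem coeFn_inclL2 {α : Type*} [MeasurableSpace α] (m : Measure α) [IsFiniteMeasure m]
    (u : Lp ℝ 2 m) : ⇑(inclL2 m u) = u := rfl

theorem norm_inclL2_le {α : Type*} [MeasurableSpace α] (m : Measure α) [IsFiniteMeasure m]
    (u : Lp ℝ 2 m) : ‖inclL2 m u‖ ≤ (m univ ^ (1 / 2 : ℝ)).toReal * ‖u‖ := by
  rw [Lp.norm_def, Lp.norm_def, coeFn_inclL2, mul_comm, ← ENNReal.toReal_mul]
  have h := eLpNorm_le_eLpNorm_mul_rpow_measure_univ (μ := m) (p := 1) (q := 2) one_le_two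
    (Lp.aestronglyMeasurable u)
  have h2 : (1 / (1 : ℝ≥0∞).toReal - 1 / (2 : ℝ≥0∞).toReal) = 1 / 2 := by norm_num
  rw [h2] at h
  refine ENNReal.toReal_mono (ENNReal.mul_ne_top (Lp.eLpNorm_ne_top u) ?_) h
  exact ENNReal.rpow_ne_top_of_nonneg (by norm_num) (measure_ne_top m _)

/-- Continuous functionals on `L¹(⟨v⟩^k)` are given by functions with growth `⟨v⟩^k`. -/
theorem L1w.exists_dual_eq (ψ : StrongDual ℝ (L1w k)) :
    ∃ φ : Vel → ℝ, Measurable φ ∧ (∀ y, |φ y| ≤ ‖ψ‖ * jap y ^ k) ∧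
      ∀ F : L1w k, ψ F = ∫ v, φ v * F v := by
  set m := gaussMeasure k with hm
  let ℓ₀ : Lp ℝ 2 m →ₗ[ℝ] ℝ := (ψ : L1w k →ₗ[ℝ] ℝ).comp ((gaussSMul k).toLinearMap.comp (inclL2 m))
  have hℓ₀ : ∀ u, |ℓ₀ u| ≤ ‖ψ‖ * ‖inclL2 m u‖ := fun u => by
    have := ψ.le_opNorm (gaussSMul k (inclL2 m u))
    rwa [norm_gaussSMul] at this
  let ℓ : StrongDual ℝ (Lp ℝ 2 m) := ℓ₀.mkContinuous (‖ψ‖ * (m univ ^ (1 / 2 : ℝ)).toReal)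
    fun u => (hℓ₀ u).trans (by
      rw [mul_assoc]
      exact mul_le_mul_of_nonneg_left (norm_inclL2_le m u) (norm_nonneg ψ))
  set g := (InnerProductSpace.toDual ℝ (Lp ℝ 2 m)).symm ℓ with hg
  have hgℓ : ∀ u, inner ℝ g u = ℓ₀ u := fun u => InnerProductSpace.toDual_symm_apply
  have hgi : Integrable g m := memLp_one_iff_integrable.1 ((Lp.memLp g).mono_exponent one_le_two)
  have hset : ∀ s, MeasurableSet s → |∫ x in s, g x ∂m| ≤ ‖ψ‖ * m.real s := by
    intro s hs
    have h1 := hℓ₀ (indicatorConstLp 2 hs (measure_ne_top m s) (1 : ℝ))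
    rw [← hgℓ, real_inner_comm, L2.inner_indicatorConstLp_one] at h1
    refine h1.trans_eq ?_
    congr 1
    have h2 : inclL2 m (indicatorConstLp 2 hs (measure_ne_top m s) (1 : ℝ)) =
        indicatorConstLp 1 hs (measure_ne_top m s) (1 : ℝ) := by
      refine Lp.ext ?_
      rw [coeFn_inclL2]
      exact indicatorConstLp_coeFn.trans indicatorConstLp_coeFn.symm
    rw [h2, norm_indicatorConstLp one_ne_zero ENNReal.one_ne_top]
    simp
  have hle : g ≤ᵐ[m] fun _ => ‖ψ‖ := by
    refine ae_le_of_forall_setIntegral_le hgi (integrable_const _) fun s hs _ => ?_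
    rw [setIntegral_const, smul_eq_mul, mul_comm]
    exact (abs_le.1 (hset s hs)).2
  have hge : (fun _ => -‖ψ‖) ≤ᵐ[m] g := by
    refine ae_le_of_forall_setIntegral_le (integrable_const _) hgi fun s hs _ => ?_
    rw [setIntegral_const, smul_eq_mul]
    have := (abs_le.1 (hset s hs)).1
    linarith
  set φ₀ : Vel → ℝ := fun v => max (-‖ψ‖) (min ‖ψ‖ (g v)) with hφ₀
  have hφ₀m : Measurable φ₀ :=
    measurable_const.max (measurable_const.min (Lp.stronglyMeasurable g).measurable)
  have hφ₀b : ∀ v, |φ₀ v| ≤ ‖ψ‖ := fun v => abs_le.2 ⟨le_max_left _ _,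
    max_le (by linarith [norm_nonneg ψ]) (min_le_left _ _)⟩
  have hφ₀g : ∀ᵐ v ∂wMeasure k, φ₀ v = g v := by
    refine ae_gaussMeasure.1 ?_
    filter_upwards [hle, hge] with v h1 h2
    simp only [hφ₀]
    rw [min_eq_right h1, max_eq_right h2]
  have hint : ∀ F : L1w k, Integrable (fun v => φ₀ v * F v) (wMeasure k) := fun F =>
    (L1.integrable_coeFn F).bdd_mul hφ₀m.aestronglyMeasurable
      (Eventually.of_forall fun v => (hφ₀b v))
  have hcont : Continuous fun F : L1w k => ∫ v, φ₀ v * F v ∂wMeasure k := by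
    let T : L1w k →ₗ[ℝ] ℝ :=
      { toFun := fun F => ∫ v, φ₀ v * F v ∂wMeasure k
        map_add' := fun F G => by
          rw [← integral_add (hint F) (hint G)]
          refine integral_congr_ae ?_
          filter_upwards [Lp.coeFn_add F G] with v hv
          rw [hv, Pi.add_apply, mul_add]
        map_smul' := fun c F => by
          rw [RingHom.id_apply, smul_eq_mul, ← integral_const_mul]
          refine integral_congr_ae ?_
          filter_upwards [Lp.coeFn_smul c F] with v hv
          rw [hv, Pi.smul_apply, smul_eq_mul]; ring }
    exact (T.mkContinuous ‖ψ‖ fun F => by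
      rw [L1.norm_eq_integral_norm, ← integral_const_mul]
      refine (norm_integral_le_integral_norm _).trans ?_
      refine integral_mono (hint F).norm ((L1.integrable_coeFn F).norm.const_mul _) fun v => ?_
      rw [norm_mul]
      exact mul_le_mul_of_nonneg_right (hφ₀b v) (norm_nonneg _)).continuous
  have heq : ∀ F : L1w k, ψ F = ∫ v, φ₀ v * F v ∂wMeasure k := by
    have hdense := Lp.dense_hasCompactSupport_contDiff (F := ℝ) (μ := wMeasure k) (p := 1)
      ENNReal.one_ne_top
    intro F
    refine congrFun (Continuous.ext_on hdense ψ.continuous hcont ?_) F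
    rintro F ⟨f, hF, hc, hs⟩
    have hu : MemLp (fun v => (gauss 1 v)⁻¹ * f v) 2 m := by
      have hcont : Continuous fun v => (gauss 1 v)⁻¹ * f v :=
        ((continuous_gauss 1).inv₀ fun v => (gauss_pos 1 v).ne').mul hs.continuous
      obtain ⟨C, hC⟩ := (hc.mul_left (f' := f) (f := fun v => (gauss 1 v)⁻¹)
        ).exists_bound_of_continuous hcont
      exact MemLp.of_bound hcont.aestronglyMeasurable C (Eventually.of_forall hC)
    have hJu : gaussSMul k (inclL2 m (hu.toLp _)) = F := by
      refine Lp.ext ?_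
      refine (coeFn_gaussSMul _).trans (EventuallyEq.trans ?_ hF.symm)
      have := ae_gaussMeasure.1 hu.coeFn_toLp
      filter_upwards [this] with v hv
      rw [coeFn_inclL2, hv,
        mul_inv_cancel_left₀ (gauss_pos 1 v).ne']
    have h1 : ψ F = ℓ₀ (hu.toLp _) := by rw [← hJu]; rfl
    rw [h1, ← hgℓ, L2.inner_def, integral_gaussMeasure]
    refine integral_congr_ae ?_
    have := ae_gaussMeasure.1 hu.coeFn_toLp
    filter_upwards [this, hφ₀g, hF] with v hv1 hv2 hv3
    rw [hv1, hv2, hv3]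
    simp only [RCLike.inner_apply, conj_trivial]
    have := (gauss_pos 1 v).ne'
    field_simp
  refine ⟨fun v => φ₀ v * jap v ^ k, hφ₀m.mul (measurable_jap.pow_const k), fun y => ?_,
    fun F => ?_⟩
  · rw [abs_mul, abs_of_pos (jap_rpow_pos y k)]
    exact mul_le_mul_of_nonneg_right (hφ₀b y) (jap_rpow_pos y k).le
  · rw [heq, integral_wMeasure]
    refine integral_congr_ae (Eventually.of_forall fun v => ?_)
    simp only
    ring

end Dual

end Boltzmann
end

noncomputable section
namespace Boltzmann

/-! ### Mollification -/

/-- The radius of the support of a mollifier. -/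
def mollRadius (n : ℕ) : ℝ := 1 / ((n : ℝ) + 1)

theorem mollRadius_pos (n : ℕ) : 0 < mollRadius n := by unfold mollRadius; positivity

theorem mollRadius_le_one (n : ℕ) : mollRadius n ≤ 1 := by
  unfold mollRadius
  rw [div_le_one (by positivity)]
  linarith [(Nat.cast_nonneg n : (0 : ℝ) ≤ n)]

theorem tendsto_mollRadius : Tendsto mollRadius atTop (𝓝 0) :=
  tendsto_one_div_add_atTop_nhds_zero_nat

/-- Bump functions with shrinking supports. -/
def mollBump (n : ℕ) : ContDiffBump (0 : Vel) where
  rIn := mollRadius n / 2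
  rOut := mollRadius n
  rIn_pos := half_pos (mollRadius_pos n)
  rIn_lt_rOut := half_lt_self (mollRadius_pos n)

theorem mollBump_rOut_le (n : ℕ) : (mollBump n).rOut ≤ 2 * (mollBump n).rIn := by
  change mollRadius n ≤ 2 * (mollRadius n / 2)
  linarith

/-- A mollifier. -/
def moll (n : ℕ) : Vel → ℝ := (mollBump n).normed volume

/-- The volume of the ball which carries a mollifier. -/
def mollVol (n : ℕ) : ℝ := volume.real (Metric.closedBall (0 : Vel) (mollRadius n))

theorem mollVol_pos (n : ℕ) : 0 < mollVol n :=
  ENNReal.toReal_pos (Metric.measure_closedBall_pos _ _ (mollRadius_pos n)).ne'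
    measure_closedBall_lt_top.ne

theorem volume_closedBall_eq_mollVol (n : ℕ) (a : Vel) :
    volume.real (Metric.closedBall a (mollRadius n)) = mollVol n := by
  rw [mollVol, measureReal_def, measureReal_def,
    Measure.addHaar_closedBall_center volume a (mollRadius n)]

theorem moll_nonneg (n : ℕ) (y : Vel) : 0 ≤ moll n y := ContDiffBump.nonneg_normed _ _

theorem integral_moll (n : ℕ) : ∫ y, moll n y = 1 := ContDiffBump.integral_normed _

theorem integrable_moll (n : ℕ) : Integrable (moll n) := ContDiffBump.integrable_normed _

theorem continuous_moll (n : ℕ) : Continuous (moll n) := ContDiffBump.continuous_normed _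

theorem moll_neg (n : ℕ) (y : Vel) : moll n (-y) = moll n y := ContDiffBump.normed_neg _ _

theorem moll_eq_zero {n : ℕ} {y : Vel} (h : mollRadius n ≤ ‖y‖) : moll n y = 0 := by
  by_contra hne
  have : y ∈ Function.support (moll n) := hne
  rw [moll, ContDiffBump.support_normed_eq, mem_ball_zero_iff] at this
  exact absurd h (not_le.2 this)

theorem norm_le_of_moll_ne_zero {n : ℕ} {y : Vel} (h : moll n y ≠ 0) : ‖y‖ ≤ mollRadius n :=
  (not_le.1 fun h' => h (moll_eq_zero h')).le

theorem isTest_moll_sub (n : ℕ) (z : Vel) : IsTest fun v => moll n (v - z) := by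
  constructor
  · exact (ContDiffBump.contDiff_normed (n := ⊤) (mollBump n)).comp (contDiff_id.sub contDiff_const)
  · exact (ContDiffBump.hasCompactSupport_normed (mollBump n)).comp_homeomorph
      (Homeomorph.subRight z)

theorem moll_le (n : ℕ) (y : Vel) : moll n y ≤ 8 / mollVol n := by
  have h := ContDiffBump.normed_le_div_measure_closedBall_rOut (μ := volume) (mollBump n) 2
    (mollBump_rOut_le n) y
  rw [finrank_euclideanSpace_fin] at h
  refine h.trans_eq ?_
  norm_num [mollVol, mollBump]

theorem exists_moll_lip : ∃ L : ℝ, 0 ≤ L ∧ ∀ n x y,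
    |moll n x - moll n y| ≤ L / (mollVol n * mollRadius n) * ‖x - y‖ := by
  let F : Vel → ℝ := (someContDiffBumpBase Vel).toFun 2
  obtain ⟨L, hL⟩ : ∃ L : ℝ≥0, LipschitzWith L F := by
    let g : ContDiffBump (0 : Vel) := ⟨1, 2, one_pos, one_lt_two⟩
    have hg : ⇑g = F := by
      funext x
      simp [g, F, ContDiffBump.apply]
    obtain ⟨L, h⟩ := ContDiff.lipschitzWith_of_hasCompactSupport (𝕂 := ℝ) g.hasCompactSupport
      (g.contDiff (n := 1)) (by simp)
    exact ⟨L, hg ▸ h⟩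
  refine ⟨16 * L, by positivity, fun n x y => ?_⟩
  have hr := mollRadius_pos n
  have hV := mollVol_pos n
  have hF : ∀ x, mollBump n x = F ((mollRadius n / 2)⁻¹ • x) := fun x => by
    rw [ContDiffBump.apply, sub_zero]
    have : (mollBump n).rOut / (mollBump n).rIn = 2 := by
      simp only [mollBump]; field_simp
    rw [this]; rfl
  have hI : mollVol n / 8 ≤ ∫ x, mollBump n x := by
    have h := ContDiffBump.measure_closedBall_div_le_integral (μ := volume) (mollBump n) 2
      (mollBump_rOut_le n)
    rw [finrank_euclideanSpace_fin] at h
    refine le_trans (le_of_eq ?_) h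
    norm_num [mollVol, mollBump]
  have hI0 : 0 < ∫ x, mollBump n x := lt_of_lt_of_le (by positivity) hI
  have h1 : |mollBump n x - mollBump n y| ≤ L * ((mollRadius n / 2)⁻¹ * ‖x - y‖) := by
    have := hL.dist_le_mul ((mollRadius n / 2)⁻¹ • x) ((mollRadius n / 2)⁻¹ • y)
    rw [dist_eq_norm, dist_eq_norm, ← smul_sub, norm_smul, ← hF, ← hF, Real.norm_eq_abs,
      Real.norm_eq_abs, abs_of_pos (by positivity : (0 : ℝ) < (mollRadius n / 2)⁻¹)] at this
    exact this
  calc |moll n x - moll n y| = |mollBump n x - mollBump n y| / ∫ x, mollBump n x := by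
        rw [moll, ContDiffBump.normed_def, ContDiffBump.normed_def, ← sub_div, abs_div,
          abs_of_pos hI0]
    _ ≤ L * ((mollRadius n / 2)⁻¹ * ‖x - y‖) / (mollVol n / 8) := by gcongr
    _ = _ := by field_simp; ring

/-- The mollification of a function. -/
def smear (n : ℕ) (φ : Vel → ℝ) (z : Vel) : ℝ := ∫ y, moll n y * φ (z + y)

section Smear

variable {φ : Vel → ℝ} {D k : ℝ}

theorem jap_add_rpow_le (hk : 0 ≤ k) (z : Vel) {y : Vel} (hy : ‖y‖ ≤ 1) :
    jap (z + y) ^ k ≤ 2 ^ k * jap z ^ k := by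
  rw [← Real.mul_rpow (by norm_num) (jap_nonneg z)]
  refine Real.rpow_le_rpow (jap_nonneg _) ?_ hk
  have h1 := jap_le_jap_add (z + y) z
  rw [add_sub_cancel_left] at h1
  linarith [one_le_jap z]

theorem nonneg_of_abs_le_jap (hφD : ∀ y, |φ y| ≤ D * jap y ^ k) : 0 ≤ D :=
  nonneg_of_mul_nonneg_left ((abs_nonneg _).trans (hφD 0)) (jap_rpow_pos 0 k)

theorem abs_le_of_moll_ne_zero (hk : 0 ≤ k) (hφD : ∀ y, |φ y| ≤ D * jap y ^ k) (z : Vel) {n : ℕ}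
    {y : Vel} (hy : moll n y ≠ 0) : |φ (z + y)| ≤ D * 2 ^ k * jap z ^ k := by
  refine (hφD _).trans ?_
  rw [mul_assoc]
  exact mul_le_mul_of_nonneg_left (jap_add_rpow_le hk z
    ((norm_le_of_moll_ne_zero hy).trans (mollRadius_le_one n))) (nonneg_of_abs_le_jap hφD)

theorem abs_moll_mul_le (hk : 0 ≤ k) (hφD : ∀ y, |φ y| ≤ D * jap y ^ k) (n : ℕ) (z y : Vel) :
    |moll n y * φ (z + y)| ≤ moll n y * (D * 2 ^ k * jap z ^ k) := by
  by_cases h : moll n y = 0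
  · simp [h]
  · rw [abs_mul, abs_of_nonneg (moll_nonneg n y)]
    exact mul_le_mul_of_nonneg_left (abs_le_of_moll_ne_zero hk hφD z h) (moll_nonneg n y)

theorem integrable_moll_mul (hφ : Measurable φ) (hk : 0 ≤ k) (hφD : ∀ y, |φ y| ≤ D * jap y ^ k)
    (n : ℕ) (z : Vel) : Integrable fun y => moll n y * φ (z + y) :=
  ((integrable_moll n).mul_const _).mono' ((continuous_moll n).measurable.mul
    (hφ.comp (measurable_const_add z))).aestronglyMeasurable
    (Eventually.of_forall (abs_moll_mul_le hk hφD n z))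

theorem abs_smear_le (hk : 0 ≤ k) (hφD : ∀ y, |φ y| ≤ D * jap y ^ k) (n : ℕ) (z : Vel) :
    |smear n φ z| ≤ D * 2 ^ k * jap z ^ k := by
  have h := norm_integral_le_of_norm_le (f := fun y => moll n y * φ (z + y))
    ((integrable_moll n).mul_const _)
    (Eventually.of_forall (abs_moll_mul_le hk hφD n z))
  rwa [integral_mul_const, integral_moll, one_mul] at h

theorem locallyIntegrable_of_abs_le (hφ : Measurable φ) (hφD : ∀ y, |φ y| ≤ D * jap y ^ k) :
    LocallyIntegrable φ :=
  (((continuous_jap_rpow k).const_mul D).locallyIntegrable (μ := volume)).mono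
    hφ.aestronglyMeasurable (Eventually.of_forall fun y => by
      rw [Real.norm_eq_abs, Real.norm_eq_abs]
      exact (hφD y).trans (le_abs_self _))

open scoped Convolution in
theorem smear_eq_convolution (n : ℕ) (φ : Vel → ℝ) (z : Vel) :
    smear n φ z = (moll n ⋆[ContinuousLinearMap.lsmul ℝ ℝ, volume] φ) z := by
  rw [smear, MeasureTheory.convolution, ← integral_neg_eq_self]
  refine integral_congr_ae (Eventually.of_forall fun y => ?_)
  simp [moll_neg, sub_eq_add_neg]

theorem continuous_smear (hφ : Measurable φ) (hφD : ∀ y, |φ y| ≤ D * jap y ^ k) (n : ℕ) :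
    Continuous (smear n φ) := by
  rw [show smear n φ = _ from funext (smear_eq_convolution n φ)]
  exact HasCompactSupport.continuous_convolution_left _
    (ContDiffBump.hasCompactSupport_normed (mollBump n)) (continuous_moll n)
    (locallyIntegrable_of_abs_le hφ hφD)

theorem ae_tendsto_smear (hφ : Measurable φ) (hφD : ∀ y, |φ y| ≤ D * jap y ^ k) :
    ∀ᵐ z, Tendsto (fun n => smear n φ z) atTop (𝓝 (φ z)) := by
  have h := ContDiffBump.ae_convolution_tendsto_right_of_locallyIntegrable (μ := volume)
    (φ := mollBump) (l := atTop) (K := 2) tendsto_mollRadius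
    (Eventually.of_forall mollBump_rOut_le) (locallyIntegrable_of_abs_le hφ hφD)
  filter_upwards [h] with z hz
  refine hz.congr fun n => ?_
  rw [smear_eq_convolution]; rfl

theorem smear_neg (n : ℕ) (φ : Vel → ℝ) (z : Vel) :
    smear n (fun y => -φ y) z = -smear n φ z := by
  simp only [smear, mul_neg, integral_neg]

/-- Integration of the increments of a function against a Lipschitz function of small support. -/
theorem abs_integral_mul_increment_le {g : Vel → ℝ} {B p : ℝ} {n : ℕ} (hφ : Measurable φ)
    (hk : 0 ≤ k) (hφD : ∀ y, |φ y| ≤ D * jap y ^ k) (hB : 0 ≤ B) (hg : Continuous g)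
    (hg0 : ∀ y, mollRadius n < ‖y‖ → g y = 0)
    (hgb : ∀ y, |g y| ≤ B / mollVol n * mollRadius n)
    (hgl : ∀ x y, |g x - g y| ≤ B / mollVol n * ‖x - y‖) (hp0 : 0 ≤ p) (hp1 : p ≤ 1) (a c : Vel) :
    |∫ y, g y * (φ (a + y) - φ (c + y))| ≤
      2 * B * 2 ^ k * D * mollRadius n ^ (1 - p) * ‖a - c‖ ^ p * (jap a ^ k + jap c ^ k) := by
  set η := mollRadius n with hη
  have hη0 : 0 < η := mollRadius_pos n
  have hη1 : η ≤ 1 := mollRadius_le_one n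
  have hV := mollVol_pos n
  have hD := nonneg_of_abs_le_jap hφD
  set E := 2 * (B / mollVol n) * η ^ (1 - p) * ‖a - c‖ ^ p with hE
  have hE0 : 0 ≤ E := by positivity
  have hmem : ∀ a x : Vel, x ∈ Metric.closedBall a η ↔ ‖x - a‖ ≤ η := fun a x => by
    rw [Metric.mem_closedBall, dist_eq_norm]
  have hbdd : ∀ a x : Vel, x ∈ Metric.closedBall a η → |φ x| ≤ D * 2 ^ k * jap a ^ k := by
    intro a x hx
    refine (hφD x).trans ?_
    have h := jap_add_rpow_le hk a (((hmem a x).1 hx).trans hη1)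
    rw [add_sub_cancel] at h
    rw [mul_assoc]
    gcongr
  let bd : Vel → Vel → ℝ := fun a => (Metric.closedBall a η).indicator fun _ => D * 2 ^ k * jap a ^ k
  have hbd0 : ∀ a x, 0 ≤ bd a x := fun a x =>
    indicator_nonneg (fun _ _ => by have := jap_rpow_pos a k; positivity) _
  have hbdi : ∀ a, Integrable (bd a) ∧ ∫ x, bd a x = mollVol n * (D * 2 ^ k * jap a ^ k) := by
    intro a
    constructor
    · exact (integrableOn_const (measure_closedBall_lt_top.ne)).integrable_indicator
        measurableSet_closedBall
    · rw [integral_indicator measurableSet_closedBall, setIntegral_const, smul_eq_mul,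
        volume_closedBall_eq_mollVol]
  have hgφ : ∀ a : Vel, ∀ x, |g (x - a) * φ x| ≤ B / mollVol n * η * bd a x := by
    intro a x
    by_cases hx : x ∈ Metric.closedBall a η
    · rw [abs_mul]
      simp only [bd, indicator_of_mem hx]
      exact mul_le_mul (hgb _) (hbdd a x hx) (abs_nonneg _) (by positivity)
    · rw [hg0 _ (not_le.1 fun h => hx ((hmem a x).2 h))]
      have := hbd0 a x
      simp only [zero_mul, abs_zero]
      positivity
  have hint : ∀ a, Integrable fun x => g (x - a) * φ x := fun a =>
    ((hbdi a).1.const_mul _).mono' ((hg.measurable.comp (measurable_sub_const a)).mul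
      hφ).aestronglyMeasurable (Eventually.of_forall (hgφ a))
  have htr : ∀ a : Vel, (fun y => g y * φ (a + y)) = fun y => (fun x => g (x - a) * φ x) (y + a) := by
    intro a
    funext y
    simp only [add_sub_cancel_right, add_comm a y]
  have e1 : ∫ y, g y * (φ (a + y) - φ (c + y)) = ∫ x, (g (x - a) - g (x - c)) * φ x := by
    have hi : ∀ a, Integrable fun y => g y * φ (a + y) := fun a => by
      rw [htr]; exact (hint a).comp_add_right a
    have hv : ∀ a, ∫ y, g y * φ (a + y) = ∫ x, g (x - a) * φ x := fun a => by
      rw [htr, integral_add_right_eq_self (fun x => g (x - a) * φ x) a]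
    simp only [mul_sub, sub_mul]
    rw [integral_sub (hi a) (hi c), integral_sub (hint a) (hint c), hv, hv]
  have hpt : ∀ x, |(g (x - a) - g (x - c)) * φ x| ≤ E * (bd a x + bd c x) := by
    intro x
    have h1 : |g (x - a) - g (x - c)| ≤ B / mollVol n * ‖a - c‖ := by
      have := hgl (x - a) (x - c)
      rwa [sub_sub_sub_cancel_left, norm_sub_rev] at this
    have h2 : |g (x - a) - g (x - c)| ≤ B / mollVol n * (2 * η) := by
      refine (abs_sub _ _).trans ?_
      linarith [hgb (x - a), hgb (x - c)]
    have h3 : |g (x - a) - g (x - c)| ≤ E := by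
      have hBV : 0 ≤ B / mollVol n := by positivity
      rcases le_total ‖a - c‖ η with h | h
      · refine h1.trans ?_
        have : ‖a - c‖ ≤ η ^ (1 - p) * ‖a - c‖ ^ p := by
          rcases (norm_nonneg (a - c)).eq_or_lt with h0 | h0
          · rw [← h0]; positivity
          calc ‖a - c‖ = ‖a - c‖ ^ (1 - p) * ‖a - c‖ ^ p := by
                rw [← Real.rpow_add h0, sub_add_cancel, Real.rpow_one]
            _ ≤ _ := by
                gcongr
        calc B / mollVol n * ‖a - c‖ ≤ B / mollVol n * (η ^ (1 - p) * ‖a - c‖ ^ p) := by gcongr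
          _ ≤ E := by
            have : 0 ≤ B / mollVol n * (η ^ (1 - p) * ‖a - c‖ ^ p) := by positivity
            rw [hE]; linarith
      · refine h2.trans ?_
        have : η ≤ η ^ (1 - p) * ‖a - c‖ ^ p := by
          calc η = η ^ (1 - p) * η ^ p := by
                rw [← Real.rpow_add hη0, sub_add_cancel, Real.rpow_one]
            _ ≤ _ := by gcongr
        calc B / mollVol n * (2 * η) ≤ B / mollVol n * (2 * (η ^ (1 - p) * ‖a - c‖ ^ p)) := by gcongr
          _ = E := by rw [hE]; ring
    by_cases hx : x ∈ Metric.closedBall a η ∪ Metric.closedBall c η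
    · rw [abs_mul]
      refine mul_le_mul h3 ?_ (abs_nonneg _) hE0
      rcases hx with hx | hx
      · refine (hbdd a x hx).trans ?_
        have : bd a x = D * 2 ^ k * jap a ^ k := indicator_of_mem hx _
        linarith [hbd0 c x]
      · refine (hbdd c x hx).trans ?_
        have : bd c x = D * 2 ^ k * jap c ^ k := indicator_of_mem hx _
        linarith [hbd0 a x]
    · rw [mem_union, not_or] at hx
      rw [hg0 _ (not_le.1 fun h => hx.1 ((hmem a x).2 h)),
        hg0 _ (not_le.1 fun h => hx.2 ((hmem c x).2 h)), sub_zero, zero_mul, abs_zero]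
      exact mul_nonneg hE0 (add_nonneg (hbd0 a x) (hbd0 c x))
  rw [e1]
  refine (norm_integral_le_of_norm_le (f := fun x => (g (x - a) - g (x - c)) * φ x)
    (((hbdi a).1.add (hbdi c).1).const_mul E)
    (Eventually.of_forall hpt)).trans_eq ?_
  rw [integral_const_mul]
  have : ∫ x, (bd a + bd c) x = mollVol n * (D * 2 ^ k * jap a ^ k) +
      mollVol n * (D * 2 ^ k * jap c ^ k) := by
    rw [← (hbdi a).2, ← (hbdi c).2]
    exact integral_add (hbdi a).1 (hbdi c).1
  rw [this, hE]
  field_simp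

end Smear

theorem abs_maxw_add_sub_le (w : Vel) {x y : Vel} (hx : ‖x‖ ≤ 1) (hy : ‖y‖ ≤ 1) :
    |maxw (w + x) - maxw (w + y)| ≤
      4 * maxwConst * Real.exp (1 / 4) * gauss (1 / 8) w * ‖x - y‖ := by
  have h := gaussLip_maxw.lip (w + x) (w + y)
  rw [add_sub_add_left_eq_sub] at h
  have h1 := gauss_add_le (c := 1 / 4) (by norm_num) w hx
  have h2 := gauss_add_le (c := 1 / 4) (by norm_num) w hy
  rw [show (1 / 4 / 2 : ℝ) = 1 / 8 by norm_num] at h1 h2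
  have h3 := maxwConst_pos
  refine h.trans ?_
  calc 2 * maxwConst * (‖x - y‖ * (gauss (1 / 4) (w + x) + gauss (1 / 4) (w + y)))
      ≤ 2 * maxwConst * (‖x - y‖ * (Real.exp (1 / 4) * gauss (1 / 8) w +
        Real.exp (1 / 4) * gauss (1 / 8) w)) := by gcongr
    _ = _ := by ring

/-- The commutator of mollification with the multiplication by the Maxwellian, against increments. -/
theorem exists_abs_integral_moll_commutator_le : ∃ A, 0 ≤ A ∧ ∀ (k p D : ℝ) (φ : Vel → ℝ) (n : ℕ)
    (w a c : Vel), Measurable φ → 0 ≤ k → (∀ y, |φ y| ≤ D * jap y ^ k) → 0 ≤ p → p ≤ 1 →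
    |∫ y, moll n y * (maxw (w + y) - maxw w) * (φ (a + y) - φ (c + y))| ≤
      A * 2 ^ k * D * mollRadius n ^ (1 - p) * gauss (1 / 8) w * ‖a - c‖ ^ p *
        (jap a ^ k + jap c ^ k) := by
  obtain ⟨L, hL0, hL⟩ := exists_moll_lip
  have hm := maxwConst_pos
  set M := 4 * maxwConst * Real.exp (1 / 4) with hM
  have hM0 : 0 ≤ M := by positivity
  refine ⟨2 * ((8 + L) * M), by positivity, fun k p D φ n w a c hφ hk hφD hp hp1 => ?_⟩
  set η := mollRadius n with hη
  have hη0 : 0 < η := mollRadius_pos n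
  have hη1 : η ≤ 1 := mollRadius_le_one n
  have hV := mollVol_pos n
  set G := gauss (1 / 8) w with hG
  have hG0 : 0 < G := gauss_pos _ _
  set g : Vel → ℝ := fun y => moll n y * (maxw (w + y) - maxw w) with hg
  have hmb : ∀ y, ‖y‖ ≤ η → |maxw (w + y) - maxw w| ≤ M * G * η := by
    intro y hy
    have h := abs_maxw_add_sub_le w (hy.trans hη1) (y := 0) (by simp)
    rw [add_zero, sub_zero] at h
    exact h.trans (by gcongr)
  have hg0 : ∀ y, η < ‖y‖ → g y = 0 := fun y hy => by
    simp only [hg]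
    rw [moll_eq_zero hy.le, zero_mul]
  have hgb : ∀ y, |g y| ≤ (8 + L) * M * G / mollVol n * η := by
    intro y
    rcases le_or_gt ‖y‖ η with hy | hy
    · simp only [hg]
      rw [abs_mul, abs_of_nonneg (moll_nonneg n y)]
      calc moll n y * |maxw (w + y) - maxw w| ≤ 8 / mollVol n * (M * G * η) :=
            mul_le_mul (moll_le n y) (hmb y hy) (abs_nonneg _) (by positivity)
        _ ≤ (8 + L) / mollVol n * (M * G * η) := by gcongr; linarith
        _ = _ := by ring
    · rw [hg0 y hy, abs_zero]; positivity
  have hle : ∀ x y, ‖x‖ ≤ η → |g x - g y| ≤ (8 + L) * M * G / mollVol n * ‖x - y‖ := by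
    intro x y hx
    have hmy : |moll n y * (maxw (w + x) - maxw (w + y))| ≤
        8 / mollVol n * (M * G * ‖x - y‖) := by
      rw [abs_mul, abs_of_nonneg (moll_nonneg n y)]
      rcases le_or_gt ‖y‖ η with hy | hy
      · exact mul_le_mul (moll_le n y) (abs_maxw_add_sub_le w (hx.trans hη1) (hy.trans hη1))
          (abs_nonneg _) (by positivity)
      · rw [moll_eq_zero hy.le, zero_mul]; positivity
    have e : g x - g y = (moll n x - moll n y) * (maxw (w + x) - maxw w) +
        moll n y * (maxw (w + x) - maxw (w + y)) := by simp only [hg]; ring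
    rw [e]
    refine (abs_add_le _ _).trans ?_
    have h1 : |(moll n x - moll n y) * (maxw (w + x) - maxw w)| ≤
        L / (mollVol n * η) * ‖x - y‖ * (M * G * η) := by
      rw [abs_mul]
      exact mul_le_mul (hL n x y) (hmb x hx) (abs_nonneg _) (by positivity)
    refine (add_le_add h1 hmy).trans_eq ?_
    field_simp
    ring
  have hgl : ∀ x y, |g x - g y| ≤ (8 + L) * M * G / mollVol n * ‖x - y‖ := by
    intro x y
    rcases le_or_gt ‖x‖ η with hx | hx
    · exact hle x y hx
    rcases le_or_gt ‖y‖ η with hy | hy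
    · rw [abs_sub_comm, norm_sub_rev]
      exact hle y x hy
    · rw [hg0 x hx, hg0 y hy, sub_zero, abs_zero]; positivity
  have hgc : Continuous g := (continuous_moll n).mul
    ((continuous_maxw.comp (continuous_const.add continuous_id)).sub continuous_const)
  refine (abs_integral_mul_increment_le hφ hk hφD (by positivity) hgc hg0 hgb hgl hp hp1 a c).trans_eq ?_
  ring

end Boltzmann
end

noncomputable section
namespace Boltzmann

/-! ### Commutation of mollification with the dual operator -/

/-- The dual of the collision operator with angular kernel `κ`. -/
def grazDual (γ : ℝ) (κ : ℝ → ℝ) (φ : Vel → ℝ) (v : Vel) : ℝ :=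
  ∫ z, maxw z.1 * (‖v - z.1‖ ^ γ * κ (cosDev v z.1 z.2)) * dualGraz φ v z ∂collMeasure

theorem post_add (v w y : Vel) (σ : Sph) : post (v + y) (w + y) σ = post v w σ + y := by
  simp only [post, add_sub_add_right_eq_sub]
  module

theorem postStar_add (v w y : Vel) (σ : Sph) :
    postStar (v + y) (w + y) σ = postStar v w σ + y := by
  simp only [postStar, add_sub_add_right_eq_sub]
  module

theorem cosDev_add (v w y : Vel) (σ : Sph) : cosDev (v + y) (w + y) σ = cosDev v w σ := by
  simp only [cosDev, add_sub_add_right_eq_sub]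

theorem integral_collMeasure_translate (F : Vel × Sph → ℝ) (y : Vel) :
    ∫ z, F (z.1 + y, z.2) ∂collMeasure = ∫ z, F z ∂collMeasure := by
  have h : MeasurePreserving (Prod.map (· + y) id) collMeasure collMeasure :=
    (measurePreserving_add_right volume y).prod (MeasurePreserving.id surf)
  exact h.integral_comp
    ((MeasurableEquiv.addRight y).prodCongr (MeasurableEquiv.refl Sph)).measurableEmbedding F

theorem grazDual_add (γ : ℝ) (κ : ℝ → ℝ) (φ : Vel → ℝ) (v y : Vel) :
    grazDual γ κ φ (v + y) = ∫ z, maxw (z.1 + y) * (‖v - z.1‖ ^ γ * κ (cosDev v z.1 z.2)) *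
      dualGraz (fun x => φ (x + y)) v z ∂collMeasure := by
  rw [grazDual, ← integral_collMeasure_translate _ y]
  simp only [add_sub_add_right_eq_sub, cosDev_add, dualGraz, post_add, postStar_add]

section

variable {φ : Vel → ℝ} {D k : ℝ}

theorem jap_rpow_le_mul_left (hk : 0 ≤ k) (v w : Vel) : jap v ^ k ≤ jap v ^ k * jap w ^ k :=
  le_mul_of_one_le_right (jap_rpow_pos v k).le (one_le_jap_rpow w hk)

theorem jap_rpow_le_mul_right (hk : 0 ≤ k) (v w : Vel) : jap w ^ k ≤ jap v ^ k * jap w ^ k :=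
  le_mul_of_one_le_left (jap_rpow_pos w k).le (one_le_jap_rpow v hk)

theorem abs_dualGraz_le (hk : 0 ≤ k) (hφD : ∀ y, |φ y| ≤ D * jap y ^ k) (v w : Vel) (σ : Sph) :
    |dualGraz φ v (w, σ)| ≤ 4 * D * (jap v ^ k * jap w ^ k) := by
  have hD := nonneg_of_abs_le_jap hφD
  have h1 := (hφD (post v w σ)).trans (mul_le_mul_of_nonneg_left (jap_post_rpow_le v w σ hk) hD)
  have h2 := (hφD (postStar v w σ)).trans
    (mul_le_mul_of_nonneg_left (jap_postStar_rpow_le v w σ hk) hD)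
  have h3 := (hφD v).trans (mul_le_mul_of_nonneg_left (jap_rpow_le_mul_left hk v w) hD)
  have h4 := (hφD w).trans (mul_le_mul_of_nonneg_left (jap_rpow_le_mul_right hk v w) hD)
  rw [abs_le] at h1 h2 h3 h4
  simp only [dualGraz]
  rw [abs_le]
  constructor <;> linarith

theorem measurable_dualGraz (hφ : Measurable φ) (v : Vel) : Measurable (dualGraz φ v) :=
  (((hφ.comp (measurable_post_right v)).sub measurable_const).add
    (hφ.comp (measurable_postStar_right v))).sub (hφ.comp measurable_fst)

theorem dualGraz_smear (hφ : Measurable φ) (hk : 0 ≤ k) (hφD : ∀ y, |φ y| ≤ D * jap y ^ k)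
    (n : ℕ) (v : Vel) (z : Vel × Sph) :
    Integrable (fun y => moll n y * dualGraz (fun x => φ (x + y)) v z) ∧
    dualGraz (smear n φ) v z = ∫ y, moll n y * dualGraz (fun x => φ (x + y)) v z := by
  have hi := integrable_moll_mul hφ hk hφD n
  have i1 := (hi (post v z.1 z.2)).sub (hi v)
  have i2 := i1.add (hi (postStar v z.1 z.2))
  have e : (fun y => moll n y * dualGraz (fun x => φ (x + y)) v z) = fun y =>
      ((fun y => moll n y * φ (post v z.1 z.2 + y)) - (fun y => moll n y * φ (v + y)) +
      fun y => moll n y * φ (postStar v z.1 z.2 + y)) y - moll n y * φ (z.1 + y) := by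
    funext y
    simp only [dualGraz, Pi.add_apply, Pi.sub_apply]
    ring
  rw [e]
  refine ⟨i2.sub (hi z.1), ?_⟩
  rw [integral_sub i2 (hi z.1), integral_add' i1 (hi _), integral_sub' (hi _) (hi _)]
  rfl

theorem abs_mollified_dualGraz_le (hk : 0 ≤ k) (hφD : ∀ y, |φ y| ≤ D * jap y ^ k) (n : ℕ)
    (v w y : Vel) (σ : Sph) :
    |moll n y * dualGraz (fun x => φ (x + y)) v (w, σ)| ≤
      moll n y * (4 * (D * 2 ^ k) * (jap v ^ k * jap w ^ k)) := by
  by_cases h : moll n y = 0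
  · simp [h]
  rw [abs_mul, abs_of_nonneg (moll_nonneg n y)]
  exact mul_le_mul_of_nonneg_left (abs_dualGraz_le hk
    (fun x => abs_le_of_moll_ne_zero hk hφD x h) v w σ) (moll_nonneg n y)

theorem Cutoff.integrable_mollified {κ : ℝ → ℝ} (hκ : Cutoff κ) {γ : ℝ} (hγ : 0 ≤ γ)
    (hφ : Measurable φ) (hk : 0 ≤ k) (hφD : ∀ y, |φ y| ≤ D * jap y ^ k) (n : ℕ) (v : Vel) :
    Integrable (fun x : Vel × Vel × Sph => moll n x.1 * (maxw (x.2.1 + x.1) *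
      (‖v - x.2.1‖ ^ γ * κ (cosDev v x.2.1 x.2.2)) *
        dualGraz (fun u => φ (u + x.1)) v x.2)) (volume.prod collMeasure) := by
  have hD := nonneg_of_abs_le_jap hφD
  have hm := maxwConst_pos
  have hw := (hκ.weighted (H := fun w => gauss (1 / 8) w * jap w ^ k) hγ
    (fun w => mul_nonneg (gauss_pos _ w).le (jap_rpow_pos w k).le)
    ((measurable_gauss _).mul (measurable_jap.pow_const k)) (by
      refine (integrable_jap_rpow_mul_gauss (k + γ) (c := 1 / 8) (by norm_num)).congr
        (Eventually.of_forall fun w => ?_)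
      simp only
      rw [Real.rpow_add (jap_pos w)]; ring) v).1
  have hb := (integrable_moll n).mul_prod (hw.const_mul
    (2 * maxwConst * Real.exp (1 / 4) * (4 * (D * 2 ^ k) * jap v ^ k)))
  refine hb.mono' ?_ (Eventually.of_forall ?_)
  · have m2 : Measurable fun x : Vel × Vel × Sph => (v, x.2.1, x.2.2) :=
      measurable_const.prodMk measurable_snd
    have mw : Measurable fun x : Vel × Vel × Sph => x.2.1 := measurable_fst.comp measurable_snd
    refine Measurable.aestronglyMeasurable (((continuous_moll n).measurable.comp measurable_fst).mul
      (((measurable_maxw.comp (mw.add measurable_fst)).mul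
        (((measurable_const.sub mw).norm.pow_const γ).mul (hκ.measurable.comp
          (measurable_cosDev.comp m2)))).mul ?_))
    exact (((hφ.comp ((measurable_post.comp m2).add measurable_fst)).sub
      (hφ.comp (measurable_const.add measurable_fst))).add
      (hφ.comp ((measurable_postStar.comp m2).add measurable_fst))).sub
      (hφ.comp (mw.add measurable_fst))
  · rintro ⟨y, w, σ⟩
    simp only
    by_cases h : moll n y = 0
    · simp [h]
    have hy := (norm_le_of_moll_ne_zero h).trans (mollRadius_le_one n)
    have h1 : maxw (w + y) ≤ 2 * maxwConst * Real.exp (1 / 4) * gauss (1 / 8) w := by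
      have e1 := (le_abs_self _).trans (gaussLip_maxw.bound (w + y))
      have e2 := gauss_add_le (c := 1 / 4) (by norm_num) w hy
      rw [show (1 / 4 / 2 : ℝ) = 1 / 8 by norm_num] at e2
      refine e1.trans ?_
      rw [mul_assoc (2 * maxwConst)]
      gcongr
    have h2 := abs_mollified_dualGraz_le hk hφD n v w y σ
    have h3 : 0 ≤ ‖v - w‖ ^ γ * κ (cosDev v w σ) :=
      mul_nonneg (Real.rpow_nonneg (norm_nonneg _) _) (hκ.nonneg _)
    rw [show moll n y * (maxw (w + y) * (‖v - w‖ ^ γ * κ (cosDev v w σ)) *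
        dualGraz (fun u => φ (u + y)) v (w, σ)) = maxw (w + y) *
        ((‖v - w‖ ^ γ * κ (cosDev v w σ)) * (moll n y * dualGraz (fun u => φ (u + y)) v (w, σ)))
      by ring, Real.norm_eq_abs, abs_mul, abs_mul, abs_of_pos (maxw_pos _), abs_of_nonneg h3]
    have h4 : 0 ≤ ‖v - w‖ ^ γ * κ (cosDev v w σ) *
        |moll n y * dualGraz (fun u => φ (u + y)) v (w, σ)| := mul_nonneg h3 (abs_nonneg _)
    refine (mul_le_mul h1 (mul_le_mul_of_nonneg_left h2 h3) h4
      (by have := gauss_pos (1 / 8) w; positivity)).trans_eq ?_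
    ring

/-- Mollification commutes with the dual operator up to a small error, uniformly in the cutoff. -/
theorem exists_abs_mollify_grazDual_sub_le {p γ : ℝ} (hk : 0 ≤ k) (hp : 0 ≤ p) (hp1 : p ≤ 1)
    (hγ : 0 ≤ γ) (hγp : γ + p ≤ 2) : ∃ C, 0 ≤ C ∧ ∀ (κ : ℝ → ℝ), Cutoff κ → ∀ (D : ℝ) (φ : Vel → ℝ)
    (n : ℕ) (v : Vel), Measurable φ → (∀ y, |φ y| ≤ D * jap y ^ k) →
    |(∫ u, moll n (u - v) * grazDual γ κ φ u) - grazDual γ κ (smear n φ) v| ≤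
      C * sphInt (fun x => κ x * hsin x ^ p) * D * mollRadius n ^ (1 - p) * jap v ^ (k + 2) := by
  obtain ⟨A, hA, hcomm⟩ := exists_abs_integral_moll_commutator_le
  have hH0 : ∀ w, 0 ≤ gauss (1 / 8) w * jap w ^ k :=
    fun w => mul_nonneg (gauss_pos _ w).le (jap_rpow_pos w k).le
  have hHm : Measurable fun w => gauss (1 / 8) w * jap w ^ k :=
    (measurable_gauss _).mul (measurable_jap.pow_const k)
  have hHi : Integrable fun w => gauss (1 / 8) w * jap w ^ k * jap w ^ (γ + p) := by
    refine (integrable_jap_rpow_mul_gauss (k + (γ + p)) (c := 1 / 8) (by norm_num)).congr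
      (Eventually.of_forall fun w => ?_)
    simp only
    rw [Real.rpow_add (jap_pos w)]; ring
  set J := ∫ w, gauss (1 / 8) w * jap w ^ k * jap w ^ (γ + p) with hJ
  have hJ0 : 0 ≤ J := integral_nonneg fun w => mul_nonneg (hH0 w) (jap_rpow_pos w _).le
  refine ⟨4 * A * 2 ^ k * (2 ^ (γ + p) * J), by positivity, fun κ hκ D φ n v hφ hφD => ?_⟩
  have hD := nonneg_of_abs_le_jap hφD
  have hη := mollRadius_pos n
  have hκp : Cutoff fun x => κ x * hsin x ^ p :=
    hκ.mul (measurable_hsin.pow_const p) (fun x => Real.rpow_nonneg (hsin_nonneg x) p) (C := 1)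
      fun x hx _ => Real.rpow_le_one (hsin_nonneg x) (hsin_le_one (by linarith)) hp
  set K : Vel × Sph → ℝ := fun z => ‖v - z.1‖ ^ γ * κ (cosDev v z.1 z.2) with hK
  have hK0 : ∀ z, 0 ≤ K z := fun z =>
    mul_nonneg (Real.rpow_nonneg (norm_nonneg _) _) (hκ.nonneg _)
  have hFub := hκ.integrable_mollified hγ hφ hk hφD n v
  have e1 : ∫ u, moll n (u - v) * grazDual γ κ φ u =
      ∫ z, (∫ y, moll n y * (maxw (z.1 + y) * K z * dualGraz (fun u => φ (u + y)) v z))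
        ∂collMeasure := by
    rw [← integral_add_left_eq_self _ v, ← integral_integral_swap (f := fun (y : Vel) (z : Vel × Sph) =>
      moll n y * (maxw (z.1 + y) * K z * dualGraz (fun u => φ (u + y)) v z)) hFub]
    refine integral_congr_ae (Eventually.of_forall fun y => ?_)
    simp only [add_sub_cancel_left]
    rw [grazDual_add, integral_const_mul]
  have hsm : ∀ z : Vel × Sph, maxw z.1 * K z * dualGraz (smear n φ) v z =
      ∫ y, moll n y * (maxw z.1 * K z * dualGraz (fun u => φ (u + y)) v z) := by
    intro z
    rw [(dualGraz_smear hφ hk hφD n v z).2, ← integral_const_mul]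
    refine integral_congr_ae (Eventually.of_forall fun y => ?_)
    simp only
    ring
  have hi2 : Integrable (fun z => maxw z.1 * K z * dualGraz (smear n φ) v z) collMeasure :=
    hκ.integrable_of_le hγ v (measurable_dualGraz (continuous_smear hφ hφD n).measurable v)
      (C := 4 * (D * 2 ^ k) * jap v ^ k) (q := k) fun w σ =>
        (abs_dualGraz_le hk (fun y => abs_smear_le hk hφD n y) v w σ).trans_eq (by ring)
  rw [e1, grazDual, ← integral_sub hFub.integral_prod_right hi2]
  have hmt : ∀ (w y : Vel), |maxw (w + y) - maxw w| ≤ 2 * maxwConst := fun w y => by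
    have h1 : ∀ x, |maxw x| ≤ maxwConst := fun x => by
      rw [abs_of_pos (maxw_pos x), maxw_eq]
      have := gauss_le_one (c := 1 / 2) (by norm_num) x
      nlinarith [maxwConst_pos]
    have := abs_sub (maxw (w + y)) (maxw w)
    linarith [h1 w, h1 (w + y)]
  have hinc : ∀ (w a c : Vel), Integrable fun y =>
      moll n y * (maxw (w + y) - maxw w) * (φ (a + y) - φ (c + y)) := by
    intro w a c
    have h1 := ((integrable_moll_mul hφ hk hφD n a).sub
      (integrable_moll_mul hφ hk hφD n c)).bdd_mul (c := 2 * maxwConst)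
      (((continuous_maxw.comp (continuous_const.add continuous_id)).sub
        continuous_const).aestronglyMeasurable) (Eventually.of_forall (hmt w))
    refine h1.congr (Eventually.of_forall fun y => ?_)
    simp only [Pi.sub_apply, Pi.add_apply, Function.comp, id]
    ring
  have hpt : ∀ z : Vel × Sph,
      |(∫ y, moll n y * (maxw (z.1 + y) * K z * dualGraz (fun u => φ (u + y)) v z)) -
        maxw z.1 * K z * dualGraz (smear n φ) v z| ≤
      4 * A * 2 ^ k * D * mollRadius n ^ (1 - p) * jap v ^ k * (gauss (1 / 8) z.1 * jap z.1 ^ k *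
        (‖v - z.1‖ ^ (γ + p) * (κ (cosDev v z.1 z.2) * hsin (cosDev v z.1 z.2) ^ p))) := by
    rintro ⟨w, σ⟩
    have e2 : (fun y => moll n y * (maxw (w + y) * K (w, σ) *
        dualGraz (fun u => φ (u + y)) v (w, σ))) = fun y => K (w, σ) *
        ((fun y => moll n y * (maxw (w + y) - maxw w) * (φ (post v w σ + y) - φ (v + y))) +
        fun y => moll n y * (maxw (w + y) - maxw w) * (φ (postStar v w σ + y) - φ (w + y))) y +
        maxw w * K (w, σ) * (moll n y * dualGraz (fun u => φ (u + y)) v (w, σ)) := by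
      funext y
      simp only [dualGraz, Pi.add_apply]
      ring
    have j1 := (hinc w (post v w σ) v).add (hinc w (postStar v w σ) w)
    obtain ⟨j2, e3⟩ := dualGraz_smear hφ hk hφD n v (w, σ)
    simp only
    rw [e2, integral_add (j1.const_mul _) (j2.const_mul _), integral_const_mul, integral_const_mul,
      ← e3, add_sub_cancel_right, integral_add' (hinc _ _ _) (hinc _ _ _), abs_mul,
      abs_of_nonneg (hK0 _)]
    have h1 := hcomm k p D φ n w (post v w σ) v hφ hk hφD hp hp1
    have h2 := hcomm k p D φ n w (postStar v w σ) w hφ hk hφD hp hp1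
    rw [norm_post_sub, Real.mul_rpow (norm_nonneg _) (hsin_nonneg _)] at h1
    rw [norm_postStar_sub, Real.mul_rpow (norm_nonneg _) (hsin_nonneg _)] at h2
    have f0 : 0 ≤ A * 2 ^ k * D * mollRadius n ^ (1 - p) * gauss (1 / 8) w *
        (‖v - w‖ ^ p * hsin (cosDev v w σ) ^ p) := by
      have := (gauss_pos (1 / 8) w).le
      have := Real.rpow_nonneg (hsin_nonneg (cosDev v w σ)) p
      positivity
    have h3 := mul_le_mul_of_nonneg_left (add_le_add (jap_post_rpow_le v w σ hk)
      (jap_rpow_le_mul_left hk v w)) f0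
    have h4 := mul_le_mul_of_nonneg_left (add_le_add (jap_postStar_rpow_le v w σ hk)
      (jap_rpow_le_mul_right hk v w)) f0
    refine (mul_le_mul_of_nonneg_left ((abs_add_le _ _).trans (add_le_add (h1.trans h3)
      (h2.trans h4))) (hK0 _)).trans_eq ?_
    rw [Real.rpow_add_of_nonneg (norm_nonneg _) hγ hp]
    simp only [hK]
    ring
  obtain ⟨hbi, -⟩ := hκp.weighted (add_nonneg hγ hp) hH0 hHm hHi v
  have hbl := hκp.weighted_le (add_nonneg hγ hp) hγp hH0 hHm hHi v
  refine (norm_integral_le_of_norm_le (f := fun z => (∫ y, moll n y *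
    (maxw (z.1 + y) * K z * dualGraz (fun u => φ (u + y)) v z)) -
    maxw z.1 * K z * dualGraz (smear n φ) v z) (hbi.const_mul
    (4 * A * 2 ^ k * D * mollRadius n ^ (1 - p) * jap v ^ k)) (Eventually.of_forall hpt)).trans ?_
  rw [integral_const_mul]
  have hv := jap_rpow_pos v k
  refine (mul_le_mul_of_nonneg_left hbl (by positivity)).trans_eq ?_
  rw [Real.rpow_add (jap_pos v)]
  ring

end

end Boltzmann
end

noncomputable section
namespace Boltzmann

/-! ### Uniqueness for the dual problem -/

section

variable {s cb γ ε k : ℝ} {b : ℝ → ℝ} {δ : ℝ} {Θ : Vel → Vel → Sph → ℝ}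

theorem norm_post_sub_le (v w : Vel) (σ : Sph) : ‖post v w σ - v‖ ≤ ‖v - w‖ := by
  rw [norm_post_sub]
  exact mul_le_of_le_one_right (norm_nonneg _) (hsin_le_one (neg_one_le_cosDev v w σ))

theorem norm_postStar_sub_left_le (v w : Vel) (σ : Sph) : ‖postStar v w σ - v‖ ≤ ‖v - w‖ := by
  rw [norm_postStar_sub_left]
  exact mul_le_of_le_one_right (norm_nonneg _) (hcos_le_one (cosDev_le_one v w σ))

theorem norm_le_of_norm_sub_le {v u : Vel} {R : ℝ} (h1 : ‖u‖ ≤ R) (h2 : ‖u - v‖ ≤ R) :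
    ‖v‖ ≤ 2 * R := by
  have := norm_sub_le u (u - v)
  rw [sub_sub_cancel] at this
  linarith

theorem IsTruncation.theta_eq_zero (hΘ : IsTruncation ε Θ) {v : Vel} (hv : 4 * ε⁻¹ < ‖v‖)
    (z : Vel × Sph) : thetaPost Θ v z = 0 ∧ thetaPostStar Θ v z = 0 ∧ thetaSwap Θ v z = 0 := by
  refine ⟨?_, ?_, ?_⟩ <;> by_contra hne
  · obtain ⟨h1, -, h2, -⟩ := hΘ.supp _ _ _ hne
    rw [norm_post_sub_postStar] at h2
    linarith [norm_le_of_norm_sub_le h1 ((norm_post_sub_le v z.1 z.2).trans h2)]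
  · obtain ⟨h1, -, h2, -⟩ := hΘ.supp _ _ _ hne
    rw [norm_sub_rev, norm_post_sub_postStar] at h2
    linarith [norm_le_of_norm_sub_le h1 ((norm_postStar_sub_left_le v z.1 z.2).trans h2)]
  · obtain ⟨h1, -, h2, -⟩ := hΘ.supp _ _ _ hne
    linarith [norm_le_of_norm_sub_le h1 h2]

theorem Cutoff.exists_abs_dualOp_sub_le {β' : ℝ → ℝ} (hβ' : Cutoff β') (hγ : 0 ≤ γ) {q : ℝ}
    (hq : 0 ≤ q) (hΘ : IsTruncation ε Θ) (hε : 0 < ε) :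
    ∃ C, 0 ≤ C ∧ ∀ (β : ℝ → ℝ) (M : ℝ) (φ : Vel → ℝ) (v : Vel), Measurable φ →
      (∀ y, |φ y| ≤ M * jap y ^ q) →
      |dualOp γ β β' (thetaPost Θ v) (thetaPostStar Θ v) (thetaSwap Θ v) φ v -
        (grazDual γ β φ v + grazDual γ β' φ v)| ≤ C * M := by
  have hH0 : ∀ w, 0 ≤ maxw w * jap w ^ q := fun w => mul_nonneg (maxw_pos w).le (jap_rpow_pos w q).le
  have hHm : Measurable fun w => maxw w * jap w ^ q :=
    measurable_maxw.mul (measurable_jap.pow_const q)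
  have hHi : Integrable fun w => maxw w * jap w ^ q * jap w ^ γ := by
    refine (integrable_maxw_mul_jap (q + γ)).congr (Eventually.of_forall fun w => ?_)
    simp only
    rw [Real.rpow_add (jap_pos w)]; ring
  set J := ∫ w, maxw w * jap w ^ q * jap w ^ γ with hJ
  have hJ0 : 0 ≤ J := integral_nonneg fun w => mul_nonneg (hH0 w) (jap_rpow_pos w _).le
  have hS0 : 0 ≤ sphInt β' := sphInt_nonneg fun x _ _ => hβ'.nonneg x
  set R := 1 + 4 * ε⁻¹ with hR
  have hR0 : 0 < R := by positivity
  refine ⟨3 * R ^ q * (2 ^ γ * J * sphInt β' * R ^ γ), by positivity, fun β M φ v hφ hφM => ?_⟩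
  have hM := nonneg_of_abs_le_jap hφM
  set d : Vel × Sph → ℝ := fun z => thetaSwap Θ v z * φ z.1 -
    thetaPost Θ v z * φ (post v z.1 z.2) - thetaPostStar Θ v z * φ (postStar v z.1 z.2) with hd
  have a1 := hΘ.isAlmostOne_post hε v
  have a2 := hΘ.isAlmostOne_postStar hε v
  have a3 := hΘ.isAlmostOne_swap v
  have hdm : Measurable d := ((a3.measurable.mul (hφ.comp measurable_fst)).sub
    (a1.measurable.mul (hφ.comp (measurable_post_right v)))).sub
    (a2.measurable.mul (hφ.comp (measurable_postStar_right v)))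
  have hdb : ∀ w σ, |d (w, σ)| ≤ 3 * M * jap v ^ q * jap w ^ q := by
    intro w σ
    have e1 := mul_le_of_abs_le (a1.nonneg (w, σ)) (a1.le_one (w, σ)) ((hφM (post v w σ)).trans
      (mul_le_mul_of_nonneg_left (jap_post_rpow_le v w σ hq) hM))
    have e2 := mul_le_of_abs_le (a2.nonneg (w, σ)) (a2.le_one (w, σ)) ((hφM (postStar v w σ)).trans
      (mul_le_mul_of_nonneg_left (jap_postStar_rpow_le v w σ hq) hM))
    have e3 := mul_le_of_abs_le (a3.nonneg (w, σ)) (a3.le_one (w, σ)) ((hφM w).trans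
      (mul_le_mul_of_nonneg_left (jap_rpow_le_mul_right hq v w) hM))
    rw [abs_le] at e1 e2 e3 ⊢
    simp only [hd]
    constructor <;> linarith
  have hdi := hβ'.integrable_of_le hγ v hdm hdb
  have hgi := hβ'.integrable_of_le hγ v (measurable_dualGraz hφ v) (C := 4 * M * jap v ^ q) (q := q)
    fun w σ => (abs_dualGraz_le hq hφM v w σ).trans_eq (by ring)
  have e : dualOp γ β β' (thetaPost Θ v) (thetaPostStar Θ v) (thetaSwap Θ v) φ v -
      (grazDual γ β φ v + grazDual γ β' φ v) =
      ∫ z, maxw z.1 * (‖v - z.1‖ ^ γ * β' (cosDev v z.1 z.2)) * d z ∂collMeasure := by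
    have e1 : ∀ z : Vel × Sph, maxw z.1 * (‖v - z.1‖ ^ γ * β' (cosDev v z.1 z.2)) *
        dualRem (thetaPost Θ v) (thetaPostStar Θ v) (thetaSwap Θ v) φ v z =
        maxw z.1 * (‖v - z.1‖ ^ γ * β' (cosDev v z.1 z.2)) * dualGraz φ v z +
        maxw z.1 * (‖v - z.1‖ ^ γ * β' (cosDev v z.1 z.2)) * d z := fun z => by
      simp only [dualRem, dualGraz, hd]; ring
    rw [dualOp, integral_congr_ae (Eventually.of_forall e1), integral_add hgi hdi, grazDual, grazDual]
    ring
  rw [e]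
  rcases lt_or_ge (4 * ε⁻¹) ‖v‖ with hv | hv
  · have : ∀ z, d z = 0 := fun z => by
      obtain ⟨t1, t2, t3⟩ := hΘ.theta_eq_zero hv z
      simp only [hd, t1, t2, t3]; ring
    simp only [this, mul_zero, integral_zero, abs_zero]
    positivity
  have hjv : jap v ≤ R := (jap_le_one_add_norm v).trans (by rw [hR]; linarith)
  obtain ⟨hwi, -⟩ := hβ'.weighted hγ hH0 hHm hHi v
  have hwl := hβ'.weighted_le hγ le_rfl hH0 hHm hHi v
  refine (norm_integral_le_of_norm_le
    (f := fun z => maxw z.1 * (‖v - z.1‖ ^ γ * β' (cosDev v z.1 z.2)) * d z) (hwi.const_mul (3 * M * jap v ^ q))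
    (Eventually.of_forall fun z => ?_)).trans ?_
  · have h0 : 0 ≤ maxw z.1 * (‖v - z.1‖ ^ γ * β' (cosDev v z.1 z.2)) :=
      mul_nonneg (maxw_pos _).le (mul_nonneg (Real.rpow_nonneg (norm_nonneg _) _) (hβ'.nonneg _))
    rw [Real.norm_eq_abs, abs_mul, abs_of_nonneg h0]
    refine (mul_le_mul_of_nonneg_left (hdb z.1 z.2) h0).trans_eq ?_
    ring
  · rw [integral_const_mul]
    have h1 : jap v ^ q ≤ R ^ q := Real.rpow_le_rpow (jap_nonneg v) hjv hq
    have h2 : jap v ^ γ ≤ R ^ γ := Real.rpow_le_rpow (jap_nonneg v) hjv hγ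
    have h3 := jap_rpow_pos v q
    calc 3 * M * jap v ^ q * _ ≤ 3 * M * jap v ^ q * (2 ^ γ * J * sphInt β' * jap v ^ γ) :=
          mul_le_mul_of_nonneg_left hwl (by positivity)
      _ ≤ 3 * M * R ^ q * (2 ^ γ * J * sphInt β' * R ^ γ) := by
          have := jap_rpow_pos v γ
          gcongr
      _ = _ := by ring

theorem Cutoff.integrable_moll_mul_grazDual {κ : ℝ → ℝ} (hκ : Cutoff κ) (hγ : 0 ≤ γ) {φ : Vel → ℝ}
    {D : ℝ} (hφ : Measurable φ) (hk : 0 ≤ k) (hφD : ∀ y, |φ y| ≤ D * jap y ^ k) (n : ℕ) (v : Vel) :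
    Integrable fun u => moll n (u - v) * grazDual γ κ φ u := by
  have h := (hκ.integrable_mollified hγ hφ hk hφD n v).integral_prod_left
  have e : (fun u => moll n (u - v) * grazDual γ κ φ u) =
      fun u => (fun y => moll n y * grazDual γ κ φ (v + y)) (u - v) := by
    funext u
    simp only [add_sub_cancel]
  rw [e]
  have h' : Integrable fun y => moll n y * grazDual γ κ φ (v + y) := by
    refine h.congr (Eventually.of_forall fun y => ?_)
    simp only
    rw [grazDual_add, integral_const_mul]
  exact h'.comp_sub_right v

theorem integral_moll_sub (n : ℕ) (v : Vel) : ∫ u, moll n (u - v) = 1 := by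
  rw [integral_sub_right_eq_self (moll n) v, integral_moll]

theorem integrable_moll_sub (n : ℕ) (v : Vel) : Integrable fun u => moll n (u - v) :=
  (integrable_moll n).comp_sub_right v

theorem integral_mul_moll_sub (n : ℕ) (v : Vel) (φ : Vel → ℝ) :
    ∫ u, φ u * moll n (u - v) = smear n φ v := by
  rw [smear, ← integral_add_left_eq_self _ v]
  refine integral_congr_ae (Eventually.of_forall fun y => ?_)
  simp only [add_sub_cancel_left]
  ring

theorem dualOp_zero (γ : ℝ) (β β' : ℝ → ℝ) (φ : Vel → ℝ) (v : Vel) :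
    dualOp γ β β' 0 0 0 φ v = grazDual γ β φ v + grazDual γ β' φ v := by
  rw [dualOp, grazDual, grazDual]
  congr 1
  refine integral_congr_ae (Eventually.of_forall fun z => ?_)
  simp only [dualRem, dualGraz, Pi.zero_apply]
  ring

theorem grazDual_const_mul (γ : ℝ) (κ : ℝ → ℝ) (c : ℝ) (φ : Vel → ℝ) (v : Vel) :
    grazDual γ κ (fun y => c * φ y) v = c * grazDual γ κ φ v := by
  rw [grazDual, grazDual, ← integral_const_mul]
  refine integral_congr_ae (Eventually.of_forall fun z => ?_)
  simp only [dualGraz]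
  ring

/-- The bound for the dual operator at maximum points, relative to the weight `⟨v⟩^q`. -/
def DualBound (γ q C₀ : ℝ) (b : ℝ → ℝ) (δ : ℝ) : Prop :=
  0 ≤ C₀ ∧ ∀ β, Cutoff β → (∀ x, β x ≤ bGraz (core b) δ x) → ∀ v φ, Measurable φ →
    (∀ y, |φ y| ≤ jap y ^ q) → φ v = jap v ^ q →
    dualOp γ β (bCut (core b) δ) 0 0 0 φ v ≤ C₀

/-- Weak solutions of the dual resolvent equation. -/
def DualResolvent (b : ℝ → ℝ) (γ δ : ℝ) (Θ : Vel → Vel → Sph → ℝ) (r : ℝ) (φ : Vel → ℝ) : Prop :=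
  ∀ f, IsTest f → r * ∫ v, φ v * f v = ∫ v, φ v * BOp b γ δ Θ f v

theorem DualBound.grazDual_le {q C₀ : ℝ} (hb : DualBound γ q C₀ b δ) {β : ℝ → ℝ} (hβ : Cutoff β)
    (hβb : ∀ x, β x ≤ bGraz (core b) δ x) {φ : Vel → ℝ} (hφ : Measurable φ) {m : ℝ} (hm : 0 < m)
    (hφm : ∀ y, |φ y| ≤ m * jap y ^ q) {v : Vel} (hv : φ v = m * jap v ^ q) :
    grazDual γ β φ v + grazDual γ (bCut (core b) δ) φ v ≤ C₀ * m := by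
  have h := hb.2 β hβ hβb v (fun y => m⁻¹ * φ y) (hφ.const_mul _) (fun y => by
    rw [abs_mul, abs_of_pos (inv_pos.2 hm), inv_mul_le_iff₀ hm]
    exact hφm y) (by rw [hv, inv_mul_cancel_left₀ hm.ne'])
  rw [dualOp_zero, grazDual_const_mul, grazDual_const_mul, ← mul_add, inv_mul_le_iff₀ hm] at h
  linarith

/-- The resolvent equation at a positive maximum of the mollified solution. -/
theorem OperatorData.exists_maximum_estimate (h : OperatorData s cb γ b δ Θ) (hk : 0 ≤ k)
    (hΘ : IsTruncation ε Θ) (hε : 0 < ε) {C₀ : ℝ} (hb : DualBound γ (k + 2) C₀ b δ) :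
    ∃ p : ℝ, p < 1 ∧ ∃ A C₁, 0 ≤ A ∧ 0 ≤ C₁ ∧ ∀ (r D M : ℝ) (φ : Vel → ℝ), Measurable φ →
      (∀ y, |φ y| ≤ D * jap y ^ k) → (∀ y, |φ y| ≤ M * jap y ^ (k + 2)) →
      DualResolvent b γ δ Θ r φ → ∀ (n : ℕ) (m : ℝ) (v : Vel), 0 < m →
      (∀ y, |smear n φ y| ≤ m * jap y ^ (k + 2)) → smear n φ v = m * jap v ^ (k + 2) →
      (r - C₀) * m ≤ C₁ * D * mollRadius n ^ (1 - p) + A * M := by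
  obtain ⟨p, hp2s, hp1⟩ := exists_between (show 2 * s < 1 by linarith [h.s_lt])
  have hp0 : 0 ≤ p := by linarith [h.s_pos]
  have hγ := h.γ_pos.le
  have hγ1 := h.γ_le
  obtain ⟨C, hC, hcomm⟩ := exists_abs_mollify_grazDual_sub_le hk hp0 hp1.le hγ (by linarith)
  obtain ⟨A, hA, hrem⟩ := h.cutoff.exists_abs_dualOp_sub_le hγ (q := k + 2) (by linarith) hΘ hε
  have hcore := h.kernel.sphIntegrable_core h.s_pos h.cb_pos hp2s (by linarith)
  set I := sphInt fun x => core b x * hsin x ^ p with hI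
  have hcore0 := h.kernel.core_nonneg h.cb_pos
  have hI0 : 0 ≤ I := sphInt_nonneg fun x _ _ =>
    mul_nonneg (hcore0 x) (Real.rpow_nonneg (hsin_nonneg x) p)
  have hle : ∀ κ, Cutoff κ → (∀ x, κ x ≤ core b x) → sphInt (fun x => κ x * hsin x ^ p) ≤ I := by
    intro κ hκ hκb
    have hpt : ∀ x, κ x * hsin x ^ p ≤ core b x * hsin x ^ p := fun x =>
      mul_le_mul_of_nonneg_right (hκb x) (Real.rpow_nonneg (hsin_nonneg x) p)
    refine sphInt_mono (hcore.mono (hκ.measurable.mul (measurable_hsin.pow_const p)) fun x _ _ => ?_)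
      hcore fun x _ _ => hpt x
    rw [abs_of_nonneg (mul_nonneg (hκ.nonneg x) (Real.rpow_nonneg (hsin_nonneg x) p))]
    exact hpt x
  refine ⟨p, hp1, A, 2 * (C * I), hA, by positivity,
    fun r D M φ hφ hφD hφM hres n m v hm hmax hv => ?_⟩
  have hD := nonneg_of_abs_le_jap hφD
  have hM := nonneg_of_abs_le_jap hφM
  have hη := mollRadius_pos n
  have hjv := jap_rpow_pos v (k + 2)
  have hj1 := one_le_jap_rpow v (show 0 ≤ k + 2 by linarith)
  set f : Vel → ℝ := fun u => moll n (u - v) with hf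
  have hft : IsTest f := isTest_moll_sub n v
  obtain ⟨Cf, hCf⟩ := exists_gaussLip_of_isTest hft
  have hlim := h.tendsto_dualOp hCf hft.measurable hφ hk hφD
  rw [← hres f hft, integral_mul_moll_sub, hv] at hlim
  have hsm := (continuous_smear hφ hφD n).measurable
  have hbound : ∀ j, ∫ u, f u * dualOp γ (grazTrunc b δ j) (bCut (core b) δ) (thetaPost Θ u)
      (thetaPostStar Θ u) (thetaSwap Θ u) φ u ≤
      C₀ * m + (2 * (C * I) * D * mollRadius n ^ (1 - p) + A * M) * jap v ^ (k + 2) := by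
    intro j
    set β := grazTrunc b δ j with hβdef
    set β' := bCut (core b) δ with hβ'def
    have hβ : Cutoff β := h.cutoff_trunc j
    have hβ' : Cutoff β' := h.cutoff
    have i1 := hβ.integrable_moll_mul_grazDual hγ hφ hk hφD n v
    have i2 := hβ'.integrable_moll_mul_grazDual hγ hφ hk hφD n v
    have i3 := (hβ.weak_form hβ' h.γ_pos hk hft.measurable hCf.bound hφ hφD h.meas h.nonneg
      h.le_one).2.1
    have c1 : ∀ κ, Cutoff κ → (∀ x, κ x ≤ core b x) → ∫ u, f u * grazDual γ κ φ u ≤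
        grazDual γ κ (smear n φ) v + C * I * D * mollRadius n ^ (1 - p) * jap v ^ (k + 2) := by
      intro κ hκ hκb
      have e := (abs_le.1 (hcomm κ hκ D φ n v hφ hφD)).2
      have : C * sphInt (fun x => κ x * hsin x ^ p) * D * mollRadius n ^ (1 - p) * jap v ^ (k + 2) ≤
          C * I * D * mollRadius n ^ (1 - p) * jap v ^ (k + 2) := by
        have := hle κ hκ hκb
        gcongr
      linarith
    have g1 := c1 β hβ fun x => (h.trunc_le j x).trans (h.kernel.bGraz_core_le h.cb_pos δ x)
    have g2 := c1 β' hβ' fun x => by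
      rw [hβ'def, bCut]
      split_ifs
      exacts [le_rfl, hcore0 x]
    have g3 := hb.grazDual_le hβ (h.trunc_le j) hsm hm hmax hv
    have g4 : ∫ u, f u * dualOp γ β β' (thetaPost Θ u) (thetaPostStar Θ u) (thetaSwap Θ u) φ u ≤
        (∫ u, f u * grazDual γ β φ u) + (∫ u, f u * grazDual γ β' φ u) + A * M := by
      have i4 : Integrable fun u => f u * (A * M) := (integrable_moll_sub n v).mul_const _
      have e4 : ∫ u, f u * (A * M) = A * M := by
        rw [integral_mul_const, integral_moll_sub, one_mul]
      have i12 : Integrable fun u => f u * grazDual γ β φ u + f u * grazDual γ β' φ u := i1.add i2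
      rw [← integral_add i1 i2, ← e4, ← integral_add i12 i4]
      refine integral_mono i3 (i12.add i4) fun u => ?_
      have := (abs_le.1 (hrem β M φ u hφ hφM)).2
      have h0 : 0 ≤ f u := moll_nonneg n _
      have := mul_le_mul_of_nonneg_left this h0
      linarith
    have : A * M ≤ A * M * jap v ^ (k + 2) := le_mul_of_one_le_right (by positivity) hj1
    linarith
  have hfin := le_of_tendsto' hlim hbound
  have h1 : C₀ * m ≤ C₀ * m * jap v ^ (k + 2) :=
    le_mul_of_one_le_right (mul_nonneg hb.1 hm.le) hj1
  refine le_of_mul_le_mul_right ?_ hjv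
  linarith

end

end Boltzmann
end

noncomputable section
namespace Boltzmann

section

variable {s cb γ ε k : ℝ} {b : ℝ → ℝ} {δ : ℝ} {Θ : Vel → Vel → Sph → ℝ}

theorem DualResolvent.neg {r : ℝ} {φ : Vel → ℝ} (h : DualResolvent b γ δ Θ r φ) :
    DualResolvent b γ δ Θ r fun y => -φ y := by
  intro f hf
  simp only [neg_mul, integral_neg, mul_neg]
  rw [h f hf]

theorem DualResolvent.congr {r : ℝ} {φ φ' : Vel → ℝ} (h : DualResolvent b γ δ Θ r φ)
    (he : φ =ᵐ[volume] φ') : DualResolvent b γ δ Θ r φ' := by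
  intro f hf
  have e : ∀ g : Vel → ℝ, ∫ v, φ' v * g v = ∫ v, φ v * g v := fun g => by
    refine integral_congr_ae ?_
    filter_upwards [he] with v hv
    rw [hv]
  rw [e, e, h f hf]

theorem tendsto_jap_cocompact : Tendsto jap (cocompact Vel) atTop :=
  tendsto_atTop_mono norm_le_jap tendsto_norm_cocompact_atTop

/-- A function which grows slower than a weight attains its weighted supremum. -/
theorem exists_maximum_weighted {u : Vel → ℝ} (hu : Continuous u) {N q : ℝ} (hkq : k < q)
    (huN : ∀ y, |u y| ≤ N * jap y ^ k) (hne : ∃ y, u y ≠ 0) :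
    ∃ m v, 0 < m ∧ (∀ y, |u y| ≤ m * jap y ^ q) ∧ |u v| = m * jap v ^ q := by
  obtain ⟨x₀, hx₀⟩ := hne
  set g : Vel → ℝ := fun y => |u y| * jap y ^ (-q) with hg
  have hgc : Continuous g := hu.abs.mul (continuous_jap_rpow (-q))
  have hg0 : 0 < g x₀ := mul_pos (abs_pos.2 hx₀) (jap_rpow_pos _ _)
  have hlim : Tendsto (fun y => N * jap y ^ (-(q - k))) (cocompact Vel) (𝓝 0) := by
    have := ((tendsto_rpow_neg_atTop (sub_pos.2 hkq)).comp tendsto_jap_cocompact).const_mul N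
    rwa [mul_zero] at this
  have hev : ∀ᶠ y in cocompact Vel, g y ≤ g x₀ := by
    filter_upwards [hlim.eventually (gt_mem_nhds hg0)] with y hy
    refine le_trans ?_ hy.le
    calc g y ≤ N * jap y ^ k * jap y ^ (-q) :=
          mul_le_mul_of_nonneg_right (huN y) (jap_rpow_pos _ _).le
      _ = _ := by rw [mul_assoc, ← Real.rpow_add (jap_pos y)]; congr 2; ring
  obtain ⟨v, hv⟩ := hgc.exists_forall_ge' x₀ hev
  have he : ∀ y, |u y| = g y * jap y ^ q := fun y => by
    simp only [hg]
    rw [mul_assoc, ← Real.rpow_add (jap_pos y), neg_add_cancel, Real.rpow_zero, mul_one]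
  refine ⟨g v, v, hg0.trans_le (hv x₀), fun y => ?_, he v⟩
  rw [he]
  exact mul_le_mul_of_nonneg_right (hv y) (jap_rpow_pos y q).le

/-- Bounded weak solutions of the dual resolvent equation vanish. -/
theorem OperatorData.exists_forall_ae_eq_zero (h : OperatorData s cb γ b δ Θ) (hk : 0 ≤ k)
    (hΘ : IsTruncation ε Θ) (hε : 0 < ε) {C₀ : ℝ} (hb : DualBound γ (k + 2) C₀ b δ) :
    ∃ r₀, ∀ r, r₀ ≤ r → ∀ (D : ℝ) (φ : Vel → ℝ), Measurable φ → (∀ y, |φ y| ≤ D * jap y ^ k) →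
      DualResolvent b γ δ Θ r φ → ∀ᵐ v, φ v = 0 := by
  obtain ⟨p, hp1, A, C₁, hA, hC₁, hest⟩ := h.exists_maximum_estimate hk hΘ hε hb
  refine ⟨C₀ + 2 * A + 1, fun r hr D φ hφ hφD hres => ?_⟩
  have hstep : ∀ (M : ℝ) (φ : Vel → ℝ), Measurable φ → (∀ y, |φ y| ≤ D * jap y ^ k) →
      (∀ y, |φ y| ≤ M * jap y ^ (k + 2)) → DualResolvent b γ δ Θ r φ →
      ∀ᵐ v, |φ v| ≤ M / 2 * jap v ^ (k + 2) := by
    intro M φ hφ hφD hφM hres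
    have hM := nonneg_of_abs_le_jap hφM
    have hD := nonneg_of_abs_le_jap hφD
    have hbd : ∀ n v, (r - C₀) * |smear n φ v| ≤
        (C₁ * D * mollRadius n ^ (1 - p) + A * M) * jap v ^ (k + 2) := by
      intro n v
      have hη := mollRadius_pos n
      have hjv := jap_rpow_pos v (k + 2)
      have hE0 : 0 ≤ C₁ * D * mollRadius n ^ (1 - p) + A * M := by positivity
      by_cases hne : ∃ y, smear n φ y ≠ 0
      · obtain ⟨m, x, hm, hmax, hx⟩ := exists_maximum_weighted (continuous_smear hφ hφD n)
          (show k < k + 2 by linarith) (abs_smear_le hk hφD n) hne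
        have hmE : (r - C₀) * m ≤ C₁ * D * mollRadius n ^ (1 - p) + A * M := by
          rcases abs_choice (smear n φ x) with hs | hs
          · exact hest r D M φ hφ hφD hφM hres n m x hm hmax (hs ▸ hx)
          · refine hest r D M (fun y => -φ y) hφ.neg (fun y => by rw [abs_neg]; exact hφD y)
              (fun y => by rw [abs_neg]; exact hφM y) hres.neg n m x hm (fun y => ?_) ?_
            · rw [smear_neg, abs_neg]; exact hmax y
            · rw [smear_neg, ← hs]; exact hx
        calc (r - C₀) * |smear n φ v| ≤ (r - C₀) * (m * jap v ^ (k + 2)) :=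
              mul_le_mul_of_nonneg_left (hmax v) (by linarith)
          _ = (r - C₀) * m * jap v ^ (k + 2) := by ring
          _ ≤ _ := mul_le_mul_of_nonneg_right hmE hjv.le
      · push Not at hne
        rw [hne, abs_zero, mul_zero]
        positivity
    have hη0 : Tendsto (fun n => mollRadius n ^ (1 - p)) atTop (𝓝 0) := by
      have := tendsto_mollRadius.rpow_const (p := 1 - p) (Or.inr (by linarith))
      rwa [Real.zero_rpow (by linarith)] at this
    filter_upwards [ae_tendsto_smear hφ hφD] with v hv
    have h1 := (hv.abs.const_mul (r - C₀))
    have h2 := (((hη0.const_mul (C₁ * D)).add_const (A * M)).mul_const (jap v ^ (k + 2)))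
    have h3 := le_of_tendsto_of_tendsto' h1 h2 fun n => hbd n v
    rw [mul_zero, zero_add] at h3
    have hjv := jap_rpow_pos v (k + 2)
    have h4 : (2 * A + 1) * |φ v| ≤ (r - C₀) * |φ v| :=
      mul_le_mul_of_nonneg_right (by linarith) (abs_nonneg _)
    have h5 : (2 * A + 1) * |φ v| ≤ (2 * A + 1) * (M / 2 * jap v ^ (k + 2)) := by
      have : 0 ≤ M * jap v ^ (k + 2) := by positivity
      nlinarith
    exact le_of_mul_le_mul_left h5 (by positivity)
  have hD := nonneg_of_abs_le_jap hφD
  have hiter : ∀ i : ℕ, ∀ᵐ v, |φ v| ≤ D / 2 ^ i * jap v ^ (k + 2) := by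
    intro i
    induction i with
    | zero =>
      refine Eventually.of_forall fun v => (hφD v).trans ?_
      rw [pow_zero, div_one]
      exact mul_le_mul_of_nonneg_left (jap_rpow_le_jap_rpow v (by linarith)) hD
    | succ i ih =>
      set N : Vel → ℝ := fun v => D / 2 ^ i * jap v ^ (k + 2) with hN
      have hN0 : ∀ v, 0 ≤ N v := fun v => by
        have := jap_rpow_pos v (k + 2)
        simp only [hN]; positivity
      have hNm : Measurable N := (measurable_jap.pow_const _).const_mul _
      set φ' : Vel → ℝ := fun v => max (-N v) (min (N v) (φ v)) with hφ'
      have heq : φ =ᵐ[volume] φ' := by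
        filter_upwards [ih] with v hv
        simp only [hφ']
        rw [min_eq_right (abs_le.1 hv).2, max_eq_right (abs_le.1 hv).1]
      have hφ'N : ∀ v, |φ' v| ≤ N v := fun v => abs_le.2 ⟨le_max_left _ _,
        max_le (by linarith [hN0 v]) (min_le_left _ _)⟩
      have hφ'D : ∀ v, |φ' v| ≤ D * jap v ^ k := fun v => by
        obtain ⟨h1, h2⟩ := abs_le.1 (hφD v)
        have h3 := (abs_nonneg _).trans (hφD v)
        refine abs_le.2 ⟨le_max_of_le_right (le_min ?_ h1), max_le ?_ (min_le_of_right_le h2)⟩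
        · linarith [hN0 v]
        · linarith [hN0 v]
      have := hstep (D / 2 ^ i) φ' (hNm.neg.max (hNm.min hφ)) hφ'D hφ'N (hres.congr heq)
      filter_upwards [this, heq] with v hv hv'
      rw [hv', pow_succ, ← div_div]
      exact hv
  filter_upwards [ae_all_iff.2 hiter] with v hv
  have hlim : Tendsto (fun i : ℕ => D / 2 ^ i * jap v ^ (k + 2)) atTop (𝓝 0) := by
    have h1 := (tendsto_inv_atTop_zero.comp (tendsto_pow_atTop_atTop_of_one_lt
      (one_lt_two : (1 : ℝ) < 2))).const_mul D
    have h2 := h1.mul_const (jap v ^ (k + 2))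
    rw [mul_zero, zero_mul] at h2
    exact h2
  exact abs_nonpos_iff.1 (ge_of_tendsto' hlim hv)

/-- The range condition for the closure of the operator. -/
theorem OperatorData.exists_surjective (h : OperatorData s cb γ b δ Θ) (hk : 0 ≤ k)
    (hΘ : IsTruncation ε Θ) (hε : 0 < ε) {C₀ : ℝ} (hb : DualBound γ (k + 2) C₀ b δ) {a : ℝ}
    (hd : IsDissipativeSub (closure (testGraph k (BOp b γ δ Θ))) a) :
    ∃ r₀ : ℝ, ∀ r, r₀ ≤ r → ∀ z : L1w k, ∃ p : L1w k × L1w k,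
      p ∈ (h.graph k).topologicalClosure ∧ r • p.1 - p.2 = z := by
  obtain ⟨r₀, hr₀⟩ := h.exists_forall_ae_eq_zero hk hΘ hε hb
  refine ⟨max r₀ (a + 1), fun r hr z => ?_⟩
  have har : a < r := by linarith [(le_max_right r₀ (a + 1)).trans hr]
  refine surjective_of_isDissipativeSub (h.graph k).isClosed_topologicalClosure hd har
    (fun ψ hψ => ?_) z
  obtain ⟨φ, hφ, hφD, hφψ⟩ := L1w.exists_dual_eq ψ
  have hres : DualResolvent b γ δ Θ r φ := by
    intro f hf
    obtain ⟨p, hp, h1, h2⟩ := h.mem_graph (k := k) hf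
    have e := hψ p (Submodule.le_topologicalClosure _ hp)
    rw [map_sub, map_smul, hφψ, hφψ, smul_eq_mul, sub_eq_zero] at e
    have e1 : ∫ v, φ v * p.1 v = ∫ v, φ v * f v := by
      refine integral_congr_ae ?_
      filter_upwards [ae_wMeasure.1 h1] with v hv
      rw [hv]
    have e2 : ∫ v, φ v * p.2 v = ∫ v, φ v * BOp b γ δ Θ f v := by
      refine integral_congr_ae ?_
      filter_upwards [ae_wMeasure.1 h2] with v hv
      rw [hv]
    rw [← e1, ← e2, e]
  have h0 := hr₀ r ((le_max_left _ _).trans hr) ‖ψ‖ φ hφ hφD hres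
  ext F
  rw [hφψ, zero_apply, ← integral_zero Vel ℝ]
  refine integral_congr_ae ?_
  filter_upwards [h0] with v hv
  rw [hv, zero_mul]

end

end Boltzmann
end

theorem lemma2 (k γ s cb : ℝ) (b : ℝ → ℝ) (hk : 2 < k) (hγ : γ ∈ Set.Ioo (0 : ℝ) 1)
    (hs : s ∈ Set.Ioo (0 : ℝ) (1 / 2)) (hcb : 0 < cb) (hb : IsAngularKernel s cb b) :
    ∃ lam : ℝ, 0 < lam ∧ ∀ a ∈ Set.Ioo (-lam) 0,
      ∃ δ₀ : ℝ, 0 < δ₀ ∧ ∀ δ ∈ Set.Ioo 0 δ₀,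
      ∃ ε₀ : ℝ, 0 < ε₀ ∧ ∀ ε ∈ Set.Ioo 0 ε₀,
      ∀ Θ : Vel → Vel → Sph → ℝ, IsTruncation ε Θ →
        -- the operator is well defined from `C_c^∞` to `L¹(⟨v⟩^k)`
        (∀ f : Vel → ℝ, IsTest f →
          (∀ v, MeasureTheory.Integrable (grazIntegrand b γ δ f v) collMeasure ∧
            MeasureTheory.Integrable (remIntegrand b γ δ Θ f v) collMeasure ∧
            MeasureTheory.Integrable (freqIntegrand b γ δ v) collMeasure) ∧
          MeasureTheory.MemLp (BOp b γ δ Θ f) 1 (wMeasure k)) ∧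
        -- it is dissipative after subtraction of `a`
        IsDissipativeSub (closure (testGraph k (BOp b γ δ Θ))) a ∧
        -- its closure generates a semigroup, which decays like `e^{at}`
        ∃ S : NNReal → L1w k →L[ℝ] L1w k,
          IsC0Semigroup S ∧
          generatorGraph S = closure (testGraph k (BOp b γ δ Θ)) ∧
          ∀ t : NNReal, ‖S t‖ ≤ Real.exp (a * t) := by
  obtain ⟨lam, hlam, δ₁, hδ₁, hδ₁1, H₁⟩ := hb.exists_dual_rate hs.1 hs.2 hcb hk hγ.1 hγ.2.le
  obtain ⟨_, -, δ₂, hδ₂, -, H₂⟩ := hb.exists_dual_rate hs.1 hs.2 hcb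
    (show 2 < k + 2 by linarith) hγ.1 hγ.2.le
  have hk0 : 0 ≤ k := by linarith
  refine ⟨lam, hlam, fun a ha => ⟨min δ₁ δ₂, lt_min hδ₁ hδ₂, fun δ hδ => ?_⟩⟩
  obtain ⟨-, ε₀, hε₀, hrate⟩ := H₁ δ hδ.1 (hδ.2.trans_le (min_le_left _ _))
  obtain ⟨⟨C₀, hC₀, hbound⟩, -⟩ := H₂ δ hδ.1 (hδ.2.trans_le (min_le_right _ _))
  refine ⟨ε₀, hε₀, fun ε hε Θ hΘ => ?_⟩
  have h : OperatorData s cb γ b δ Θ :=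
    ⟨hb, hs.1, hs.2, hcb, hγ.1, hγ.2.le, hδ.1, ((hδ.2.trans_le (min_le_left _ _)).le.trans hδ₁1),
      hΘ.measurable, hΘ.nonneg, hΘ.le_one⟩
  have hdecay : DualDecay γ k lam b δ Θ := fun n v φ hφ hφk hv =>
    hrate ε hε.1 hε.2 _ (h.cutoff_trunc n) (h.trunc_le n) v φ hφ hφk hv _ _ _
      (hΘ.isAlmostOne_post hε.1 v) (hΘ.isAlmostOne_postStar hε.1 v) (hΘ.isAlmostOne_swap v)
  have hdiss : IsDissipativeSub (closure (testGraph k (BOp b γ δ Θ))) a :=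
    (h.isDissipativeSub hdecay hk0 ha.1.le).closure
  refine ⟨fun f hf => ?_, hdiss, ?_⟩
  · obtain ⟨C, hC⟩ := exists_gaussLip_of_isTest hf
    exact ⟨h.integrable_integrands hC hf.measurable, h.memLp_BOp hC hf.measurable⟩
  · obtain ⟨r₀, hr₀⟩ := h.exists_surjective hk0 hΘ hε.1 ⟨hC₀, hbound⟩ hdiss
    exact exists_semigroup_of_dissipative hdiss h.dense_domain hr₀
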